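/- Let $n\ge 3$, let $M\subset\mathbb R^n$ be a compact oriented smoothly embedded $(n-2)$-dimensional submanifold without boundary, and let $U\supset M$ be a bounded convex open set. *Chains.* For $U'$ open in a Euclidean space $V$, a Dirac $k$-chain in $U'$ is a finite formal sum $\sum(p_i;\alpha_i)$ with $p_i\in U'$, $\alpha_i\in\Lambda^kV$; $\|\alpha\|$ denotes the mass of a $k$-vector (the infimum of $\sum_i\|\alpha_i\|$ over decompositions $\alpha=\sum_i\alpha_i$ into simple $k$-vectors). Put $\Delta_u(p;\alpha)=(p+u;\alpha)-(p;\alpha)$. The norm $\|A\|_{B^r}$ is the infimum of $\sum_i\|u_1^i\|\cdots\|u_{j_i}^i\|\,\|\alpha_i\|$ over all ways of writing $A=\sum_i\Delta_{u_1^i}\cdots\Delta_{u^i_{j_i}}(p_i;\alpha_i)$ as a finite sum with $0\le j_i\le r$ such that the convex hull of the support of each summand lies in $U'$. Let $\hat{\mathcal B}^r_k(U')$ be the completion, and identify $\hat{\mathcal B}^r_k$ with its image in $\hat{\mathcal B}^s_k$ for $r\le s$ (linking maps, the continuous extensions of the identity). For a form $\omega$ let $⨍_J\omega$ be the continuous extension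 of $\sum(p_i;\alpha_i)\mapsto\sum\omega(p_i)(\alpha_i)$, and let $dV$ be the volume form of $\mathbb R^n$. The following operators are defined on Dirac chains and extended by continuity: extrusion $E_X(p;\alpha)=(p;X(p)\wedge\alpha)$; pushforward $G_*(p;\alpha)=(G(p);dG_p\alpha)$; boundary $\partial=\sum_iP_{e_i}E^\dagger_{e_i}$, where $(e_i)$ is an orthonormal basis, $P_v(p;\alpha)=\lim_{t\to0}\big[(p+tv;\alpha/t)-(p;\alpha/t)\big]$ and $E_v^\dagger$ is contraction with $v$. Put $P_X=E_X\partial+\partial E_X$. Let $\widetilde M\in\hat{\mathcal B}^1_{n-2}(U)$ be the chain representing $M$, so $⨍_{\widetilde M}\omega=\int_M\omega$. *Data.* Let $Y$ be a smooth vector field on $U$ with bounded derivatives of every order such that $Y(p)$ is a unit vector normal to $M$ for each $p\in M$. Let $F:[0,1]\times U\to U$ be smooth, with bounded derivatives of every order on $(0,1)\times U$, such that $F(0,p)=p$ and $F(1,p)=q$ for all $p\in U$ (where $q\in U$ is fixed) and $\partial_tF(0,p)=Y(p)$ for $p\in M$. The cone operator $\kappa_Y:\hat{\mathcal B}^r_k(U)\to\hat{\mathcal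 B}^r_{k+1}(U)$, $r\ge1$, is $\kappa_Y(J)=F_*\big(\widetilde{(0,1)}\,\hat\times\,J\big)$, where $\widetilde{(0,1)}\,\hat\times\,(p;\alpha)=\int_0^1((t,p);e\wedge\alpha)\,dt$ and $e$ is the unit vector of the first factor. *Spanning sets.* A simple link of $M$ is a smoothly embedded circle in $\mathbb R^n\setminus M$ whose linking number with one connected component of $M$ is $\pm1$ and with each other component is $0$. A compact set spans $M$ if it meets every simple link of $M$. Let $\mathcal S^{n-1}$ be normalized Hausdorff spherical measure, and let $\mathfrak S^*(M,U)$ be the collection of compact sets $X\subset U$ that span $M$, have $\mathcal S^{n-1}(X)<\infty$, and are reduced, i.e. every ball centred at a point of $X$ meets $X$ in a set of positive $(n-1)$-dimensional Hausdorff measure. Put $\mathfrak m=\inf\{\mathcal S^{n-1}(X):X\in\mathfrak S^*(M,U)\}$. *Film chains.* Let $\mathcal C(U)$ be the set of limits $J\in\hat{\mathcal B}^1_n(U)$ of positively oriented Dirac $n$-chains with $\operatorname{supp}J\subset U$, where $p\in\operatorname{supp}J$ iff for every $\epsilon>0$ some bounded Lipschitz form $\eta$ on $U$ vanishing outside the $\epsilon$-ball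 about $p$ has $⨍_J\eta\ne0$. For $J\in\mathcal C(U)$ let $\mu_J$ be the finite Borel measure on $U$ with $\int_Uf\,d\mu_J=⨍_Jf\,dV$ for all bounded Lipschitz $f$ on $U$. A film chain is an $S\in\hat{\mathcal B}^2_{n-1}(U)$ such that $\partial S=P_Y\widetilde M$, $\kappa_YS\in\mathcal C(U)$, and $\mu_{\kappa_YS}=\mathcal S^{n-1}\lfloor_X$ for some $X\in\mathfrak S^*(M,U)$. For $S\in\hat{\mathcal B}^2_{n-1}(U)$ let $\mathcal A^{n-1}(S)=⨍_{\kappa_YS}dV$. Let $c_0=\operatorname{diam}(U)\operatorname{vol}(M)$, and let $\mathcal T(M,Y,U)\subset\hat{\mathcal B}^2_{n-1}(U)$ be the set of limits in the $B^2$ norm of sequences of film chains $S_i$ with $\mathcal A^{n-1}(S_i)\le c_0$ for all $i$. **Theorem.** There exists $S_0\in\mathcal T(M,Y,U)$ with $\mathcal A^{n-1}(S_0)=\mathfrak m$. -/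

import Mathlib

open Set Filter Topology MeasureTheory Module
open scoped ENNReal ContDiff RealInnerProductSpace

noncomputable section

/-! ## Multivectors -/

section Multivectors

variable {V : Type*} [NormedAddCommGroup V] [InnerProductSpace ℝ V]

/-- Mass of the `k`-vector `α`: the infimum of `∑ |cᵢ| ‖v₁ⁱ ∧ ⋯ ∧ vₖⁱ‖` over all ways of writing
`α` as a finite sum of simple `k`-vectors `cᵢ v₁ⁱ ∧ ⋯ ∧ vₖⁱ`, where
`‖v₁ ∧ ⋯ ∧ vₖ‖² = det ⟪vᵢ, vⱼ⟫`. (The scalars `cᵢ` matter for `k = 0` only.) -/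
def kvMass {k : ℕ} (α : ⋀[ℝ]^k V) : ℝ :=
  sInf {c : ℝ | ∃ L : List (ℝ × (Fin k → V)),
    α = (L.map fun s => s.1 • exteriorPower.ιMulti ℝ k s.2).sum ∧
    c = (L.map fun s => |s.1| * √(Matrix.det (Matrix.of fun i j => ⟪s.2 i, s.2 j⟫))).sum}

/-- The product `v ∧ α` of a vector and a `k`-vector. -/
def kvWedge {k : ℕ} (v : V) (α : ⋀[ℝ]^k V) : ⋀[ℝ]^(k + 1) V :=
  ⟨ExteriorAlgebra.ι ℝ v * (α : ExteriorAlgebra ℝ V), by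
    change _ ∈ LinearMap.range (ExteriorAlgebra.ι ℝ) ^ (k + 1)
    rw [pow_succ']
    exact Submodule.mul_mem_mul (LinearMap.mem_range_self _ v) α.2⟩

theorem contractLeft_mem (d : Dual ℝ V) (k : ℕ) (x : ExteriorAlgebra ℝ V)
    (hx : x ∈ ⋀[ℝ]^(k + 1) V) : CliffordAlgebra.contractLeft d x ∈ ⋀[ℝ]^k V := by
  induction k generalizing x with
  | zero =>
    change x ∈ LinearMap.range (ExteriorAlgebra.ι ℝ) ^ (0 + 1) at hx
    rw [zero_add, pow_one] at hx
    obtain ⟨v, rfl⟩ := hx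
    have h := CliffordAlgebra.contractLeft_ι (0 : QuadraticForm ℝ V) (d := d) v
    erw [h]
    change _ ∈ LinearMap.range (ExteriorAlgebra.ι ℝ) ^ 0
    rw [pow_zero]
    exact Submodule.algebraMap_mem _
  | succ k ih =>
    change x ∈ LinearMap.range (ExteriorAlgebra.ι ℝ) ^ (k + 1 + 1) at hx
    rw [pow_succ'] at hx
    refine Submodule.mul_induction_on hx ?_ ?_
    · rintro _ ⟨v, rfl⟩ y hy
      have h := CliffordAlgebra.contractLeft_ι_mul (Q := (0 : QuadraticForm ℝ V)) (d := d) v y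
      erw [h]
      refine Submodule.sub_mem _ (Submodule.smul_mem _ _ hy) ?_
      change _ ∈ LinearMap.range (ExteriorAlgebra.ι ℝ) ^ (k + 1)
      rw [pow_succ']
      exact Submodule.mul_mem_mul (LinearMap.mem_range_self _ v) (ih y hy)
    · intro x y hx hy
      rw [map_add]
      exact Submodule.add_mem _ hx hy

/-- Contraction of a `(k+1)`-vector with the vector `v`:
`v₁ ∧ ⋯ ∧ vₖ₊₁ ↦ ∑ᵢ (-1)^(i+1) ⟪v, vᵢ⟫ v₁ ∧ ⋯ v̂ᵢ ⋯ ∧ vₖ₊₁`. -/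
def kvContract {k : ℕ} (v : V) (α : ⋀[ℝ]^(k + 1) V) : ⋀[ℝ]^k V :=
  ⟨CliffordAlgebra.contractLeft (innerₛₗ ℝ v) (α : ExteriorAlgebra ℝ V),
    contractLeft_mem _ k _ α.2⟩

theorem kvMass_nonneg {k : ℕ} (α : ⋀[ℝ]^k V) : 0 ≤ kvMass α := by
  apply Real.sInf_nonneg
  rintro c ⟨L, -, rfl⟩
  apply List.sum_nonneg
  simp only [List.mem_map]
  rintro _ ⟨s, -, rfl⟩
  positivity

theorem kvMass_smul_le {k : ℕ} (c : ℝ) (α : ⋀[ℝ]^k V) : kvMass (c • α) ≤ |c| * kvMass α := by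
  rcases eq_or_ne c 0 with rfl | hc
  · rw [zero_smul, abs_zero, zero_mul]
    refine csInf_le ⟨0, ?_⟩ ⟨[], by simp, by simp⟩
    rintro c ⟨L, -, rfl⟩
    apply List.sum_nonneg
    simp only [List.mem_map]
    rintro _ ⟨s, -, rfl⟩
    positivity
  · have key : ∀ (c : ℝ) (L : List (ℝ × (Fin k → V))),
        (L.map fun s => |c * s.1| * √(Matrix.det (Matrix.of fun i j => ⟪s.2 i, s.2 j⟫))).sum =
          |c| * (L.map fun s =>
            |s.1| * √(Matrix.det (Matrix.of fun i j => ⟪s.2 i, s.2 j⟫))).sum := by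
      intro c L
      simp only [abs_mul, mul_assoc]
      rw [List.sum_map_mul_left]
    rw [kvMass, kvMass, ← smul_eq_mul (a := |c|), ← Real.sInf_smul_of_nonneg (abs_nonneg c)]
    apply le_of_eq
    congr 1
    ext x
    rw [Set.mem_smul_set]
    constructor
    · rintro ⟨L, hα, rfl⟩
      refine ⟨|c⁻¹| * (L.map fun s =>
        |s.1| * √(Matrix.det (Matrix.of fun i j => ⟪s.2 i, s.2 j⟫))).sum,
        ⟨L.map fun s => (c⁻¹ * s.1, s.2), ?_, ?_⟩, ?_⟩
      · rw [List.map_map]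
        have : α = c⁻¹ • (c • α) := by rw [smul_smul, inv_mul_cancel₀ hc, one_smul]
        rw [this, hα, List.smul_sum, List.map_map]
        congr 1
        apply List.map_congr_left
        intro s _
        simp [smul_smul]
      · rw [← key, List.map_map]; rfl
      · rw [smul_eq_mul, ← mul_assoc, ← abs_mul, mul_inv_cancel₀ hc, abs_one, one_mul]
    · rintro ⟨_, ⟨L, rfl, rfl⟩, rfl⟩
      refine ⟨L.map fun s => (c * s.1, s.2), ?_, ?_⟩
      · rw [List.smul_sum, List.map_map, List.map_map]
        congr 1
        apply List.map_congr_left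
        intro s _
        simp [smul_smul]
      · rw [smul_eq_mul, ← key, List.map_map]; rfl

end Multivectors

/-! ## Dirac chains and the `B^r` norms -/

section DiracChains

variable {V : Type*} [NormedAddCommGroup V] [InnerProductSpace ℝ V]

/-- The space of Dirac `k`-chains in `U`: finitely supported functions `U → Λ^k V`.
The index `r` only records the norm `B^{r,U}` which the space carries. -/
def DiracChain (U : Set V) (k _r : ℕ) : Type _ := U →₀ ⋀[ℝ]^k V

instance (U : Set V) (k r : ℕ) : AddCommGroup (DiracChain U k r) :=
  inferInstanceAs (AddCommGroup (U →₀ ⋀[ℝ]^k V))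

instance (U : Set V) (k r : ℕ) : Module ℝ (DiracChain U k r) :=
  inferInstanceAs (Module ℝ (U →₀ ⋀[ℝ]^k V))

/-- The extension of a Dirac chain in `U` by zero to all of `V`. -/
def DiracChain.coeff {U : Set V} {k r : ℕ} : DiracChain U k r →ₗ[ℝ] (V →₀ ⋀[ℝ]^k V) :=
  Finsupp.lmapDomain (⋀[ℝ]^k V) ℝ Subtype.val

/-- The restriction of a Dirac chain to `U`. -/
def DiracChain.ofCoeff (U : Set V) {k : ℕ} (r : ℕ) : (V →₀ ⋀[ℝ]^k V) →ₗ[ℝ] DiracChain U k r :=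
  Finsupp.lsubtypeDomain U

/-- Translation `T_u : (p; α) ↦ (p + u; α)`. -/
def translateCoeff {k : ℕ} (u : V) (A : V →₀ ⋀[ℝ]^k V) : V →₀ ⋀[ℝ]^k V :=
  A.mapDomain (fun p => p + u)

/-- The data `(p; α)` and `u₁, …, uⱼ` of a `j`-difference `k`-chain `Δ_{u₁,…,uⱼ}(p; α)`. -/
structure DifferenceData (V : Type*) [NormedAddCommGroup V] [InnerProductSpace ℝ V] (k : ℕ) where
  base : V
  dirs : List V
  vec : ⋀[ℝ]^k V

/-- The difference chain `Δ_{u₁} ∘ ⋯ ∘ Δ_{uⱼ} (p; α)`, where `Δ_u = T_u - I`. -/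
def DifferenceData.toCoeff {k : ℕ} (D : DifferenceData V k) : V →₀ ⋀[ℝ]^k V :=
  D.dirs.foldr (fun u A => translateCoeff u A - A) (Finsupp.single D.base D.vec)

/-- The weight `‖u₁‖ ⋯ ‖uⱼ‖ ‖α‖`. -/
def DifferenceData.weight {k : ℕ} (D : DifferenceData V k) : ℝ :=
  (D.dirs.map fun u => ‖u‖).prod * kvMass D.vec

/-- The difference chain is of order at most `r`, and the convex hull of its support is in `U`. -/
def DifferenceData.Admissible {k : ℕ} (U : Set V) (r : ℕ) (D : DifferenceData V k) : Prop :=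
  D.dirs.length ≤ r ∧ convexHull ℝ (D.toCoeff.support : Set V) ⊆ U

/-- The weights of all ways to write `A` as a finite sum of `j`-difference chains inside `U`,
`0 ≤ j ≤ r`. -/
def bCosts {U : Set V} {k r : ℕ} (A : DiracChain U k r) : Set ℝ :=
  {c | ∃ L : List (DifferenceData V k), (∀ D ∈ L, D.Admissible U r) ∧
    A.coeff = (L.map DifferenceData.toCoeff).sum ∧ c = (L.map DifferenceData.weight).sum}

theorem bCosts_nonneg {U : Set V} {k r : ℕ} (A : DiracChain U k r) {c : ℝ} (hc : c ∈ bCosts A) :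
    0 ≤ c := by
  obtain ⟨L, -, -, rfl⟩ := hc
  apply List.sum_nonneg
  simp only [List.mem_map]
  rintro _ ⟨D, -, rfl⟩
  refine mul_nonneg (List.prod_nonneg ?_) (kvMass_nonneg _)
  simp only [List.mem_map]
  rintro _ ⟨u, -, rfl⟩
  exact norm_nonneg u

theorem bCosts_bddBelow {U : Set V} {k r : ℕ} (A : DiracChain U k r) : BddBelow (bCosts A) :=
  ⟨0, fun _ hc => bCosts_nonneg A hc⟩

theorem bCosts_nonempty {U : Set V} {k r : ℕ} (A : DiracChain U k r) : (bCosts A).Nonempty := by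
  refine ⟨_, A.coeff.support.toList.map fun p => ⟨p, [], A.coeff p⟩, ?_, ?_, rfl⟩
  · simp only [List.mem_map, Finset.mem_toList]
    rintro _ ⟨p, hp, rfl⟩
    refine ⟨Nat.zero_le _, ?_⟩
    refine (convexHull_mono (t := {p}) ?_).trans ?_
    · intro x hx
      have := Finsupp.support_single_subset (Finset.mem_coe.1 hx)
      simpa using this
    · rw [convexHull_singleton, Set.singleton_subset_iff]
      classical
      have h := Finsupp.mapDomain_support hp
      obtain ⟨q, -, rfl⟩ := Finset.mem_image.1 h
      exact q.2
  · rw [List.map_map, Finset.sum_map_toList]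
    exact (Finsupp.sum_single A.coeff).symm

theorem DifferenceData.toCoeff_smul {k : ℕ} (c : ℝ) (p : V) (l : List V) (α : ⋀[ℝ]^k V) :
    (⟨p, l, c • α⟩ : DifferenceData V k).toCoeff = c • (⟨p, l, α⟩ : DifferenceData V k).toCoeff := by
  induction l with
  | nil => simp [DifferenceData.toCoeff]
  | cons u l ih =>
    simp only [DifferenceData.toCoeff, List.foldr_cons] at ih ⊢
    rw [ih, translateCoeff, translateCoeff, Finsupp.mapDomain_smul]
    generalize List.foldr (fun u A => translateCoeff u A - A) (Finsupp.single p α) l = B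
    exact (smul_sub c (Finsupp.mapDomain (fun p => p + u) B : V →₀ ⋀[ℝ]^k V) B).symm

theorem bCosts_smul {U : Set V} {k r : ℕ} (c : ℝ) (A : DiracChain U k r) {x : ℝ}
    (hx : x ∈ bCosts A) : sInf (bCosts (c • A)) ≤ |c| * x := by
  obtain ⟨L, hL, hA, rfl⟩ := hx
  let L' : List (DifferenceData V k) := L.map fun D => ⟨D.base, D.dirs, c • D.vec⟩
  have hmem : (L'.map DifferenceData.weight).sum ∈ bCosts (c • A) := by
    refine ⟨L', ?_, ?_, rfl⟩
    · simp only [L', List.mem_map]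
      rintro _ ⟨D, hD, rfl⟩
      refine ⟨(hL D hD).1, (convexHull_mono ?_).trans (hL D hD).2⟩
      rw [DifferenceData.toCoeff_smul]
      exact Finset.coe_subset.2 Finsupp.support_smul
    · rw [map_smul, hA, List.smul_sum]
      simp only [L', List.map_map]
      congr 1
      apply List.map_congr_left
      intro D _
      exact (DifferenceData.toCoeff_smul c D.base D.dirs D.vec).symm
  refine (csInf_le (bCosts_bddBelow _) hmem).trans ?_
  rw [← List.sum_map_mul_left]
  simp only [L', List.map_map]
  apply List.sum_le_sum
  intro D _
  simp only [Function.comp, DifferenceData.weight]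
  rw [mul_left_comm]
  refine mul_le_mul_of_nonneg_left (kvMass_smul_le c D.vec) (List.prod_nonneg ?_)
  simp only [List.mem_map]
  rintro _ ⟨u, -, rfl⟩
  exact norm_nonneg u

/-- The `B^{r,U}` norm of Dirac chains. -/
def bNorm (U : Set V) (k r : ℕ) : Seminorm ℝ (DiracChain U k r) :=
  Seminorm.ofSMulLE (fun A => sInf (bCosts A))
    (by
      apply le_antisymm
      · exact csInf_le (bCosts_bddBelow _) ⟨[], by simp, by simp, by simp⟩
      · exact Real.sInf_nonneg fun c hc => bCosts_nonneg _ hc)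
    (by
      intro A B
      rw [← csInf_add (bCosts_nonempty A) (bCosts_bddBelow A) (bCosts_nonempty B)
        (bCosts_bddBelow B)]
      refine csInf_le_csInf (bCosts_bddBelow _) ((bCosts_nonempty A).add (bCosts_nonempty B)) ?_
      rintro _ ⟨_, ⟨L, hL, hA, rfl⟩, _, ⟨L', hL', hB, rfl⟩, rfl⟩
      refine ⟨L ++ L', ?_, by simp [hA, hB], by simp⟩
      intro D hD
      rcases List.mem_append.1 hD with h | h
      exacts [hL D h, hL' D h])
    (by
      intro c A
      rw [Real.norm_eq_abs, ← smul_eq_mul, ← Real.sInf_smul_of_nonneg (abs_nonneg c)]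
      refine le_csInf ((bCosts_nonempty A).smul_set) ?_
      rintro _ ⟨x, hx, rfl⟩
      exact bCosts_smul c A hx)

instance (U : Set V) (k r : ℕ) : SeminormedAddCommGroup (DiracChain U k r) :=
  (bNorm U k r).toAddGroupSeminorm.toSeminormedAddCommGroup

instance (U : Set V) (k r : ℕ) : NormedSpace ℝ (DiracChain U k r) where
  norm_smul_le c A := (map_smul_eq_mul (bNorm U k r) c A).le

end DiracChains

/-! ## Differential chains and their operators

Every operator below is given on Dirac chains and extended by continuity, through
`UniformSpace.Completion.extension` and `UniformSpace.Completion.map`. -/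

section DifferentialChains

open UniformSpace

variable {V : Type*} [NormedAddCommGroup V] [InnerProductSpace ℝ V]
variable {W : Type*} [NormedAddCommGroup W] [InnerProductSpace ℝ W]

/-- The Banach space of differential `k`-chains of class `B^r` in `U`: the completion of the space
of Dirac `k`-chains in `U` with respect to the norm `B^{r,U}`. -/
abbrev DiffChain (U : Set V) (k r : ℕ) : Type _ := Completion (DiracChain U k r)

/-- The `k`-element `(p; α)` as a differential chain in `U` (meant for `p ∈ U`). -/
def kElement (U : Set V) {k : ℕ} (r : ℕ) (p : V) (α : ⋀[ℝ]^k V) : DiffChain U k r :=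
  ((DiracChain.ofCoeff U r (Finsupp.single p α) : DiracChain U k r) : DiffChain U k r)

/-- The linking map `u_k^{r,s}`, `r ≤ s`: the continuous extension of the identity of
Dirac chains. -/
def linking {U : Set V} {k : ℕ} (r s : ℕ) : DiffChain U k r → DiffChain U k s :=
  Completion.map fun A : DiracChain U k r => (DiracChain.ofCoeff U s A.coeff : DiracChain U k s)

/-- The integral `⨍_J w` of a differential form, a function `w` from points to covectors
on `Λ^k V`: the continuous extension of `∑ (pᵢ; αᵢ) ↦ ∑ w(pᵢ)(αᵢ)`. -/
def chainIntegral {U : Set V} {k r : ℕ} (w : V → ⋀[ℝ]^k V →ₗ[ℝ] ℝ) : DiffChain U k r → ℝ :=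
  Completion.extension fun A : DiracChain U k r => A.coeff.sum fun p α => w p α

/-- `w` is a form of class `B^1` in the convex open set `U`: bounded and Lipschitz in comass.
(In a convex set the intrinsic metric is the Euclidean one.) -/
def IsFormB1 (U : Set V) {k : ℕ} (w : V → ⋀[ℝ]^k V →ₗ[ℝ] ℝ) : Prop :=
  ∃ C : ℝ, (∀ p ∈ U, ∀ α, |w p α| ≤ C * kvMass α) ∧
    ∀ p ∈ U, ∀ q ∈ U, ∀ α, |w p α - w q α| ≤ C * ‖p - q‖ * kvMass α

/-- Support of a differential chain of class `B^1`. -/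
def chainSupport {U : Set V} {k : ℕ} (J : DiffChain U k 1) : Set V :=
  {p | ∀ ε > 0, ∃ η : V → ⋀[ℝ]^k V →ₗ[ℝ] ℝ, IsFormB1 U η ∧
    (∀ x ∈ U, x ∉ Metric.ball p ε → η x = 0) ∧ chainIntegral η J ≠ 0}

/-- Extrusion `E_X : (p; α) ↦ (p; X(p) ∧ α)`. -/
def extrusion {U : Set V} {k r : ℕ} (X : V → V) : DiffChain U k r → DiffChain U (k + 1) r :=
  Completion.map fun A : DiracChain U k r =>
    (DiracChain.ofCoeff U r (A.coeff.sum fun p α => Finsupp.single p (kvWedge (X p) α)) :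
      DiracChain U (k + 1) r)

/-- Retraction by the constant vector `v` on Dirac chains: `(p; α) ↦ (p; v ⌟ α)`. -/
def retractionCoeff {k : ℕ} (v : V) (A : V →₀ ⋀[ℝ]^(k + 1) V) : V →₀ ⋀[ℝ]^k V :=
  A.sum fun p α => Finsupp.single p (kvContract v α)

/-- Prederivative of a Dirac chain in the constant direction `v`:
`P_v (p; α) = lim_{t → 0} ((p + t v; α / t) - (p; α / t))`, the limit taken in class `B^s`,
`s ≥ 2`. -/
def prederivConst (U : Set V) {k : ℕ} (s : ℕ) (v : V) (A : V →₀ ⋀[ℝ]^k V) : DiffChain U k s :=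
  limUnder (𝓝[≠] (0 : ℝ)) fun t : ℝ =>
    ((DiracChain.ofCoeff U s (t⁻¹ • (translateCoeff (t • v) A - A)) : DiracChain U k s) :
      DiffChain U k s)

/-- Boundary `∂ = ∑ᵢ P_{eᵢ} E†_{eᵢ}` (`eᵢ` an orthonormal basis), from class `B^r` to class
`B^{r+1}`, `r ≥ 1`. -/
def chainBoundary [FiniteDimensional ℝ V] {U : Set V} {k r : ℕ} :
    DiffChain U (k + 1) r → DiffChain U k (r + 1) :=
  Completion.extension fun A : DiracChain U (k + 1) r =>
    ∑ i, prederivConst U (r + 1) (stdOrthonormalBasis ℝ V i)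
      (retractionCoeff (stdOrthonormalBasis ℝ V i) A.coeff)

/-- Prederivative `P_X = E_X ∂ + ∂ E_X` (on chains of positive dimension). -/
def prederivative [FiniteDimensional ℝ V] {U : Set V} {k r : ℕ} (X : V → V)
    (J : DiffChain U (k + 1) r) : DiffChain U (k + 1) (r + 1) :=
  extrusion X (chainBoundary J) + chainBoundary (extrusion X J)

/-- Pushforward `G_* : (p; α) ↦ (G p; dG_p α)` for a map `G : U₁ → U₂`. -/
def pushforward {U₁ : Set V} (U₂ : Set W) {k r : ℕ} (G : V → W) :
    DiffChain U₁ k r → DiffChain U₂ k r :=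
  Completion.map fun A : DiracChain U₁ k r =>
    (DiracChain.ofCoeff U₂ r (A.coeff.sum fun p α =>
      Finsupp.single (G p) (exteriorPower.map k (fderiv ℝ G p).toLinearMap α)) :
        DiracChain U₂ k r)

/-- The open set `(0,1) × U` of the Euclidean product `ℝ × V`. -/
def openCylinder (U : Set V) : Set (WithLp 2 (ℝ × V)) := {x | x.fst ∈ Ioo (0 : ℝ) 1 ∧ x.snd ∈ U}

/-- The Cartesian wedge product of the chain representing the interval `(0,1)` with a chain. On
`k`-elements it is `(p; α) ↦ ∫₀¹ ((t, p); e ∧ α) dt`, `e` the unit vector of the first factor. -/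
def intervalProd {U : Set V} {k r : ℕ} (J : DiffChain U k r) :
    DiffChain (openCylinder U) (k + 1) r :=
  Completion.extension (fun A : DiracChain U k r => A.coeff.sum fun p α =>
    ∫ t in Ioo (0 : ℝ) 1, kElement (openCylinder U) r (WithLp.toLp 2 (t, p))
      (kvWedge (WithLp.toLp 2 ((1 : ℝ), (0 : V))) (exteriorPower.map k
        ((WithLp.linearEquiv 2 ℝ (ℝ × V)).symm.toLinearMap ∘ₗ LinearMap.inr ℝ ℝ V) α))) J

/-- The cone operator `κ_F = F_* ((0,1) × ·)` of a homotopy `F : [0,1] × U → U`. -/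
def coneOperator {U : Set V} {k r : ℕ} (F : ℝ → V → V) (J : DiffChain U k r) :
    DiffChain U (k + 1) r :=
  pushforward U (fun x : WithLp 2 (ℝ × V) => F x.fst x.snd) (intervalProd J)

/-- `G` is smooth with bounded derivatives of every order on the open set `Ω`. -/
def SmoothBoundedOn (G : V → W) (Ω : Set V) : Prop :=
  ContDiffOn ℝ ∞ G Ω ∧ ∀ j : ℕ, ∃ C : ℝ, ∀ x ∈ Ω, ‖iteratedFDeriv ℝ j G x‖ ≤ C

end DifferentialChains

/-! ## Hausdorff measures, submanifolds, spanning sets -/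

section Geometry

variable {V : Type*} [NormedAddCommGroup V] [InnerProductSpace ℝ V]
  [MeasurableSpace V] [BorelSpace V]

/-- The volume of the unit ball of `ℝ^d`. -/
def unitBallVolume (d : ℕ) : ℝ≥0∞ := volume (Metric.ball (0 : EuclideanSpace ℝ (Fin d)) 1)

/-- Normalized `d`-dimensional Hausdorff measure. -/
def normHausdorff (d : ℕ) : Measure V := (unitBallVolume d / 2 ^ d) • (μH[(d : ℝ)] : Measure V)

/-- Normalized `d`-dimensional Hausdorff spherical measure: only coverings by balls are allowed,
and a ball of radius `ρ` counts `α_d ρ^d`. -/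
def sphericalHausdorff (d : ℕ) : Measure V :=
  Measure.mkMetric' fun s : Set V =>
    ⨅ (c : V) (ρ : ℝ) (_ : 0 ≤ ρ) (_ : s = Metric.closedBall c ρ),
      unitBallVolume d * ENNReal.ofReal ρ ^ d

/-- `M` is a smooth embedded `d`-dimensional submanifold (without boundary) of `V`. -/
def IsEmbeddedSubmanifold (d : ℕ) (M : Set V) : Prop :=
  ∀ p ∈ M, ∃ (e : OpenPartialHomeomorph V V) (L : Submodule ℝ V),
    p ∈ e.source ∧ ContDiffOn ℝ ∞ e e.source ∧ ContDiffOn ℝ ∞ e.symm e.target ∧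
    finrank ℝ L = d ∧ ∀ x ∈ e.source, (x ∈ M ↔ e x ∈ L)

/-- `τ` orients the `d`-dimensional submanifold `M`: it is a continuous field of unit simple
tangent `d`-vectors. The tangent space of a submanifold is its tangent cone. -/
def IsOrientingField (d : ℕ) (M : Set V) (τ : V → ⋀[ℝ]^d V) : Prop :=
  (∀ p ∈ M, ∃ v : Fin d → V, Orthonormal ℝ v ∧ (∀ i, v i ∈ tangentConeAt ℝ M p) ∧
    τ p = exteriorPower.ιMulti ℝ d v) ∧
  ∀ φ : ⋀[ℝ]^d V →ₗ[ℝ] ℝ, ContinuousOn (fun p => φ (τ p)) M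

/-- The chain representing the submanifold `M` oriented by `τ`, the one whose integral against a
form `ω` is `∫_M ω = ∫_M ω(p)(τ(p)) dℋ^d(p)`. -/
def submanifoldChain (U : Set V) {d : ℕ} (M : Set V) (τ : V → ⋀[ℝ]^d V) : DiffChain U d 1 :=
  ∫ p in M, kElement U 1 p (τ p) ∂(normHausdorff d)

/-- The core of `X` in dimension `d`. -/
def core (d : ℕ) (X : Set V) : Set V :=
  {p ∈ X | ∀ r > 0, 0 < (normHausdorff d : Measure V) (X ∩ Metric.ball p r)}

end Geometry

/-- Euclidean space `ℝ^n`. -/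
abbrev EucSp (n : ℕ) : Type := EuclideanSpace ℝ (Fin n)

/-- The volume form `dV` of `ℝ^n`, as a covector on `Λ^n ℝ^n`. -/
def volForm (n : ℕ) : ⋀[ℝ]^n (EucSp n) →ₗ[ℝ] ℝ :=
  exteriorPower.alternatingMapLinearEquiv (EuclideanSpace.basisFun (Fin n) ℝ).toBasis.det

/-! In what follows `n = m + 3`, and `M` is a submanifold of dimension `n - 2 = m + 1`. -/

section Plateau

variable {m : ℕ}

/-- A smoothly embedded circle, given by a `2π`-periodic parametrization. -/
def IsEmbeddedCircle (γ : ℝ → EucSp (m + 3)) : Prop :=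
  ContDiff ℝ ∞ γ ∧ Function.Periodic γ (2 * Real.pi) ∧ InjOn γ (Ico 0 (2 * Real.pi)) ∧
    ∀ t, deriv γ t ≠ 0

/-- The linking number of the circle `γ` with the closed `(n-2)`-dimensional submanifold `N`
oriented by `τ`, up to sign: the degree of `N × S¹ → S^{n-1}`, `(x, t) ↦ (x - γ t) / |x - γ t|`,
as a Gauss integral, `n α_n` being the area of `S^{n-1}`. -/
def linkingNumber (γ : ℝ → EucSp (m + 3)) (N : Set (EucSp (m + 3)))
    (τ : EucSp (m + 3) → ⋀[ℝ]^(m + 1) (EucSp (m + 3))) : ℝ :=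
  (((m + 3 : ℕ) : ℝ) * (unitBallVolume (m + 3)).toReal)⁻¹ *
    ∫ t in (0 : ℝ)..(2 * Real.pi), ∫ x in N,
      volForm (m + 3) (kvWedge (x - γ t) (kvWedge (deriv γ t) (τ x))) / ‖x - γ t‖ ^ (m + 3)
        ∂(normHausdorff (m + 1))

/-- `γ` is a simple link of `M`: an embedded circle in the complement of `M` whose linking number
is `±1` with one connected component of `M`, and `0` with all the others. -/
def IsSimpleLink (M : Set (EucSp (m + 3))) (τ : EucSp (m + 3) → ⋀[ℝ]^(m + 1) (EucSp (m + 3)))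
    (γ : ℝ → EucSp (m + 3)) : Prop :=
  IsEmbeddedCircle γ ∧ (∀ t, γ t ∉ M) ∧
    ∃ x ∈ M, |linkingNumber γ (connectedComponentIn M x) τ| = 1 ∧
      ∀ y ∈ M, connectedComponentIn M y ≠ connectedComponentIn M x →
        linkingNumber γ (connectedComponentIn M y) τ = 0

/-- `X` spans `M` if every simple link of `M` intersects `X`. -/
def Spans (M : Set (EucSp (m + 3))) (τ : EucSp (m + 3) → ⋀[ℝ]^(m + 1) (EucSp (m + 3)))
    (X : Set (EucSp (m + 3))) : Prop :=
  ∀ γ, IsSimpleLink M τ γ → ∃ t, γ t ∈ X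

/-- The collection `𝔖*(M, U)` of reduced compact subsets of `U` with finite `𝒮^{n-1}` measure
which span `M`. -/
def spanningSets (M : Set (EucSp (m + 3))) (τ : EucSp (m + 3) → ⋀[ℝ]^(m + 1) (EucSp (m + 3)))
    (U : Set (EucSp (m + 3))) : Set (Set (EucSp (m + 3))) :=
  {X | IsCompact X ∧ X ⊆ U ∧ core (m + 2) X = X ∧
    (sphericalHausdorff (m + 2) : Measure (EucSp (m + 3))) X < ⊤ ∧ Spans M τ X}

/-- The least size `𝔪` of the sets in `𝔖*(M, U)`. -/
def minimalSize (M : Set (EucSp (m + 3))) (τ : EucSp (m + 3) → ⋀[ℝ]^(m + 1) (EucSp (m + 3)))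
    (U : Set (EucSp (m + 3))) : ℝ≥0∞ :=
  ⨅ X ∈ spanningSets M τ U, (sphericalHausdorff (m + 2) : Measure (EucSp (m + 3))) X

/-- A top-dimensional chain is positive if it is a limit of positive Dirac chains. -/
def IsPositiveChain {n r : ℕ} {U : Set (EucSp n)} (J : DiffChain U n r) : Prop :=
  J ∈ closure {K | ∃ A : DiracChain U n r, (∀ p, 0 ≤ volForm n (A.coeff p)) ∧
    K = (A : DiffChain U n r)}

/-- The cone `𝒞(U)` of positive chains of class `B^1` with support in `U`. -/
def positiveCone {n : ℕ} (U : Set (EucSp n)) : Set (DiffChain U n 1) :=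
  {J | IsPositiveChain J ∧ chainSupport J ⊆ U}

/-- `μ` is the measure `μ_J` of `J ∈ 𝒞(U)`: the finite Borel measure on `U` with
`∫_U f dμ = ⨍_J f dV` for all bounded Lipschitz functions `f` on `U`. -/
def IsMeasureOf {n : ℕ} {U : Set (EucSp n)} (J : DiffChain U n 1) (μ : Measure (EucSp n)) : Prop :=
  IsFiniteMeasure μ ∧ μ Uᶜ = 0 ∧
    ∀ f : EucSp n → ℝ, (∃ C : ℝ, (∀ p ∈ U, |f p| ≤ C) ∧
        ∀ p ∈ U, ∀ q ∈ U, |f p - f q| ≤ C * ‖p - q‖) →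
      ∫ p in U, f p ∂μ = chainIntegral (fun p => f p • volForm n) J

/-- The film chains `ℱ(M, Y, U)`; `F` is the homotopy which defines the cone operator `κ_Y`. -/
def filmChains (M : Set (EucSp (m + 3))) (τ : EucSp (m + 3) → ⋀[ℝ]^(m + 1) (EucSp (m + 3)))
    (U : Set (EucSp (m + 3))) (Y : EucSp (m + 3) → EucSp (m + 3))
    (F : ℝ → EucSp (m + 3) → EucSp (m + 3)) : Set (DiffChain U (m + 2) 2) :=
  {S | chainBoundary S = linking 2 3 (prederivative Y (submanifoldChain U M τ)) ∧
    ∃ J ∈ positiveCone U, linking 1 2 J = coneOperator F S ∧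
      ∃ X ∈ spanningSets M τ U, IsMeasureOf J ((sphericalHausdorff (m + 2)).restrict X)}

/-- The area functional `𝒜^{n-1}(S) = ⨍_{κ_Y S} dV`. -/
def chainArea {U : Set (EucSp (m + 3))} (F : ℝ → EucSp (m + 3) → EucSp (m + 3))
    (S : DiffChain U (m + 2) 2) : ℝ :=
  chainIntegral (fun _ => volForm (m + 3)) (coneOperator F S)

/-- The constant `c₀ = diam(U) vol(M)`. -/
def areaBound (M U : Set (EucSp (m + 3))) : ℝ :=
  Metric.diam U * ((normHausdorff (m + 1) : Measure (EucSp (m + 3))) M).toReal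

/-- `𝒯(M, Y, U)`: the limits in class `B^2` of film chains of area at most `c₀`. -/
def filmClosure (M : Set (EucSp (m + 3))) (τ : EucSp (m + 3) → ⋀[ℝ]^(m + 1) (EucSp (m + 3)))
    (U : Set (EucSp (m + 3))) (Y : EucSp (m + 3) → EucSp (m + 3))
    (F : ℝ → EucSp (m + 3) → EucSp (m + 3)) : Set (DiffChain U (m + 2) 2) :=
  {S | ∃ T : ℕ → DiffChain U (m + 2) 2, (∀ i, T i ∈ filmChains M τ U Y F) ∧
    (∀ i, chainArea F (T i) ≤ areaBound M U) ∧ Tendsto T atTop (𝓝 S)}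

end Plateau

end

/-! The cone operator inverts the boundary on top-dimensional chains: `κ_Y ∂J = -J` for every
`n`-chain `J` (`coneOperator_chainBoundary`). This is the homotopy formula. The pullback of an
`n`-form on `ℝⁿ` under `F` is closed, so its integral over the fibres `(0,1)` is a primitive of the
difference of its two end restrictions. At `t = 1` the restriction vanishes because `F(1, ·)` is
constant, and at `t = 0` it is the form itself.

Since `∂M̃ = 0` (Stokes, `chainBoundary_submanifoldChain`), `P_Y M̃ = ∂Z` with `Z = E_Y M̃`. Put `Q
= κ_Y Z` and, for an `n`-chain `J` of class `B¹`, `S(J) = Z + ∂Q - ∂J`. Then `∂S(J) = ∂Z = P_Y M̃`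
and `κ_Y S(J) = Q - Q + J = J`. Thus every `n`-chain is the cone of a chain with the prescribed
boundary, and it depends on `J` continuously. For a spanning set `X` let `J_X = ∫_X (p; e₁ ∧ ⋯ ∧ eₙ)
d𝒮ⁿ⁻¹`; then `S(J_X)` is a film chain of area `𝒮ⁿ⁻¹(X)`.

Existence follows by compactness (`exists_isCompact_massChain`). The map `p ↦ (p; e₁ ∧ ⋯ ∧ eₙ)` is
Lipschitz on the bounded set `U`, so its image is totally bounded, and `J_X` is a bounded multiple
of an average over this image. A minimizing sequence `J_{X_i}` therefore has a limit point `J`, and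
by continuity of `S` and of the area, `S(J)` is a limit of film chains with area `𝔪`. No spanning
set has to be attached to the limit.

The bound `c₀` on the areas requires one spanning set of size at most `c₀`
(`exists_mem_spanningSets_le_areaBound`). The cone over `M` with vertex `q` serves: a closed curve
which misses it is unlinked from each component of `M`, because the Gauss integral of the closed
solid angle form is unchanged while the component shrinks to `q`. Its size is at most `R vol(M)` for
some `R < diam U`, and the slack pays for small flat disks that make the set reduced.

All operators are handled by duality. A map given on `k`-elements by a form `ψ` extends to the
completion when the iterated differences of `ψ` up to order `r` are bounded (`HasDiffBound`). The
universal form `univForm`, `p ↦ (p; ·)`, satisfies such a bound with constant `1` and is therefore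
differentiable in the classes that occur. On it the boundary acts as the exterior derivative,
pushforward as pullback, and the product with `(0,1)` as fibre integration. The identities between
operators become `d² = 0`, the homotopy formula and Stokes' theorem for forms with values in a
Banach space of chains. -/

set_option linter.unusedSectionVars false
set_option linter.style.haveILetI false
set_option linter.deprecated false

/-! ### Mass of `k`-vectors, wedge and contraction -/

section Mass

variable {V : Type*} [NormedAddCommGroup V] [InnerProductSpace ℝ V]
variable {W : Type*} [NormedAddCommGroup W] [InnerProductSpace ℝ W]

/-- The `k`-dimensional volume of the parallelepiped spanned by `v`. -/
noncomputable def gramVol {k : ℕ} (v : Fin k → V) : ℝ :=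
  √(Matrix.det (Matrix.of fun i j => ⟪v i, v j⟫))

theorem gramVol_nonneg {k : ℕ} (v : Fin k → V) : 0 ≤ gramVol v := Real.sqrt_nonneg _

/-- If `B` is the coordinate matrix, then `det B ^ 2 = det (Bᵀ B)`, and `Bᵀ B` is the Gram matrix by
Parseval. -/
theorem OrthonormalBasis.abs_det_eq_gramVol {k : ℕ} (b : OrthonormalBasis (Fin k) ℝ V)
    (v : Fin k → V) : |b.toBasis.det v| = gramVol v := by
  rw [gramVol, ← Real.sqrt_sq_eq_abs, Basis.det_apply]
  congr 1
  rw [sq]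
  nth_rw 1 [← Matrix.det_transpose]
  rw [← Matrix.det_mul]
  congr 1
  ext i j
  simp only [Matrix.mul_apply, Matrix.transpose_apply, Basis.toMatrix_apply, Matrix.of_apply,
    OrthonormalBasis.coe_toBasis_repr_apply, OrthonormalBasis.repr_apply_apply]
  rw [← b.sum_inner_mul_inner]
  exact Finset.sum_congr rfl fun l _ => by rw [real_inner_comm]

theorem AlternatingMap.apply_eq_det_smul {M N : Type*} [AddCommGroup M] [Module ℝ M]
    [AddCommGroup N] [Module ℝ N] {k : ℕ} (f : M [⋀^Fin k]→ₗ[ℝ] N) (b : Basis (Fin k) ℝ M)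
    (v : Fin k → M) : f v = b.det v • f b := by
  have h : f = (LinearMap.toSpanSingleton ℝ N (f b)).compAlternatingMap b.det := by
    refine Basis.ext_alternating b fun σ hσ => ?_
    let e : Equiv.Perm (Fin k) := Equiv.ofBijective σ (Finite.injective_iff_bijective.1 hσ)
    have : (fun i => b (σ i)) = b ∘ e := rfl
    rw [this, AlternatingMap.map_perm, AlternatingMap.map_perm]
    simp [b.det_self]
  conv_lhs => rw [h]
  simp

/-- A simple `k`-vector is a multiple of a unit simple `k`-vector. -/
theorem ιMulti_eq_zero_or_orthonormal {k : ℕ} (v : Fin k → V) :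
    exteriorPower.ιMulti ℝ k v = 0 ∨ ∃ e : Fin k → V, Orthonormal ℝ e ∧
      (∀ i, e i ∈ Submodule.span ℝ (range v)) ∧
      ∃ c : ℝ, |c| = gramVol v ∧ exteriorPower.ιMulti ℝ k v = c • exteriorPower.ιMulti ℝ k e := by
  by_cases hv : LinearIndependent ℝ v
  · right
    let S := Submodule.span ℝ (range v)
    have hfin : finrank ℝ S = k := by
      rw [finrank_span_eq_card hv, Fintype.card_fin]
    haveI : FiniteDimensional ℝ S := FiniteDimensional.span_of_finite ℝ (finite_range v)
    let b : OrthonormalBasis (Fin k) ℝ S := (stdOrthonormalBasis ℝ S).reindex (finCongr hfin)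
    let w : Fin k → S := fun i => ⟨v i, Submodule.subset_span (mem_range_self i)⟩
    refine ⟨fun i => b i, ?_, fun i => (b i).2, b.toBasis.det w, ?_, ?_⟩
    · exact b.orthonormal.comp_linearIsometry S.subtypeₗᵢ
    · rw [b.abs_det_eq_gramVol]
      rfl
    · have := AlternatingMap.apply_eq_det_smul
        ((exteriorPower.ιMulti ℝ k).compLinearMap S.subtype) b.toBasis w
      simpa [w] using this
  · left
    exact AlternatingMap.map_linearDependent _ v hv

/-- Hadamard's inequality: for independent vectors the left side is the absolute value of the volume
form of their span; for dependent vectors the rows of the Gram matrix are dependent. -/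
theorem gramVol_le_prod_norm {k : ℕ} (v : Fin k → V) : gramVol v ≤ ∏ i, ‖v i‖ := by
  by_cases hv : LinearIndependent ℝ v
  · let S := Submodule.span ℝ (range v)
    have hfin : finrank ℝ S = k := by
      rw [finrank_span_eq_card hv, Fintype.card_fin]
    haveI : FiniteDimensional ℝ S := FiniteDimensional.span_of_finite ℝ (finite_range v)
    let b : OrthonormalBasis (Fin k) ℝ S := (stdOrthonormalBasis ℝ S).reindex (finCongr hfin)
    let w : Fin k → S := fun i => ⟨v i, Submodule.subset_span (mem_range_self i)⟩
    have h1 : gramVol v = |b.toBasis.det w| := by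
      rw [b.abs_det_eq_gramVol]
      rfl
    haveI : Fact (finrank ℝ S = k) := ⟨hfin⟩
    rw [h1, ← b.toBasis.orientation.volumeForm_robust b rfl]
    exact Orientation.abs_volumeForm_apply_le _ _
  · have : gramVol v = 0 := by
      have hd : Matrix.det (Matrix.of fun i j => ⟪v i, v j⟫) = 0 := by
        by_contra hne
        apply hv
        have hinj := Matrix.linearIndependent_rows_of_det_ne_zero hne
        rw [Fintype.linearIndependent_iff] at hinj ⊢
        intro g hg
        refine hinj g ?_
        ext j
        have := congrArg (fun x => ⟪x, v j⟫) hg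
        simpa [sum_inner, inner_smul_left] using this
      rw [gramVol, hd, Real.sqrt_zero]
    rw [this]
    positivity

theorem kvMass_bddBelow {k : ℕ} (α : ⋀[ℝ]^k V) : BddBelow {c : ℝ | ∃ L : List (ℝ × (Fin k → V)),
    α = (L.map fun s => s.1 • exteriorPower.ιMulti ℝ k s.2).sum ∧
    c = (L.map fun s => |s.1| * √(Matrix.det (Matrix.of fun i j => ⟪s.2 i, s.2 j⟫))).sum} := by
  refine ⟨0, ?_⟩
  rintro c ⟨L, -, rfl⟩
  apply List.sum_nonneg
  simp only [List.mem_map]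
  rintro _ ⟨s, -, rfl⟩
  positivity

theorem kvMass_nonempty {k : ℕ} (α : ⋀[ℝ]^k V) : {c : ℝ | ∃ L : List (ℝ × (Fin k → V)),
    α = (L.map fun s => s.1 • exteriorPower.ιMulti ℝ k s.2).sum ∧
    c = (L.map fun s =>
      |s.1| * √(Matrix.det (Matrix.of fun i j => ⟪s.2 i, s.2 j⟫))).sum}.Nonempty := by
  have hα : α ∈ Submodule.span ℝ (range (exteriorPower.ιMulti ℝ k (M := V))) := by
    rw [exteriorPower.ιMulti_span]; trivial
  suffices ∃ L : List (ℝ × (Fin k → V)),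
      α = (L.map fun s => s.1 • exteriorPower.ιMulti ℝ k s.2).sum by
    obtain ⟨L, hL⟩ := this
    exact ⟨_, L, hL, rfl⟩
  induction hα using Submodule.span_induction with
  | mem x hx => obtain ⟨v, rfl⟩ := hx; exact ⟨[(1, v)], by simp⟩
  | zero => exact ⟨[], by simp⟩
  | add x y _ _ hx hy =>
    obtain ⟨L, rfl⟩ := hx
    obtain ⟨L', rfl⟩ := hy
    exact ⟨L ++ L', by simp⟩
  | smul c x _ hx =>
    obtain ⟨L, rfl⟩ := hx
    refine ⟨L.map fun s => (c * s.1, s.2), ?_⟩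
    rw [List.smul_sum, List.map_map, List.map_map]
    congr 1
    apply List.map_congr_left
    intro s _
    simp [smul_smul]

theorem kvMass_zero {k : ℕ} : kvMass (0 : ⋀[ℝ]^k V) = 0 :=
  le_antisymm (csInf_le (kvMass_bddBelow _) ⟨[], by simp, by simp⟩) (kvMass_nonneg _)

theorem kvMass_ιMulti_le {k : ℕ} (v : Fin k → V) :
    kvMass (exteriorPower.ιMulti ℝ k v) ≤ gramVol v :=
  csInf_le (kvMass_bddBelow _) ⟨[(1, v)], by simp, by simp [gramVol]⟩

theorem kvMass_ιMulti_le_prod {k : ℕ} (v : Fin k → V) :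
    kvMass (exteriorPower.ιMulti ℝ k v) ≤ ∏ i, ‖v i‖ :=
  (kvMass_ιMulti_le v).trans (gramVol_le_prod_norm v)

/-- A subadditive homogeneous functional which is at most `C` on unit simple `k`-vectors is at most
`C` times the mass. -/
theorem le_mul_kvMass {k : ℕ} (N : (⋀[ℝ]^k V) → ℝ) {C : ℝ} (hC : 0 ≤ C)
    (h0 : N 0 ≤ 0) (hadd : ∀ x y, N (x + y) ≤ N x + N y)
    (hsmul : ∀ (c : ℝ) x, N (c • x) ≤ |c| * N x)
    (hN : ∀ e : Fin k → V, Orthonormal ℝ e → N (exteriorPower.ιMulti ℝ k e) ≤ C)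
    (α : ⋀[ℝ]^k V) : N α ≤ C * kvMass α := by
  have h1 : ∀ v : Fin k → V, N (exteriorPower.ιMulti ℝ k v) ≤ C * gramVol v := by
    intro v
    rcases ιMulti_eq_zero_or_orthonormal v with h | ⟨e, he, -, c, hc, h⟩
    · rw [h]
      exact h0.trans (mul_nonneg hC (gramVol_nonneg v))
    · rw [h, ← hc, mul_comm C]
      exact (hsmul _ _).trans (mul_le_mul_of_nonneg_left (hN e he) (abs_nonneg c))
  rw [kvMass, ← smul_eq_mul, ← Real.sInf_smul_of_nonneg hC]
  refine le_csInf ((kvMass_nonempty α).smul_set) ?_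
  rintro _ ⟨_, ⟨L, rfl, rfl⟩, rfl⟩
  induction L with
  | nil => simpa using h0
  | cons s L ih =>
    simp only [List.map_cons, List.sum_cons, smul_eq_mul, mul_add] at ih ⊢
    refine (hadd _ _).trans (add_le_add ?_ ih)
    refine (hsmul _ _).trans ?_
    rw [mul_left_comm]
    exact mul_le_mul_of_nonneg_left (h1 s.2) (abs_nonneg _)

/-- A linear map is compared with the mass by testing it only on wedges of vectors of length at most
one; this is how every bound on `k`-vectors below is obtained. -/
theorem norm_le_mul_kvMass {F : Type*} [SeminormedAddCommGroup F] [NormedSpace ℝ F] {k : ℕ}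
    (T : (⋀[ℝ]^k V) →ₗ[ℝ] F) {C : ℝ} (hC : 0 ≤ C)
    (hT : ∀ e : Fin k → V, (∀ i, ‖e i‖ ≤ 1) → ‖T (exteriorPower.ιMulti ℝ k e)‖ ≤ C)
    (α : ⋀[ℝ]^k V) : ‖T α‖ ≤ C * kvMass α :=
  le_mul_kvMass (fun α => ‖T α‖) hC (by simp) (fun x y => by rw [map_add]; exact norm_add_le _ _)
    (fun c x => by rw [map_smul, norm_smul, Real.norm_eq_abs])
    (fun e he => hT e fun i => (he.1 i).le) α

theorem kvWedge_ιMulti {k : ℕ} (v : V) (w : Fin k → V) :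
    kvWedge v (exteriorPower.ιMulti ℝ k w) = exteriorPower.ιMulti ℝ (k + 1) (Fin.cons v w) := by
  apply Subtype.ext
  simp only [kvWedge, exteriorPower.ιMulti_apply_coe, ExteriorAlgebra.ιMulti_apply,
    List.ofFn_succ, List.prod_cons, Fin.cons_zero, Fin.cons_succ]

/-- Exterior multiplication with a vector as a linear map. -/
noncomputable def kvWedgeₗ {k : ℕ} (v : V) : (⋀[ℝ]^k V) →ₗ[ℝ] ⋀[ℝ]^(k + 1) V where
  toFun := kvWedge v
  map_add' x y := Subtype.ext (by simp [kvWedge, mul_add])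
  map_smul' c x := Subtype.ext (by simp [kvWedge])

/-- Contraction with a vector as a linear map. -/
noncomputable def kvContractₗ {k : ℕ} (v : V) : (⋀[ℝ]^(k + 1) V) →ₗ[ℝ] ⋀[ℝ]^k V where
  toFun := kvContract v
  map_add' x y := Subtype.ext (by simp [kvContract])
  map_smul' c x := Subtype.ext (by simp [kvContract])

/-- The antiderivation rule, unrolled. It produces the same alternating sum as the exterior
derivative, which is what makes the boundary dual to `d`. -/
theorem kvContract_ιMulti {k : ℕ} (u : V) (v : Fin (k + 1) → V) :
    kvContract u (exteriorPower.ιMulti ℝ (k + 1) v) =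
      ∑ i : Fin (k + 1), ((-1 : ℝ) ^ (i : ℕ) * ⟪u, v i⟫) •
        exteriorPower.ιMulti ℝ k (i.removeNth v) := by
  have hcons : ∀ {j : ℕ} (w : Fin (j + 1) → V), ExteriorAlgebra.ιMulti ℝ (j + 1) w =
      ExteriorAlgebra.ι ℝ (w 0) * ExteriorAlgebra.ιMulti ℝ j (Fin.tail w) := by
    intro j w
    simp only [ExteriorAlgebra.ιMulti_apply, List.ofFn_succ, List.prod_cons, Fin.tail]
  apply Subtype.ext
  induction k with
  | zero =>
    simp only [kvContract, exteriorPower.ιMulti_apply_coe, hcons]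
    have h := CliffordAlgebra.contractLeft_ι (0 : QuadraticForm ℝ V) (d := innerₛₗ ℝ u) (v 0)
    simp only [ExteriorAlgebra.ιMulti_apply, List.ofFn_zero, List.prod_nil, mul_one]
    erw [h]
    simp [Algebra.algebraMap_eq_smul_one]
  | succ k ih =>
    have hk := ih (Fin.tail v)
    simp only [kvContract, exteriorPower.ιMulti_apply_coe] at hk ⊢
    rw [hcons]
    have h := CliffordAlgebra.contractLeft_ι_mul (Q := (0 : QuadraticForm ℝ V))
      (d := innerₛₗ ℝ u) (v 0) (ExteriorAlgebra.ιMulti ℝ (k + 1) (Fin.tail v))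
    erw [h, hk]
    simp only [AddSubmonoidClass.coe_finset_sum, Submodule.coe_smul,
      exteriorPower.ιMulti_apply_coe]
    rw [Fin.sum_univ_succ (n := k + 1)]
    rw [sub_eq_add_neg]
    congr 1
    · simp only [Fin.val_zero, pow_zero, one_mul]
      congr 2
    · rw [Finset.mul_sum, ← Finset.sum_neg_distrib]
      refine Finset.sum_congr rfl fun i _ => ?_
      rw [hcons (i.succ.removeNth v)]
      have e1 : i.succ.removeNth v 0 = v 0 := by simp [Fin.removeNth]
      have e2 : Fin.tail (i.succ.removeNth v) = i.removeNth (Fin.tail v) := by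
        ext j
        simp [Fin.removeNth, Fin.tail]
      rw [e1, e2]
      erw [mul_smul_comm]
      rw [← neg_smul]
      congr 1
      simp [pow_succ, Fin.tail]

end Mass

/-! ### Continuous alternating maps as functionals on `k`-vectors -/

section FormEval

variable {V : Type*} [NormedAddCommGroup V] [InnerProductSpace ℝ V]
variable {F : Type*} [NormedAddCommGroup F] [NormedSpace ℝ F]

/-- The linear map on `k`-vectors given by a continuous alternating map. -/
noncomputable def formEval {k : ℕ} (φ : V [⋀^Fin k]→L[ℝ] F) : (⋀[ℝ]^k V) →ₗ[ℝ] F :=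
  exteriorPower.alternatingMapLinearEquiv φ.toAlternatingMap

@[simp] theorem formEval_ιMulti {k : ℕ} (φ : V [⋀^Fin k]→L[ℝ] F) (v : Fin k → V) :
    formEval φ (exteriorPower.ιMulti ℝ k v) = φ v := by
  simp [formEval]

theorem kvector_hom_ext {k : ℕ} {N : Type*} [AddCommGroup N] [Module ℝ N]
    {f g : (⋀[ℝ]^k V) →ₗ[ℝ] N}
    (h : ∀ v, f (exteriorPower.ιMulti ℝ k v) = g (exteriorPower.ιMulti ℝ k v)) : f = g :=
  exteriorPower.linearMap_ext (by ext v; exact h v)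

theorem formEval_add {k : ℕ} (φ ψ : V [⋀^Fin k]→L[ℝ] F) :
    formEval (φ + ψ) = formEval φ + formEval ψ :=
  kvector_hom_ext fun v => by simp

theorem formEval_smul {k : ℕ} (c : ℝ) (φ : V [⋀^Fin k]→L[ℝ] F) :
    formEval (c • φ) = c • formEval φ :=
  kvector_hom_ext fun v => by simp

theorem norm_formEval_le {k : ℕ} (φ : V [⋀^Fin k]→L[ℝ] F) (α : ⋀[ℝ]^k V) :
    ‖formEval φ α‖ ≤ ‖φ‖ * kvMass α := by
  refine norm_le_mul_kvMass _ (norm_nonneg _) (fun e he => ?_) α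
  rw [formEval_ιMulti]
  refine (φ.le_opNorm e).trans ?_
  exact mul_le_of_le_one_right (norm_nonneg _)
    (Finset.prod_le_one (fun i _ => norm_nonneg _) fun i _ => he i)

end FormEval

/-! ### Functions with bounded iterated differences -/

section IteratedDifferences

variable {V : Type*} [NormedAddCommGroup V] [NormedSpace ℝ V]
variable {W : Type*} [NormedAddCommGroup W] [NormedSpace ℝ W]
variable {X : Type*} [NormedAddCommGroup X] [NormedSpace ℝ X]
variable {Y : Type*} [NormedAddCommGroup Y] [NormedSpace ℝ Y]
variable {Z : Type*} [NormedAddCommGroup Z] [NormedSpace ℝ Z]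

/-- The iterated difference of a function in the directions of a list. -/
def iterDiff {A : Type*} [AddCommGroup A] : List V → (V → A) → V → A
  | [], ψ => ψ
  | u :: l, ψ => iterDiff l fun p => ψ (p + u) - ψ p

/-- The vertices of the parallelepiped at `p` spanned by a list of vectors. -/
def corners (p : V) : List V → Set V
  | [] => {p}
  | u :: l => corners p l ∪ (fun x => x + u) '' corners p l

theorem corners_finite (p : V) (l : List V) : (corners p l).Finite := by
  induction l with
  | nil => exact finite_singleton p
  | cons u l ih => exact ih.union (ih.image _)

theorem corners_add (p u : V) (l : List V) :
    corners (p + u) l = (fun x => x + u) '' corners p l := by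
  induction l with
  | nil => simp [corners]
  | cons v l ih =>
    simp only [corners, ih, image_union, image_image]
    congr 2
    ext x
    rw [add_right_comm]

theorem iterDiff_map {A B : Type*} [AddCommGroup A] [AddCommGroup B] (g : A →+ B) (l : List V)
    (ψ : V → A) (p : V) : g (iterDiff l ψ p) = iterDiff l (fun p => g (ψ p)) p := by
  induction l generalizing ψ with
  | nil => rfl
  | cons u l ih => simp only [iterDiff, ih, map_sub]

theorem iterDiff_sub {A : Type*} [AddCommGroup A] (l : List V) (ψ φ : V → A) (p : V) :
    iterDiff l (fun p => ψ p - φ p) p = iterDiff l ψ p - iterDiff l φ p := by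
  induction l generalizing ψ φ with
  | nil => rfl
  | cons u l ih =>
    simp only [iterDiff]
    rw [← ih]
    congr 1
    ext p
    abel

theorem iterDiff_translate {A : Type*} [AddCommGroup A] (l : List V) (ψ : V → A) (u p : V) :
    iterDiff l (fun p => ψ (p + u)) p = iterDiff l ψ (p + u) := by
  induction l generalizing ψ with
  | nil => rfl
  | cons v l ih =>
    simp only [iterDiff]
    rw [← ih]
    congr 1
    ext p
    rw [add_right_comm]

theorem iterDiff_cons {A : Type*} [AddCommGroup A] (l : List V) (ψ : V → A) (u p : V) :
    iterDiff (u :: l) ψ p = iterDiff l ψ (p + u) - iterDiff l ψ p := by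
  rw [← iterDiff_translate, ← iterDiff_sub]
  rfl

theorem iterDiff_congr {A : Type*} [AddCommGroup A] {l : List V} {ψ φ : V → A} {p : V}
    (h : ∀ x ∈ corners p l, ψ x = φ x) : iterDiff l ψ p = iterDiff l φ p := by
  induction l generalizing p with
  | nil => exact h p rfl
  | cons u l ih =>
    rw [iterDiff_cons, iterDiff_cons, ih fun x hx => h x (Or.inl hx),
      ih fun x hx => h x (Or.inr (by rwa [corners_add] at hx))]

/-- All differences of `ψ` of order at most `r` inside `U` are bounded by `C` times the product of
the lengths of the directions. -/
def HasDiffBound (U : Set V) (r : ℕ) (C : ℝ) (ψ : V → X) : Prop :=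
  ∀ l : List V, l.length ≤ r → ∀ p, corners p l ⊆ U → ‖iterDiff l ψ p‖ ≤ C * (l.map norm).prod

theorem List.prod_map_norm_nonneg (l : List V) : 0 ≤ (l.map norm).prod :=
  List.prod_nonneg fun _ h => by
    obtain ⟨u, -, rfl⟩ := List.mem_map.1 h
    exact norm_nonneg u

theorem HasDiffBound.mono {U : Set V} {r s : ℕ} {C D : ℝ} {ψ : V → X} (h : HasDiffBound U r C ψ)
    (hs : s ≤ r) (hD : C ≤ D) : HasDiffBound U s D ψ := fun l hl p hp =>
  (h l (hl.trans hs) p hp).trans (mul_le_mul_of_nonneg_right hD l.prod_map_norm_nonneg)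

theorem HasDiffBound.bound {U : Set V} {r : ℕ} {C : ℝ} {ψ : V → X} (h : HasDiffBound U r C ψ)
    {p : V} (hp : p ∈ U) : ‖ψ p‖ ≤ C := by
  simpa [iterDiff] using h [] (Nat.zero_le _) p (by simpa [corners] using hp)

theorem HasDiffBound.lipschitz {U : Set V} {r : ℕ} {C : ℝ} {ψ : V → X} (h : HasDiffBound U r C ψ)
    (hr : 1 ≤ r) {p q : V} (hp : p ∈ U) (hq : q ∈ U) : ‖ψ q - ψ p‖ ≤ C * ‖q - p‖ := by
  have := h [q - p] hr p (by
    rintro x (rfl | ⟨_, rfl, rfl⟩)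
    · exact hp
    · simpa using hq)
  simpa [iterDiff] using this

theorem HasDiffBound.continuousOn {U : Set V} {r : ℕ} {C : ℝ} {ψ : V → X}
    (h : HasDiffBound U r C ψ) (hr : 1 ≤ r) : ContinuousOn ψ U := by
  have : LipschitzOnWith C.toNNReal ψ U := LipschitzOnWith.of_dist_le_mul fun x hx y hy => by
    rw [dist_eq_norm, dist_eq_norm]
    exact (h.lipschitz hr hy hx).trans
      (mul_le_mul_of_nonneg_right (Real.le_coe_toNNReal C) (norm_nonneg _))
  exact this.continuousOn

theorem HasDiffBound.clm {U : Set V} {r : ℕ} {C : ℝ} {ψ : V → X} (h : HasDiffBound U r C ψ)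
    (L : X →L[ℝ] Y) : HasDiffBound U r (‖L‖ * C) fun p => L (ψ p) := fun l hl p hp => by
  have := iterDiff_map (L : X →+ Y) l ψ p
  simp only [AddMonoidHom.coe_coe] at this
  rw [← this, mul_assoc]
  exact L.le_opNorm_of_le (h l hl p hp)

theorem HasDiffBound.const_nonneg {U : Set V} {r : ℕ} {C : ℝ} {ψ : V → X}
    (h : HasDiffBound U r C ψ) (hU : U.Nonempty) : 0 ≤ C :=
  (norm_nonneg _).trans (h.bound hU.some_mem)

theorem hasDiffBound_const {U : Set V} {r : ℕ} (x : X) :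
    HasDiffBound U r ‖x‖ fun _ : V => x := by
  intro l _ p _
  cases l with
  | nil => simp [iterDiff]
  | cons u l =>
    have : iterDiff (u :: l) (fun _ : V => x) p = 0 := by
      rw [iterDiff_cons, ← iterDiff_translate, sub_self]
    rw [this, norm_zero]
    exact mul_nonneg (norm_nonneg x) (List.prod_map_norm_nonneg _)

/-- A bilinear map applied to functions with bounded differences. -/
theorem HasDiffBound.bilin {U : Set V} {r : ℕ} (hr : r ≤ 2) {C D : ℝ} {f : V → X} {g : V → Y}
    (hC : 0 ≤ C) (hD : 0 ≤ D)
    (hf : HasDiffBound U r C f) (hg : HasDiffBound U r D g) (B : X →ₗ[ℝ] Y →ₗ[ℝ] Z)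
    (hB : ∀ x y, ‖B x y‖ ≤ ‖x‖ * ‖y‖) : HasDiffBound U r (4 * (C * D)) fun p => B (f p) (g p) := by
  have hb : ∀ x y a b, ‖x‖ ≤ a → ‖y‖ ≤ b → ‖B x y‖ ≤ a * b := fun x y a b hx hy => by
    have ha := (norm_nonneg x).trans hx
    exact (hB x y).trans (by gcongr)
  intro l hl p hp
  match l, hl with
  | [], hl =>
    simp only [iterDiff, List.map_nil, List.prod_nil, mul_one]
    have hpU : p ∈ U := hp rfl
    refine (hb _ _ _ _ (hf.bound hpU) (hg.bound hpU)).trans ?_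
    nlinarith [mul_nonneg hC hD]
  | [u], hl =>
    have hr1 : 1 ≤ r := hl
    have h1 : p ∈ U := hp (Or.inl rfl)
    have h2 : p + u ∈ U := hp (Or.inr ⟨p, rfl, rfl⟩)
    simp only [iterDiff, List.map_cons, List.map_nil, List.prod_cons, List.prod_nil, mul_one]
    have e : B (f (p + u)) (g (p + u)) - B (f p) (g p) =
        B (f (p + u) - f p) (g (p + u)) + B (f p) (g (p + u) - g p) := by
      simp
    have hfu := hf.lipschitz hr1 h1 h2
    have hgu := hg.lipschitz hr1 h1 h2
    rw [add_sub_cancel_left] at hfu hgu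
    rw [e]
    refine (norm_add_le _ _).trans ((add_le_add (hb _ _ _ _ hfu (hg.bound h2))
      (hb _ _ _ _ (hf.bound h1) hgu)).trans ?_)
    nlinarith [mul_nonneg (mul_nonneg hC hD) (norm_nonneg u)]
  | [u, v], hl =>
    have hr2 : 2 ≤ r := hl
    have hr1 : 1 ≤ r := by omega
    have h1 : p ∈ U := hp (Or.inl (Or.inl rfl))
    have h2 : p + v ∈ U := hp (Or.inl (Or.inr ⟨p, rfl, rfl⟩))
    have h3 : p + u ∈ U := hp (Or.inr ⟨p, Or.inl rfl, rfl⟩)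
    have h4 : p + v + u ∈ U := hp (Or.inr ⟨p + v, Or.inr ⟨p, rfl, rfl⟩, rfl⟩)
    have hf2 := hf [u, v] hl p hp
    have hg2 := hg [u, v] hl p hp
    simp only [iterDiff, List.map_cons, List.map_nil, List.prod_cons, List.prod_nil, mul_one]
      at hf2 hg2 ⊢
    -- Second-order Leibniz rule. Each of the four terms is at most `C D ‖u‖ ‖v‖`, whence the factor
    -- `4`.
    have e : B (f (p + v + u)) (g (p + v + u)) - B (f (p + v)) (g (p + v)) -
        (B (f (p + u)) (g (p + u)) - B (f p) (g p)) =
        B (f (p + v + u) - f (p + v) - (f (p + u) - f p)) (g (p + v + u)) +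
        B (f (p + u) - f p) (g (p + v + u) - g (p + u)) +
        B (f (p + v) - f p) (g (p + v + u) - g (p + v)) +
        B (f p) (g (p + v + u) - g (p + v) - (g (p + u) - g p)) := by
      simp only [map_sub, LinearMap.sub_apply]
      abel
    have a1 := hf.lipschitz hr1 h1 h3
    have a2 := hf.lipschitz hr1 h1 h2
    have b1 := hg.lipschitz hr1 h3 h4
    have b2 := hg.lipschitz hr1 h2 h4
    have e1 : p + v + u - (p + u) = v := by abel
    rw [add_sub_cancel_left] at a1 a2 b2
    rw [e1] at b1
    rw [e]
    refine (norm_add_le_of_le (norm_add_le_of_le (norm_add_le_of_le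
      (hb _ _ _ _ hf2 (hg.bound h4)) (hb _ _ _ _ a1 b1)) (hb _ _ _ _ a2 b2))
      (hb _ _ _ _ (hf.bound h1) hg2)).trans (le_of_eq ?_)
    ring
  | u :: v :: w :: l, hl =>
    simp only [List.length_cons] at hl
    omega

/-- A form with bounded differences, applied to vector fields with bounded differences. -/
theorem HasDiffBound.alternating_apply {U : Set V} {r : ℕ} (hr : r ≤ 2) {k : ℕ} {C D : ℝ}
    (hC : 0 ≤ C) (hD : 0 ≤ D) {Φ : V → W [⋀^Fin k]→L[ℝ] X} {w : Fin k → V → W}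
    (hΦ : HasDiffBound U r C Φ) (hw : ∀ i, HasDiffBound U r D (w i)) :
    HasDiffBound U r (C * (4 * D) ^ k) fun p => Φ p fun i => w i p := by
  induction k generalizing C with
  | zero =>
    let L : (W [⋀^Fin 0]→L[ℝ] X) →L[ℝ] X :=
      (ContinuousAlternatingMap.constOfIsEmptyLIE ℝ W X (Fin 0)).symm.toContinuousLinearEquiv
    have hL : ‖L‖ ≤ 1 := ContinuousLinearMap.opNorm_le_bound _ zero_le_one fun x => by
      rw [one_mul]
      exact (LinearIsometryEquiv.norm_map _ x).le
    refine (?_ : HasDiffBound U r (‖L‖ * C) _).mono le_rfl ?_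
    · convert hΦ.clm L using 2 with p
      change Φ p _ = Φ p _
      congr 1
      exact Subsingleton.elim _ _
    · rw [pow_zero, mul_one]
      exact mul_le_of_le_one_left hC hL
  | succ k ih =>
    -- Inserting the first vector field is a bilinear pairing, so each of the `k` arguments costs a
    -- factor `4 D`.
    let B : (W [⋀^Fin (k + 1)]→L[ℝ] X) →ₗ[ℝ] W →ₗ[ℝ] (W [⋀^Fin k]→L[ℝ] X) :=
      LinearMap.mk₂ ℝ (fun φ v => φ.curryLeft v) (fun _ _ _ => rfl) (fun _ _ _ => rfl)
        (fun φ v v' => map_add φ.curryLeft v v') (fun c φ v => map_smul φ.curryLeft c v)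
    have hB : ∀ φ v, ‖B φ v‖ ≤ ‖φ‖ * ‖v‖ := fun φ v =>
      φ.curryLeft.le_of_opNorm_le φ.norm_curryLeft.le v
    have h := ih (C := 4 * (C * D)) (by positivity) (hΦ.bilin hr hC hD (hw 0) B hB)
      (w := fun i => w i.succ) fun i => hw i.succ
    have e : 4 * (C * D) * (4 * D) ^ k = C * (4 * D) ^ (k + 1) := by ring
    rw [e] at h
    convert h using 2 with p
    change Φ p _ = Φ p (Matrix.vecCons _ _)
    congr 1
    ext i
    refine Fin.cases ?_ (fun j => ?_) i <;> rfl

/-- A function of class `C^{1,1}` has bounded differences of second order. -/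
theorem hasDiffBound_two_of_fderiv {U : Set V} (hUc : Convex ℝ U) {C : ℝ} {f : V → X}
    (h0 : ∀ p ∈ U, ‖f p‖ ≤ C) (hd : ∀ p ∈ U, DifferentiableAt ℝ f p)
    (hf : HasDiffBound U 1 C (fderiv ℝ f)) : HasDiffBound U 2 C f := by
  have hseg : ∀ {p u : V}, p ∈ U → p + u ∈ U → segment ℝ p (p + u) ⊆ U :=
    fun h h' => hUc.segment_subset h h'
  intro l hl p hp
  match l, hl with
  | [], hl =>
    simpa [iterDiff] using h0 p (hp rfl)
  | [u], hl =>
    have h1 : p ∈ U := hp (Or.inl rfl)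
    have h2 : p + u ∈ U := hp (Or.inr ⟨p, rfl, rfl⟩)
    simp only [iterDiff, List.map_cons, List.map_nil, List.prod_cons, List.prod_nil, mul_one]
    have := hUc.norm_image_sub_le_of_norm_fderiv_le hd (fun x hx => hf.bound hx) h1 h2
    simpa using this
  | [u, v], hl =>
    have h1 : p ∈ U := hp (Or.inl (Or.inl rfl))
    have h2 : p + v ∈ U := hp (Or.inl (Or.inr ⟨p, rfl, rfl⟩))
    have h3 : p + u ∈ U := hp (Or.inr ⟨p, Or.inl rfl, rfl⟩)
    have h4 : p + v + u ∈ U := hp (Or.inr ⟨p + v, Or.inr ⟨p, rfl, rfl⟩, rfl⟩)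
    simp only [iterDiff, List.map_cons, List.map_nil, List.prod_cons, List.prod_nil, mul_one]
    have hs1 : segment ℝ p (p + v) ⊆ U := hseg h1 h2
    have hs2 : ∀ x ∈ segment ℝ p (p + v), x + u ∈ U := fun x hx => by
      obtain ⟨a, b, ha, hb, hab, rfl⟩ := hx
      have := hUc h3 h4 ha hb hab
      convert this using 1
      have hu : u = a • u + b • u := by rw [← add_smul, hab, one_smul]
      nth_rw 1 [hu]
      simp only [smul_add]
      abel
    -- The second difference is the increment of `x ↦ f (x + u) - f x` along `[p, p + v]`. Its
    -- derivative is a first difference of `f'`, hence at most `C ‖u‖`.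
    have key := (convex_segment (𝕜 := ℝ) p (p + v)).norm_image_sub_le_of_norm_hasFDerivWithin_le
      (f := fun x => f (x + u) - f x) (f' := fun x => fderiv ℝ f (x + u) - fderiv ℝ f x)
      (C := C * ‖u‖) (fun x hx => ?_) (fun x hx => ?_) (left_mem_segment ℝ _ _)
      (right_mem_segment ℝ _ _)
    · rw [add_sub_cancel_left] at key
      rw [← mul_assoc]
      exact key
    · have hx1 := (hd _ (hs2 x hx)).hasFDerivAt
      have hx2 : HasFDerivAt (fun x => f (x + u)) (fderiv ℝ f (x + u)) x :=
        hx1.comp x ((hasFDerivAt_id x).add_const u)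
      exact (hx2.sub (hd x (hs1 hx)).hasFDerivAt).hasFDerivWithinAt
    · simpa using hf.lipschitz le_rfl (hs1 hx) (hs2 x hx)
  | u :: v :: w :: l, hl =>
    simp only [List.length_cons] at hl
    omega

theorem eventually_corners_add_subset {U : Set V} (hU : IsOpen U) {p : V} {l : List V}
    (hp : corners p l ⊆ U) : ∀ᶠ u in 𝓝 (0 : V), corners (p + u) l ⊆ U := by
  have : ∀ x ∈ corners p l, ∀ᶠ u in 𝓝 (0 : V), x + u ∈ U := fun x hx => by
    have hc : Tendsto (fun u : V => x + u) (𝓝 0) (𝓝 x) := by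
      have : Continuous fun u : V => x + u := by fun_prop
      simpa using this.tendsto 0
    exact hc (hU.mem_nhds (hp hx))
  filter_upwards [((corners_finite p l).eventually_all).2 this] with u hu
  rw [corners_add]
  rintro _ ⟨x, hx, rfl⟩
  exact hu x hx

theorem hasFDerivAt_iterDiff {l : List V} {p : V} {f : V → X} {f' : V → V →L[ℝ] X}
    (h : ∀ x ∈ corners p l, HasFDerivAt f (f' x) x) :
    HasFDerivAt (iterDiff l f) (iterDiff l f' p) p := by
  induction l generalizing p with
  | nil => exact h p rfl
  | cons u l ih =>
    have e : iterDiff (u :: l) f = fun p => iterDiff l f (p + u) - iterDiff l f p := by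
      ext p
      exact iterDiff_cons l f u p
    rw [e, iterDiff_cons]
    refine HasFDerivAt.sub ?_ (ih fun x hx => h x (Or.inl hx))
    exact (ih (p := p + u) fun x hx => h x (Or.inr (by rwa [corners_add] at hx))).comp p
      ((hasFDerivAt_id p).add_const u)

/-- A function with bounded second differences is differentiable. -/
theorem HasDiffBound.exists_hasFDerivAt [CompleteSpace X] {U : Set V} (hUo : IsOpen U)
    (hUc : Convex ℝ U) {C : ℝ} (hC : 0 ≤ C) {f : V → X} (hf : HasDiffBound U 2 C f) {p : V}
    (hp : p ∈ U) : ∃ A : V →L[ℝ] X, ∀ u, p + u ∈ U → ‖f (p + u) - f p - A u‖ ≤ C * ‖u‖ ^ 2 := by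
  -- Dyadic difference quotients in the direction `u`; their limit is the candidate for the
  -- derivative.
  let s : V → ℕ → X := fun u n => (2 : ℝ) ^ n • (f (p + (1 / 2 : ℝ) ^ n • u) - f p)
  have hpow : ∀ n : ℕ, (2 : ℝ) ^ n * (1 / 2) ^ n = 1 := fun n => by
    rw [← mul_pow]; norm_num
  have hzero : ∀ u : V, Tendsto (fun n : ℕ => (1 / 2 : ℝ) ^ n • u) atTop (𝓝 0) := fun u => by
    have := (tendsto_pow_atTop_nhds_zero_of_lt_one (r := (1 / 2 : ℝ)) (by norm_num)
      (by norm_num)).smul_const u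
    simpa using this
  have hmem : ∀ u, ∀ᶠ n in atTop, p + (1 / 2 : ℝ) ^ n • u ∈ U := fun u => by
    have := (hzero u).const_add p
    rw [add_zero] at this
    exact this (hUo.mem_nhds hp)
  have hhalf : ∀ u n, p + (1 / 2 : ℝ) ^ n • u ∈ U → p + (1 / 2 : ℝ) ^ (n + 1) • u ∈ U := by
    intro u n h
    have := hUc hp h (a := 1 / 2) (b := 1 / 2) (by norm_num) (by norm_num) (by norm_num)
    convert this using 1
    rw [smul_add, ← add_assoc, ← add_smul, smul_smul, pow_succ']
    norm_num
  have hstep : ∀ u n, p + (1 / 2 : ℝ) ^ n • u ∈ U →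
      ‖s u (n + 1) - s u n‖ ≤ C * ‖u‖ ^ 2 / 2 / 2 / 2 ^ n := by
    intro u n h
    set w := (1 / 2 : ℝ) ^ (n + 1) • u with hw
    have h2 := hhalf u n h
    have e : (1 / 2 : ℝ) ^ n • u = w + w := by
      rw [hw, ← add_smul, pow_succ]
      congr 1
      ring
    have key := hf [w, w] le_rfl p (by
      rintro x ((rfl | ⟨_, rfl, rfl⟩) | ⟨_, (rfl | ⟨_, rfl, rfl⟩), rfl⟩)
      · exact hp
      · exact h2
      · exact h2
      · simpa [add_assoc, ← e] using h)
    simp only [iterDiff, List.map_cons, List.map_nil, List.prod_cons, List.prod_nil, mul_one] at key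
    -- With `w = u / 2ⁿ⁺¹`, consecutive quotients differ by `2ⁿ` times the second difference in the
    -- directions `w, w`, so the sequence is geometrically Cauchy.
    have e2 : s u (n + 1) - s u n =
        -((2 : ℝ) ^ n • (f (p + w + w) - f (p + w) - (f (p + w) - f p))) := by
      simp only [s]
      rw [e, ← hw, pow_succ, mul_smul, ← smul_sub, ← smul_neg, two_smul, add_assoc p w w]
      congr 1
      abel
    rw [e2, norm_neg, norm_smul, Real.norm_of_nonneg (by positivity)]
    calc (2 : ℝ) ^ n * ‖f (p + w + w) - f (p + w) - (f (p + w) - f p)‖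
        ≤ 2 ^ n * (C * (‖w‖ * ‖w‖)) := by gcongr
      _ = C * ‖u‖ ^ 2 / 2 / 2 / 2 ^ n := by
        rw [hw, norm_smul, Real.norm_of_nonneg (by positivity), pow_succ, div_pow, one_pow]
        field_simp
  have hlim : ∀ u, ∃ a, Tendsto (s u) atTop (𝓝 a) := by
    intro u
    obtain ⟨N, hN⟩ := eventually_atTop.1 (hmem u)
    have hc : CauchySeq fun n => s u (n + N) := by
      refine cauchySeq_of_le_geometric_two (C := C * ‖u‖ ^ 2 / 2) fun n => ?_
      rw [dist_comm, dist_eq_norm]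
      have := hstep u (n + N) (hN _ (Nat.le_add_left _ _))
      rw [show n + 1 + N = n + N + 1 by ring]
      refine this.trans ?_
      refine div_le_div_of_nonneg_left (by positivity) (by positivity) ?_
      exact pow_le_pow_right₀ (by norm_num) (Nat.le_add_right _ _)
    obtain ⟨a, ha⟩ := cauchySeq_tendsto_of_complete hc
    exact ⟨a, (tendsto_add_atTop_iff_nat N).1 ha⟩
  choose A hA using hlim
  have hbound : ∀ u, ‖A u‖ ≤ C * ‖u‖ := fun u => by
    refine le_of_tendsto (hA u).norm ?_
    filter_upwards [hmem u] with n hn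
    have := hf.lipschitz one_le_two hp hn
    simp only [s, norm_smul, add_sub_cancel_left] at this ⊢
    rw [Real.norm_of_nonneg (by positivity : (0 : ℝ) ≤ (1 / 2) ^ n)] at this
    rw [Real.norm_of_nonneg (by positivity : (0 : ℝ) ≤ 2 ^ n)]
    calc _ ≤ (2 : ℝ) ^ n * (C * ((1 / 2) ^ n * ‖u‖)) := by gcongr
      _ = C * ‖u‖ * (2 ^ n * (1 / 2) ^ n) := by ring
      _ = _ := by rw [hpow, mul_one]
  -- The failure of additivity at stage `n` is `2ⁿ` times a second difference in the directions `u /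
  -- 2ⁿ, v / 2ⁿ`, so it is of order `2⁻ⁿ`.
  have hadd : ∀ u v, A (u + v) = A u + A v := fun u v => by
    have h1 : Tendsto (fun n => s (u + v) n - (s u n + s v n)) atTop
        (𝓝 (A (u + v) - (A u + A v))) := (hA _).sub ((hA u).add (hA v))
    have h2 : Tendsto (fun n => s (u + v) n - (s u n + s v n)) atTop (𝓝 0) := by
      refine squeeze_zero_norm' (a := fun n : ℕ => C * (‖u‖ * ‖v‖) * (1 / 2) ^ n) ?_ ?_
      · filter_upwards [hmem u, hmem v, hmem (u + v)] with n h1 h2 h3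
        have hcor : p + (1 / 2 : ℝ) ^ n • v + (1 / 2 : ℝ) ^ n • u = p + (1 / 2 : ℝ) ^ n • (u + v) := by
          rw [smul_add]; abel
        have key := hf [(1 / 2 : ℝ) ^ n • u, (1 / 2 : ℝ) ^ n • v] le_rfl p (by
          rintro x ((rfl | ⟨_, rfl, rfl⟩) | ⟨_, (rfl | ⟨_, rfl, rfl⟩), rfl⟩)
          · exact hp
          · exact h2
          · exact h1
          · simpa only [hcor] using h3)
        simp only [iterDiff, List.map_cons, List.map_nil, List.prod_cons, List.prod_nil, mul_one,
          norm_smul, Real.norm_of_nonneg (by positivity : (0 : ℝ) ≤ (1 / 2) ^ n)] at key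
        rw [hcor] at key
        have e : s (u + v) n - (s u n + s v n) = (2 : ℝ) ^ n •
            (f (p + (1 / 2 : ℝ) ^ n • (u + v)) - f (p + (1 / 2 : ℝ) ^ n • v) -
              (f (p + (1 / 2 : ℝ) ^ n • u) - f p)) := by
          simp only [s, ← smul_add, ← smul_sub]
          congr 1
          abel
        rw [e, norm_smul, Real.norm_of_nonneg (by positivity)]
        calc _ ≤ (2 : ℝ) ^ n * (C * ((1 / 2) ^ n * ‖u‖ * ((1 / 2) ^ n * ‖v‖))) := by gcongr
          _ = C * (‖u‖ * ‖v‖) * (1 / 2) ^ n * (2 ^ n * (1 / 2) ^ n) := by ring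
          _ = _ := by rw [hpow, mul_one]
      · have := (tendsto_pow_atTop_nhds_zero_of_lt_one (r := (1 / 2 : ℝ)) (by norm_num)
          (by norm_num)).const_mul (C * (‖u‖ * ‖v‖))
        simpa using this
    exact sub_eq_zero.1 (tendsto_nhds_unique h1 h2)
  let A' : V →+ X := AddMonoidHom.mk' A hadd
  have hcont : Continuous A' := AddMonoidHomClass.continuous_of_bound A' C hbound
  refine ⟨A'.toRealLinearMap hcont, fun u hu => ?_⟩
  have hall : ∀ n, p + (1 / 2 : ℝ) ^ n • u ∈ U := fun n => by
    induction n with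
    | zero => simpa using hu
    | succ n ih => exact hhalf u n ih
  -- The quotient at stage `0` is `f (p + u) - f p` itself, so summing the geometric series bounds
  -- the Taylor remainder.
  have := dist_le_of_le_geometric_two_of_tendsto₀ (f := s u) (C := C * ‖u‖ ^ 2 / 2)
    (fun n => by rw [dist_comm, dist_eq_norm]; exact hstep u n (hall n)) (hA u)
  rw [dist_eq_norm] at this
  simp only [s, pow_zero, one_smul] at this
  refine this.trans ?_
  nlinarith [mul_nonneg hC (sq_nonneg ‖u‖)]

theorem HasDiffBound.differentiableAt [CompleteSpace X] {U : Set V} (hUo : IsOpen U)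
    (hUc : Convex ℝ U) {C : ℝ} {r : ℕ} (hr : 2 ≤ r) {f : V → X} (hf : HasDiffBound U r C f)
    {p : V} (hp : p ∈ U) : DifferentiableAt ℝ f p := by
  have hC := hf.const_nonneg ⟨p, hp⟩
  obtain ⟨A, hA⟩ := (hf.mono hr le_rfl).exists_hasFDerivAt hUo hUc hC hp
  refine HasFDerivAt.differentiableAt (f' := A) ?_
  rw [hasFDerivAt_iff_isLittleO_nhds_zero]
  have hO : (fun h : V => f (p + h) - f p - A h) =O[𝓝 0] fun h => ‖h‖ ^ 2 := by
    refine Asymptotics.IsBigO.of_bound C ?_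
    filter_upwards [eventually_corners_add_subset (l := []) hUo (by simpa [corners] using hp)]
      with u hu
    rw [Real.norm_of_nonneg (by positivity : (0 : ℝ) ≤ ‖u‖ ^ 2)]
    exact hA u (hu rfl)
  refine hO.trans_isLittleO ?_
  have := Asymptotics.isLittleO_norm_pow_id (E' := V) one_lt_two
  simpa using this

/-- A difference of order `j` of `f` is Lipschitz near `p`, because one further difference in the
direction `x - p` is bounded. Its derivative, which is the same difference of `f'`, is bounded by
the Lipschitz constant. One order is lost. -/
theorem HasDiffBound.fderiv [CompleteSpace X] {U : Set V} (hUo : IsOpen U)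
    (hUc : Convex ℝ U) {C : ℝ} (hC : 0 ≤ C) {r : ℕ} (hr : 1 ≤ r) {f : V → X}
    (hf : HasDiffBound U (r + 1) C f) : HasDiffBound U r C (fderiv ℝ f) := by
  intro l hl p hp
  have h := hasFDerivAt_iterDiff (l := l) (p := p) (f := f) (f' := _root_.fderiv ℝ f) fun x hx =>
    (hf.differentiableAt hUo hUc (by omega) (hp hx)).hasFDerivAt
  refine h.le_of_lip' (mul_nonneg hC l.prod_map_norm_nonneg) ?_
  have hev := eventually_corners_add_subset hUo hp
  have htend : Tendsto (fun x : V => x - p) (𝓝 p) (𝓝 0) := by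
    have : Continuous fun x : V => x - p := by fun_prop
    simpa using this.tendsto p
  filter_upwards [htend.eventually hev] with x hx
  have key := hf ((x - p) :: l) (by simpa using hl) p (by
    refine union_subset hp ?_
    rwa [← corners_add])
  rw [iterDiff_cons, add_sub_cancel] at key
  refine key.trans (le_of_eq ?_)
  simp only [List.map_cons, List.prod_cons]
  ring

/-- Composition with a Lipschitz map. -/
theorem HasDiffBound.comp_one {U : Set V} {U' : Set W} {C D : ℝ} (hC : 0 ≤ C) (hD : 0 ≤ D)
    {g : W → X} (hg : HasDiffBound U' 1 C g) {G : V → W} (hG : MapsTo G U U')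
    (hGlip : ∀ p ∈ U, ∀ q ∈ U, ‖G q - G p‖ ≤ D * ‖q - p‖) :
    HasDiffBound U 1 (C * (D + 1)) fun p => g (G p) := by
  intro l hl p hp
  match l, hl with
  | [], hl =>
    simp only [iterDiff, List.map_nil, List.prod_nil, mul_one]
    have := hg.bound (hG (hp rfl))
    nlinarith
  | [u], hl =>
    have h1 : p ∈ U := hp (Or.inl rfl)
    have h2 : p + u ∈ U := hp (Or.inr ⟨p, rfl, rfl⟩)
    simp only [iterDiff, List.map_cons, List.map_nil, List.prod_cons, List.prod_nil, mul_one]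
    have a := hg.lipschitz le_rfl (hG h1) (hG h2)
    have b := hGlip p h1 _ h2
    rw [add_sub_cancel_left] at b
    refine a.trans ?_
    have := mul_le_mul_of_nonneg_left b hC
    nlinarith [mul_nonneg hC (norm_nonneg u)]
  | u :: v :: l, hl =>
    simp only [List.length_cons] at hl
    omega

/-- Composition with a map of class `C^{1,1}`. -/
theorem HasDiffBound.comp [CompleteSpace X] {U : Set V} {U' : Set W} (hUc : Convex ℝ U)
    (hUo' : IsOpen U') (hUc' : Convex ℝ U') {C D : ℝ} (hC : 0 ≤ C) (hD : 0 ≤ D) {r : ℕ}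
    (hr : 1 ≤ r) (hr2 : r ≤ 2) {f : W → X} (hf : HasDiffBound U' r C f) {G : V → W}
    (hG : MapsTo G U U') (hGd : ∀ p ∈ U, DifferentiableAt ℝ G p)
    (hG' : HasDiffBound U 1 D (_root_.fderiv ℝ G)) :
    ∃ C', 0 ≤ C' ∧ HasDiffBound U r C' fun p => f (G p) := by
  have hGlip : ∀ p ∈ U, ∀ q ∈ U, ‖G q - G p‖ ≤ D * ‖q - p‖ := fun p hp q hq =>
    hUc.norm_image_sub_le_of_norm_fderiv_le hGd (fun x hx => hG'.bound hx) hp hq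
  obtain rfl | rfl : r = 1 ∨ r = 2 := by omega
  · exact ⟨_, by positivity, hf.comp_one hC hD hG hGlip⟩
  · have hf' := hf.fderiv hUo' hUc' hC le_rfl
    have hder : ∀ p ∈ U, HasFDerivAt (fun p => f (G p))
        ((_root_.fderiv ℝ f (G p)).comp (_root_.fderiv ℝ G p)) p := fun p hp =>
      (hf.differentiableAt hUo' hUc' le_rfl (hG hp)).hasFDerivAt.comp p (hGd p hp).hasFDerivAt
    -- By the chain rule the derivative of `f ∘ G` is a bilinear expression in `f' ∘ G` and `G'`,
    -- both with first-order bounds.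
    have hB := HasDiffBound.bilin one_le_two (by positivity) hD (hf'.comp_one hC hD hG hGlip) hG'
      (LinearMap.mk₂ ℝ (fun (f : W →L[ℝ] X) (g : V →L[ℝ] W) => f.comp g)
        (fun _ _ _ => ContinuousLinearMap.add_comp _ _ _)
        (fun _ _ _ => ContinuousLinearMap.smul_comp _ _ _)
        (fun _ _ _ => ContinuousLinearMap.comp_add _ _ _)
        (fun _ _ _ => ContinuousLinearMap.comp_smul _ _ _))
      (fun f g => ContinuousLinearMap.opNorm_comp_le f g)
    refine ⟨C + 4 * (C * (D + 1) * D), by positivity, hasDiffBound_two_of_fderiv hUc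
      (fun p hp => (hf.bound (hG hp)).trans ?_) (fun p hp => (hder p hp).differentiableAt) ?_⟩
    · have : 0 ≤ 4 * (C * (D + 1) * D) := by positivity
      linarith
    · intro l hl p hp
      rw [iterDiff_congr fun x hx => (hder x (hp hx)).fderiv]
      exact (hB.mono (D := C + 4 * (C * (D + 1) * D)) le_rfl (by linarith)) l hl p hp

end IteratedDifferences

/-! ### Pairing Dirac chains with forms -/

section ChainPairing

variable {V : Type*} [NormedAddCommGroup V] [InnerProductSpace ℝ V]
variable {F : Type*} [NormedAddCommGroup F] [NormedSpace ℝ F]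

/-- The pairing of a Dirac chain with a function from points to linear maps on `k`-vectors. -/
noncomputable def diracPair {N : Type*} [AddCommGroup N] [Module ℝ N] {k : ℕ}
    (ψ : V → (⋀[ℝ]^k V) →ₗ[ℝ] N) : (V →₀ ⋀[ℝ]^k V) →ₗ[ℝ] N :=
  Finsupp.lsum ℝ ψ

theorem diracPair_apply {N : Type*} [AddCommGroup N] [Module ℝ N] {k : ℕ}
    (ψ : V → (⋀[ℝ]^k V) →ₗ[ℝ] N) (A : V →₀ ⋀[ℝ]^k V) :
    diracPair ψ A = A.sum fun p α => ψ p α := rfl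

@[simp] theorem diracPair_single {N : Type*} [AddCommGroup N] [Module ℝ N] {k : ℕ}
    (ψ : V → (⋀[ℝ]^k V) →ₗ[ℝ] N) (p : V) (α : ⋀[ℝ]^k V) :
    diracPair ψ (Finsupp.single p α) = ψ p α := by
  simp [diracPair]

theorem diracPair_translateCoeff {N : Type*} [AddCommGroup N] [Module ℝ N] {k : ℕ}
    (ψ : V → (⋀[ℝ]^k V) →ₗ[ℝ] N) (u : V) (A : V →₀ ⋀[ℝ]^k V) :
    diracPair ψ (translateCoeff u A) = diracPair (fun p => ψ (p + u)) A := by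
  rw [diracPair_apply, diracPair_apply, translateCoeff,
    Finsupp.sum_mapDomain_index (fun _ => map_zero _) (fun _ _ _ => map_add _ _ _)]

theorem diracPair_fun_sub {N : Type*} [AddCommGroup N] [Module ℝ N] {k : ℕ}
    (ψ φ : V → (⋀[ℝ]^k V) →ₗ[ℝ] N) (A : V →₀ ⋀[ℝ]^k V) :
    diracPair (fun p => ψ p - φ p) A = diracPair ψ A - diracPair φ A := by
  simp only [diracPair_apply, LinearMap.sub_apply, Finsupp.sum_sub]

theorem DifferenceData.toCoeff_cons {k : ℕ} (p u : V) (l : List V) (α : ⋀[ℝ]^k V) :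
    (⟨p, u :: l, α⟩ : DifferenceData V k).toCoeff =
      translateCoeff u (⟨p, l, α⟩ : DifferenceData V k).toCoeff -
        (⟨p, l, α⟩ : DifferenceData V k).toCoeff := rfl

/-- Translation of chains is adjoint to translation of forms, so differences move from the chain to
the form. -/
theorem diracPair_toCoeff {N : Type*} [AddCommGroup N] [Module ℝ N] {k : ℕ}
    (ψ : V → (⋀[ℝ]^k V) →ₗ[ℝ] N) (p : V) (l : List V) (α : ⋀[ℝ]^k V) :
    diracPair ψ (⟨p, l, α⟩ : DifferenceData V k).toCoeff = iterDiff l ψ p α := by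
  induction l generalizing ψ with
  | nil => simp [DifferenceData.toCoeff, iterDiff]
  | cons u l ih =>
    rw [DifferenceData.toCoeff_cons]
    have hsub : ∀ A B : V →₀ ⋀[ℝ]^k V, diracPair ψ (A - B) = diracPair ψ A - diracPair ψ B :=
      fun A B => by
        rw [eq_sub_iff_add_eq, ← map_add]
        exact congrArg (diracPair ψ) (sub_add_cancel A B)
    rw [hsub, diracPair_translateCoeff, ← diracPair_fun_sub, ih]
    rfl

theorem diracPair_congr {N : Type*} [AddCommGroup N] [Module ℝ N] {k : ℕ}
    {ψ φ : V → (⋀[ℝ]^k V) →ₗ[ℝ] N} {A : V →₀ ⋀[ℝ]^k V} (h : ∀ p ∈ A.support, ψ p = φ p) :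
    diracPair ψ A = diracPair φ A :=
  Finsupp.sum_congr fun p hp => by rw [h p hp]

theorem diracPair_comp {N N' : Type*} [AddCommGroup N] [Module ℝ N] [AddCommGroup N'] [Module ℝ N']
    {k : ℕ} (L : N →ₗ[ℝ] N') (ψ : V → (⋀[ℝ]^k V) →ₗ[ℝ] N) (A : V →₀ ⋀[ℝ]^k V) :
    L (diracPair ψ A) = diracPair (fun p => L ∘ₗ ψ p) A := by
  simp only [diracPair_apply, Finsupp.sum, map_sum, LinearMap.comp_apply]

theorem translateCoeff_apply {k : ℕ} (u : V) (A : V →₀ ⋀[ℝ]^k V) (x : V) :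
    translateCoeff u A x = A (x - u) := by
  have : translateCoeff u A (x - u + u) = A (x - u) :=
    Finsupp.mapDomain_apply (add_left_injective u) A (x - u)
  rwa [sub_add_cancel] at this

/-- The support of `A` and its translate lie in the convex hull of the support of the
difference. -/
theorem support_subset_convexHull_diff {k : ℕ} {u : V} (hu : u ≠ 0) (A : V →₀ ⋀[ℝ]^k V) {a : V}
    (ha : a ∈ A.support) :
    a ∈ convexHull ℝ ((translateCoeff u A - A).support : Set V) ∧
      a + u ∈ convexHull ℝ ((translateCoeff u A - A).support : Set V) := by
  have hinj : Function.Injective fun n : ℤ => a + n • u := by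
    intro n n' h
    have h' : (n - n') • u = 0 := by
      rw [sub_smul, sub_eq_zero]
      exact add_left_cancel h
    rw [← Int.cast_smul_eq_zsmul ℝ] at h'
    rcases smul_eq_zero.1 h' with h | h
    · have : n - n' = 0 := by exact_mod_cast h
      omega
    · exact absurd h hu
  -- Look along the line `a + ℤ u`. If `i` and `j` are the largest and smallest indices in the
  -- support, nothing cancels in `T_u A - A` at the indices `i + 1` and `j`. Both `a` and `a + u`
  -- lie on the segment between these two points.
  let S : Set ℤ := {n | a + n • u ∈ A.support}
  have hS : S.Finite := A.support.finite_toSet.preimage hinj.injOn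
  have h0 : (0 : ℤ) ∈ S := by simpa [S] using ha
  obtain ⟨i, hi, hmax⟩ := hS.exists_maximalFor id S ⟨0, h0⟩
  obtain ⟨j, hj, hmin⟩ := hS.exists_minimalFor id S ⟨0, h0⟩
  have hi0 : 0 ≤ i := by
    by_contra h
    exact h (hmax h0 (by simp; omega))
  have hj0 : j ≤ 0 := by
    by_contra h
    exact h (hmin h0 (by simp; omega))
  have hi1 : i + 1 ∉ S := fun h => by
    have := hmax h (by simp)
    simp at this
  have hj1 : j - 1 ∉ S := fun h => by
    have := hmin h (by simp)
    simp at this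
  have hA1 : a + (i + 1) • u ∈ (translateCoeff u A - A).support := by
    have e : a + (i + 1) • u - u = a + i • u := by rw [add_smul, one_smul]; abel
    rw [Finsupp.mem_support_iff, Finsupp.sub_apply, translateCoeff_apply, e]
    have hz : A (a + (i + 1) • u) = 0 := by simpa [S] using hi1
    rw [hz, sub_zero]
    simpa [S] using hi
  have hA2 : a + j • u ∈ (translateCoeff u A - A).support := by
    have e : a + j • u - u = a + (j - 1) • u := by rw [sub_smul, one_smul]; abel
    rw [Finsupp.mem_support_iff, Finsupp.sub_apply, translateCoeff_apply, e]
    have hz : A (a + (j - 1) • u) = 0 := by simpa [S] using hj1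
    rw [hz, zero_sub, neg_ne_zero]
    simpa [S] using hj
  have hseg : ∀ t : ℝ, (j : ℝ) ≤ t → t ≤ i + 1 →
      a + t • u ∈ convexHull ℝ ((translateCoeff u A - A).support : Set V) := by
    intro t ht ht'
    refine segment_subset_convexHull (Finset.mem_coe.2 hA2) (Finset.mem_coe.2 hA1) ?_
    have hpos : (0 : ℝ) < i + 1 - j := by
      have : (j : ℝ) ≤ i := by exact_mod_cast hj0.trans hi0
      linarith
    refine ⟨(i + 1 - t) / (i + 1 - j), (t - j) / (i + 1 - j),
      div_nonneg (by linarith) hpos.le, div_nonneg (by linarith) hpos.le, by field_simp; ring, ?_⟩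
    have e1 : j • u = (j : ℝ) • u := (Int.cast_smul_eq_zsmul ℝ j u).symm
    have e2 : (i + 1) • u = ((i : ℝ) + 1) • u := by
      rw [← Int.cast_smul_eq_zsmul ℝ]; simp
    rw [e1, e2, smul_add, smul_add, add_add_add_comm, ← add_smul, smul_smul, smul_smul, ← add_smul]
    congr 1
    · rw [← add_div]
      have : (i + 1 - t + (t - j)) / (i + 1 - (j : ℝ)) = 1 := by
        rw [div_eq_one_iff_eq hpos.ne']; ring
      rw [this, one_smul]
    · congr 1
      field_simp
      ring
  constructor
  · have := hseg 0 (by exact_mod_cast hj0) (by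
      have : (0 : ℝ) ≤ i := by exact_mod_cast hi0
      linarith)
    simpa using this
  · have := hseg 1 ((by exact_mod_cast hj0 : (j : ℝ) ≤ 0).trans zero_le_one) (by
      have : (0 : ℝ) ≤ i := by exact_mod_cast hi0
      linarith)
    simpa using this

/-- Admissibility controls only the points where the difference chain does not cancel, whereas
difference bounds require all vertices to lie in `U`. Cancellation leaves the hull unaffected as
long as the `k`-vector and all directions are nonzero. -/
theorem corners_subset_convexHull {k : ℕ} {p : V} {l : List V} {α : ⋀[ℝ]^k V} (hα : α ≠ 0)
    (hl : ∀ u ∈ l, u ≠ 0) :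
    corners p l ⊆ convexHull ℝ ((⟨p, l, α⟩ : DifferenceData V k).toCoeff.support : Set V) := by
  induction l with
  | nil =>
    refine Subset.trans ?_ (subset_convexHull ℝ _)
    simp [corners, DifferenceData.toCoeff, hα]
  | cons u l ih =>
    have ih' := ih fun v hv => hl v (List.mem_cons_of_mem _ hv)
    have hu := hl u List.mem_cons_self
    set B := (⟨p, l, α⟩ : DifferenceData V k).toCoeff with hB
    rw [DifferenceData.toCoeff_cons, ← hB]
    refine union_subset (ih'.trans (convexHull_min (fun a ha => ?_) (convex_convexHull ℝ _))) ?_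
    · exact (support_subset_convexHull_diff hu B (Finset.mem_coe.1 ha)).1
    · rintro _ ⟨x, hx, rfl⟩
      have hsub : (B.support : Set V) ⊆ (fun x => x + u) ⁻¹'
          convexHull ℝ ((translateCoeff u B - B).support : Set V) := fun a ha =>
        (support_subset_convexHull_diff hu B (Finset.mem_coe.1 ha)).2
      exact convexHull_min hsub ((convex_convexHull ℝ _).translate_preimage_left u) (ih' hx)

theorem support_toCoeff_subset_corners {k : ℕ} (p : V) (l : List V) (α : ⋀[ℝ]^k V) :
    ((⟨p, l, α⟩ : DifferenceData V k).toCoeff.support : Set V) ⊆ corners p l := by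
  classical
  induction l with
  | nil =>
    intro x hx
    have := Finsupp.support_single_subset (Finset.mem_coe.1 hx)
    simpa [corners] using this
  | cons u l ih =>
    rw [DifferenceData.toCoeff_cons]
    intro x hx
    by_contra hcon
    rw [corners, mem_union, not_or] at hcon
    rw [Finset.mem_coe, Finsupp.mem_support_iff, Finsupp.sub_apply, translateCoeff_apply] at hx
    apply hx
    rw [Finsupp.notMem_support_iff.1 fun h => hcon.1 (ih (Finset.mem_coe.2 h)),
      Finsupp.notMem_support_iff.1 fun h => hcon.2 ⟨x - u, ih (Finset.mem_coe.2 h), by simp⟩,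
      sub_zero]

theorem iterDiff_eq_zero_of_mem {A : Type*} [AddCommGroup A] {l : List V} (hl : (0 : V) ∈ l)
    (ψ : V → A) (p : V) : iterDiff l ψ p = 0 := by
  induction l generalizing p with
  | nil => simp at hl
  | cons u l ih =>
    rw [iterDiff_cons]
    rcases List.mem_cons.1 hl with rfl | h
    · rw [add_zero, sub_self]
    · rw [ih h, ih h, sub_self]

/-- The pairing with an admissible difference chain is bounded by its weight. -/
theorem norm_diracPair_toCoeff_le {U : Set V} {k r : ℕ} {C : ℝ} (hC : 0 ≤ C)
    {ψ : V → (⋀[ℝ]^k V) →ₗ[ℝ] F}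
    (hψ : ∀ v : Fin k → V, (∀ i, ‖v i‖ ≤ 1) →
      HasDiffBound U r C fun p => ψ p (exteriorPower.ιMulti ℝ k v))
    {D : DifferenceData V k} (hD : D.Admissible U r) :
    ‖diracPair ψ D.toCoeff‖ ≤ C * D.weight := by
  obtain ⟨p, l, α⟩ := D
  rw [diracPair_toCoeff]
  simp only [DifferenceData.weight]
  -- If `α = 0` or some direction is zero, the chain vanishes and its vertices may lie outside `U`;
  -- the estimate is then trivial.
  by_cases hα : α = 0
  · rw [hα, map_zero, norm_zero, kvMass_zero, mul_zero, mul_zero]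
  by_cases hl : (0 : V) ∈ l
  · rw [iterDiff_eq_zero_of_mem hl, LinearMap.zero_apply, norm_zero]
    exact mul_nonneg hC (mul_nonneg l.prod_map_norm_nonneg (kvMass_nonneg α))
  have hc : corners p l ⊆ U :=
    (corners_subset_convexHull hα fun u hu h => hl (h ▸ hu)).trans hD.2
  rw [← mul_assoc]
  refine norm_le_mul_kvMass _ (mul_nonneg hC l.prod_map_norm_nonneg) (fun e he => ?_) α
  have := iterDiff_map (LinearMap.applyₗ (exteriorPower.ιMulti ℝ k e) :
    ((⋀[ℝ]^k V) →ₗ[ℝ] F) →ₗ[ℝ] F).toAddMonoidHom l ψ p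
  simp only [LinearMap.toAddMonoidHom_coe, LinearMap.applyₗ_apply_apply] at this
  rw [this]
  exact hψ e he l hD.1 p hc

theorem DiracChain.norm_def {U : Set V} {k r : ℕ} (A : DiracChain U k r) :
    ‖A‖ = sInf (bCosts A) := rfl

/-- Sum the estimate for single difference chains over a decomposition of `A`, then take the
infimum. This is the half of the duality by which forms extend to the completion. -/
theorem norm_diracPair_le {U : Set V} {k r : ℕ} {C : ℝ} (hC : 0 ≤ C)
    {ψ : V → (⋀[ℝ]^k V) →ₗ[ℝ] F}
    (hψ : ∀ v : Fin k → V, (∀ i, ‖v i‖ ≤ 1) →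
      HasDiffBound U r C fun p => ψ p (exteriorPower.ιMulti ℝ k v))
    (A : DiracChain U k r) : ‖diracPair ψ A.coeff‖ ≤ C * ‖A‖ := by
  rw [DiracChain.norm_def, ← smul_eq_mul, ← Real.sInf_smul_of_nonneg hC]
  refine le_csInf ((bCosts_nonempty A).smul_set) ?_
  rintro _ ⟨_, ⟨L, hL, hA, rfl⟩, rfl⟩
  rw [hA]
  change _ ≤ C * _
  clear hA

  induction L with
  | nil => simp
  | cons D L ih =>
    simp only [List.map_cons, List.sum_cons, map_add, mul_add]
    exact norm_add_le_of_le (norm_diracPair_toCoeff_le hC hψ (hL D List.mem_cons_self))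
      (ih fun D hD => hL D (List.mem_cons_of_mem _ hD))

end ChainPairing

/-! ### The universal form and continuous extension of operators -/

section UniversalForm

open UniformSpace

variable {V : Type*} [NormedAddCommGroup V] [InnerProductSpace ℝ V]
variable {F : Type*} [NormedAddCommGroup F] [NormedSpace ℝ F]

theorem DiracChain.coeff_ofCoeff {U : Set V} {k r : ℕ} {A : V →₀ ⋀[ℝ]^k V}
    (hA : (A.support : Set V) ⊆ U) : (DiracChain.ofCoeff U r A).coeff = A := by
  ext1 x
  by_cases hx : x ∈ U
  · exact Finsupp.mapDomain_apply Subtype.val_injective _ (⟨x, hx⟩ : U)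
  · have h1 : x ∉ A.support := fun h => hx (hA h)
    rw [Finsupp.notMem_support_iff.1 h1]
    exact Finsupp.mapDomain_notin_range _ _ (by simpa using hx)

theorem DiracChain.support_coeff_subset {U : Set V} {k r : ℕ} (A : DiracChain U k r) :
    (A.coeff.support : Set V) ⊆ U := by
  classical
  intro x hx
  obtain ⟨y, -, rfl⟩ := Finset.mem_image.1 (Finsupp.mapDomain_support (Finset.mem_coe.1 hx))
  exact y.2

theorem DiracChain.ofCoeff_coeff {U : Set V} {k r : ℕ} (A : DiracChain U k r) :
    DiracChain.ofCoeff U r A.coeff = A := by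
  refine Finsupp.ext fun x => ?_
  exact Finsupp.mapDomain_apply Subtype.val_injective _ x

theorem DiracChain.norm_ofCoeff_toCoeff_le {U : Set V} {k r : ℕ} {D : DifferenceData V k}
    (hD : D.Admissible U r) : ‖DiracChain.ofCoeff U r D.toCoeff‖ ≤ D.weight := by
  rw [DiracChain.norm_def]
  refine csInf_le (bCosts_bddBelow _) ⟨[D], by simpa using hD, ?_, by simp⟩
  rw [DiracChain.coeff_ofCoeff ((subset_convexHull ℝ _).trans hD.2)]
  simp

/-- A Dirac chain as a differential chain, as a linear map. -/
noncomputable def ofCoeffL (U : Set V) (k r : ℕ) : (V →₀ ⋀[ℝ]^k V) →ₗ[ℝ] DiffChain U k r :=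
  (Completion.toComplL (𝕜 := ℝ) (E := DiracChain U k r)).toLinearMap ∘ₗ DiracChain.ofCoeff U r

theorem ofCoeffL_apply (U : Set V) (k r : ℕ) (A : V →₀ ⋀[ℝ]^k V) :
    ofCoeffL U k r A = ((DiracChain.ofCoeff U r A : DiracChain U k r) : DiffChain U k r) := rfl

/-- The map `α ↦ (p; α)`. -/
noncomputable def kElementL (U : Set V) (k r : ℕ) (p : V) : (⋀[ℝ]^k V) →ₗ[ℝ] DiffChain U k r :=
  ofCoeffL U k r ∘ₗ Finsupp.lsingle p

theorem kElementL_apply (U : Set V) (k r : ℕ) (p : V) (α : ⋀[ℝ]^k V) :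
    kElementL U k r p α = kElement U r p α := rfl

theorem diracPair_kElementL (U : Set V) (k r : ℕ) (A : V →₀ ⋀[ℝ]^k V) :
    diracPair (kElementL U k r) A = ofCoeffL U k r A := by
  induction A using Finsupp.induction_linear with
  | zero => rw [map_zero, map_zero]
  | add A B hA hB => rw [map_add, map_add, hA, hB]
  | single p α => exact diracPair_single _ _ _

theorem norm_kElementL_le (U : Set V) (k r : ℕ) (p : V) (α : ⋀[ℝ]^k V) :
    ‖kElementL U k r p α‖ ≤ kvMass α := by
  change ‖((DiracChain.ofCoeff U r (Finsupp.single p α) : DiracChain U k r) : DiffChain U k r)‖ ≤ _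
  rw [Completion.norm_coe]
  by_cases hp : p ∈ U
  · have := DiracChain.norm_ofCoeff_toCoeff_le (U := U) (r := r)
      (D := ⟨p, [], α⟩) ⟨Nat.zero_le _, ?_⟩
    · simpa [DifferenceData.weight, DifferenceData.toCoeff] using this
    · refine (convexHull_mono (support_toCoeff_subset_corners p [] α)).trans ?_
      simpa [corners] using hp
  · have : DiracChain.ofCoeff U r (Finsupp.single p α) = 0 := by
      refine Finsupp.ext fun x => ?_
      exact Finsupp.single_eq_of_ne fun h => hp (h ▸ x.2)
    rw [this, norm_zero]
    exact kvMass_nonneg α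

/-- The universal form: at `p` it is `v ↦ (p; v₁ ∧ ⋯ ∧ vₖ)`. -/
noncomputable def univForm (U : Set V) (k r : ℕ) (p : V) : V [⋀^Fin k]→L[ℝ] DiffChain U k r :=
  AlternatingMap.mkContinuous
    ((kElementL U k r p).compAlternatingMap (exteriorPower.ιMulti ℝ k)) 1 fun v => by
      rw [one_mul]
      exact (norm_kElementL_le U k r p _).trans (kvMass_ιMulti_le_prod v)

theorem univForm_apply (U : Set V) (k r : ℕ) (p : V) (v : Fin k → V) :
    univForm U k r p v = kElement U r p (exteriorPower.ιMulti ℝ k v) := rfl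

theorem formEval_univForm (U : Set V) (k r : ℕ) (p : V) :
    formEval (univForm U k r p) = kElementL U k r p :=
  kvector_hom_ext fun v => by rw [formEval_ιMulti]; rfl

/-- An iterated difference of the universal form, evaluated on vectors, is itself a difference
chain, so its norm is at most its weight. Convexity of `U` passes from vertices in `U` to hulls in
`U`. -/
theorem hasDiffBound_univForm {U : Set V} (hU : Convex ℝ U) (k r : ℕ) :
    HasDiffBound U r 1 (univForm U k r) := by
  intro l hl p hp
  rw [one_mul]
  refine ContinuousAlternatingMap.opNorm_le_bound _ l.prod_map_norm_nonneg fun v => ?_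
  have h1 := iterDiff_map (AddMonoidHom.mk' (fun φ : V [⋀^Fin k]→L[ℝ] DiffChain U k r => φ v)
    fun _ _ => rfl) l (univForm U k r) p
  have h2 := iterDiff_map (LinearMap.applyₗ (exteriorPower.ιMulti ℝ k v) :
    ((⋀[ℝ]^k V) →ₗ[ℝ] DiffChain U k r) →ₗ[ℝ] DiffChain U k r).toAddMonoidHom l
      (kElementL U k r) p
  simp only [AddMonoidHom.mk'_apply, LinearMap.toAddMonoidHom_coe,
    LinearMap.applyₗ_apply_apply] at h1 h2
  rw [h1]
  simp only [univForm_apply, ← kElementL_apply]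
  rw [← h2, ← diracPair_toCoeff, diracPair_kElementL, ofCoeffL_apply, Completion.norm_coe]
  refine (DiracChain.norm_ofCoeff_toCoeff_le ⟨hl, ?_⟩).trans ?_
  · exact convexHull_min ((support_toCoeff_subset_corners p l _).trans hp) hU
  · exact mul_le_mul_of_nonneg_left (kvMass_ιMulti_le_prod v) l.prod_map_norm_nonneg

/-- A linear map on differential chains is determined by its values on simple `k`-elements. -/
theorem diffChain_hom_ext {U : Set V} {k r : ℕ} {N : Type*} [NormedAddCommGroup N] [NormedSpace ℝ N]
    {S T : DiffChain U k r →L[ℝ] N}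
    (h : ∀ p ∈ U, ∀ v, S (univForm U k r p v) = T (univForm U k r p v)) : S = T := by
  refine ContinuousLinearMap.ext fun J => ?_
  refine Completion.induction_on J (isClosed_eq S.continuous T.continuous) fun A => ?_
  rw [← DiracChain.ofCoeff_coeff A, ← ofCoeffL_apply, ← diracPair_kElementL]
  have h1 := diracPair_comp S.toLinearMap (kElementL U k r) A.coeff
  have h2 := diracPair_comp T.toLinearMap (kElementL U k r) A.coeff
  simp only [ContinuousLinearMap.coe_coe] at h1 h2
  rw [h1, h2]
  refine diracPair_congr fun p hp => ?_
  exact kvector_hom_ext fun v => h p (A.support_coeff_subset hp) v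

/-- The continuous extension of a bounded linear map on Dirac chains. -/
noncomputable def chainLift {U : Set V} {k r : ℕ} [CompleteSpace F]
    (T : DiracChain U k r →L[ℝ] F) : DiffChain U k r →L[ℝ] F :=
  T.extend (Completion.toComplL (𝕜 := ℝ) (E := DiracChain U k r))

theorem chainLift_coe {U : Set V} {k r : ℕ} [CompleteSpace F] (T : DiracChain U k r →L[ℝ] F)
    (A : DiracChain U k r) : chainLift T (A : DiffChain U k r) = T A :=
  ContinuousLinearMap.extend_eq T (Completion.denseRange_coe)
    (Completion.isUniformInducing_coe _) A

/-- `Completion.extension` takes a default value on functions that are not uniformly continuous.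
Agreement with a bounded linear map on Dirac chains excludes this and identifies the extension. -/
theorem extension_eq_chainLift {U : Set V} {k r : ℕ} [CompleteSpace F]
    (T : DiracChain U k r →L[ℝ] F) {f : DiracChain U k r → F} (hf : ∀ A, f A = T A) :
    Completion.extension f = chainLift T := by
  have hfe : f = T := funext hf
  subst hfe
  refine (Completion.extension_unique T.uniformContinuous (chainLift T).uniformContinuous
    fun A => (chainLift_coe T A).symm)

theorem map_eq_chainLift {V' : Type*} [NormedAddCommGroup V'] [InnerProductSpace ℝ V']
    {U : Set V} {U' : Set V'} {k r k' r' : ℕ}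
    (T : DiracChain U k r →L[ℝ] DiffChain U' k' r') {f : DiracChain U k r → DiracChain U' k' r'}
    (hf : ∀ A, (f A : DiffChain U' k' r') = T A) :
    Completion.map f = chainLift T := by
  have hu : UniformContinuous fun A => (f A : DiffChain U' k' r') := by
    rw [funext hf]
    exact T.uniformContinuous
  have hf' : UniformContinuous f := (Completion.isUniformInducing_coe _).uniformContinuous_iff.2 hu
  refine Completion.map_unique (chainLift T).uniformContinuous fun A => ?_
  rw [chainLift_coe, ← hf]

/-- The pairing with a form with bounded differences, on Dirac chains. -/
noncomputable def diracPairL (U : Set V) (k r : ℕ) {C : ℝ} (hC : 0 ≤ C)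
    {ψ : V → (⋀[ℝ]^k V) →ₗ[ℝ] F}
    (hψ : ∀ v : Fin k → V, (∀ i, ‖v i‖ ≤ 1) →
      HasDiffBound U r C fun p => ψ p (exteriorPower.ιMulti ℝ k v)) : DiracChain U k r →L[ℝ] F :=
  LinearMap.mkContinuous (diracPair ψ ∘ₗ DiracChain.coeff) C fun A => norm_diracPair_le hC hψ A

theorem diracPairL_apply {U : Set V} {k r : ℕ} {C : ℝ} (hC : 0 ≤ C)
    {ψ : V → (⋀[ℝ]^k V) →ₗ[ℝ] F}
    (hψ : ∀ v : Fin k → V, (∀ i, ‖v i‖ ≤ 1) →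
      HasDiffBound U r C fun p => ψ p (exteriorPower.ιMulti ℝ k v)) (A : DiracChain U k r) :
    diracPairL U k r hC hψ A = diracPair ψ A.coeff := rfl

/-- The pairing with a form with bounded differences. -/
noncomputable def chainPairL [CompleteSpace F] (U : Set V) (k r : ℕ) {C : ℝ} (hC : 0 ≤ C)
    {ψ : V → (⋀[ℝ]^k V) →ₗ[ℝ] F}
    (hψ : ∀ v : Fin k → V, (∀ i, ‖v i‖ ≤ 1) →
      HasDiffBound U r C fun p => ψ p (exteriorPower.ιMulti ℝ k v)) : DiffChain U k r →L[ℝ] F :=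
  chainLift (diracPairL U k r hC hψ)

theorem chainPairL_kElement [CompleteSpace F] {U : Set V} {k r : ℕ} {C : ℝ} (hC : 0 ≤ C)
    {ψ : V → (⋀[ℝ]^k V) →ₗ[ℝ] F}
    (hψ : ∀ v : Fin k → V, (∀ i, ‖v i‖ ≤ 1) →
      HasDiffBound U r C fun p => ψ p (exteriorPower.ιMulti ℝ k v)) {p : V} (hp : p ∈ U)
    (α : ⋀[ℝ]^k V) : chainPairL U k r hC hψ (kElement U r p α) = ψ p α := by
  rw [kElement, chainPairL, chainLift_coe, diracPairL_apply, DiracChain.coeff_ofCoeff,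
    diracPair_single]
  intro x hx
  have := Finsupp.support_single_subset (Finset.mem_coe.1 hx)
  rwa [Finset.mem_singleton.1 this]

end UniversalForm

/-! ### Difference bounds from bounded derivatives, affine maps, integrals and sums -/

section BoundedDerivatives

variable {V : Type*} [NormedAddCommGroup V] [NormedSpace ℝ V]
variable {W : Type*} [NormedAddCommGroup W] [NormedSpace ℝ W]
variable {X : Type*} [NormedAddCommGroup X] [NormedSpace ℝ X]

theorem hasDiffBound_one_of_fderiv {U : Set V} (hUc : Convex ℝ U) {C : ℝ} {f : V → X}
    (h0 : ∀ p ∈ U, ‖f p‖ ≤ C) (hd : ∀ p ∈ U, DifferentiableAt ℝ f p)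
    (hf : ∀ p ∈ U, ‖fderiv ℝ f p‖ ≤ C) : HasDiffBound U 1 C f := by
  intro l hl p hp
  match l, hl with
  | [], hl => simpa [iterDiff] using h0 p (hp rfl)
  | [u], hl =>
    have h1 : p ∈ U := hp (Or.inl rfl)
    have h2 : p + u ∈ U := hp (Or.inr ⟨p, rfl, rfl⟩)
    simp only [iterDiff, List.map_cons, List.map_nil, List.prod_cons, List.prod_nil, mul_one]
    simpa using hUc.norm_image_sub_le_of_norm_fderiv_le hd hf h1 h2
  | u :: v :: l, hl =>
    simp only [List.length_cons] at hl
    omega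

theorem exists_hasDiffBound_one {U : Set V} (hUo : IsOpen U) (hUc : Convex ℝ U) {f : V → X}
    (hf : ContDiffOn ℝ ∞ f U) (hb : ∀ j : ℕ, ∃ C : ℝ, ∀ x ∈ U, ‖iteratedFDeriv ℝ j f x‖ ≤ C) :
    ∃ D, 0 ≤ D ∧ HasDiffBound U 1 D f := by
  obtain ⟨C₀, h₀⟩ := hb 0
  obtain ⟨C₁, h₁⟩ := hb 1
  refine ⟨|C₀| + |C₁|, by positivity, hasDiffBound_one_of_fderiv hUc (fun p hp => ?_)
    (fun p hp => ?_) fun p hp => ?_⟩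
  · have := h₀ p hp
    rw [norm_iteratedFDeriv_zero] at this
    linarith [le_abs_self C₀, abs_nonneg C₁]
  · exact (hf.contDiffAt (hUo.mem_nhds hp)).differentiableAt (by simp)
  · have := h₁ p hp
    rw [norm_iteratedFDeriv_one] at this
    linarith [le_abs_self C₁, abs_nonneg C₀]

theorem exists_hasDiffBound_two {U : Set V} (hUo : IsOpen U) (hUc : Convex ℝ U) {f : V → X}
    (hf : ContDiffOn ℝ ∞ f U) (hb : ∀ j : ℕ, ∃ C : ℝ, ∀ x ∈ U, ‖iteratedFDeriv ℝ j f x‖ ≤ C) :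
    ∃ D, 0 ≤ D ∧ HasDiffBound U 2 D f := by
  obtain ⟨C₀, hC₀, h₀⟩ := exists_hasDiffBound_one hUo hUc hf hb
  obtain ⟨C₁, hC₁, h₁⟩ := exists_hasDiffBound_one hUo hUc
    (hf.fderiv_of_isOpen hUo (m := ∞) (by simp)) fun j => by
      obtain ⟨C, hC⟩ := hb (j + 1)
      exact ⟨C, fun x hx => by rw [norm_iteratedFDeriv_fderiv]; exact hC x hx⟩
  refine ⟨C₀ + C₁, by positivity, hasDiffBound_two_of_fderiv hUc (fun p hp => ?_)
    (fun p hp => ?_) (h₁.mono le_rfl (by linarith))⟩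
  · linarith [h₀.bound hp]
  · exact (hf.contDiffAt (hUo.mem_nhds hp)).differentiableAt (by simp)

theorem iterDiff_comp_affine {A : Type*} [AddCommGroup A] {g : V → W} {h : V → W}
    (hg : ∀ p u, g (p + u) = g p + h u) (l : List V) (f : W → A) (p : V) :
    iterDiff l (fun p => f (g p)) p = iterDiff (l.map h) f (g p) := by
  induction l generalizing p with
  | nil => rfl
  | cons u l ih => rw [iterDiff_cons, ih, ih, List.map_cons, iterDiff_cons, hg]

theorem corners_map_affine {g : V → W} {h : V → W} (hg : ∀ p u, g (p + u) = g p + h u)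
    (l : List V) (p : V) : corners (g p) (l.map h) = g '' corners p l := by
  induction l generalizing p with
  | nil => simp [corners]
  | cons u l ih =>
    rw [List.map_cons, corners, corners, ih, image_union, image_image, image_image]
    simp only [hg]

theorem HasDiffBound.comp_affine {U : Set V} {U' : Set W} {r : ℕ} {C : ℝ} {f : W → X}
    (hf : HasDiffBound U' r C f) {g : V → W} {h : V → W} (hg : ∀ p u, g (p + u) = g p + h u)
    (hh : ∀ u, ‖h u‖ = ‖u‖) (hU : MapsTo g U U') : HasDiffBound U r C fun p => f (g p) := by
  intro l hl p hp
  rw [iterDiff_comp_affine hg]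
  have := hf (l.map h) (by simpa using hl) (g p) (by
    rw [corners_map_affine hg]
    exact (image_mono hp).trans hU.image_subset)
  rw [List.map_map] at this
  rwa [show (norm ∘ h : V → ℝ) = norm from funext hh] at this

theorem iterDiff_integral {α : Type*} [MeasurableSpace α] {μ : Measure α} {U : Set V}
    {f : α → V → X} (hf : ∀ p ∈ U, Integrable (fun t => f t p) μ) (l : List V) {p : V}
    (hp : corners p l ⊆ U) :
    Integrable (fun t => iterDiff l (f t) p) μ ∧
      iterDiff l (fun p => ∫ t, f t p ∂μ) p = ∫ t, iterDiff l (f t) p ∂μ := by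
  induction l generalizing p with
  | nil => exact ⟨hf p (hp rfl), rfl⟩
  | cons u l ih =>
    have h1 := ih (p := p) fun x hx => hp (Or.inl hx)
    have h2 := ih (p := p + u) (by
      rw [corners_add]
      exact fun x hx => hp (Or.inr hx))
    simp only [iterDiff_cons]
    exact ⟨h2.1.sub h1.1, by rw [h1.2, h2.2, integral_sub h2.1 h1.1]⟩

/-- Differences commute with integration in a parameter, so a uniform bound passes under the
integral. -/
theorem HasDiffBound.integral {α : Type*} [MeasurableSpace α] {μ : Measure α} [IsFiniteMeasure μ]
    {U : Set V} {r : ℕ} {C : ℝ} {f : α → V → X} (hfi : ∀ p ∈ U, Integrable (fun t => f t p) μ)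
    (hf : ∀ᵐ t ∂μ, HasDiffBound U r C (f t)) :
    HasDiffBound U r (C * μ.real univ) fun p => ∫ t, f t p ∂μ := by
  intro l hl p hp
  rw [(iterDiff_integral hfi l hp).2, mul_right_comm]
  exact norm_integral_le_of_norm_le_const (hf.mono fun t ht => ht l hl p hp)

theorem HasDiffBound.eval {U : Set V} {r : ℕ} {C : ℝ} {k : ℕ} {Φ : V → W [⋀^Fin k]→L[ℝ] X}
    (hΦ : HasDiffBound U r C Φ) {v : Fin k → W} (hv : ∀ i, ‖v i‖ ≤ 1) :
    HasDiffBound U r C fun p => Φ p v := by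
  intro l hl p hp
  have h1 := iterDiff_map (AddMonoidHom.mk' (fun φ : W [⋀^Fin k]→L[ℝ] X => φ v)
    fun _ _ => rfl) l Φ p
  simp only [AddMonoidHom.mk'_apply] at h1
  rw [← h1]
  refine ((iterDiff l Φ p).le_opNorm v).trans ((mul_le_of_le_one_right (norm_nonneg _) ?_).trans
    (hΦ l hl p hp))
  exact Finset.prod_le_one (fun _ _ => norm_nonneg _) fun i _ => hv i

theorem HasDiffBound.add {U : Set V} {r : ℕ} {C D : ℝ} {f g : V → X}
    (hf : HasDiffBound U r C f) (hg : HasDiffBound U r D g) :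
    HasDiffBound U r (C + D) fun p => f p + g p := by
  intro l hl p hp
  have : iterDiff l (fun p => f p + g p) p = iterDiff l f p + iterDiff l g p := by
    clear hp hl
    induction l generalizing p with
    | nil => rfl
    | cons u l ih => rw [iterDiff_cons, iterDiff_cons, iterDiff_cons, ih, ih]; abel
  rw [this, add_mul]
  exact norm_add_le_of_le (hf l hl p hp) (hg l hl p hp)

theorem HasDiffBound.sum {U : Set V} {r : ℕ} {ι : Type*} (s : Finset ι) {C : ι → ℝ}
    {f : ι → V → X} (hf : ∀ i ∈ s, HasDiffBound U r (C i) (f i)) :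
    HasDiffBound U r (∑ i ∈ s, C i) fun p => ∑ i ∈ s, f i p := by
  classical
  induction s using Finset.induction_on with
  | empty => simpa using hasDiffBound_const (U := U) (r := r) (0 : X)
  | insert a s ha ih =>
    simp only [Finset.sum_insert ha]
    exact (hf a (Finset.mem_insert_self a s)).add
      (ih fun i hi => hf i (Finset.mem_insert_of_mem hi))

theorem HasDiffBound.congr {U : Set V} {r : ℕ} {C : ℝ} {f g : V → X}
    (hf : HasDiffBound U r C f) (h : ∀ p ∈ U, g p = f p) : HasDiffBound U r C g := by
  intro l hl p hp
  rw [iterDiff_congr fun x hx => h x (hp hx)]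
  exact hf l hl p hp

end BoundedDerivatives

/-! ### Linking maps, integration of forms, extrusion, pushforward -/

section Operators

open UniformSpace

variable {V : Type*} [NormedAddCommGroup V] [InnerProductSpace ℝ V]
variable {W : Type*} [NormedAddCommGroup W] [InnerProductSpace ℝ W]
variable {F : Type*} [NormedAddCommGroup F] [NormedSpace ℝ F]

theorem SmoothBoundedOn.exists_hasDiffBound {G : V → W} {Ω : Set V} (hG : SmoothBoundedOn G Ω)
    (hΩo : IsOpen Ω) (hΩc : Convex ℝ Ω) :
    ∃ D, 0 ≤ D ∧ HasDiffBound Ω 2 D G ∧ HasDiffBound Ω 2 D (fderiv ℝ G) := by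
  obtain ⟨C₀, hC₀, h₀⟩ := exists_hasDiffBound_two hΩo hΩc hG.1 hG.2
  obtain ⟨C₁, hC₁, h₁⟩ := exists_hasDiffBound_two hΩo hΩc
    (hG.1.fderiv_of_isOpen hΩo (m := ∞) (by simp)) fun j => by
      obtain ⟨C, hC⟩ := hG.2 (j + 1)
      exact ⟨C, fun x hx => by rw [norm_iteratedFDeriv_fderiv]; exact hC x hx⟩
  exact ⟨C₀ + C₁, by positivity, h₀.mono le_rfl (by linarith), h₁.mono le_rfl (by linarith)⟩

theorem ofCoeffL_sum_single {U : Set W} {k l r : ℕ} (g : V → W)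
    (T : V → (⋀[ℝ]^k V) →ₗ[ℝ] ⋀[ℝ]^l W) (A : V →₀ ⋀[ℝ]^k V) :
    ofCoeffL U l r (A.sum fun p α => Finsupp.single (g p) (T p α)) =
      diracPair (fun p => kElementL U l r (g p) ∘ₗ T p) A := by
  rw [Finsupp.sum, map_sum]
  rfl

/-- The pattern for all operators: pairing with a chain-valued form yields a continuous linear map
that agrees with the operator, and its value on the universal form is recorded. By
`diffChain_hom_ext` these values suffice for proving identities. -/
theorem exists_linking (U : Set V) (hUc : Convex ℝ U) (k : ℕ) {r s : ℕ} (hrs : r ≤ s) :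
    ∃ T : DiffChain U k r →L[ℝ] DiffChain U k s, (∀ J, linking r s J = T J) ∧
      ∀ p ∈ U, ∀ v, T (univForm U k r p v) = univForm U k s p v := by
  have hψ : ∀ v : Fin k → V, (∀ i, ‖v i‖ ≤ 1) → HasDiffBound U r 1 fun p =>
      kElementL U k s p (exteriorPower.ιMulti ℝ k v) := fun v hv =>
    (hasDiffBound_univForm hUc k s).eval hv |>.mono hrs le_rfl
  refine ⟨chainPairL U k r zero_le_one hψ, fun J => ?_, fun p hp v => ?_⟩
  · rw [linking, chainPairL, map_eq_chainLift (diracPairL U k r zero_le_one hψ)]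
    intro A
    rw [diracPairL_apply, diracPair_kElementL, ofCoeffL_apply]
  · rw [univForm_apply, chainPairL_kElement _ _ hp]
    rfl

theorem exists_chainIntegral {U : Set V} {k r : ℕ} {w : V → (⋀[ℝ]^k V) →ₗ[ℝ] ℝ} {C : ℝ}
    (hC : 0 ≤ C) (hw : ∀ v : Fin k → V, (∀ i, ‖v i‖ ≤ 1) →
      HasDiffBound U r C fun p => w p (exteriorPower.ιMulti ℝ k v)) :
    ∃ T : DiffChain U k r →L[ℝ] ℝ, (∀ J, chainIntegral w J = T J) ∧
      ∀ p ∈ U, ∀ α, T (kElement U r p α) = w p α := by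
  refine ⟨chainPairL U k r hC hw, fun J => ?_, fun p hp v => chainPairL_kElement _ _ hp v⟩
  rw [chainIntegral, chainPairL, extension_eq_chainLift (diracPairL U k r hC hw)]
  intro A
  rfl

theorem hasDiffBound_of_bound_lipschitz {U : Set V} {C : ℝ} {f : V → F}
    (h0 : ∀ p ∈ U, ‖f p‖ ≤ C) (h1 : ∀ p ∈ U, ∀ q ∈ U, ‖f p - f q‖ ≤ C * ‖p - q‖) :
    HasDiffBound U 1 C f := by
  intro l hl p hp
  match l, hl with
  | [], hl => simpa [iterDiff] using h0 p (hp rfl)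
  | [u], hl =>
    have h2 : p ∈ U := hp (Or.inl rfl)
    have h3 : p + u ∈ U := hp (Or.inr ⟨p, rfl, rfl⟩)
    simp only [iterDiff, List.map_cons, List.map_nil, List.prod_cons, List.prod_nil, mul_one]
    simpa using h1 _ h3 _ h2
  | u :: v :: l, hl =>
    simp only [List.length_cons] at hl
    omega

theorem kvMass_ιMulti_le_one {k : ℕ} {v : Fin k → V} (hv : ∀ i, ‖v i‖ ≤ 1) :
    kvMass (exteriorPower.ιMulti ℝ k v) ≤ 1 :=
  (kvMass_ιMulti_le_prod v).trans (Finset.prod_le_one (fun _ _ => norm_nonneg _) fun i _ => hv i)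

theorem IsFormB1.exists_hasDiffBound {U : Set V} {k : ℕ} {w : V → (⋀[ℝ]^k V) →ₗ[ℝ] ℝ}
    (hw : IsFormB1 U w) : ∃ C, 0 ≤ C ∧ ∀ v : Fin k → V, (∀ i, ‖v i‖ ≤ 1) →
      HasDiffBound U 1 C fun p => w p (exteriorPower.ιMulti ℝ k v) := by
  obtain ⟨C, h0, h1⟩ := hw
  refine ⟨|C|, abs_nonneg C, fun v hv => ?_⟩
  have hm := kvMass_ιMulti_le_one hv
  have hm0 := kvMass_nonneg (exteriorPower.ιMulti ℝ k v)
  refine hasDiffBound_of_bound_lipschitz (fun p hp => (h0 p hp _).trans ?_)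
    fun p hp q hq => (h1 p hp q hq _).trans ?_
  · exact (mul_le_mul_of_nonneg_right (le_abs_self C) hm0).trans
      (mul_le_of_le_one_right (abs_nonneg C) hm)
  · exact (mul_le_mul_of_nonneg_right (mul_le_mul_of_nonneg_right (le_abs_self C)
      (norm_nonneg _)) hm0).trans (mul_le_of_le_one_right (by positivity) hm)

theorem exists_extrusion {U : Set V} (hUc : Convex ℝ U) {k r : ℕ} (hr : r ≤ 2) {X : V → V} {D : ℝ}
    (hD : 0 ≤ D) (hX : HasDiffBound U 2 D X) :
    ∃ T : DiffChain U k r →L[ℝ] DiffChain U (k + 1) r, (∀ J, extrusion X J = T J) ∧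
      ∀ p ∈ U, ∀ v, T (univForm U k r p v) = univForm U (k + 1) r p (Fin.cons (X p) v) := by
  -- `D + 1` bounds the field `X` and the constant vectors `v j` at once.
  have hC : 0 ≤ 1 * (4 * (D + 1)) ^ (k + 1) := by positivity
  have hψ : ∀ v : Fin k → V, (∀ i, ‖v i‖ ≤ 1) → HasDiffBound U r (1 * (4 * (D + 1)) ^ (k + 1))
      fun p => (kElementL U (k + 1) r p ∘ₗ kvWedgeₗ (X p)) (exteriorPower.ιMulti ℝ k v) := by
    intro v hv
    have h := (hasDiffBound_univForm hUc (k + 1) r).alternating_apply hr zero_le_one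
      (D := D + 1) (by linarith) (w := Fin.cons X fun i _ => v i) (fun i => by
        refine Fin.cases ?_ (fun j => ?_) i
        · exact hX.mono hr (by linarith)
        · simpa using (hasDiffBound_const (v j)).mono le_rfl ((hv j).trans (by linarith)))
    refine h.congr fun p _ => ?_
    change kElement U r p (kvWedge (X p) _) = _
    rw [kvWedge_ιMulti, ← univForm_apply]
    congr 1
    ext i
    refine Fin.cases ?_ (fun j => ?_) i <;> simp
  refine ⟨chainPairL U k r hC hψ, fun J => ?_, fun p hp v => ?_⟩
  · rw [extrusion, chainPairL, map_eq_chainLift (diracPairL U k r hC hψ)]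
    intro A
    rw [diracPairL_apply]
    exact ofCoeffL_sum_single (fun p => p) (fun p => kvWedgeₗ (X p)) A.coeff
  · rw [univForm_apply, chainPairL_kElement _ _ hp]
    change kElement U r p (kvWedge (X p) _) = _
    rw [kvWedge_ιMulti, ← univForm_apply]

/-- Pushforward is pairing with the pullback `G^* univForm`. Its bounds follow from those for
composition with `G` and for insertion of the fields `p ↦ dG_p (v i)`. -/
theorem exists_pushforward {Ω : Set V} (hΩo : IsOpen Ω) (hΩc : Convex ℝ Ω) {U : Set W}
    (hUo : IsOpen U) (hUc : Convex ℝ U) {k r : ℕ} (hr1 : 1 ≤ r) (hr : r ≤ 2) {G : V → W}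
    (hG : SmoothBoundedOn G Ω) (hGU : MapsTo G Ω U) :
    ∃ T : DiffChain Ω k r →L[ℝ] DiffChain U k r, (∀ J, pushforward U G J = T J) ∧
      ∀ p ∈ Ω, ∀ v, T (univForm Ω k r p v) =
        (univForm U k r (G p)).compContinuousLinearMap (fderiv ℝ G p) v := by
  obtain ⟨D, hD, -, hG'⟩ := hG.exists_hasDiffBound hΩo hΩc
  obtain ⟨C, hC, hΦ⟩ := (hasDiffBound_univForm hUc k r).comp hΩc hUo hUc zero_le_one hD hr1 hr hGU
    (fun p hp => (hG.1.contDiffAt (hΩo.mem_nhds hp)).differentiableAt (by simp))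
    (hG'.mono one_le_two le_rfl)
  have hC' : 0 ≤ C * (4 * D) ^ k := by positivity
  have hval : ∀ p v, (kElementL U k r (G p) ∘ₗ exteriorPower.map k (fderiv ℝ G p).toLinearMap)
      (exteriorPower.ιMulti ℝ k v) =
        (univForm U k r (G p)).compContinuousLinearMap (fderiv ℝ G p) v := by
    intro p v
    rw [LinearMap.comp_apply, exteriorPower.map_apply_ιMulti]
    rfl
  have hψ : ∀ v : Fin k → V, (∀ i, ‖v i‖ ≤ 1) → HasDiffBound Ω r (C * (4 * D) ^ k)
      fun p => (kElementL U k r (G p) ∘ₗ exteriorPower.map k (fderiv ℝ G p).toLinearMap)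
        (exteriorPower.ιMulti ℝ k v) := by
    intro v hv
    simp only [hval]
    refine hΦ.alternating_apply hr hC hD (w := fun i p => fderiv ℝ G p (v i)) fun i => ?_
    refine ((hG'.mono hr le_rfl).clm (ContinuousLinearMap.apply ℝ W (v i))).mono le_rfl ?_
    refine mul_le_of_le_one_left hD ?_
    refine ContinuousLinearMap.opNorm_le_bound _ zero_le_one fun L => ?_
    rw [one_mul]
    exact (L.le_opNorm _).trans (mul_le_of_le_one_right (norm_nonneg _) (hv i))
  refine ⟨chainPairL Ω k r hC' hψ, fun J => ?_, fun p hp v => ?_⟩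
  · rw [pushforward, chainPairL, map_eq_chainLift (diracPairL Ω k r hC' hψ)]
    intro A
    rw [diracPairL_apply]
    exact ofCoeffL_sum_single G (fun p => exteriorPower.map k (fderiv ℝ G p).toLinearMap) A.coeff
  · rw [univForm_apply, chainPairL_kElement _ _ hp, hval]

end Operators

/-! ### The product with the unit interval and the cone operator -/

section Cylinder

open UniformSpace

variable {V : Type*} [NormedAddCommGroup V] [InnerProductSpace ℝ V]

/-- The inclusion of `V` in `ℝ × V`. -/
noncomputable def cylInr (V : Type*) [NormedAddCommGroup V] [InnerProductSpace ℝ V] :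
    V →L[ℝ] WithLp 2 (ℝ × V) :=
  ((WithLp.prodContinuousLinearEquiv 2 ℝ ℝ V).symm : ℝ × V →L[ℝ] WithLp 2 (ℝ × V)) ∘L
    ContinuousLinearMap.inr ℝ ℝ V

theorem cylInr_apply (u : V) : cylInr V u = WithLp.toLp 2 (0, u) := rfl

theorem norm_cylInr (u : V) : ‖cylInr V u‖ = ‖u‖ := by
  rw [cylInr_apply, WithLp.prod_norm_eq_of_L2]
  simp

/-- The unit vector of the first factor of `ℝ × V`. -/
noncomputable def cylUnit (V : Type*) [NormedAddCommGroup V] [InnerProductSpace ℝ V] :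
    WithLp 2 (ℝ × V) := WithLp.toLp 2 ((1 : ℝ), (0 : V))

theorem norm_cylUnit : ‖cylUnit V‖ = 1 := by
  rw [cylUnit, WithLp.prod_norm_eq_of_L2]
  simp

theorem isOpen_openCylinder {U : Set V} (hU : IsOpen U) : IsOpen (openCylinder U) :=
  (isOpen_Ioo.preimage (WithLp.prod_continuous_ofLp 2 ℝ V).fst).inter
    (hU.preimage (WithLp.prod_continuous_ofLp 2 ℝ V).snd)

theorem convex_openCylinder {U : Set V} (hU : Convex ℝ U) : Convex ℝ (openCylinder U) := by
  intro x hx y hy a b ha hb hab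
  exact ⟨convex_Ioo 0 1 hx.1 hy.1 ha hb hab, hU hx.2 hy.2 ha hb hab⟩

theorem kElement_of_notMem {U : Set V} {k r : ℕ} {p : V} (hp : p ∉ U) (α : ⋀[ℝ]^k V) :
    kElement U r p α = 0 := by
  have : DiracChain.ofCoeff U r (Finsupp.single p α) = 0 := by
    refine Finsupp.ext fun x => ?_
    exact Finsupp.single_eq_of_ne fun h => hp (h ▸ x.2)
  rw [kElement, this]
  exact Completion.coe_zero

theorem continuousOn_cyl_univForm {U : Set V} (hUc : Convex ℝ U) {k r : ℕ} (hr : 1 ≤ r) {p : V}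
    (hp : p ∈ U) : ContinuousOn (fun t : ℝ => univForm (openCylinder U) k r (WithLp.toLp 2 (t, p)))
      (Ioo 0 1) := by
  refine ((hasDiffBound_univForm (convex_openCylinder hUc) k r).continuousOn hr).comp
    (Continuous.continuousOn ?_) fun t ht => ⟨ht, hp⟩
  exact (WithLp.prod_continuous_toLp 2 ℝ V).comp (by fun_prop)

theorem integrableOn_Ioo_of_bound {F : Type*} [NormedAddCommGroup F] {f : ℝ → F}
    (hf : ContinuousOn f (Ioo 0 1)) {C : ℝ} (hC : ∀ t ∈ Ioo (0 : ℝ) 1, ‖f t‖ ≤ C) :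
    IntegrableOn f (Ioo 0 1) :=
  IntegrableOn.of_bound (by simp) (hf.aestronglyMeasurable measurableSet_Ioo) C
    ((ae_restrict_iff' measurableSet_Ioo).2 (.of_forall hC))

theorem integrableOn_cyl_kElement {U : Set V} (hUc : Convex ℝ U) {k r : ℕ} (hr : 1 ≤ r) (p : V)
    (α : ⋀[ℝ]^k (WithLp 2 (ℝ × V))) :
    IntegrableOn (fun t : ℝ => kElement (openCylinder U) r (WithLp.toLp 2 (t, p)) α)
      (Ioo 0 1) := by
  by_cases hp : p ∈ U
  · have hα : α ∈ Submodule.span ℝ (range (exteriorPower.ιMulti ℝ k)) := by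
      rw [exteriorPower.ιMulti_span]; trivial
    simp only [← kElementL_apply]
    induction hα using Submodule.span_induction with
    | mem x hx =>
      obtain ⟨v, rfl⟩ := hx
      have h := continuousOn_cyl_univForm (k := k) hUc hr hp
      refine integrableOn_Ioo_of_bound (C := ∏ i, ‖v i‖) ?_ fun t _ =>
        (norm_kElementL_le _ _ _ _ _).trans (kvMass_ιMulti_le_prod v)
      exact (ContinuousAlternatingMap.apply ℝ _ _ v).continuous.comp_continuousOn h
    | zero => simp
    | add x y _ _ hx hy =>
      simp only [map_add]
      exact hx.add hy
    | smul c x _ hx =>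
      simp only [map_smul]
      exact hx.smul c
  · have : ∀ t : ℝ, kElement (openCylinder U) r (WithLp.toLp 2 (t, p)) α = 0 :=
      fun t => kElement_of_notMem (fun h => hp h.2) α
    simp [this]

/-- On the universal form this is integration over the fibre. The slice inclusions `p ↦ (t, p)` are
affine isometries, so the constant `1` is uniform in `t`. -/
theorem exists_intervalProd {U : Set V} (hUc : Convex ℝ U) {k r : ℕ} (hr : 1 ≤ r) :
    ∃ T : DiffChain U k r →L[ℝ] DiffChain (openCylinder U) (k + 1) r,
      (∀ J, intervalProd J = T J) ∧
      ∀ p ∈ U, ∀ v, T (univForm U k r p v) = ∫ t in Ioo (0 : ℝ) 1,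
        univForm (openCylinder U) (k + 1) r (WithLp.toLp 2 (t, p))
          (Fin.cons (cylUnit V) fun i => cylInr V (v i)) := by
  have hint := fun (p : V) (α : ⋀[ℝ]^(k + 1) (WithLp 2 (ℝ × V))) =>
    integrableOn_cyl_kElement hUc hr p α
  let L : (⋀[ℝ]^k V) →ₗ[ℝ] ⋀[ℝ]^(k + 1) (WithLp 2 (ℝ × V)) :=
    kvWedgeₗ (cylUnit V) ∘ₗ exteriorPower.map k
      ((WithLp.linearEquiv 2 ℝ (ℝ × V)).symm.toLinearMap ∘ₗ LinearMap.inr ℝ ℝ V)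
  let ψ : V → (⋀[ℝ]^k V) →ₗ[ℝ] DiffChain (openCylinder U) (k + 1) r := fun p =>
    { toFun := fun α => ∫ t in Ioo (0 : ℝ) 1,
        kElement (openCylinder U) r (WithLp.toLp 2 (t, p)) (L α)
      map_add' := fun α β => by
        rw [← integral_add (hint p _) (hint p _)]
        simp only [← kElementL_apply, map_add]
      map_smul' := fun c α => by
        rw [RingHom.id_apply, ← integral_smul]
        simp only [← kElementL_apply, map_smul] }
  have hL : ∀ v : Fin k → V, L (exteriorPower.ιMulti ℝ k v) =
      exteriorPower.ιMulti ℝ (k + 1) (Fin.cons (cylUnit V) fun i => cylInr V (v i)) := by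
    intro v
    change kvWedge _ _ = _
    rw [exteriorPower.map_apply_ιMulti, kvWedge_ιMulti]
    rfl
  have hval : ∀ p v, ψ p (exteriorPower.ιMulti ℝ k v) = ∫ t in Ioo (0 : ℝ) 1,
        univForm (openCylinder U) (k + 1) r (WithLp.toLp 2 (t, p))
          (Fin.cons (cylUnit V) fun i => cylInr V (v i)) := by
    intro p v
    change ∫ t in Ioo (0 : ℝ) 1, kElement (openCylinder U) r (WithLp.toLp 2 (t, p)) (L _) = _
    rw [hL]
    rfl
  have hψ : ∀ v : Fin k → V, (∀ i, ‖v i‖ ≤ 1) → HasDiffBound U r 1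
      fun p => ψ p (exteriorPower.ιMulti ℝ k v) := by
    intro v hv
    simp only [hval]
    have h := HasDiffBound.integral (μ := volume.restrict (Ioo (0 : ℝ) 1)) (U := U) (r := r) (C := 1)
      (f := fun t p => univForm (openCylinder U) (k + 1) r (WithLp.toLp 2 (t, p))
          (Fin.cons (cylUnit V) fun i => cylInr V (v i))) (fun p _ => hint p _) ?_
    · simpa using h
    · refine (ae_restrict_iff' measurableSet_Ioo).2 (.of_forall fun t ht => ?_)
      refine ((hasDiffBound_univForm (convex_openCylinder hUc) (k + 1) r).eval ?_).comp_affine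
        (g := fun p => WithLp.toLp 2 (t, p)) (h := cylInr V) ?_ norm_cylInr fun p hp => ⟨ht, hp⟩
      · intro i
        refine Fin.cases ?_ (fun j => ?_) i
        · simp [norm_cylUnit]
        · simpa [norm_cylInr] using hv j
      · intro p u
        rw [cylInr_apply, ← WithLp.toLp_add]
        simp
  refine ⟨chainPairL U k r zero_le_one hψ, fun J => ?_, fun p hp v => ?_⟩
  · rw [intervalProd, chainPairL, extension_eq_chainLift (diracPairL U k r zero_le_one hψ)]
    intro A
    rfl
  · rw [univForm_apply, chainPairL_kElement _ _ hp, hval]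

theorem exists_coneOperator {U : Set V} (hUo : IsOpen U) (hUc : Convex ℝ U) {k r : ℕ}
    (hr : 1 ≤ r) (hr2 : r ≤ 2) {F : ℝ → V → V}
    (hFb : SmoothBoundedOn (fun x : WithLp 2 (ℝ × V) => F x.fst x.snd) (openCylinder U))
    (hFU : ∀ t ∈ Icc (0 : ℝ) 1, ∀ p ∈ U, F t p ∈ U) :
    ∃ T : DiffChain U k r →L[ℝ] DiffChain U (k + 1) r,
      (∀ J, coneOperator F J = T J) ∧
      ∀ p ∈ U, ∀ v, T (univForm U k r p v) = ∫ t in Ioo (0 : ℝ) 1,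
        (univForm U (k + 1) r (F t p)).compContinuousLinearMap
          (fderiv ℝ (fun x : WithLp 2 (ℝ × V) => F x.fst x.snd) (WithLp.toLp 2 (t, p)))
          (Fin.cons (cylUnit V) fun i => cylInr V (v i)) := by
  obtain ⟨S, hS, hS'⟩ := exists_intervalProd (k := k) hUc hr
  obtain ⟨T, hT, hT'⟩ := exists_pushforward (k := k + 1) (isOpen_openCylinder hUo)
    (convex_openCylinder hUc) hUo hUc hr hr2 hFb
    fun x hx => hFU _ (Ioo_subset_Icc_self hx.1) _ hx.2
  refine ⟨T ∘L S, fun J => ?_, fun p hp v => ?_⟩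
  · rw [coneOperator, hT, hS]
    rfl
  · rw [ContinuousLinearMap.comp_apply, hS' p hp]
    refine (T.integral_comp_comm (φ := fun t : ℝ => univForm (openCylinder U) (k + 1) r
      (WithLp.toLp 2 (t, p)) (Fin.cons (cylUnit V) fun i => cylInr V (v i)))
      (integrableOn_cyl_kElement hUc hr p _)).symm.trans ?_
    exact setIntegral_congr_fun measurableSet_Ioo fun t ht =>
      hT' (WithLp.toLp 2 (t, p)) ⟨ht, hp⟩ _

end Cylinder

/-! ### The boundary as the dual of the exterior derivative -/

section Boundary

open UniformSpace

variable {V : Type*} [NormedAddCommGroup V] [InnerProductSpace ℝ V]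

theorem formEval_sub {F : Type*} [NormedAddCommGroup F] [NormedSpace ℝ F] {k : ℕ}
    (φ ψ : V [⋀^Fin k]→L[ℝ] F) : formEval (φ - ψ) = formEval φ - formEval ψ :=
  kvector_hom_ext fun v => by
    rw [LinearMap.sub_apply, formEval_ιMulti, formEval_ιMulti, formEval_ιMulti]
    rfl

/-- Difference quotients of a Dirac chain are pairings with difference quotients of the universal
form, which is differentiable in class `s ≥ 2`. This shows that the limit defining `P_v` exists. -/
theorem tendsto_prederivConst {U : Set V} (hUo : IsOpen U) (hUc : Convex ℝ U) {k s : ℕ}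
    (hs : 2 ≤ s) (v : V) {A : V →₀ ⋀[ℝ]^k V} (hA : (A.support : Set V) ⊆ U) :
    Tendsto (fun t : ℝ => ofCoeffL U k s (t⁻¹ • (translateCoeff (t • v) A - A))) (𝓝[≠] 0)
      (𝓝 (diracPair (fun p => formEval (fderiv ℝ (univForm U k s) p v)) A)) := by
  have hsub : ∀ A B : V →₀ ⋀[ℝ]^k V, ofCoeffL U k s (A - B) = ofCoeffL U k s A - ofCoeffL U k s B :=
    fun A B => by
      rw [eq_sub_iff_add_eq, ← map_add]
      exact congrArg (ofCoeffL U k s) (sub_add_cancel A B)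
  have h1 : ∀ t : ℝ, ofCoeffL U k s (t⁻¹ • (translateCoeff (t • v) A - A)) =
      ∑ p ∈ A.support, formEval (t⁻¹ • (univForm U k s (p + t • v) - univForm U k s p)) (A p) := by
    intro t
    refine (map_smul (ofCoeffL U k s) _ _).trans ?_
    rw [hsub, ← diracPair_kElementL, ← diracPair_kElementL, diracPair_translateCoeff,
      ← diracPair_fun_sub, diracPair_apply, Finsupp.sum, Finset.smul_sum]
    refine Finset.sum_congr rfl fun p _ => ?_
    rw [formEval_smul, LinearMap.smul_apply]
    congr 1
    rw [formEval_sub, formEval_univForm, formEval_univForm]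
  simp only [h1, diracPair_apply, Finsupp.sum]
  refine tendsto_finset_sum _ fun p hp => ?_
  have hd := ((hasDiffBound_univForm hUc k s).differentiableAt hUo hUc hs (hA hp)).hasFDerivAt
  have hl : HasDerivAt (fun t : ℝ => univForm U k s (p + t • v))
      (fderiv ℝ (univForm U k s) p v) 0 := by
    have hd' : HasFDerivAt (univForm U k s) (fderiv ℝ (univForm U k s) p) (p + (0 : ℝ) • v) := by
      simpa using hd
    have := hd'.comp_hasDerivAt (0 : ℝ) (((hasDerivAt_id (0 : ℝ)).smul_const v).const_add p)
    simpa [Function.comp_def] using this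
  have ht := hasDerivAt_iff_tendsto_slope_zero.1 hl
  simp only [zero_add, zero_smul, add_zero] at ht
  rw [tendsto_iff_norm_sub_tendsto_zero] at ht ⊢
  have hm := ht.mul_const (kvMass (A p))
  rw [zero_mul] at hm
  refine squeeze_zero (fun _ => norm_nonneg _) (fun t => ?_) hm
  refine le_trans (le_of_eq ?_) (norm_formEval_le _ _)
  rw [formEval_sub, LinearMap.sub_apply]

/-- The sum `∑ P_{eᵢ} E†_{eᵢ}` pairs with the alternatized derivative of the universal form, that
is, with its exterior derivative. The bound needs one order more in the target class, because
differentiating a form costs one. -/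
theorem exists_chainBoundary [FiniteDimensional ℝ V] {U : Set V} (hUo : IsOpen U)
    (hUc : Convex ℝ U) {k r : ℕ} (hr : 1 ≤ r) :
    ∃ T : DiffChain U (k + 1) r →L[ℝ] DiffChain U k (r + 1), (∀ J, chainBoundary J = T J) ∧
      ∀ p ∈ U, ∀ v, T (univForm U (k + 1) r p v) = extDeriv (univForm U k (r + 1)) p v := by
  have hD : HasDiffBound U r 1 (fderiv ℝ (univForm U k (r + 1))) :=
    (hasDiffBound_univForm hUc k (r + 1)).fderiv hUo hUc zero_le_one hr
  have hC : (0 : ℝ) ≤ ∑ _i : Fin (k + 1), 1 := by positivity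
  have hψ : ∀ v : Fin (k + 1) → V, (∀ i, ‖v i‖ ≤ 1) → HasDiffBound U r (∑ _i : Fin (k + 1), 1)
      fun p => formEval (extDeriv (univForm U k (r + 1)) p) (exteriorPower.ιMulti ℝ (k + 1) v) := by
    intro v hv
    simp only [formEval_ιMulti, extDeriv,
      ContinuousAlternatingMap.alternatizeUncurryFin_apply]
    refine HasDiffBound.sum _ fun i _ => ?_
    have h1 : HasDiffBound U r 1 fun p => fderiv ℝ (univForm U k (r + 1)) p (v i) := by
      refine (hD.clm (ContinuousLinearMap.apply ℝ _ (v i))).mono le_rfl ?_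
      rw [mul_one]
      refine ContinuousLinearMap.opNorm_le_bound _ zero_le_one fun L => ?_
      rw [one_mul]
      exact (L.le_opNorm _).trans (mul_le_of_le_one_right (norm_nonneg _) (hv i))
    have h2 := h1.eval (v := i.removeNth v) fun j => hv _
    intro l hl p hp
    have h3 := iterDiff_map (AddMonoidHom.mk' (fun x : DiffChain U k (r + 1) =>
      ((-1 : ℤ) ^ (i : ℕ)) • x) fun _ _ => smul_add _ _ _) l
      (fun p => fderiv ℝ (univForm U k (r + 1)) p (v i) (i.removeNth v)) p
    simp only [AddMonoidHom.mk'_apply] at h3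
    rw [← h3]
    rcases neg_one_pow_eq_or ℤ (i : ℕ) with h | h <;> rw [h]
    · rw [one_smul]; exact h2 l hl p hp
    · rw [neg_one_smul, norm_neg]; exact h2 l hl p hp
  -- Expand the contraction, exchange the sums over basis vectors and over slots, and recombine `∑
  -- ⟪eᵢ, vⱼ⟫ eᵢ = vⱼ` by linearity of the derivative.
  have hform : ∀ p, ∑ i, formEval (fderiv ℝ (univForm U k (r + 1)) p (stdOrthonormalBasis ℝ V i)) ∘ₗ
      kvContractₗ (stdOrthonormalBasis ℝ V i) = formEval (extDeriv (univForm U k (r + 1)) p) := by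
    intro p
    refine kvector_hom_ext fun v => ?_
    rw [formEval_ιMulti, extDeriv, ContinuousAlternatingMap.alternatizeUncurryFin_apply,
      LinearMap.sum_apply]
    have : ∀ i, (formEval (fderiv ℝ (univForm U k (r + 1)) p (stdOrthonormalBasis ℝ V i)) ∘ₗ
        kvContractₗ (stdOrthonormalBasis ℝ V i)) (exteriorPower.ιMulti ℝ (k + 1) v) =
        ∑ j : Fin (k + 1), ((-1 : ℝ) ^ (j : ℕ) * ⟪stdOrthonormalBasis ℝ V i, v j⟫) •
          fderiv ℝ (univForm U k (r + 1)) p (stdOrthonormalBasis ℝ V i) (j.removeNth v) := by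
      intro i
      rw [LinearMap.comp_apply]
      change formEval _ (kvContract _ _) = _
      rw [kvContract_ιMulti, map_sum]
      simp only [map_smul, formEval_ιMulti]
    simp only [this]
    rw [Finset.sum_comm]
    refine Finset.sum_congr rfl fun j _ => ?_
    conv_rhs => rw [← (stdOrthonormalBasis ℝ V).sum_repr' (v j)]
    rw [map_sum, ContinuousAlternatingMap.sum_apply, Finset.smul_sum]
    refine Finset.sum_congr rfl fun i _ => ?_
    rw [map_smul, ContinuousAlternatingMap.smul_apply, mul_smul]
    rcases neg_one_pow_eq_or ℝ (j : ℕ) with h | h <;> rcases neg_one_pow_eq_or ℤ (j : ℕ) with h' | h'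
    · rw [h, h', one_smul, one_smul]
    · exfalso
      have : ((-1 : ℤ) ^ (j : ℕ) : ℝ) = 1 := by push_cast; exact h
      rw [← Int.cast_one, ← Int.cast_neg, ← Int.cast_pow, h'] at h
      norm_num at h
    · exfalso
      rw [← Int.cast_one, ← Int.cast_neg, ← Int.cast_pow, h'] at h
      norm_num at h
    · rw [h, h', neg_one_smul, neg_one_smul]
  refine ⟨chainPairL U (k + 1) r hC hψ, fun J => ?_, fun p hp v => ?_⟩
  · rw [chainBoundary, chainPairL, extension_eq_chainLift (diracPairL U (k + 1) r hC hψ)]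
    intro A
    have hA := A.support_coeff_subset
    rw [diracPairL_apply, ← funext hform]
    have hret : ∀ i, ((retractionCoeff (stdOrthonormalBasis ℝ V i) A.coeff).support : Set V) ⊆ U := by
      classical
      intro i x hx
      have := Finsupp.support_sum (Finset.mem_coe.1 hx)
      obtain ⟨y, hy, hy'⟩ := Finset.mem_biUnion.1 this
      rw [Finset.mem_singleton.1 (Finsupp.support_single_subset hy')]
      exact hA hy
    have h1 : ∀ i, prederivConst U (r + 1) (stdOrthonormalBasis ℝ V i)
        (retractionCoeff (stdOrthonormalBasis ℝ V i) A.coeff) =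
        diracPair (fun p => formEval (fderiv ℝ (univForm U k (r + 1)) p
          (stdOrthonormalBasis ℝ V i)) ∘ₗ kvContractₗ (stdOrthonormalBasis ℝ V i)) A.coeff := by
      intro i
      refine ((tendsto_prederivConst hUo hUc (by omega) _ (hret i)).limUnder_eq).trans ?_
      rw [retractionCoeff, Finsupp.sum, map_sum]
      simp only [diracPair_single]
      rfl
    simp only [h1, diracPair_apply, Finsupp.sum, LinearMap.sum_apply]
    rw [Finset.sum_comm]
  · rw [univForm_apply, chainPairL_kElement _ _ hp, formEval_ιMulti]

end Boundary

/-! ### The homotopy formula for chain-valued forms -/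

section Homotopy

variable {V : Type*} [NormedAddCommGroup V] [InnerProductSpace ℝ V]
variable {W : Type*} [NormedAddCommGroup W] [NormedSpace ℝ W]
variable {X : Type*} [NormedAddCommGroup X] [NormedSpace ℝ X]

/-- Contraction with the unit vector of the first factor of `ℝ × V`, restricted to `V`. -/
noncomputable def cylContract (V X : Type*) [NormedAddCommGroup V] [InnerProductSpace ℝ V]
    [NormedAddCommGroup X] [NormedSpace ℝ X] (k : ℕ) :
    ((WithLp 2 (ℝ × V)) [⋀^Fin (k + 1)]→L[ℝ] X) →L[ℝ] (V [⋀^Fin k]→L[ℝ] X) :=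
  ContinuousAlternatingMap.compContinuousLinearMapCLM (cylInr V) ∘L
    ContinuousLinearMap.apply ℝ _ (cylUnit V) ∘L
      (ContinuousAlternatingMap.curryLeftLI (𝕜 := ℝ) (E := WithLp 2 (ℝ × V))
        (F := X) (n := k)).toContinuousLinearMap

/-- The form `∫₀¹ i_{∂t} Ψ dt`. -/
noncomputable def fiberIntegral {k : ℕ}
    (Ψ : WithLp 2 (ℝ × V) → (WithLp 2 (ℝ × V)) [⋀^Fin (k + 1)]→L[ℝ] X) (p : V) :
    V [⋀^Fin k]→L[ℝ] X :=
  ∫ t in Ioo (0 : ℝ) 1, cylContract V X k (Ψ (WithLp.toLp 2 (t, p)))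

theorem continuous_toLp_left (p : V) :
    Continuous fun t : ℝ => (WithLp.toLp 2 (t, p) : WithLp 2 (ℝ × V)) :=
  (WithLp.prod_continuous_toLp 2 ℝ V).comp (by fun_prop)

theorem hasDerivAt_toLp_left (p : V) (t : ℝ) :
    HasDerivAt (fun t : ℝ => (WithLp.toLp 2 (t, p) : WithLp 2 (ℝ × V))) (cylUnit V) t := by
  have h : (fun t : ℝ => (WithLp.toLp 2 (t, p) : WithLp 2 (ℝ × V))) =
      fun t => t • cylUnit V + cylInr V p := by
    ext1 t
    rw [cylUnit, cylInr_apply, ← WithLp.toLp_smul, ← WithLp.toLp_add]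
    simp
  rw [h]
  simpa using ((hasDerivAt_id t).smul_const (cylUnit V)).add_const (cylInr V p)

theorem hasFDerivAt_toLp_right (t : ℝ) (p : V) :
    HasFDerivAt (fun p : V => (WithLp.toLp 2 (t, p) : WithLp 2 (ℝ × V))) (cylInr V) p := by
  have h : (fun p : V => (WithLp.toLp 2 (t, p) : WithLp 2 (ℝ × V))) =
      fun p => t • cylUnit V + cylInr V p := by
    ext1 p
    rw [cylUnit, cylInr_apply, ← WithLp.toLp_smul, ← WithLp.toLp_add]
    simp
  rw [h]
  exact (cylInr V).hasFDerivAt.const_add _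

/-- `f` is bounded with bounded continuous derivative on `Ω`. -/
def IsBoundedC1 (Ω : Set W) (C : ℝ) (f : W → X) : Prop :=
  (∀ x ∈ Ω, DifferentiableAt ℝ f x) ∧ ContinuousOn (fderiv ℝ f) Ω ∧
    ∀ x ∈ Ω, ‖f x‖ ≤ C ∧ ‖fderiv ℝ f x‖ ≤ C

theorem HasDiffBound.isBoundedC1 [CompleteSpace X] {Ω : Set W} (hΩo : IsOpen Ω)
    (hΩc : Convex ℝ Ω) {C : ℝ} (hC : 0 ≤ C) {f : W → X} (hf : HasDiffBound Ω 2 C f) :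
    IsBoundedC1 Ω C f := by
  have h := hf.fderiv hΩo hΩc hC le_rfl
  exact ⟨fun x hx => hf.differentiableAt hΩo hΩc le_rfl hx, h.continuousOn le_rfl,
    fun x hx => ⟨hf.bound hx, h.bound hx⟩⟩

theorem hasFDerivAt_fiberIntegral {Z : Type*} [NormedAddCommGroup Z] [NormedSpace ℝ Z]
    [CompleteSpace Z] {U : Set V} (hU : IsOpen U)
    {Ψ : WithLp 2 (ℝ × V) → X} {C : ℝ} (hΨ : IsBoundedC1 (openCylinder U) C Ψ) (Λ : X →L[ℝ] Z)
    {p : V} (hp : p ∈ U) :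
    DifferentiableAt ℝ (fun p => ∫ t in Ioo (0 : ℝ) 1, Λ (Ψ (WithLp.toLp 2 (t, p)))) p ∧
    IntegrableOn (fun t : ℝ => Λ (Ψ (WithLp.toLp 2 (t, p)))) (Ioo 0 1) ∧ ∀ u : V,
      IntegrableOn (fun t : ℝ => Λ (fderiv ℝ Ψ (WithLp.toLp 2 (t, p)) (cylInr V u))) (Ioo 0 1) ∧
      fderiv ℝ (fun p => ∫ t in Ioo (0 : ℝ) 1, Λ (Ψ (WithLp.toLp 2 (t, p)))) p u =
        ∫ t in Ioo (0 : ℝ) 1, Λ (fderiv ℝ Ψ (WithLp.toLp 2 (t, p)) (cylInr V u)) := by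
  obtain ⟨hd, hc, hbb⟩ := hΨ
  have hmem : ∀ t ∈ Ioo (0 : ℝ) 1, ∀ p ∈ U, (WithLp.toLp 2 (t, p) : WithLp 2 (ℝ × V)) ∈
      openCylinder U := fun t ht p hp => ⟨ht, hp⟩
  have hcont : ∀ p ∈ U, ContinuousOn (fun t : ℝ => Ψ (WithLp.toLp 2 (t, p))) (Ioo 0 1) := by
    intro p hp t ht
    have h := (hd _ (hmem t ht p hp)).continuousAt
    exact (ContinuousAt.comp (f := fun t : ℝ => (WithLp.toLp 2 (t, p) : WithLp 2 (ℝ × V))) h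
      (continuous_toLp_left p).continuousAt).continuousWithinAt
  have hcont' : ContinuousOn (fun t : ℝ => fderiv ℝ Ψ (WithLp.toLp 2 (t, p))) (Ioo 0 1) :=
    hc.comp (continuous_toLp_left p).continuousOn fun t ht => hmem t ht p hp
  let Ψ' : V → ℝ → V →L[ℝ] Z := fun p t =>
    Λ ∘L fderiv ℝ Ψ (WithLp.toLp 2 (t, p)) ∘L cylInr V
  have hcontΨ' : ContinuousOn (Ψ' p) (Ioo 0 1) :=
    (continuousOn_const (c := Λ)).clm_comp (hcont'.clm_comp (continuousOn_const (c := cylInr V)))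
  have hbΨ' : ∀ p ∈ U, ∀ t ∈ Ioo (0 : ℝ) 1, ‖Ψ' p t‖ ≤ ‖Λ‖ * C := by
    intro p hp t ht
    have hb' := (hbb _ (hmem t ht p hp)).2
    refine ContinuousLinearMap.opNorm_le_bound _
      (mul_nonneg (norm_nonneg _) ((norm_nonneg _).trans hb')) fun u => ?_
    change ‖Λ (fderiv ℝ Ψ (WithLp.toLp 2 (t, p)) (cylInr V u))‖ ≤ _
    refine (Λ.le_opNorm _).trans ?_
    rw [mul_assoc]
    refine mul_le_mul_of_nonneg_left ?_ (norm_nonneg _)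
    refine (ContinuousLinearMap.le_opNorm _ _).trans ?_
    rw [norm_cylInr]
    exact mul_le_mul_of_nonneg_right hb' (norm_nonneg _)
  have hint : IntegrableOn (fun t : ℝ => Λ (Ψ (WithLp.toLp 2 (t, p)))) (Ioo 0 1) :=
    integrableOn_Ioo_of_bound (C := ‖Λ‖ * C) (Λ.continuous.comp_continuousOn (hcont p hp))
      fun t ht => (Λ.le_opNorm _).trans
        (mul_le_mul_of_nonneg_left (hbb _ (hmem t ht p hp)).1 (norm_nonneg _))
  have hF : HasFDerivAt (fun p => ∫ t in Ioo (0 : ℝ) 1, Λ (Ψ (WithLp.toLp 2 (t, p))))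
      (∫ t in Ioo (0 : ℝ) 1, Ψ' p t) p := by
    refine hasFDerivAt_integral_of_dominated_of_fderiv_le
      (F := fun p t => Λ (Ψ (WithLp.toLp 2 (t, p)))) (F' := Ψ') (bound := fun _ => ‖Λ‖ * C)
      (hU.mem_nhds hp) ?_ hint ?_ ?_ ?_ ?_
    · filter_upwards [hU.mem_nhds hp] with x hx
      exact (Λ.continuous.comp_continuousOn (hcont x hx)).aestronglyMeasurable measurableSet_Ioo
    · exact hcontΨ'.aestronglyMeasurable measurableSet_Ioo
    · exact (ae_restrict_iff' measurableSet_Ioo).2 (.of_forall fun t ht x hx => hbΨ' x hx t ht)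
    · exact integrable_const _
    · refine (ae_restrict_iff' measurableSet_Ioo).2 (.of_forall fun t ht x hx => ?_)
      have h := (hd _ (hmem t ht x hx)).hasFDerivAt
      exact Λ.hasFDerivAt.comp x (HasFDerivAt.comp
        (f := fun p : V => (WithLp.toLp 2 (t, p) : WithLp 2 (ℝ × V))) x h
        (hasFDerivAt_toLp_right t x))
  have hΨ'int : IntegrableOn (Ψ' p) (Ioo 0 1) :=
    integrableOn_Ioo_of_bound hcontΨ' fun t ht => hbΨ' p hp t ht
  refine ⟨hF.differentiableAt, hint, fun u =>
    ⟨(ContinuousLinearMap.apply ℝ Z u).integrable_comp hΨ'int, ?_⟩⟩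
  rw [hF.fderiv]
  exact ((ContinuousLinearMap.apply ℝ Z u).integral_comp_comm hΨ'int).symm

theorem cons_removeNth_succ {k : ℕ} (e : W) (v : Fin (k + 1) → W) (i : Fin (k + 1)) :
    (i.succ.removeNth (Fin.cons e v : Fin (k + 2) → W)) = Fin.cons e (i.removeNth v) := by
  ext j
  refine Fin.cases ?_ (fun j => ?_) j
  · simp [Fin.removeNth]
  · simp [Fin.removeNth]

theorem neg_one_pow_zsmul (i : ℕ) (x : X) : (-1 : ℤ) ^ i • x = (-1 : ℝ) ^ i • x := by
  rw [← Int.cast_smul_eq_zsmul ℝ]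
  push_cast
  rfl

/-- The homotopy formula: for a closed form `Ψ` on the cylinder, `∫₀¹ i_{∂t} Ψ dt` is a primitive
of the difference of its restrictions to the two ends. -/
theorem extDeriv_fiberIntegral [CompleteSpace X] {U : Set V} (hU : IsOpen U) {k : ℕ}
    {Ψ : WithLp 2 (ℝ × V) → (WithLp 2 (ℝ × V)) [⋀^Fin (k + 1)]→L[ℝ] X} {C : ℝ}
    (hΨ : IsBoundedC1 (openCylinder U) C Ψ)
    (hcl : ∀ x ∈ openCylinder U, extDeriv Ψ x = 0) {p : V} (hp : p ∈ U) :
    DifferentiableAt ℝ (fiberIntegral Ψ) p ∧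
    ∀ (v : Fin (k + 1) → V) (a b : X),
      Tendsto (fun t : ℝ => Ψ (WithLp.toLp 2 (t, p)) fun i => cylInr V (v i)) (𝓝[>] 0) (𝓝 a) →
      Tendsto (fun t : ℝ => Ψ (WithLp.toLp 2 (t, p)) fun i => cylInr V (v i)) (𝓝[<] 1) (𝓝 b) →
      extDeriv (fiberIntegral Ψ) p v = b - a := by
  obtain ⟨h1, -, h2⟩ := hasFDerivAt_fiberIntegral hU hΨ (cylContract V X k) hp
  refine ⟨h1, fun v a b ha hb => ?_⟩
  have hmem : ∀ t ∈ Ioo (0 : ℝ) 1, (WithLp.toLp 2 (t, p) : WithLp 2 (ℝ × V)) ∈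
      openCylinder U := fun t ht => ⟨ht, hp⟩
  let D : ℝ → Fin (k + 1) → X := fun t i => (-1 : ℝ) ^ (i : ℕ) •
    fderiv ℝ Ψ (WithLp.toLp 2 (t, p)) (cylInr V (v i))
      (Fin.cons (cylUnit V) (i.removeNth fun i => cylInr V (v i)))
  have hDint : ∀ i, IntegrableOn (fun t => D t i) (Ioo 0 1) := fun i =>
    ((ContinuousAlternatingMap.apply ℝ V X (i.removeNth v)).integrable_comp (h2 (v i)).1).smul
      ((-1 : ℝ) ^ (i : ℕ))
  -- Closedness evaluated on `(∂t, v₀, …, v_k)`: the alternating sum of derivatives of `i_{∂t} Ψ`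
  -- along `V` equals `∂t Ψ (v₀, …, v_k)`.
  have hA : ∀ t ∈ Ioo (0 : ℝ) 1, ∑ i, D t i =
      fderiv ℝ Ψ (WithLp.toLp 2 (t, p)) (cylUnit V) fun i => cylInr V (v i) := by
    intro t ht
    have h0 := congrArg (fun φ => φ (Fin.cons (cylUnit V) fun i => cylInr V (v i)))
      (hcl _ (hmem t ht))
    simp only [extDeriv, ContinuousAlternatingMap.alternatizeUncurryFin_apply,
      neg_one_pow_zsmul] at h0
    change _ = (0 : X) at h0
    rw [Fin.sum_univ_succ] at h0
    simp only [cons_removeNth_succ, Fin.cons_zero, Fin.cons_succ, Fin.val_zero, pow_zero, one_smul,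
      Fin.val_succ, pow_succ, mul_neg, mul_one, neg_smul, Finset.sum_neg_distrib] at h0
    rw [← sub_eq_add_neg, sub_eq_zero] at h0
    rw [← h0]
    congr 1
  have hval : extDeriv (fiberIntegral Ψ) p v = ∫ t in Ioo (0 : ℝ) 1,
      fderiv ℝ Ψ (WithLp.toLp 2 (t, p)) (cylUnit V) fun i => cylInr V (v i) := by
    rw [← setIntegral_congr_fun measurableSet_Ioo hA, integral_finset_sum _ fun i _ => hDint i,
      extDeriv, ContinuousAlternatingMap.alternatizeUncurryFin_apply]
    refine Finset.sum_congr rfl fun i _ => ?_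
    rw [neg_one_pow_zsmul]
    refine Eq.trans ?_ (integral_smul _ _).symm
    congr 1
    have h3 := congrArg (fun φ => φ (i.removeNth v)) (h2 (v i)).2
    refine h3.trans ?_
    exact ((ContinuousAlternatingMap.apply ℝ V X (i.removeNth v)).integral_comp_comm
      (h2 (v i)).1).symm
  rw [hval, ← integral_Ioc_eq_integral_Ioo, ← intervalIntegral.integral_of_le zero_le_one]
  -- `Ψ` is controlled on the open cylinder only, so the fundamental theorem is used with one-sided
  -- limits at the ends.
  refine intervalIntegral.integral_eq_sub_of_hasDerivAt_of_tendsto zero_lt_one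
    (f := fun t => Ψ (WithLp.toLp 2 (t, p)) fun i => cylInr V (v i)) (fun t ht => ?_) ?_ ha hb
  · have h3 := (hΨ.1 _ (hmem t ht)).hasFDerivAt
    have h4 := HasFDerivAt.comp_hasDerivAt
      (f := fun t : ℝ => (WithLp.toLp 2 (t, p) : WithLp 2 (ℝ × V))) t h3 (hasDerivAt_toLp_left p t)
    exact (ContinuousAlternatingMap.apply ℝ (WithLp 2 (ℝ × V)) X
      fun i => cylInr V (v i)).hasFDerivAt.comp_hasDerivAt t h4
  · rw [intervalIntegrable_iff_integrableOn_Ioo_of_le zero_le_one]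
    exact (integrableOn_congr_fun hA measurableSet_Ioo).1 (integrable_finset_sum _ fun i _ => hDint i)

theorem HasDiffBound.of_eval {W : Type*} [NormedAddCommGroup W] [NormedSpace ℝ W]
    {E : Type*} [NormedAddCommGroup E] [NormedSpace ℝ E] {U : Set E} {r : ℕ} {C : ℝ}
    {k : ℕ} {Φ : E → W [⋀^Fin k]→L[ℝ] X} (hC : 0 ≤ C)
    (hΦ : ∀ v : Fin k → W, (∀ i, ‖v i‖ ≤ 1) → HasDiffBound U r C fun p => Φ p v) :
    HasDiffBound U r C Φ := by
  intro l hl p hp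
  refine ContinuousAlternatingMap.opNorm_le_bound _ (mul_nonneg hC l.prod_map_norm_nonneg)
    fun v => ?_
  have h1 : ∀ v, iterDiff l Φ p v = iterDiff l (fun p => Φ p v) p := fun v =>
    iterDiff_map (AddMonoidHom.mk' (fun φ : W [⋀^Fin k]→L[ℝ] X => φ v) fun _ _ => rfl) l Φ p
  by_cases hv : ∃ i, v i = 0
  · obtain ⟨i, hi⟩ := hv
    rw [(iterDiff l Φ p).map_coord_zero i hi, norm_zero]
    exact mul_nonneg (mul_nonneg hC l.prod_map_norm_nonneg)
      (Finset.prod_nonneg fun _ _ => norm_nonneg _)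
  · push Not at hv
    have h2 : v = fun i => ‖v i‖ • (‖v i‖⁻¹ • v i) := by
      ext1 i
      rw [smul_smul, mul_inv_cancel₀ (norm_ne_zero_iff.2 (hv i)), one_smul]
    have h3 : iterDiff l Φ p v = (∏ i, ‖v i‖) • iterDiff l Φ p (fun i => ‖v i‖⁻¹ • v i) := by
      conv_lhs => rw [h2]
      exact (iterDiff l Φ p).toMultilinearMap.map_smul_univ _ _
    rw [h3, norm_smul, Real.norm_of_nonneg (Finset.prod_nonneg fun _ _ => norm_nonneg _), mul_comm,
      h1]
    refine mul_le_mul_of_nonneg_right (hΦ _ (fun i => ?_) l hl p hp)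
      (Finset.prod_nonneg fun _ _ => norm_nonneg _)
    rw [norm_smul, norm_inv, norm_norm, inv_mul_cancel₀ (norm_ne_zero_iff.2 (hv i))]

theorem ContinuousLinearMap.map_extDeriv {E : Type*} [NormedAddCommGroup E] [NormedSpace ℝ E]
    {Y : Type*} [NormedAddCommGroup Y] [NormedSpace ℝ Y] (T : X →L[ℝ] Y) {k : ℕ}
    {φ : E → E [⋀^Fin k]→L[ℝ] X} {p : E} (hφ : DifferentiableAt ℝ φ p) (v : Fin (k + 1) → E) :
    T (extDeriv φ p v) = extDeriv (fun p => T.compContinuousAlternatingMap (φ p)) p v := by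
  have h1 : HasFDerivAt (fun p => T.compContinuousAlternatingMap (φ p))
      ((ContinuousLinearMap.compContinuousAlternatingMapCLM ℝ E X Y (Fin k) T) ∘L
        fderiv ℝ φ p) p :=
    (ContinuousLinearMap.compContinuousAlternatingMapCLM ℝ E X Y (Fin k) T).hasFDerivAt.comp p
      hφ.hasFDerivAt
  rw [extDeriv, extDeriv, h1.fderiv, ContinuousAlternatingMap.alternatizeUncurryFin_apply,
    ContinuousAlternatingMap.alternatizeUncurryFin_apply, map_sum]
  refine Finset.sum_congr rfl fun i _ => ?_
  rw [map_zsmul]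
  rfl

theorem extDeriv_eq_zero_of_finrank_lt [FiniteDimensional ℝ V] {k : ℕ}
    (hk : finrank ℝ V < k) (φ : V [⋀^Fin k]→L[ℝ] X) : φ = 0 := by
  ext v
  refine φ.toAlternatingMap.map_linearDependent v fun h => ?_
  have := h.fintype_card_le_finrank
  rw [Fintype.card_fin] at this
  omega

end Homotopy

/-! ### The identities `∂∂ = 0` and `κ∂ = -1` in top dimension -/

section ConeIdentities

variable {V : Type*} [NormedAddCommGroup V] [InnerProductSpace ℝ V]

theorem two_le_infty : (2 : WithTop ℕ∞) ≤ ((⊤ : ℕ∞) : WithTop ℕ∞) :=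
  WithTop.coe_le_coe.2 (le_top : (2 : ℕ∞) ≤ ⊤)

theorem contDiffAt_two_univForm {U : Set V} (hUo : IsOpen U) (hUc : Convex ℝ U) (k : ℕ) {p : V}
    (hp : p ∈ U) : ContDiffAt ℝ 2 (univForm U k 3) p := by
  have h0 := hasDiffBound_univForm hUc k 3
  have h1 := h0.fderiv hUo hUc zero_le_one (r := 2) one_le_two
  have h2 := h1.fderiv hUo hUc zero_le_one (r := 1) le_rfl
  have hc : ContDiffOn ℝ (1 + 1) (univForm U k 3) U := by
    refine (contDiffOn_succ_iff_fderiv_of_isOpen hUo).2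
      ⟨fun x hx => (h0.differentiableAt hUo hUc (by norm_num) hx).differentiableWithinAt,
        by simp, ?_⟩
    rw [show (1 : WithTop ℕ∞) = 0 + 1 from (zero_add 1).symm]
    refine (contDiffOn_succ_iff_fderiv_of_isOpen hUo).2
      ⟨fun x hx => (h1.differentiableAt hUo hUc le_rfl hx).differentiableWithinAt,
        by simp, ?_⟩
    exact contDiffOn_zero.2 (h2.continuousOn le_rfl)
  have := hc.contDiffAt (hUo.mem_nhds hp)
  rwa [one_add_one_eq_two] at this

/-- Dual to `d ∘ d = 0`. The universal form must be `C²` for this; class `3` provides it, since each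
derivative costs one order and continuity uses the last. -/
theorem chainBoundary_chainBoundary [FiniteDimensional ℝ V] {U : Set V} (hUo : IsOpen U)
    (hUc : Convex ℝ U) {k : ℕ} (J : DiffChain U (k + 2) 1) :
    chainBoundary (chainBoundary J) = (0 : DiffChain U k 3) := by
  obtain ⟨S, hS, hS'⟩ := exists_chainBoundary (k := k + 1) hUo hUc (le_refl 1)
  obtain ⟨T, hT, hT'⟩ := exists_chainBoundary (k := k) hUo hUc one_le_two
  have h : T ∘L S = 0 := by
    refine diffChain_hom_ext fun p hp v => ?_
    rw [ContinuousLinearMap.comp_apply, hS' p hp, T.map_extDeriv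
      ((hasDiffBound_univForm hUc (k + 1) 2).differentiableAt hUo hUc le_rfl hp)]
    have h1 : (fun p => T.compContinuousAlternatingMap (univForm U (k + 1) 2 p)) =ᶠ[𝓝 p]
        extDeriv (univForm U k 3) := by
      filter_upwards [hUo.mem_nhds hp] with x hx
      ext w
      exact hT' x hx w
    have h2 : extDeriv (extDeriv (univForm U k 3)) p = 0 :=
      extDeriv_extDeriv_apply (contDiffAt_two_univForm hUo hUc k hp) (by simp)
    refine (congrArg (fun φ => φ v) h1.extDeriv_eq).trans ?_
    exact congrArg (fun φ => φ v) h2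
  rw [hT, hS]
  exact congrArg (fun f : DiffChain U (k + 2) 1 →L[ℝ] DiffChain U k 3 => f J) h

/-- `F` is smooth up to `t = 0` and `t = 1` only from inside, while the pushforward uses `fderiv` in
the open cylinder. Continuity of `fderivWithin` on the closed slab yields the limits, and in
directions along `V` its end values are the derivatives of the end maps. -/
theorem tendsto_fderiv_cylinder {U : Set V} (hUo : IsOpen U) {F : ℝ → V → V}
    (hFs : ContDiffOn ℝ ∞ (Function.uncurry F) (Icc (0 : ℝ) 1 ×ˢ U)) {t₀ : ℝ}
    (ht₀ : t₀ ∈ Icc (0 : ℝ) 1) {h : V → V} {h' : V →L[ℝ] V} (hF : ∀ p ∈ U, F t₀ p = h p) {p : V}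
    (hp : p ∈ U) (hh : HasFDerivAt h h' p) (u : V) :
    Tendsto (fun t : ℝ => fderiv ℝ (fun x : WithLp 2 (ℝ × V) => F x.fst x.snd)
      (WithLp.toLp 2 (t, p)) (cylInr V u)) (𝓝[Ioo 0 1] t₀) (𝓝 (h' u)) := by
  have hS : UniqueDiffOn ℝ (Icc (0 : ℝ) 1 ×ˢ U) :=
    (uniqueDiffOn_Icc_zero_one).prod hUo.uniqueDiffOn
  have hcont := hFs.continuousOn_fderivWithin hS (by simp)
  have hlim : Tendsto (fun t : ℝ => fderivWithin ℝ (Function.uncurry F) (Icc (0 : ℝ) 1 ×ˢ U) (t, p)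
      (0, u)) (𝓝[Ioo 0 1] t₀)
      (𝓝 (fderivWithin ℝ (Function.uncurry F) (Icc (0 : ℝ) 1 ×ˢ U) (t₀, p) (0, u))) := by
    have h1 : ContinuousWithinAt (fun t : ℝ => (t, p)) (Ioo 0 1) t₀ := by fun_prop
    have h2 := ContinuousWithinAt.comp (f := fun t : ℝ => (t, p)) (hcont (t₀, p) ⟨ht₀, hp⟩) h1
      (fun t ht => ⟨Ioo_subset_Icc_self ht, hp⟩)
    exact ((ContinuousLinearMap.apply ℝ V ((0, u) : ℝ × V)).continuous.tendsto _).comp h2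
  have hval : fderivWithin ℝ (Function.uncurry F) (Icc (0 : ℝ) 1 ×ˢ U) (t₀, p) (0, u) = h' u := by
    have h1 := ((hFs.differentiableOn (by simp)) (t₀, p) ⟨ht₀, hp⟩).hasFDerivWithinAt
    have h2 : HasFDerivWithinAt (fun x : V => (t₀, x)) (ContinuousLinearMap.inr ℝ ℝ V) U p :=
      (hasFDerivAt_prodMk_right t₀ p).hasFDerivWithinAt
    have h3 := (HasFDerivWithinAt.comp (g := Function.uncurry F) p h1 h2
      fun x hx => ⟨ht₀, hx⟩).hasFDerivAt (hUo.mem_nhds hp)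
    have h4 : HasFDerivAt (Function.uncurry F ∘ fun x : V => (t₀, x)) h' p := by
      refine hh.congr_of_eventuallyEq ?_
      filter_upwards [hUo.mem_nhds hp] with x hx
      exact hF x hx
    have h5 := congrArg (fun L : V →L[ℝ] V => L u) (h3.unique h4)
    simpa using h5
  rw [hval] at hlim
  refine hlim.congr' ?_
  filter_upwards [self_mem_nhdsWithin] with t ht
  have h1 : HasFDerivAt (Function.uncurry F)
      (fderivWithin ℝ (Function.uncurry F) (Icc (0 : ℝ) 1 ×ˢ U) (t, p)) (t, p) := by
    refine ((hFs.differentiableOn (by simp)) (t, p)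
      ⟨Ioo_subset_Icc_self ht, hp⟩).hasFDerivWithinAt.hasFDerivAt ?_
    exact prod_mem_nhds (Icc_mem_nhds ht.1 ht.2) (hUo.mem_nhds hp)
  have h2 : HasFDerivAt (fun x : WithLp 2 (ℝ × V) => F x.fst x.snd)
      (fderivWithin ℝ (Function.uncurry F) (Icc (0 : ℝ) 1 ×ˢ U) (t, p) ∘L
        (WithLp.prodContinuousLinearEquiv 2 ℝ ℝ V : WithLp 2 (ℝ × V) →L[ℝ] ℝ × V))
      (WithLp.toLp 2 (t, p)) :=
    HasFDerivAt.comp (g := Function.uncurry F) (WithLp.toLp 2 (t, p)) h1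
      (WithLp.prodContinuousLinearEquiv 2 ℝ ℝ V).hasFDerivAt
  rw [h2.fderiv]
  rfl

theorem tendsto_alternating_apply {ι X : Type*} [NormedAddCommGroup X] [NormedSpace ℝ X]
    {l : Filter ι} {k : ℕ} {φ : ι → V [⋀^Fin k]→L[ℝ] X} {φ₀ : V [⋀^Fin k]→L[ℝ] X}
    {w : ι → Fin k → V} {w₀ : Fin k → V} (hφ : Tendsto φ l (𝓝 φ₀)) (hw : Tendsto w l (𝓝 w₀)) :
    Tendsto (fun i => φ i (w i)) l (𝓝 (φ₀ w₀)) :=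
  hφ.eval hw

theorem exists_hasDiffBound_pullback [FiniteDimensional ℝ V] {W : Type*} [NormedAddCommGroup W]
    [InnerProductSpace ℝ W] {Ω : Set W}
    (hΩo : IsOpen Ω) (hΩc : Convex ℝ Ω) {U : Set V} (hUo : IsOpen U) (hUc : Convex ℝ U)
    {X : Type*} [NormedAddCommGroup X] [NormedSpace ℝ X] [CompleteSpace X] {k : ℕ}
    {φ : V → V [⋀^Fin k]→L[ℝ] X} {C : ℝ} (hC : 0 ≤ C) (hφ : HasDiffBound U 2 C φ) {G : W → V}
    (hG : SmoothBoundedOn G Ω) (hGU : MapsTo G Ω U) :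
    ∃ C', 0 ≤ C' ∧ HasDiffBound Ω 2 C' fun x => (φ (G x)).compContinuousLinearMap (fderiv ℝ G x) := by
  obtain ⟨D, hD, -, hG'⟩ := hG.exists_hasDiffBound hΩo hΩc
  obtain ⟨C₁, hC₁, hΦ⟩ := hφ.comp hΩc hUo hUc hC hD one_le_two le_rfl hGU
    (fun p hp => (hG.1.contDiffAt (hΩo.mem_nhds hp)).differentiableAt (by simp))
    (hG'.mono one_le_two le_rfl)
  refine ⟨C₁ * (4 * D) ^ k, by positivity, HasDiffBound.of_eval (by positivity) fun v hv => ?_⟩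
  refine hΦ.alternating_apply le_rfl hC₁ hD (w := fun i p => fderiv ℝ G p (v i)) fun i => ?_
  refine (hG'.clm (ContinuousLinearMap.apply ℝ V (v i))).mono le_rfl ?_
  refine mul_le_of_le_one_left hD ?_
  refine ContinuousLinearMap.opNorm_le_bound _ zero_le_one fun L => ?_
  rw [one_mul]
  exact (L.le_opNorm _).trans (mul_le_of_le_one_right (norm_nonneg _) (hv i))

/-- Applied to the universal form, `κ ∘ ∂` is `d` of the fibre integral of `Ψ = F^* univForm`. The
homotopy formula gives `Ψ` at `t = 1` minus `Ψ` at `t = 0`, that is, `0` minus the universal form.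
The hypothesis that `k + 1` is the dimension of `V` makes `Ψ` closed and removes the usual second
term. -/
theorem coneOperator_chainBoundary [FiniteDimensional ℝ V] {U : Set V} (hUo : IsOpen U)
    (hUc : Convex ℝ U) {k : ℕ} (hk : finrank ℝ V = k + 1) {F : ℝ → V → V} {q : V}
    (hFU : ∀ t ∈ Icc (0 : ℝ) 1, ∀ p ∈ U, F t p ∈ U) (hF0 : ∀ p ∈ U, F 0 p = p)
    (hF1 : ∀ p ∈ U, F 1 p = q)
    (hFs : ContDiffOn ℝ ∞ (Function.uncurry F) (Icc (0 : ℝ) 1 ×ˢ U))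
    (hFb : SmoothBoundedOn (fun x : WithLp 2 (ℝ × V) => F x.fst x.snd) (openCylinder U))
    (J : DiffChain U (k + 1) 1) :
    coneOperator F (chainBoundary J) = -linking 1 2 J := by
  obtain ⟨S, hS, hS'⟩ := exists_chainBoundary (k := k) hUo hUc (le_refl 1)
  obtain ⟨T, hT, hT'⟩ := exists_coneOperator (k := k) hUo hUc one_le_two (le_refl 2) hFb hFU
  obtain ⟨L, hL, hL'⟩ := exists_linking U hUc (k + 1) one_le_two
  set G : WithLp 2 (ℝ × V) → V := fun x => F x.fst x.snd with hG
  let Ψ : WithLp 2 (ℝ × V) → (WithLp 2 (ℝ × V)) [⋀^Fin (k + 1)]→L[ℝ] DiffChain U (k + 1) 2 :=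
    fun x => (univForm U (k + 1) 2 (G x)).compContinuousLinearMap (fderiv ℝ G x)
  have hΩo := isOpen_openCylinder hUo
  have hΩc := convex_openCylinder hUc
  have hmaps : MapsTo G (openCylinder U) U := fun x hx =>
    hFU _ (Ioo_subset_Icc_self hx.1) _ hx.2
  obtain ⟨C, hC, hΨ⟩ := exists_hasDiffBound_pullback hΩo hΩc hUo hUc zero_le_one
    (hasDiffBound_univForm hUc (k + 1) 2) hFb hmaps
  have hΨ1 : IsBoundedC1 (openCylinder U) C Ψ := hΨ.isBoundedC1 hΩo hΩc hC
  have hcl : ∀ x ∈ openCylinder U, extDeriv Ψ x = 0 := by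
    intro x hx
    have h1 := extDeriv_pullback (r := ∞)
      ((hasDiffBound_univForm hUc (k + 1) 2).differentiableAt hUo hUc le_rfl (hmaps hx))
      (hFb.1.contDiffAt (hΩo.mem_nhds hx)) (by simpa using two_le_infty)
    refine h1.trans ?_
    -- The exterior derivative of a top-degree form has degree `dim V + 1`, hence vanishes.
    rw [extDeriv_eq_zero_of_finrank_lt (by omega) (extDeriv (univForm U (k + 1) 2) (G x))]
    rfl
  have h : T ∘L S = -L := by
    refine diffChain_hom_ext fun p hp v => ?_
    rw [ContinuousLinearMap.comp_apply, hS' p hp, T.map_extDeriv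
      ((hasDiffBound_univForm hUc k 2).differentiableAt hUo hUc le_rfl hp)]
    have hfib : ∀ x ∈ U, T.compContinuousAlternatingMap (univForm U k 2 x) = fiberIntegral Ψ x := by
      intro x hx
      ext w
      refine (hT' x hx w).trans ?_
      exact (ContinuousAlternatingMap.apply ℝ V _ w).integral_comp_comm
        (hasFDerivAt_fiberIntegral hUo hΨ1 (cylContract V _ k) hx).2.1
    have h1 : (fun p => T.compContinuousAlternatingMap (univForm U k 2 p)) =ᶠ[𝓝 p]
        fiberIntegral Ψ := by
      filter_upwards [hUo.mem_nhds hp] with x hx using hfib x hx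
    refine (congrArg (fun φ => φ v) h1.extDeriv_eq).trans ?_
    have hev : ∀ t₀ ∈ Icc (0 : ℝ) 1, ∀ (h : V → V) (h' : V →L[ℝ] V), (∀ p ∈ U, F t₀ p = h p) →
        HasFDerivAt h h' p → Tendsto (fun t : ℝ => Ψ (WithLp.toLp 2 (t, p)) fun i => cylInr V (v i))
          (𝓝[Ioo 0 1] t₀) (𝓝 (univForm U (k + 1) 2 (h p) fun i => h' (v i))) := by
      intro t₀ ht₀ h h' hF hh
      refine tendsto_alternating_apply (φ := fun t => univForm U (k + 1) 2 (F t p))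
        (w := fun t i => fderiv ℝ G (WithLp.toLp 2 (t, p)) (cylInr V (v i)))
        (w₀ := fun i => h' (v i)) ?_ (tendsto_pi_nhds.2 fun i =>
        tendsto_fderiv_cylinder hUo hFs ht₀ hF hp hh (v i))
      have h2 : ContinuousOn (fun t => F t p) (Icc 0 1) :=
        hFs.continuousOn.comp (f := fun t : ℝ => (t, p)) (by fun_prop) fun t ht => ⟨ht, hp⟩
      have h3 : ContinuousOn (fun t => univForm U (k + 1) 2 (F t p)) (Icc 0 1) :=
        ((hasDiffBound_univForm hUc (k + 1) 2).continuousOn one_le_two).comp h2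
          fun t ht => hFU t ht p hp
      have h4 := (h3 t₀ ht₀).mono_left (nhdsWithin_mono _ Ioo_subset_Icc_self)
      rw [← hF p hp]
      exact h4
    have h0 := hev 0 (by simp) id (.id ℝ V) hF0 (hasFDerivAt_id p)
    have h1 := hev 1 (by simp) (fun _ => q) 0 hF1 (hasFDerivAt_const q p)
    rw [nhdsWithin_Ioo_eq_nhdsGT zero_lt_one] at h0
    rw [nhdsWithin_Ioo_eq_nhdsLT zero_lt_one] at h1
    rw [(extDeriv_fiberIntegral hUo hΨ1 hcl hp).2 v _ _ h0 h1]
    -- `F 1` is constant, so zero vectors are inserted into a form of positive degree.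
    have hz : (univForm U (k + 1) 2 q fun i => (0 : V →L[ℝ] V) (v i)) = 0 :=
      (univForm U (k + 1) 2 q).map_coord_zero 0 rfl
    rw [hz, zero_sub, ContinuousLinearMap.neg_apply, hL' p hp]
    rfl
  rw [hS, hT, hL]
  exact congrArg (fun f : DiffChain U (k + 1) 1 →L[ℝ] DiffChain U (k + 1) 2 => f J) h

end ConeIdentities

/-! ### The top-dimensional chain of a measure -/

section MassChains

/-- The unit positively oriented `n`-vector of `ℝ^n`. -/
noncomputable def volVec (n : ℕ) : ⋀[ℝ]^n (EucSp n) :=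
  exteriorPower.ιMulti ℝ n (EuclideanSpace.basisFun (Fin n) ℝ)

theorem volForm_ιMulti {n : ℕ} (v : Fin n → EucSp n) :
    volForm n (exteriorPower.ιMulti ℝ n v) =
      (EuclideanSpace.basisFun (Fin n) ℝ).toBasis.det v := by
  rw [volForm, exteriorPower.alternatingMapLinearEquiv_apply_ιMulti]

theorem volForm_volVec (n : ℕ) : volForm n (volVec n) = 1 := by
  rw [volVec, volForm_ιMulti, ← OrthonormalBasis.coe_toBasis, Basis.det_self]

theorem abs_volForm_ιMulti_le {n : ℕ} (v : Fin n → EucSp n) :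
    |volForm n (exteriorPower.ιMulti ℝ n v)| ≤ ∏ i, ‖v i‖ := by
  rw [volForm_ιMulti, OrthonormalBasis.abs_det_eq_gramVol]
  exact gramVol_le_prod_norm v

theorem abs_volForm_ιMulti_le_one {n : ℕ} {v : Fin n → EucSp n} (hv : ∀ i, ‖v i‖ ≤ 1) :
    |volForm n (exteriorPower.ιMulti ℝ n v)| ≤ 1 :=
  (abs_volForm_ιMulti_le v).trans (Finset.prod_le_one (fun _ _ => norm_nonneg _) fun i _ => hv i)

variable {n : ℕ} {U X : Set (EucSp n)}

/-- The chain `∫_X (p; e₁ ∧ ⋯ ∧ eₙ) dμ`. -/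
noncomputable def massChain (U : Set (EucSp n)) (μ : Measure (EucSp n)) : DiffChain U n 1 :=
  ∫ p, kElement U 1 p (volVec n) ∂μ

/-- The difference of two points with the same `n`-vector is a first-order difference chain; this is
why class `B¹` sees moving masses continuously. -/
theorem lipschitz_kElement_volVec (hUc : Convex ℝ U) {p q : EucSp n} (hp : p ∈ U) (hq : q ∈ U) :
    ‖kElement U 1 q (volVec n) - kElement U 1 p (volVec n)‖ ≤ ‖q - p‖ := by
  have h := ((hasDiffBound_univForm hUc n 1).eval
    (v := EuclideanSpace.basisFun (Fin n) ℝ) fun i => by simp).lipschitz le_rfl hp hq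
  rwa [one_mul] at h

theorem norm_kElement_volVec_le (p : EucSp n) : ‖kElement U 1 p (volVec n)‖ ≤ 1 :=
  (norm_kElementL_le U n 1 p (volVec n)).trans (kvMass_ιMulti_le_one fun i => by simp)

theorem integrableOn_kElement_volVec (hUc : Convex ℝ U) (hX : IsCompact X) (hXU : X ⊆ U)
    {μ : Measure (EucSp n)} (hμ : μ X < ⊤) :
    IntegrableOn (fun p => kElement U 1 p (volVec n)) X μ := by
  have hc : ContinuousOn (fun p => kElement U 1 p (volVec n)) X := by
    refine LipschitzOnWith.continuousOn (K := 1) (LipschitzOnWith.of_dist_le_mul ?_)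
    intro p hp q hq
    rw [dist_eq_norm, dist_eq_norm, NNReal.coe_one, one_mul]
    exact lipschitz_kElement_volVec hUc (hXU hq) (hXU hp)
  exact IntegrableOn.of_bound hμ (hc.aestronglyMeasurable_of_isCompact hX hX.measurableSet) 1
    (.of_forall norm_kElement_volVec_le)

theorem hasDiffBound_smul_volForm {f : EucSp n → ℝ} {C : ℝ} (hf0 : ∀ p ∈ U, |f p| ≤ C)
    (hf : ∀ p ∈ U, ∀ q ∈ U, |f p - f q| ≤ C * ‖p - q‖) (v : Fin n → EucSp n)
    (hv : ∀ i, ‖v i‖ ≤ 1) :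
    HasDiffBound U 1 |C| fun p => (f p • volForm n) (exteriorPower.ιMulti ℝ n v) := by
  have h1 := abs_volForm_ιMulti_le_one hv
  refine hasDiffBound_of_bound_lipschitz (fun p hp => ?_) fun p hp q hq => ?_
  · rw [LinearMap.smul_apply, smul_eq_mul, Real.norm_eq_abs, abs_mul]
    exact (mul_le_of_le_one_right (abs_nonneg _) h1).trans ((hf0 p hp).trans (le_abs_self C))
  · rw [LinearMap.smul_apply, LinearMap.smul_apply, smul_eq_mul, smul_eq_mul, ← sub_mul,
      Real.norm_eq_abs, abs_mul]
    exact (mul_le_of_le_one_right (abs_nonneg _) h1).trans ((hf p hp q hq).trans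
      (mul_le_mul_of_nonneg_right (le_abs_self C) (norm_nonneg _)))

theorem chainIntegral_massChain (hUc : Convex ℝ U) (hX : IsCompact X) (hXU : X ⊆ U)
    {μ : Measure (EucSp n)} (hμ : μ X < ⊤) {w : EucSp n → (⋀[ℝ]^n (EucSp n)) →ₗ[ℝ] ℝ} {C : ℝ}
    (hC : 0 ≤ C) (hw : ∀ v : Fin n → EucSp n, (∀ i, ‖v i‖ ≤ 1) →
      HasDiffBound U 1 C fun p => w p (exteriorPower.ιMulti ℝ n v)) :
    chainIntegral w (massChain U (μ.restrict X)) = ∫ p in X, w p (volVec n) ∂μ := by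
  obtain ⟨T, hT, hT'⟩ := exists_chainIntegral hC hw
  rw [hT, massChain, ← T.integral_comp_comm (integrableOn_kElement_volVec hUc hX hXU hμ)]
  exact setIntegral_congr_fun hX.measurableSet fun p hp => hT' p (hXU hp) _

/-- Averages of a function with values in a closed convex set stay in it. Here the set is the
closure of the convex cone of positive Dirac chains, and the mass rescales the average. -/
theorem isPositiveChain_massChain (hUc : Convex ℝ U) (hX : IsCompact X) (hXU : X ⊆ U)
    {μ : Measure (EucSp n)} (hμ : μ X < ⊤) : IsPositiveChain (massChain U (μ.restrict X)) := by
  let K : Set (DiffChain U n 1) := {K | ∃ A : DiracChain U n 1, (∀ p, 0 ≤ volForm n (A.coeff p)) ∧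
    K = (A : DiffChain U n 1)}
  have hsmul : ∀ c : ℝ, 0 ≤ c → ∀ x ∈ K, c • x ∈ K := by
    rintro c hc _ ⟨A, hA, rfl⟩
    refine ⟨c • A, fun p => ?_, (UniformSpace.Completion.coe_smul c A).symm⟩
    rw [map_smul, Finsupp.smul_apply, map_smul]
    exact mul_nonneg hc (hA p)
  have hadd : ∀ x ∈ K, ∀ y ∈ K, x + y ∈ K := by
    rintro _ ⟨A, hA, rfl⟩ _ ⟨B, hB, rfl⟩
    refine ⟨A + B, fun p => ?_, (UniformSpace.Completion.coe_add A B).symm⟩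
    rw [map_add, Finsupp.add_apply, map_add]
    exact add_nonneg (hA p) (hB p)
  have hconv : Convex ℝ K := fun x hx y hy a b ha hb _ =>
    hadd _ (hsmul a ha x hx) _ (hsmul b hb y hy)
  have hmem : ∀ p ∈ X, kElement U 1 p (volVec n) ∈ K := by
    intro p hp
    refine ⟨_, fun q => ?_, rfl⟩
    rw [DiracChain.coeff_ofCoeff]
    · rcases eq_or_ne q p with rfl | h
      · rw [Finsupp.single_eq_same, volForm_volVec]
        exact zero_le_one
      · rw [Finsupp.single_eq_of_ne h, map_zero]
    · intro x hx
      have := Finsupp.support_single_subset (Finset.mem_coe.1 hx)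
      rw [Finset.mem_singleton.1 this]
      exact hXU hp
  change massChain U (μ.restrict X) ∈ closure K
  have hint := integrableOn_kElement_volVec hUc hX hXU hμ
  rcases eq_or_ne (μ X) 0 with h0 | h0
  · rw [massChain, Measure.restrict_eq_zero.2 h0, integral_zero_measure]
    refine subset_closure ⟨0, fun p => ?_, UniformSpace.Completion.coe_zero.symm⟩
    simp
  · have h1 := hconv.closure.set_average_mem isClosed_closure h0 hμ.ne
      ((ae_restrict_iff' hX.measurableSet).2 (.of_forall fun p hp => subset_closure (hmem p hp)))
      hint
    rw [setAverage_eq] at h1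
    have h2 : ∀ c : ℝ, 0 ≤ c → ∀ x ∈ closure K, c • x ∈ closure K := fun c hc x hx =>
      map_mem_closure (continuous_const_smul c) hx (hsmul c hc)
    have h3 := h2 (μ.real X) measureReal_nonneg _ h1
    rwa [smul_smul, mul_inv_cancel₀, one_smul] at h3
    exact (ENNReal.toReal_pos h0 hμ.ne).ne'

theorem massChain_mem_positiveCone (hUc : Convex ℝ U) (hX : IsCompact X) (hXU : X ⊆ U)
    {μ : Measure (EucSp n)} (hμ : μ X < ⊤) : massChain U (μ.restrict X) ∈ positiveCone U := by
  -- A form concentrated in a ball disjoint from `X` integrates to zero, so the support lies in the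
  -- closed set `X`.
  refine ⟨isPositiveChain_massChain hUc hX hXU hμ, fun p hp => hXU ?_⟩
  by_contra hpX
  obtain ⟨ε, hε, hball⟩ := Metric.isOpen_iff.1 hX.isClosed.isOpen_compl p hpX
  obtain ⟨η, hη, hη0, hne⟩ := hp ε hε
  obtain ⟨C, hC, hC'⟩ := hη.exists_hasDiffBound
  apply hne
  rw [chainIntegral_massChain hUc hX hXU hμ hC hC']
  refine setIntegral_eq_zero_of_forall_eq_zero fun x hx => ?_
  rw [hη0 x (hXU hx) fun h => hball h hx, LinearMap.zero_apply]

theorem isMeasureOf_massChain (hUo : IsOpen U) (hUc : Convex ℝ U) (hX : IsCompact X) (hXU : X ⊆ U)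
    {μ : Measure (EucSp n)} (hμ : μ X < ⊤) :
    IsMeasureOf (massChain U (μ.restrict X)) (μ.restrict X) := by
  refine ⟨⟨by simpa using hμ⟩, ?_, fun f ⟨C, hf0, hf⟩ => ?_⟩
  · rw [Measure.restrict_apply hUo.measurableSet.compl]
    have : Uᶜ ∩ X = ∅ := by
      ext x
      simpa using fun h h' => h (hXU h')
    rw [this, measure_empty]
  · rw [chainIntegral_massChain hUc hX hXU hμ (abs_nonneg C) (hasDiffBound_smul_volForm hf0 hf),
      Measure.restrict_restrict hUo.measurableSet, inter_eq_self_of_subset_right hXU]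
    simp [volForm_volVec]

theorem exists_chainIntegral_volForm (U : Set (EucSp n)) (r : ℕ) :
    ∃ T : DiffChain U n r →L[ℝ] ℝ, (∀ J, chainIntegral (fun _ => volForm n) J = T J) ∧
      ∀ p ∈ U, ∀ α, T (kElement U r p α) = volForm n α :=
  exists_chainIntegral zero_le_one fun v hv =>
    (hasDiffBound_const (volForm n (exteriorPower.ιMulti ℝ n v))).mono le_rfl
      (abs_volForm_ιMulti_le_one hv)

theorem chainIntegral_linking_massChain (hUc : Convex ℝ U) (hX : IsCompact X) (hXU : X ⊆ U)
    {μ : Measure (EucSp n)} (hμ : μ X < ⊤) :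
    chainIntegral (fun _ => volForm n) (linking 1 2 (massChain U (μ.restrict X))) =
      (μ X).toReal := by
  obtain ⟨T, hT, hT'⟩ := exists_chainIntegral_volForm U 2
  obtain ⟨L, hL, hL'⟩ := exists_linking U hUc n one_le_two
  rw [hT, hL, massChain]
  have h := (T ∘L L).integral_comp_comm (integrableOn_kElement_volVec hUc hX hXU hμ)
  refine h.symm.trans ?_
  have h1 : ∫ p in X, (T ∘L L) (kElement U 1 p (volVec n)) ∂μ = ∫ p in X, (1 : ℝ) ∂μ := by
    refine setIntegral_congr_fun hX.measurableSet fun p hp => ?_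
    have h2 := hL' p (hXU hp) (EuclideanSpace.basisFun (Fin n) ℝ)
    rw [univForm_apply, univForm_apply] at h2
    change T (L _) = 1
    rw [volVec, h2, hT' p (hXU hp)]
    exact volForm_volVec n
  rw [h1]
  simp [Measure.real]

/-- Mass chains of bounded mass form a relatively compact set. -/
theorem exists_isCompact_massChain (hUc : Convex ℝ U) (hUb : Bornology.IsBounded U) (c : ℝ) :
    ∃ K : Set (DiffChain U n 1), IsCompact K ∧ ∀ (μ : Measure (EucSp n)) (X : Set (EucSp n)),
      IsCompact X → X ⊆ U → μ X < ⊤ → (μ X).toReal ≤ c → massChain U (μ.restrict X) ∈ K := by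
  let E : Set (DiffChain U n 1) := (fun p => kElement U 1 p (volVec n)) '' U
  have hE : TotallyBounded E := by
    have hu : TotallyBounded (univ : Set U) := by
      rw [← totallyBounded_image_iff (isUniformInducing_val U), image_univ, Subtype.range_coe]
      exact (Bornology.IsBounded.isCompact_closure hUb).totallyBounded.subset subset_closure
    have hlip : LipschitzWith 1 fun p : U => kElement U 1 (p : EucSp n) (volVec n) := by
      refine LipschitzWith.of_dist_le_mul fun p q => ?_
      rw [dist_eq_norm, NNReal.coe_one, one_mul, Subtype.dist_eq, dist_eq_norm]
      exact lipschitz_kElement_volVec hUc q.2 p.2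
    have h1 := hu.image hlip.uniformContinuous
    rwa [image_univ, show range (fun p : U => kElement U 1 (p : EucSp n) (volVec n)) = E by
      ext x; simp [E]] at h1
  -- Mazur: in a Banach space the closed absolutely convex hull of a totally bounded set is compact.
  -- It contains every average of `E`, and a mass chain is an average scaled by a mass in `[0, c]`.
  -- The point `0` is inserted for the null measure, which has no average.
  let Q := closedAbsConvexHull ℝ E
  have hQ : IsCompact Q := isCompact_closedAbsConvexHull_of_totallyBounded hE
  refine ⟨insert 0 ((fun x : ℝ × DiffChain U n 1 => x.1 • x.2) '' (Icc 0 c ×ˢ Q)),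
    ((isCompact_Icc.prod hQ).image continuous_smul).insert 0, fun μ X hX hXU hμ hc => ?_⟩
  rcases eq_or_ne (μ X) 0 with h0 | h0
  · rw [massChain, Measure.restrict_eq_zero.2 h0, integral_zero_measure]
    exact mem_insert _ _
  · have h1 := absConvex_convexClosedHull.2.set_average_mem isClosed_closedAbsConvexHull h0 hμ.ne
      ((ae_restrict_iff' hX.measurableSet).2 (.of_forall fun p hp =>
        subset_closedAbsConvexHull (show kElement U 1 p (volVec n) ∈ E from ⟨p, hXU hp, rfl⟩)))
      (integrableOn_kElement_volVec hUc hX hXU hμ)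
    refine mem_insert_of_mem _ ⟨(μ.real X, _), ⟨⟨measureReal_nonneg, hc⟩, h1⟩, ?_⟩
    change μ.real X • ⨍ p in X, kElement U 1 p (volVec n) ∂μ = _
    rw [setAverage_eq, smul_smul, mul_inv_cancel₀, one_smul, massChain]
    exact (ENNReal.toReal_pos h0 hμ.ne).ne'

end MassChains

/-! ### Film chains with a given cone, and the minimizing sequence -/

section FilmChains

/-- The film chain built below adds the class `1` chain `Z` to boundaries, which have class `2`, so
boundary and cone must commute with the linking maps. -/
theorem chainBoundary_linking {V : Type*} [NormedAddCommGroup V] [InnerProductSpace ℝ V]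
    [FiniteDimensional ℝ V] {U : Set V} (hUo : IsOpen U) (hUc : Convex ℝ U) {k : ℕ}
    (J : DiffChain U (k + 1) 1) :
    chainBoundary (linking 1 2 J) = (linking 2 3 (chainBoundary J) : DiffChain U k 3) := by
  obtain ⟨S, hS, hS'⟩ := exists_chainBoundary (k := k) hUo hUc (le_refl 1)
  obtain ⟨T, hT, hT'⟩ := exists_chainBoundary (k := k) hUo hUc one_le_two
  obtain ⟨L, hL, hL'⟩ := exists_linking U hUc (k + 1) one_le_two
  obtain ⟨L₂, hL₂, hL₂'⟩ := exists_linking U hUc k (r := 2) (s := 3) (by norm_num)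
  have h : T ∘L L = L₂ ∘L S := by
    refine diffChain_hom_ext fun p hp v => ?_
    rw [ContinuousLinearMap.comp_apply, ContinuousLinearMap.comp_apply, hL' p hp, hT' p hp,
      hS' p hp, L₂.map_extDeriv
      ((hasDiffBound_univForm hUc k 2).differentiableAt hUo hUc le_rfl hp)]
    have h1 : (fun p => L₂.compContinuousAlternatingMap (univForm U k 2 p)) =ᶠ[𝓝 p]
        univForm U k 3 := by
      filter_upwards [hUo.mem_nhds hp] with x hx
      ext w
      exact hL₂' x hx w
    exact (congrArg (fun φ => φ v) h1.extDeriv_eq).symm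
  rw [hT, hL, hS, hL₂]
  exact congrArg (fun f : DiffChain U (k + 1) 1 →L[ℝ] DiffChain U k 3 => f J) h

theorem coneOperator_linking {V : Type*} [NormedAddCommGroup V] [InnerProductSpace ℝ V]
    {U : Set V} (hUo : IsOpen U) (hUc : Convex ℝ U) {k : ℕ} {F : ℝ → V → V}
    (hFb : SmoothBoundedOn (fun x : WithLp 2 (ℝ × V) => F x.fst x.snd) (openCylinder U))
    (hFU : ∀ t ∈ Icc (0 : ℝ) 1, ∀ p ∈ U, F t p ∈ U) (J : DiffChain U k 1) :
    coneOperator F (linking 1 2 J : DiffChain U k 2) = linking 1 2 (coneOperator F J) := by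
  obtain ⟨S, hS, hS'⟩ := exists_coneOperator (k := k) hUo hUc (le_refl 1) one_le_two hFb hFU
  obtain ⟨T, hT, hT'⟩ := exists_coneOperator (k := k) hUo hUc one_le_two (le_refl 2) hFb hFU
  obtain ⟨L, hL, hL'⟩ := exists_linking U hUc k one_le_two
  obtain ⟨L₂, hL₂, hL₂'⟩ := exists_linking U hUc (k + 1) one_le_two
  obtain ⟨P, hP, hP'⟩ := exists_pushforward (k := k + 1) (isOpen_openCylinder hUo)
    (convex_openCylinder hUc) hUo hUc (le_refl 1) one_le_two hFb
    fun x hx => hFU _ (Ioo_subset_Icc_self hx.1) _ hx.2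
  have h : T ∘L L = L₂ ∘L S := by
    refine diffChain_hom_ext fun p hp v => ?_
    rw [ContinuousLinearMap.comp_apply, ContinuousLinearMap.comp_apply, hL' p hp, hT' p hp,
      hS' p hp]
    have hint : IntegrableOn (fun t : ℝ =>
        (univForm U (k + 1) 1 (F t p)).compContinuousLinearMap
          (fderiv ℝ (fun x : WithLp 2 (ℝ × V) => F x.fst x.snd) (WithLp.toLp 2 (t, p)))
          (Fin.cons (cylUnit V) fun i => cylInr V (v i))) (Ioo 0 1) := by
      have h1 := P.integrable_comp (integrableOn_cyl_kElement hUc (le_refl 1) p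
        (exteriorPower.ιMulti ℝ (k + 1) (Fin.cons (cylUnit V) fun i => cylInr V (v i))))
      refine (integrableOn_congr_fun (fun t ht => ?_) measurableSet_Ioo).1 h1
      exact hP' (WithLp.toLp 2 (t, p)) ⟨ht, hp⟩ _
    refine Eq.trans ?_ (L₂.integral_comp_comm hint)
    refine setIntegral_congr_fun measurableSet_Ioo fun t ht => ?_
    exact (hL₂' _ (hFU t (Ioo_subset_Icc_self ht) p hp) _).symm
  rw [hT, hL, hS, hL₂]
  exact congrArg (fun f : DiffChain U k 1 →L[ℝ] DiffChain U (k + 1) 2 => f J) h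

variable {m : ℕ}

/-- The heart of the argument: `∂M̃ = 0` makes the prescribed boundary exact, `κ∂ = -1` solves `κ S
= J` for arbitrary `J`, and compactness of the mass chains yields the limit. -/
theorem exists_minimizer_of_boundary_eq_zero
    (M U : Set (EucSp (m + 3))) (τ : EucSp (m + 3) → ⋀[ℝ]^(m + 1) (EucSp (m + 3)))
    (Y : EucSp (m + 3) → EucSp (m + 3)) (F : ℝ → EucSp (m + 3) → EucSp (m + 3))
    (q : EucSp (m + 3))
    (hUo : IsOpen U) (hUc : Convex ℝ U) (hUb : Bornology.IsBounded U)
    (hY : SmoothBoundedOn Y U)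
    (hFU : ∀ t ∈ Set.Icc (0 : ℝ) 1, ∀ p ∈ U, F t p ∈ U)
    (hF0 : ∀ p ∈ U, F 0 p = p) (hF1 : ∀ p ∈ U, F 1 p = q)
    (hFs : ContDiffOn ℝ ∞ (Function.uncurry F) (Set.Icc (0 : ℝ) 1 ×ˢ U))
    (hFb : SmoothBoundedOn (fun x : WithLp 2 (ℝ × EucSp (m + 3)) => F x.fst x.snd)
      (openCylinder U))
    (hbd : chainBoundary (submanifoldChain U M τ) = (0 : DiffChain U m 2))
    (hex : ∃ X ∈ spanningSets M τ U, (sphericalHausdorff (m + 2) : Measure (EucSp (m + 3))) X ≤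
      ENNReal.ofReal (areaBound M U)) :
    ∃ S₀ ∈ filmClosure M τ U Y F,
      ((chainArea F S₀ : ℝ) : EReal) = ((minimalSize M τ U : ℝ≥0∞) : EReal) := by
  set σ : Measure (EucSp (m + 3)) := sphericalHausdorff (m + 2) with hσ
  obtain ⟨D, hD, hYD, -⟩ := hY.exists_hasDiffBound hUo hUc
  obtain ⟨Ext, hExt, -⟩ := exists_extrusion (k := m + 1) (r := 1) hUc one_le_two hD hYD
  obtain ⟨Ext₂, hExt₂, -⟩ := exists_extrusion (k := m) (r := 2) hUc le_rfl hD hYD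
  obtain ⟨L, hL, -⟩ := exists_linking U hUc (m + 3) one_le_two
  obtain ⟨L', hL', -⟩ := exists_linking U hUc (m + 2) one_le_two
  obtain ⟨B, hB, -⟩ := exists_chainBoundary (k := m + 2) hUo hUc (le_refl 1)
  obtain ⟨B₂, hB₂, -⟩ := exists_chainBoundary (k := m + 1) hUo hUc one_le_two
  obtain ⟨K, hK, -⟩ := exists_coneOperator (k := m + 2) hUo hUc one_le_two (le_refl 2) hFb hFU
  obtain ⟨T, hT, -⟩ := exists_chainIntegral_volForm U (n := m + 3) 2
  set Z : DiffChain U (m + 2) 1 := extrusion Y (submanifoldChain U M τ) with hZ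
  set Q : DiffChain U (m + 3) 1 := coneOperator F Z with hQ
  have hpre : prederivative Y (submanifoldChain U M τ) = chainBoundary Z := by
    rw [prederivative, hbd, hExt₂, map_zero, zero_add]
  have hfin : finrank ℝ (EucSp (m + 3)) = (m + 2) + 1 := by simp
  have hKB : ∀ J : DiffChain U (m + 3) 1, K (B J) = -L J := by
    intro J
    rw [← hB, ← hK, ← hL]
    exact coneOperator_chainBoundary hUo hUc hfin hFU hF0 hF1 hFs hFb J
  have hBB : ∀ J : DiffChain U (m + 3) 1, B₂ (B J) = 0 := by
    intro J
    rw [← hB, ← hB₂]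
    exact chainBoundary_chainBoundary hUo hUc J
  -- `Z` has the right boundary but cone `Q`. Adding `∂Q` cancels this cone and subtracting `∂J`
  -- installs `J`; neither changes the boundary.
  let S : DiffChain U (m + 3) 1 → DiffChain U (m + 2) 2 := fun J => L' Z + B Q - B J
  have hKS : ∀ J, K (S J) = L J := by
    intro J
    change K (L' Z + B Q - B J) = _
    rw [map_sub, map_add, hKB, hKB, ← hL', ← hK, coneOperator_linking hUo hUc hFb hFU, hL]
    abel
  have hBS : ∀ J, B₂ (S J) = linking 2 3 (prederivative Y (submanifoldChain U M τ)) := by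
    intro J
    change B₂ (L' Z + B Q - B J) = _
    rw [map_sub, map_add, hBB, hBB, add_zero, sub_zero, ← hL', ← hB₂,
      chainBoundary_linking hUo hUc, hpre]
  have harea : ∀ J, chainArea F (S J) = T (L J) := by
    intro J
    rw [chainArea, hT, hK, hKS]
  have hfilm : ∀ X ∈ spanningSets M τ U, S (massChain U (σ.restrict X)) ∈ filmChains M τ U Y F := by
    rintro X hXs
    obtain ⟨hX, hXU, -, hXσ, -⟩ := id hXs
    refine ⟨by rw [hB₂, hBS], massChain U (σ.restrict X),
      massChain_mem_positiveCone hUc hX hXU hXσ, ?_, X, hXs,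
      isMeasureOf_massChain hUo hUc hX hXU hXσ⟩
    rw [hK, hKS, hL]
  have harea' : ∀ X ∈ spanningSets M τ U, T (L (massChain U (σ.restrict X))) = (σ X).toReal := by
    rintro X ⟨hX, hXU, -, hXσ, -⟩
    rw [← hL, ← hT]
    exact chainIntegral_linking_massChain hUc hX hXU hXσ
  obtain ⟨X₀, hX₀, hX₀c⟩ := hex
  have hmle : ∀ X ∈ spanningSets M τ U, minimalSize M τ U ≤ σ X := fun X hX => iInf₂_le X hX
  -- Every member is kept below `X₀`, and not only close to the infimum: this gives the area bound
  -- `c₀` for all indices and one compact set for the whole sequence.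
  have hmin : ∀ i : ℕ, ∃ X ∈ spanningSets M τ U, σ X ≤ σ X₀ ∧
      (σ X).toReal ≤ (minimalSize M τ U).toReal + 1 / (i + 1) := by
    intro i
    have hpos : (0 : ℝ) < 1 / (i + 1) := by positivity
    rcases (hmle X₀ hX₀).eq_or_lt with h | h
    · exact ⟨X₀, hX₀, le_rfl, by rw [h]; linarith⟩
    · have hmfin : minimalSize M τ U ≠ ⊤ := h.ne_top
      have h1 : minimalSize M τ U <
          min (σ X₀) (minimalSize M τ U + ENNReal.ofReal (1 / (i + 1))) := by
        refine lt_min h (ENNReal.lt_add_right hmfin ?_)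
        simpa using hpos
      nth_rewrite 1 [minimalSize] at h1
      obtain ⟨X, h1⟩ := iInf_lt_iff.1 h1
      obtain ⟨hX, hlt⟩ := iInf_lt_iff.1 h1
      refine ⟨X, hX, (hlt.trans_le (min_le_left _ _)).le, ?_⟩
      have h2 := (hlt.trans_le (min_le_right _ _)).le
      have h3 := ENNReal.toReal_mono (ENNReal.add_ne_top.2 ⟨hmfin, ENNReal.ofReal_ne_top⟩) h2
      rwa [ENNReal.toReal_add hmfin ENNReal.ofReal_ne_top, ENNReal.toReal_ofReal hpos.le] at h3
  choose X hX hXle hXm using hmin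
  have hX₀fin : σ X₀ ≠ ⊤ := hX₀.2.2.2.1.ne
  obtain ⟨C, hC, hCmem⟩ := exists_isCompact_massChain (n := m + 3) hUc hUb (σ X₀).toReal
  have hmem : ∀ i, massChain U (σ.restrict (X i)) ∈ C := fun i =>
    hCmem σ (X i) (hX i).1 (hX i).2.1 (hX i).2.2.2.1
      (ENNReal.toReal_mono hX₀fin (hXle i))
  obtain ⟨J, -, φ, hφ, hlim⟩ := hC.tendsto_subseq hmem
  have hScont : Continuous S := by
    have : Continuous fun J => B J := B.continuous
    fun_prop
  have hlim' : Tendsto (fun i => (σ (X (φ i))).toReal) atTop (𝓝 (T (L J))) := by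
    have h1 := ((T.continuous.comp L.continuous).tendsto J).comp hlim
    refine h1.congr fun i => ?_
    exact harea' _ (hX (φ i))
  have hmfin : minimalSize M τ U ≠ ⊤ := ne_top_of_le_ne_top hX₀fin (hmle X₀ hX₀)
  have hlim'' : Tendsto (fun i => (σ (X (φ i))).toReal) atTop (𝓝 (minimalSize M τ U).toReal) := by
    have h0 : Tendsto (fun i : ℕ => (minimalSize M τ U).toReal + 1 / ((i : ℝ) + 1)) atTop
        (𝓝 ((minimalSize M τ U).toReal + 0)) :=
      tendsto_const_nhds.add tendsto_one_div_add_atTop_nhds_zero_nat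
    rw [add_zero] at h0
    refine tendsto_of_tendsto_of_tendsto_of_le_of_le tendsto_const_nhds
      (h0.comp hφ.tendsto_atTop) (fun i => ?_) fun i => hXm (φ i)
    exact ENNReal.toReal_mono (hX (φ i)).2.2.2.1.ne (hmle _ (hX (φ i)))
  refine ⟨S J, ⟨fun i => S (massChain U (σ.restrict (X (φ i)))), fun i => hfilm _ (hX _), fun i => ?_,
    (hScont.tendsto J).comp hlim⟩, ?_⟩
  · rw [harea, harea' _ (hX _)]
    refine ENNReal.toReal_le_of_le_ofReal ?_ ((hXle _).trans hX₀c)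
    exact mul_nonneg Metric.diam_nonneg ENNReal.toReal_nonneg
  · rw [harea, tendsto_nhds_unique hlim' hlim'', EReal.coe_ennreal_toReal hmfin]

end FilmChains

noncomputable section

/-! ### Steiner symmetrization and the isodiametric inequality -/

section Isodiametric

variable {ι : Type*} [Fintype ι] [DecidableEq ι]

/-- Length of the section of `A` through `x` in the `i`-th coordinate direction. -/
def sectionLength (A : Set (ι → ℝ)) (i : ι) (x : ι → ℝ) : ℝ≥0∞ :=
  volume {t : ℝ | Function.update x i t ∈ A}

/-- Steiner symmetrization in the `i`-th coordinate direction. -/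
def steiner (A : Set (ι → ℝ)) (i : ι) : Set (ι → ℝ) :=
  {x | ENNReal.ofReal (2 * |x i|) < sectionLength A i x}

theorem measurableSet_section {A : Set (ι → ℝ)} (hA : MeasurableSet A) (i : ι) (x : ι → ℝ) :
    MeasurableSet {t : ℝ | Function.update x i t ∈ A} :=
  (measurable_update x (a := i)) hA

theorem sectionLength_eq_lmarginal {A : Set (ι → ℝ)} (hA : MeasurableSet A) (i : ι) :
    sectionLength A i =
      ∫⋯∫⁻_{i}, A.indicator 1 ∂(fun _ : ι => (volume : Measure ℝ)) := by
  rw [lmarginal_singleton]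
  funext x
  rw [sectionLength, ← lintegral_indicator_one (measurableSet_section hA i x)]
  rfl

theorem measurable_sectionLength {A : Set (ι → ℝ)} (hA : MeasurableSet A) (i : ι) :
    Measurable (sectionLength A i) := by
  rw [sectionLength_eq_lmarginal hA]
  exact (measurable_one.indicator hA).lmarginal _

theorem measurableSet_steiner {A : Set (ι → ℝ)} (hA : MeasurableSet A) (i : ι) :
    MeasurableSet (steiner A i) := by
  refine measurableSet_lt ?_ (measurable_sectionLength hA i)
  fun_prop

theorem sectionLength_update (A : Set (ι → ℝ)) (i : ι) (x : ι → ℝ) (t : ℝ) :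
    sectionLength A i (Function.update x i t) = sectionLength A i x := by
  simp [sectionLength]

theorem volume_setOf_two_mul_abs_lt (c : ℝ≥0∞) :
    volume {t : ℝ | ENNReal.ofReal (2 * |t|) < c} = c := by
  induction c with
  | top => simp [ENNReal.ofReal_lt_top, -ENNReal.ofReal_mul]
  | coe c =>
    have : {t : ℝ | ENNReal.ofReal (2 * |t|) < c} = Ioo (-(c / 2 : ℝ)) (c / 2) := by
      ext t
      rw [mem_setOf_eq, ← ENNReal.ofReal_coe_nnreal, ENNReal.ofReal_lt_ofReal_iff_of_nonneg
        (by positivity), mem_Ioo, ← abs_lt, lt_div_iff₀ two_pos, mul_comm]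
    rw [this, Real.volume_Ioo]
    simp

/-- Fubini: the symmetrized set has sections of the same length. -/
theorem volume_steiner {A : Set (ι → ℝ)} (hA : MeasurableSet A) (i : ι) :
    volume (steiner A i) = volume A := by
  rw [← lintegral_indicator_one (measurableSet_steiner hA i), ← lintegral_indicator_one hA]
  refine lintegral_eq_of_lmarginal_eq {i} (measurable_one.indicator (measurableSet_steiner hA i))
    (measurable_one.indicator hA) ?_
  rw [← sectionLength_eq_lmarginal hA, ← sectionLength_eq_lmarginal (measurableSet_steiner hA i)]
  funext x
  conv_rhs => rw [← volume_setOf_two_mul_abs_lt (sectionLength A i x)]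
  simp [sectionLength, steiner]

/-- Otherwise both `sup S - inf T` and `sup T - inf S` are at most `c = |a - b|`, so the two lengths
add up to at most `2 c ≤ 2 |a| + 2 |b|`, contradicting the strict bounds. -/
theorem exists_abs_sub_ge_of_volume_lt {S T : Set ℝ} {a b : ℝ} 
    (hS : ENNReal.ofReal (2 * |a|) < volume S) (hT : ENNReal.ofReal (2 * |b|) < volume T) :
    ∃ s ∈ S, ∃ t ∈ T, |a - b| ≤ |s - t| := by
  by_contra! h
  obtain ⟨s₀, hs₀⟩ : S.Nonempty := nonempty_of_measure_ne_zero (ne_bot_of_gt hS)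
  obtain ⟨t₀, ht₀⟩ : T.Nonempty := nonempty_of_measure_ne_zero (ne_bot_of_gt hT)
  set c := |a - b|
  have hc : c ≤ |a| + |b| := abs_sub _ _
  have hSb : BddAbove S ∧ BddBelow S :=
    ⟨⟨t₀ + c, fun s hs => by have := abs_lt.1 (h s hs t₀ ht₀); linarith⟩,
      ⟨t₀ - c, fun s hs => by have := abs_lt.1 (h s hs t₀ ht₀); linarith⟩⟩
  have hTb : BddAbove T ∧ BddBelow T :=
    ⟨⟨s₀ + c, fun s hs => by have := abs_lt.1 (h s₀ hs₀ s hs); linarith⟩,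
      ⟨s₀ - c, fun s hs => by have := abs_lt.1 (h s₀ hs₀ s hs); linarith⟩⟩
  have hvol : ∀ {S : Set ℝ} {a : ℝ}, BddAbove S ∧ BddBelow S → ENNReal.ofReal (2 * |a|) < volume S →
      2 * |a| < sSup S - sInf S := by
    intro S a hb ha
    have h1 : volume S ≤ ENNReal.ofReal (sSup S - sInf S) := by
      rw [← Real.volume_Icc]
      exact measure_mono fun s hs => ⟨csInf_le hb.2 hs, le_csSup hb.1 hs⟩
    exact (ENNReal.ofReal_lt_ofReal_iff_of_nonneg (by positivity)).1 (ha.trans_le h1)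
  have h1 := hvol hSb hS
  have h2 := hvol hTb hT
  have h3 : sSup S ≤ sInf T + c := by
    refine csSup_le ⟨s₀, hs₀⟩ fun s hs => ?_
    rw [← sub_le_iff_le_add]
    refine le_csInf ⟨t₀, ht₀⟩ fun t ht => ?_
    have := abs_lt.1 (h s hs t ht); linarith
  have h4 : sSup T ≤ sInf S + c := by
    refine csSup_le ⟨t₀, ht₀⟩ fun t ht => ?_
    rw [← sub_le_iff_le_add]
    refine le_csInf ⟨s₀, hs₀⟩ fun s hs => ?_
    have := abs_lt.1 (h s hs t ht); linarith
  linarith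

/-- Symmetrization does not increase the diameter: the `i`-th coordinates of two points can be
exchanged for points of the original sections that are at least as far apart. -/
theorem sum_sq_sub_le_of_mem_steiner {A : Set (ι → ℝ)} {D : ℝ}
    (hA : ∀ x ∈ A, ∀ y ∈ A, ∑ j, (x j - y j) ^ 2 ≤ D) (i : ι) :
    ∀ x ∈ steiner A i, ∀ y ∈ steiner A i, ∑ j, (x j - y j) ^ 2 ≤ D := by
  intro x hx y hy
  obtain ⟨s, hs, t, ht, hst⟩ := exists_abs_sub_ge_of_volume_lt hx hy
  refine le_trans (Finset.sum_le_sum fun j _ => ?_) (hA _ hs _ ht)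
  rcases eq_or_ne j i with rfl | hj
  · simpa using sq_le_sq.2 hst
  · simp [hj]

/-- Reflection in the `j`-th coordinate. -/
def reflectCoord (j : ι) (x : ι → ℝ) : ι → ℝ := Function.update x j (-x j)

theorem reflectCoord_mem_steiner_self {A : Set (ι → ℝ)} {i : ι} {x : ι → ℝ}
    (hx : x ∈ steiner A i) : reflectCoord i x ∈ steiner A i := by
  simpa [steiner, reflectCoord, sectionLength_update] using hx

/-- Symmetrizing in another direction preserves a symmetry already gained, since a reflection maps
sections to sections of at least the same length. -/
theorem reflectCoord_mem_steiner {A : Set (ι → ℝ)} {i j : ι}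
    (hA : ∀ x ∈ A, reflectCoord j x ∈ A) {x : ι → ℝ} (hx : x ∈ steiner A i) :
    reflectCoord j x ∈ steiner A i := by
  rcases eq_or_ne j i with rfl | hj
  · exact reflectCoord_mem_steiner_self hx
  · refine lt_of_lt_of_le (b := sectionLength A i x) (by
        simpa only [steiner, mem_setOf_eq, reflectCoord, Function.update_of_ne hj.symm] using hx)
      (measure_mono fun t ht => ?_)
    have := hA _ ht
    rw [reflectCoord, Function.update_of_ne hj, Function.update_comm hj.symm] at this
    exact this

theorem exists_symmetrization {A : Set (ι → ℝ)} (hA : MeasurableSet A) {D : ℝ}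
    (hD : ∀ x ∈ A, ∀ y ∈ A, ∑ j, (x j - y j) ^ 2 ≤ D) (s : Finset ι) :
    ∃ B : Set (ι → ℝ), MeasurableSet B ∧ volume B = volume A ∧
      (∀ x ∈ B, ∀ y ∈ B, ∑ j, (x j - y j) ^ 2 ≤ D) ∧
      ∀ j ∈ s, ∀ x ∈ B, reflectCoord j x ∈ B := by
  induction s using Finset.induction_on with
  | empty => exact ⟨A, hA, rfl, hD, by simp⟩
  | insert i s _ ih =>
    obtain ⟨B, hB, hv, hDB, hs⟩ := ih
    refine ⟨steiner B i, measurableSet_steiner hB i, (volume_steiner hB i).trans hv,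
      sum_sq_sub_le_of_mem_steiner hDB i, fun j hj x hx => ?_⟩
    rcases Finset.mem_insert.1 hj with rfl | hj
    · exact reflectCoord_mem_steiner_self hx
    · exact reflectCoord_mem_steiner (hs j hj) hx

theorem neg_mem_of_reflectCoord_mem {B : Set (ι → ℝ)} (hB : ∀ j, ∀ x ∈ B, reflectCoord j x ∈ B)
    {x : ι → ℝ} (hx : x ∈ B) : -x ∈ B := by
  have : ∀ s : Finset ι, (fun j => if j ∈ s then -x j else x j) ∈ B := by
    intro s
    induction s using Finset.induction_on with
    | empty => simpa using hx
    | insert i s hi ih =>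
      convert hB i _ ih using 1
      funext j
      rcases eq_or_ne j i with rfl | hj
      · simp [reflectCoord, hi]
      · simp [reflectCoord, hj]
  simpa [← Pi.neg_def] using this Finset.univ

end Isodiametric

/-- **Isodiametric inequality**. -/
theorem volume_le_unitBallVolume_mul_ediam {d : ℕ} (A : Set (EuclideanSpace ℝ (Fin d))) :
    volume A ≤ unitBallVolume d / 2 ^ d * Metric.ediam A ^ d := by
  rcases A.eq_empty_or_nonempty with rfl | hne
  · simp
  rcases Nat.eq_zero_or_pos d with rfl | hd
  · have : A ⊆ Metric.ball 0 1 := fun x _ => by simp [Subsingleton.elim x 0]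
    simpa [unitBallVolume] using measure_mono (μ := volume) this
  rcases eq_or_ne (Metric.ediam A) ⊤ with htop | hfin
  · have h0 : unitBallVolume d / 2 ^ d ≠ 0 := by
      refine (ENNReal.div_pos ?_ (by finiteness)).ne'
      exact (Metric.measure_ball_pos _ _ one_pos).ne'
    rw [htop, ENNReal.top_pow hd.ne', ENNReal.mul_top h0]
    exact le_top
  set r : ℝ := Metric.diam A with hr
  have hr0 : 0 ≤ r := Metric.diam_nonneg
  have hre : Metric.ediam A = ENNReal.ofReal r := by
    rw [hr, Metric.diam, ENNReal.ofReal_toReal hfin]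
  have hbdd : Bornology.IsBounded A := Metric.isBounded_iff_ediam_ne_top.2 hfin
  set T : (Fin d → ℝ) → EuclideanSpace ℝ (Fin d) := WithLp.toLp 2
  have hT : MeasurePreserving T := PiLp.volume_preserving_toLp (Fin d)
  have hsum : ∀ x y : Fin d → ℝ, ∑ j, (x j - y j) ^ 2 = dist (T x) (T y) ^ 2 := by
    intro x y
    rw [EuclideanSpace.dist_eq, Real.sq_sqrt (by positivity)]
    simp [T, Real.dist_eq]
  -- The closure is measurable and has the same diameter as `A`.
  obtain ⟨B, hB, hvol, hdist, hsym⟩ := exists_symmetrization (A := T ⁻¹' closure A)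
    (hT.measurable isClosed_closure.measurableSet) (D := r ^ 2) (by
      intro x hx y hy
      rw [hsum]
      have : dist (T x) (T y) ≤ Metric.diam (closure A) :=
        Metric.dist_le_diam_of_mem hbdd.closure hx hy
      rw [Metric.diam_closure] at this
      gcongr) Finset.univ
  -- After symmetrization in all coordinates `B = -B`, so `2 ‖x‖ = ‖x - (-x)‖ ≤ r`.
  have hsub : B ⊆ T ⁻¹' Metric.closedBall 0 (r / 2) := by
    intro x hx
    have h1 := hdist x hx (-x) (neg_mem_of_reflectCoord_mem (fun j => hsym j (Finset.mem_univ _)) hx)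
    rw [hsum] at h1
    have h2 : dist (T x) (T (-x)) = 2 * ‖T x‖ := by
      rw [dist_eq_norm, show T x - T (-x) = (2 : ℝ) • T x by
        ext j; simp [T]; ring, norm_smul]
      simp
    rw [h2] at h1
    have h4 := le_of_abs_le (abs_le_of_sq_le_sq h1 hr0)
    simp only [mem_preimage, Metric.mem_closedBall, dist_zero_right]
    linarith
  calc volume A ≤ volume (closure A) := measure_mono subset_closure
    _ = volume (T ⁻¹' closure A) :=
      (hT.measure_preimage isClosed_closure.measurableSet.nullMeasurableSet).symm
    _ = volume B := hvol.symm
    _ ≤ volume (T ⁻¹' Metric.closedBall 0 (r / 2)) := measure_mono hsub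
    _ = volume (Metric.closedBall (0 : EuclideanSpace ℝ (Fin d)) (r / 2)) :=
      hT.measure_preimage Metric.isClosed_closedBall.measurableSet.nullMeasurableSet
    _ = ENNReal.ofReal ((r / 2) ^ d) * unitBallVolume d := by
      rw [Measure.addHaar_closedBall _ _ (by positivity), finrank_euclideanSpace_fin]
      rfl
    _ = _ := by
      rw [hre, mul_comm, ENNReal.ofReal_pow (by positivity), ENNReal.ofReal_div_of_pos two_pos,
        ENNReal.ofReal_ofNat, ENNReal.div_eq_inv_mul, ENNReal.div_eq_inv_mul, mul_pow,
        ENNReal.inv_pow]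
      ring

theorem unitBallVolume_ne_zero (d : ℕ) : unitBallVolume d ≠ 0 :=
  (Metric.measure_ball_pos _ _ one_pos).ne'

theorem unitBallVolume_ne_top (d : ℕ) : unitBallVolume d ≠ ⊤ := measure_ball_lt_top.ne

/-! ### Normalizations of Hausdorff measure -/

section Comparison

open Measure

variable {X : Type*} [EMetricSpace X] [MeasurableSpace X] [BorelSpace X]

/-- The isodiametric inequality says that Lebesgue measure is at most `α_d 2⁻ᵈ` times Hausdorff
measure; evaluating both on the unit ball compares the constants. -/
theorem addHaarScalarFactor_le (d : ℕ) :
    (addHaarScalarFactor (volume : Measure (EuclideanSpace ℝ (Fin d))) μH[(d : ℝ)] : ℝ≥0∞) ≤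
      unitBallVolume d / 2 ^ d := by
  set c := unitBallVolume d / 2 ^ d with hc
  have hc0 : c ≠ 0 := (ENNReal.div_pos (unitBallVolume_ne_zero d) (by finiteness)).ne'
  have hct : c ≠ ⊤ := ENNReal.div_ne_top (unitBallVolume_ne_top d) (by positivity)
  have h1 : c⁻¹ • (volume : Measure (EuclideanSpace ℝ (Fin d))) ≤ μH[(d : ℝ)] := by
    refine le_hausdorffMeasure _ _ ⊤ (by simp) fun s _ => ?_
    rw [Measure.smul_apply, smul_eq_mul, ENNReal.rpow_natCast]
    refine (mul_le_mul_right (volume_le_unitBallVolume_mul_ediam s) _).trans_eq ?_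
    rw [← hc, ← mul_assoc, ENNReal.inv_mul_cancel hc0 hct, one_mul]
  set B : Set (EuclideanSpace ℝ (Fin d)) := Metric.ball 0 1
  have h2 := h1 B
  have h3 : (volume : Measure (EuclideanSpace ℝ (Fin d))) B =
      addHaarScalarFactor (volume : Measure (EuclideanSpace ℝ (Fin d))) μH[(d : ℝ)] *
        μH[(d : ℝ)] B := by
    conv_lhs => rw [← EuclideanSpace.euclideanHausdorffMeasure_eq_volume d]
    rfl
  have hB : (volume : Measure (EuclideanSpace ℝ (Fin d))) B ≠ 0 := unitBallVolume_ne_zero d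
  have hB' : (volume : Measure (EuclideanSpace ℝ (Fin d))) B ≠ ⊤ := unitBallVolume_ne_top d
  have hHt : (μH[(d : ℝ)] : Measure (EuclideanSpace ℝ (Fin d))) B ≠ ⊤ := measure_ball_lt_top.ne
  have hH0 : (μH[(d : ℝ)] : Measure (EuclideanSpace ℝ (Fin d))) B ≠ 0 := by
    intro h; rw [h, mul_zero] at h3; exact hB h3
  rw [Measure.smul_apply, smul_eq_mul, h3, ← mul_assoc] at h2
  have h4 := (ENNReal.mul_le_mul_iff_left hH0 hHt).1 (h2.trans_eq (one_mul _).symm)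
  rw [mul_comm, ← div_eq_mul_inv, ENNReal.div_le_iff hc0 hct, one_mul] at h4
  exact h4

theorem euclideanHausdorffMeasure_le_normHausdorff {X : Type*} [NormedAddCommGroup X]
    [InnerProductSpace ℝ X] [MeasurableSpace X] [BorelSpace X] (d : ℕ) (s : Set X) :
    (μHE[d] : Measure X) s ≤ (normHausdorff d : Measure X) s := by
  rw [euclideanHausdorffMeasure_def, normHausdorff, Measure.smul_apply, Measure.smul_apply,
    ENNReal.smul_def]
  exact mul_le_mul_left (addHaarScalarFactor_le d) _

/-- The area formula and Stokes are proved for `μHE`. Vanishing and finiteness pass to the other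
normalization whatever the positive finite constant is. -/
theorem exists_normHausdorff_eq_smul (X : Type*) [NormedAddCommGroup X]
    [InnerProductSpace ℝ X] [MeasurableSpace X] [BorelSpace X] (d : ℕ) :
    ∃ c : ℝ≥0∞, c ≠ 0 ∧ c ≠ ⊤ ∧ (normHausdorff d : Measure X) = c • μHE[d] := by
  have h0 := addHaarScalarFactor_volume_hausdorffMeasure_ne_zero d
  set a := addHaarScalarFactor (volume : Measure (EuclideanSpace ℝ (Fin d))) μH[d] with ha
  have ha0 : (a : ℝ≥0∞) ≠ 0 := by exact_mod_cast h0
  have hb0 : unitBallVolume d / 2 ^ d ≠ 0 :=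
    (ENNReal.div_pos (unitBallVolume_ne_zero d) (by finiteness)).ne'
  refine ⟨unitBallVolume d / 2 ^ d / a, (ENNReal.div_pos hb0 (by simp)).ne',
    ENNReal.div_ne_top (ENNReal.div_ne_top (unitBallVolume_ne_top d) (by positivity)) ha0, ?_⟩
  rw [euclideanHausdorffMeasure_def, normHausdorff, ← ha, ENNReal.smul_def, smul_smul,
    ENNReal.div_mul_cancel ha0 (by simp)]

end Comparison

end

noncomputable section

/-! ### From local to global domination of measures -/

section LocalToGlobal

variable {X : Type*} [TopologicalSpace X] [SecondCountableTopology X] [MeasurableSpace X]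
  [OpensMeasurableSpace X]

/-- A countably subadditive set function which is locally dominated by a measure is dominated by
it. -/
theorem le_measure_of_locally_le {Φ : Set X → ℝ≥0∞} {μ : Measure X} {K : Set X}
    (h0 : Φ ∅ = 0) (hΦ : ∀ s : ℕ → Set X, Φ (⋃ i, s i) ≤ ∑' i, Φ (s i))
    (hloc : ∀ x ∈ K, ∃ V ∈ 𝓝[K] x, ∀ E ⊆ V, MeasurableSet E → Φ E ≤ μ E)
    {E : Set X} (hEK : E ⊆ K) (hE : MeasurableSet E) : Φ E ≤ μ E := by
  have h1 : ∀ x : X, ∃ O : Set X, IsOpen O ∧ (x ∈ K → x ∈ O) ∧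
      ∀ F ⊆ O ∩ K, MeasurableSet F → Φ F ≤ μ F := by
    intro x
    by_cases hx : x ∈ K
    · obtain ⟨V, hV, h⟩ := hloc x hx
      obtain ⟨O, hO, hxO, hOV⟩ := mem_nhdsWithin.1 hV
      exact ⟨O, hO, fun _ => hxO, fun F hF => h F (hF.trans hOV)⟩
    · refine ⟨∅, isOpen_empty, fun h => absurd h hx, fun F hF _ => ?_⟩
      rw [show F = ∅ by simpa using hF, h0]
      exact zero_le
  choose O hO hxO hOF using h1
  obtain ⟨t, htK, htc, hcov⟩ := TopologicalSpace.countable_cover_nhdsWithin (s := K) (f := O)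
    fun x hx => mem_nhdsWithin_of_mem_nhds ((hO x).mem_nhds (hxO x hx))
  rcases t.eq_empty_or_nonempty with rfl | htn
  · rw [show E = ∅ from subset_empty_iff.1 (hEK.trans (by simpa using hcov)), h0]
    exact zero_le
  obtain ⟨x, rfl⟩ := htc.exists_eq_range htn
  -- Over disjoint pieces `μ` is additive, so subadditivity of `Φ` loses nothing.
  set D : ℕ → Set X := disjointed fun i => O (x i)
  have hD : ∀ i, MeasurableSet (D i) := MeasurableSet.disjointed fun i => (hO _).measurableSet
  have hEU : E = ⋃ i, E ∩ D i := by
    rw [← inter_iUnion, iUnion_disjointed, eq_comm, inter_eq_left]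
    intro y hy
    simpa using hcov (hEK hy)
  calc Φ E = Φ (⋃ i, E ∩ D i) := by rw [← hEU]
    _ ≤ ∑' i, Φ (E ∩ D i) := hΦ _
    _ ≤ ∑' i, μ (E ∩ D i) := ENNReal.tsum_le_tsum fun i =>
        hOF (x i) _ (fun y hy => ⟨disjointed_subset _ i hy.2, hEK hy.1⟩) (hE.inter (hD i))
    _ = μ E := by
      rw [← measure_iUnion (fun i j hij => ((disjoint_disjointed _) hij).mono inter_subset_right
        inter_subset_right) fun i => hE.inter (hD i), ← hEU]

end LocalToGlobal

/-! ### Upper bounds for spherical Hausdorff measure -/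

section Spherical

variable {E : Type*} [NormedAddCommGroup E] [InnerProductSpace ℝ E] [MeasurableSpace E]
  [BorelSpace E]

/-- Coverings by small balls bound the measure from above. `S` may fail to be measurable, so it is
first enlarged to the measurable set `⋂ T n`. Diameters at most `1 / (n + 1)` fit the scale `n⁻¹`
and avoid the real inverse of zero. -/
theorem sphericalHausdorff_le {k : ℕ} {S : Set E} {c : ℝ≥0∞} {ι : ℕ → Type*}
    [∀ n, Countable (ι n)] (x : ∀ n, ι n → E) (r : ∀ n, ι n → ℝ)
    (hr : ∀ n i, 0 ≤ r n i ∧ 2 * r n i ≤ ((n : ℝ) + 1)⁻¹)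
    (hS : ∀ n, S ⊆ ⋃ i, Metric.closedBall (x n i) (r n i))
    (hc : ∀ n, ∑' i, unitBallVolume k * ENNReal.ofReal (r n i) ^ k ≤ c) :
    sphericalHausdorff k S ≤ c := by
  set m : Set E → ℝ≥0∞ := fun s : Set E =>
    ⨅ (c : E) (ρ : ℝ) (_ : 0 ≤ ρ) (_ : s = Metric.closedBall c ρ),
      unitBallVolume k * ENNReal.ofReal ρ ^ k with hm
  set T : ℕ → Set E := fun n => ⋃ i, Metric.closedBall (x n i) (r n i)
  have hT : ∀ n, MeasurableSet (T n) := fun n =>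
    MeasurableSet.iUnion fun i => Metric.isClosed_closedBall.measurableSet
  have hST : S ⊆ ⋂ n, T n := subset_iInter hS
  refine (measure_mono hST).trans ?_
  change Measure.mkMetric' m _ ≤ c
  rw [Measure.mkMetric', toMeasure_apply _ _ (MeasurableSet.iInter hT),
    OuterMeasure.mkMetric'.eq_iSup_nat, OuterMeasure.iSup_apply]
  refine iSup_le fun n => ?_
  calc OuterMeasure.mkMetric'.pre m (n : ℝ≥0∞)⁻¹ (⋂ n, T n)
      ≤ OuterMeasure.mkMetric'.pre m (n : ℝ≥0∞)⁻¹ (T n) := measure_mono (iInter_subset _ n)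
    _ ≤ ∑' i : ι n, OuterMeasure.mkMetric'.pre m (n : ℝ≥0∞)⁻¹
          (Metric.closedBall (x n i) (r n i)) := measure_iUnion_le _
    _ ≤ ∑' i : ι n, unitBallVolume k * ENNReal.ofReal (r n i) ^ k := by
      refine ENNReal.tsum_le_tsum fun i => ?_
      obtain ⟨h1, h2⟩ := hr n i
      refine (OuterMeasure.mkMetric'.pre_le ?_).trans
        (iInf_le_of_le (x n i) (iInf_le_of_le _ (iInf_le_of_le h1 (iInf_le_of_le rfl le_rfl))))
      refine (Metric.ediam_le_of_forall_dist_le (C := ((n : ℝ) + 1)⁻¹) fun y hy z hz => ?_).trans ?_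
      · have := dist_triangle_right y z (x n i)
        rw [Metric.mem_closedBall] at hy hz
        linarith
      · rw [ENNReal.ofReal_inv_of_pos (by positivity), ENNReal.inv_le_inv,
          ENNReal.ofReal_add (by positivity) zero_le_one]
        simp
    _ ≤ c := hc n

variable {H : Type*} [NormedAddCommGroup H] [InnerProductSpace ℝ H] [MeasurableSpace H]
  [BorelSpace H] [FiniteDimensional ℝ H]

theorem volume_closedBall_eq {k : ℕ} (hk : finrank ℝ H = k) (x : H) {r : ℝ} (hr : 0 ≤ r) :
    volume (Metric.closedBall x r) = unitBallVolume k * ENNReal.ofReal r ^ k := by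
  subst hk
  rw [Measure.addHaar_closedBall _ _ hr, ENNReal.ofReal_pow hr, mul_comm, unitBallVolume]
  congr 1
  have := (stdOrthonormalBasis ℝ H).measurePreserving_repr
  rw [← this.measure_preimage Metric.isOpen_ball.measurableSet.nullMeasurableSet]
  congr 1
  ext y
  simp

/-- Besicovitch covers `A` by small closed balls centred in `A` with total volume at most `volume A
+ ε`. The image of `A` in such a ball lies in a ball of `L` times the radius, so balls suffice and
no dimensional constant is lost. -/
theorem sphericalHausdorff_image_le {k : ℕ} (hk : finrank ℝ H = k) {f : H → E} {A : Set H}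
    {L : NNReal} (hf : LipschitzOnWith L f A) :
    sphericalHausdorff k (f '' A) ≤ (L : ℝ≥0∞) ^ k * volume A := by
  have key : ∀ ε : ℝ≥0∞, ε ≠ 0 →
      sphericalHausdorff k (f '' A) ≤ (L : ℝ≥0∞) ^ k * (volume A + ε) := by
    intro ε hε
    have hcov : ∀ n : ℕ, ∃ (t : Set H) (r : H → ℝ), t.Countable ∧ t ⊆ A ∧
        (∀ x ∈ t, r x ∈ Ioo 0 ((((n : ℝ) + 1)⁻¹) / (2 * (L + 1)))) ∧
        (A ⊆ ⋃ x ∈ t, Metric.closedBall x (r x)) ∧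
        ∑' x : t, volume (Metric.closedBall (x : H) (r x)) ≤ volume A + ε := fun n =>
      Besicovitch.exists_closedBall_covering_tsum_measure_le (volume : Measure H) hε
        (fun _ => Ioo 0 ((((n : ℝ) + 1)⁻¹) / (2 * (L + 1)))) A (fun x _ δ hδ => by
          have h1 : 0 < min ((((n : ℝ) + 1)⁻¹) / (2 * (L + 1))) δ := lt_min (by positivity) hδ
          have h2 := min_le_left ((((n : ℝ) + 1)⁻¹) / (2 * ((L : ℝ) + 1))) δ
          have h3 := min_le_right ((((n : ℝ) + 1)⁻¹) / (2 * ((L : ℝ) + 1))) δ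
          refine ⟨min ((((n : ℝ) + 1)⁻¹) / (2 * (L + 1))) δ / 2, ⟨?_, ?_⟩, ?_, ?_⟩ <;> linarith)
    choose t r htc htA hr hcov hsum using hcov
    haveI := fun n => (htc n).to_subtype
    refine sphericalHausdorff_le (ι := fun n => t n) (fun n i => f i) (fun n i => L * r n i)
      (fun n i => ?_) (fun n => ?_) fun n => ?_
    · obtain ⟨h1, h2⟩ := hr n i i.2
      refine ⟨by positivity, ?_⟩
      rw [lt_div_iff₀ (by positivity)] at h2
      nlinarith
    · rintro _ ⟨y, hy, rfl⟩
      obtain ⟨x, hx, hyx⟩ := mem_iUnion₂.1 (hcov n hy)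
      refine mem_iUnion.2 ⟨⟨x, hx⟩, ?_⟩
      rw [Metric.mem_closedBall] at hyx ⊢
      exact (hf.dist_le_mul y hy x (htA n hx)).trans (by gcongr)
    · calc ∑' i : t n, unitBallVolume k * ENNReal.ofReal (L * r n i) ^ k
          = ∑' i : t n, (L : ℝ≥0∞) ^ k * volume (Metric.closedBall (i : H) (r n i)) := by
            refine tsum_congr fun i => ?_
            rw [volume_closedBall_eq hk _ (hr n i i.2).1.le, ENNReal.ofReal_mul (by positivity),
              ENNReal.ofReal_coe_nnreal, mul_pow]
            ring
        _ ≤ (L : ℝ≥0∞) ^ k * (volume A + ε) := by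
          rw [ENNReal.tsum_mul_left]
          gcongr
          exact hsum n
  have hlim : Tendsto (fun ε : ℝ≥0∞ => (L : ℝ≥0∞) ^ k * (volume A + ε)) (𝓝[≠] 0)
      (𝓝 ((L : ℝ≥0∞) ^ k * (volume A + 0))) := by
    refine ENNReal.Tendsto.const_mul ?_ (Or.inr (by finiteness))
    exact (tendsto_const_nhds.add tendsto_id).mono_left nhdsWithin_le_nhds
  rw [add_zero] at hlim
  exact ge_of_tendsto hlim (eventually_mem_nhdsWithin.mono fun ε hε => key ε hε)

end Spherical

/-! ### Images under a map close to its derivative -/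

section LocalComparison

open Measure

variable {H E : Type*} [NormedAddCommGroup H] [InnerProductSpace ℝ H] [FiniteDimensional ℝ H]
  [MeasurableSpace H] [BorelSpace H] [NormedAddCommGroup E] [InnerProductSpace ℝ E]
  [MeasurableSpace E] [BorelSpace E]

theorem LipschitzOnWith.euclideanHausdorffMeasure_image_le {X Y : Type*} [EMetricSpace X]
    [MeasurableSpace X] [BorelSpace X] [EMetricSpace Y] [MeasurableSpace Y] [BorelSpace Y]
    {f : X → Y} {s : Set X} {L : NNReal} (hf : LipschitzOnWith L f s) (d : ℕ) :
    (μHE[d] : Measure Y) (f '' s) ≤ (L : ℝ≥0∞) ^ d * (μHE[d] : Measure X) s := by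
  simp only [euclideanHausdorffMeasure_def, Measure.smul_apply, ENNReal.smul_def, smul_eq_mul]
  have := hf.hausdorffMeasure_image_le (d := d) (by positivity)
  rw [ENNReal.rpow_natCast] at this
  calc _ ≤ _ := mul_le_mul_right this _
    _ = _ := by ring

/-- The distance hypothesis makes `f` factor through `g` by an `L`-Lipschitz map on `g '' A`. -/
theorem euclideanHausdorffMeasure_image_le_of_dist_le {α X Y : Type*} [MetricSpace X]
    [MeasurableSpace X] [BorelSpace X] [MetricSpace Y] [MeasurableSpace Y] [BorelSpace Y]
    {f : α → X} {g : α → Y} {A : Set α} {L : NNReal}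
    (h : ∀ x ∈ A, ∀ y ∈ A, dist (f x) (f y) ≤ L * dist (g x) (g y)) (d : ℕ) :
    (μHE[d] : Measure X) (f '' A) ≤ (L : ℝ≥0∞) ^ d * (μHE[d] : Measure Y) (g '' A) := by
  rcases A.eq_empty_or_nonempty with rfl | ⟨a, ha⟩
  · simp
  haveI : Nonempty α := ⟨a⟩
  set s := Function.invFunOn g A
  have hs : ∀ x ∈ A, s (g x) ∈ A ∧ g (s (g x)) = g x := fun x hx =>
    Function.invFunOn_pos ⟨x, hx, rfl⟩
  have hfs : ∀ x ∈ A, f (s (g x)) = f x := fun x hx => by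
    have := h _ (hs x hx).1 x hx
    rw [(hs x hx).2, dist_self, mul_zero] at this
    exact dist_le_zero.1 this
  have hlip : LipschitzOnWith L (f ∘ s) (g '' A) := by
    refine LipschitzOnWith.of_dist_le_mul ?_
    rintro _ ⟨x, hx, rfl⟩ _ ⟨y, hy, rfl⟩
    rw [Function.comp, Function.comp, hfs x hx, hfs y hy]
    exact h x hx y hy
  have himg : (f ∘ s) '' (g '' A) = f '' A := by
    rw [image_image]
    exact image_congr hfs
  rw [← himg]
  exact hlip.euclideanHausdorffMeasure_image_le d

theorem exists_norm_le_mul_of_injective (D : H →ₗ[ℝ] E) (hD : Function.Injective D) :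
    ∃ K > 0, ∀ v, ‖v‖ ≤ K * ‖D v‖ := by
  obtain ⟨K, hK, h⟩ := D.exists_antilipschitzWith (LinearMap.ker_eq_bot.2 hD)
  exact ⟨K, hK, fun v => h.le_mul_norm (map_zero D) v⟩

/-- Near `z` the increments of `f` and of `D` agree in length up to the factor `1 + ε` both ways,
and for `D` the measure of an image is known exactly. -/
theorem HasStrictFDerivAt.exists_euclideanHausdorffMeasure_image {d : ℕ} (hd : finrank ℝ H = d)
    {f : H → E} {D : H →L[ℝ] E} {z : H} (hf : HasStrictFDerivAt f D z)
    (hD : Function.Injective D) {ε : NNReal} (hε : 0 < ε) :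
    ∃ V ∈ 𝓝 z, ∀ A ⊆ V,
      (μHE[d] : Measure E) (f '' A) ≤
        (1 + ε : ℝ≥0∞) ^ d * (ENNReal.ofReal D.toLinearMap.normDet * volume A) ∧
      ENNReal.ofReal D.toLinearMap.normDet * volume A ≤
        (1 + ε : ℝ≥0∞) ^ d * (μHE[d] : Measure E) (f '' A) := by
  obtain ⟨K, hK, hKD⟩ := exists_norm_le_mul_of_injective D.toLinearMap hD
  have hε' : (0 : ℝ) < ε := hε
  -- Chosen so that the relative error is `ε / (1 + ε)`: then `1 - ε / (1 + ε) = (1 + ε)⁻¹` provides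
  -- the reverse estimate.
  set c : NNReal := ⟨ε / (1 + ε) / K, by positivity⟩ with hc
  have hcK : (c : ℝ) * K = ε / (1 + ε) := div_mul_cancel₀ _ hK.ne'
  obtain ⟨V, hV, happ⟩ := hf.approximates_deriv_on_nhds (c := c) (Or.inr (by
    rw [← NNReal.coe_pos]; change 0 < (ε : ℝ) / (1 + ε) / K; positivity))
  have key : ∀ x ∈ V, ∀ y ∈ V, ‖f x - f y - (D x - D y)‖ ≤ ε / (1 + ε) * ‖D x - D y‖ := by
    intro x hx y hy
    have h1 := happ x hx y hy
    rw [map_sub] at h1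
    refine h1.trans ?_
    rw [← hcK, mul_assoc]
    gcongr
    simpa using hKD (x - y)
  have hle : (ε : ℝ) / (1 + ε) ≤ ε := div_le_self hε'.le (by linarith)
  refine ⟨V, hV, fun A hA => ?_⟩
  have hvol := D.toLinearMap.euclideanHausdorffMeasure_image_eq_normDet_mul_volume A
  rw [hd] at hvol
  rw [← hvol]
  have hcoe : (1 + ε : ℝ≥0∞) = ((1 + ε : NNReal) : ℝ≥0∞) := by push_cast; rfl
  rw [hcoe]
  constructor
  · refine euclideanHausdorffMeasure_image_le_of_dist_le (fun x hx y hy => ?_) d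
    have h1 := key x (hA hx) y (hA hy)
    have h2 := norm_le_norm_add_norm_sub' (f x - f y) (D x - D y)
    rw [dist_eq_norm, dist_eq_norm]
    push_cast
    change _ ≤ (1 + (ε : ℝ)) * ‖D x - D y‖
    nlinarith [norm_nonneg (D x - D y)]
  · refine euclideanHausdorffMeasure_image_le_of_dist_le (fun x hx y hy => ?_) d
    have h1 := key x (hA hx) y (hA hy)
    have h2 := norm_le_norm_add_norm_sub (f x - f y) (D x - D y)
    rw [dist_eq_norm, dist_eq_norm]
    push_cast
    change ‖D x - D y‖ ≤ (1 + (ε : ℝ)) * _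
    have h3 : ‖D x - D y‖ * (1 - ε / (1 + ε)) ≤ ‖f x - f y‖ := by linarith
    rw [show 1 - (ε : ℝ) / (1 + ε) = (1 + (ε : ℝ))⁻¹ by field_simp; ring] at h3
    rwa [← div_eq_mul_inv, div_le_iff₀ (by positivity), mul_comm] at h3

/-- Identify the range of `D` isometrically with `H`; `C` is `D` under this identification. -/
theorem exists_linearMap_norm_eq (D : H →ₗ[ℝ] E) (hD : Function.Injective D) :
    ∃ C : H →ₗ[ℝ] H, (∀ v, ‖C v‖ = ‖D v‖) ∧ |C.det| = D.normDet := by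
  have hrank : finrank ℝ D.range = finrank ℝ H := (D.normDet_ne_zero_tfae.out 4 2).mp hD
  obtain ⟨bv⟩ := (D.normDet_ne_zero_tfae.out 4 3).mp hD
  let g : H ≃ₗᵢ[ℝ] D.range := (stdOrthonormalBasis ℝ H).equiv bv (Equiv.refl _)
  set C : H →ₗ[ℝ] H := g.symm.toLinearIsometry.toLinearMap ∘ₗ D.rangeRestrict
  have hC : ∀ v, (g (C v) : E) = D v := fun v => by
    change ((g (g.symm (D.rangeRestrict v)) : D.range) : E) = D v
    rw [g.apply_symm_apply]
    rfl
  refine ⟨C, fun v => by rw [← hC v]; exact (g.norm_map (C v)).symm, ?_⟩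
  have : D = (D.range.subtypeₗᵢ.comp g.toLinearIsometry).toLinearMap ∘ₗ C := by
    ext v
    simp [hC]
  conv_rhs => rw [this]
  rw [LinearMap.normDet_comp_of_finrank_eq _ _ rfl, LinearIsometry.normDet_eq_one, one_mul,
    LinearMap.normDet_eq_abs_det]

/-- Near a point where the derivative `D` of `f` satisfies `‖D v‖ ≤ ‖Q v‖`, the spherical measure of
images is at most about `|det Q|` times the volume. -/
theorem HasStrictFDerivAt.exists_sphericalHausdorff_image_le {k : ℕ} (hk : finrank ℝ H = k)
    {f : H → E} {D : H →L[ℝ] E} {z : H} (hf : HasStrictFDerivAt f D z) (Q : H →ₗ[ℝ] H)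
    (hQ : Q.det ≠ 0) (hDQ : ∀ v, ‖D v‖ ≤ ‖Q v‖) {ε : NNReal} (hε : 0 < ε) :
    ∃ V ∈ 𝓝 z, ∀ A ⊆ V,
      sphericalHausdorff k (f '' A) ≤ (1 + ε : ℝ≥0∞) ^ k * (ENNReal.ofReal |Q.det| * volume A) := by
  have hinj : Function.Injective Q := by
    rw [← LinearMap.ker_eq_bot]
    exact (LinearMap.isUnit_iff_ker_eq_bot Q).1 ((LinearMap.isUnit_iff_isUnit_det Q).2 hQ.isUnit)
  obtain ⟨K, hK, hKQ⟩ := exists_norm_le_mul_of_injective Q hinj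
  have hε' : (0 : ℝ) < ε := hε
  set c : NNReal := ⟨ε / K, by positivity⟩ with hc
  have hcK : (c : ℝ) * K = ε := div_mul_cancel₀ _ hK.ne'
  obtain ⟨V, hV, happ⟩ := hf.approximates_deriv_on_nhds (c := c) (Or.inr (by
    rw [← NNReal.coe_pos]; change 0 < (ε : ℝ) / K; positivity))
  refine ⟨V, hV, fun A hA => ?_⟩
  rw [← Measure.addHaar_image_linearMap volume Q A]
  set s := Function.invFun Q
  have hs : ∀ x, s (Q x) = x := Function.leftInverse_invFun hinj
  -- Changing variables by `Q` makes `f` nearly `1`-Lipschitz, and `Q '' A` has volume `|det Q|`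
  -- times that of `A`.
  have hlip : LipschitzOnWith (1 + ε) (f ∘ s) (Q '' A) := by
    refine LipschitzOnWith.of_dist_le_mul ?_
    rintro _ ⟨x, hx, rfl⟩ _ ⟨y, hy, rfl⟩
    rw [Function.comp, Function.comp, hs, hs, dist_eq_norm, dist_eq_norm, ← map_sub]
    have h1 := happ x (hA hx) y (hA hy)
    have h2 := norm_le_norm_add_norm_sub' (f x - f y) (D (x - y))
    have h3 : (c : ℝ) * ‖x - y‖ ≤ ε * ‖Q (x - y)‖ := by
      rw [← hcK, mul_assoc]
      gcongr
      exact hKQ _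
    have h4 := hDQ (x - y)
    push_cast
    linarith
  have himg : (f ∘ s) '' (Q '' A) = f '' A := by
    rw [image_image]
    exact image_congr fun x _ => by rw [Function.comp, hs]
  rw [← himg]
  have := sphericalHausdorff_image_le hk hlip
  push_cast at this
  exact this

end LocalComparison

end

noncomputable section

/-! ### Local parametrizations of submanifolds and the area formula -/

section Charts

variable {V : Type*} [NormedAddCommGroup V] [InnerProductSpace ℝ V] [FiniteDimensional ℝ V]

/-- `g` parametrizes a relatively open part of `M` by the open subset `B` of `ℝ^d`. -/
structure IsParametrization {d : ℕ} (M : Set V) (g : EuclideanSpace ℝ (Fin d) → V)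
    (B : Set (EuclideanSpace ℝ (Fin d))) : Prop where
  isOpen : IsOpen B
  contDiffOn : ContDiffOn ℝ ∞ g B
  injOn : InjOn g B
  injective_fderiv : ∀ y ∈ B, Function.Injective (fderiv ℝ g y)
  exists_isOpen : ∀ W ⊆ B, IsOpen W → ∃ O : Set V, IsOpen O ∧ g '' W = M ∩ O
  tangentCone_subset : ∀ y ∈ B, tangentConeAt ℝ M (g y) ⊆ range (fderiv ℝ g y)

theorem tangentConeAt_subset_submodule (L : Submodule ℝ V) {x : V} (hx : x ∈ L) :
    tangentConeAt ℝ (L : Set V) x ⊆ L := by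
  intro v hv
  obtain ⟨ι, l, hl, c, d, hd₀, hds, hcd⟩ := exists_fun_of_mem_tangentConeAt hv
  refine L.closed_of_finiteDimensional.mem_of_tendsto hcd (hds.mono fun n hn => ?_)
  have : d n ∈ L := by simpa using L.sub_mem hn hx
  exact L.smul_mem _ this

/-- A straightening chart `e` maps `M` to a linear subspace `L`, so `g = e⁻¹` on `L` through `e p`,
in orthonormal coordinates. `Ψ ∘ e` is a smooth left inverse, which gives injectivity of `g` and of
its derivative. Tangent vectors of `M` are carried by `de` into `L` and back. -/
theorem IsEmbeddedSubmanifold.exists_isParametrization {d : ℕ} {M : Set V}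
    (hM : IsEmbeddedSubmanifold d M) {p : V} (hp : p ∈ M) :
    ∃ (g : EuclideanSpace ℝ (Fin d) → V) (R : ℝ), 0 < R ∧ g 0 = p ∧
      IsParametrization M g (Metric.ball 0 R) := by
  obtain ⟨e, L, hpe, he, hes, hL, hLM⟩ := hM p hp
  have hpL : e p ∈ L := (hLM p hpe).1 hp
  let b : OrthonormalBasis (Fin d) ℝ L := (stdOrthonormalBasis ℝ L).reindex (finCongr hL)
  let ι : EuclideanSpace ℝ (Fin d) ≃ₗᵢ[ℝ] L := b.repr.symm
  let j : EuclideanSpace ℝ (Fin d) →L[ℝ] V := L.subtypeL ∘L ι.toContinuousLinearEquiv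
  let π : V →L[ℝ] EuclideanSpace ℝ (Fin d) :=
    (ι.symm.toContinuousLinearEquiv : L →L[ℝ] EuclideanSpace ℝ (Fin d)) ∘L L.orthogonalProjection
  have hjL : ∀ y, j y ∈ L := fun y => (ι y).2
  have hπj : ∀ y, π (j y) = y := fun y => by
    change ι.symm (L.orthogonalProjection (ι y : V)) = y
    rw [Submodule.orthogonalProjection_mem_subspace_eq_self, ι.symm_apply_apply]
  have hjπ : ∀ x ∈ L, j (π x) = x := fun x hx => by
    change ((ι (ι.symm (L.orthogonalProjection x)) : L) : V) = x
    rw [ι.apply_symm_apply]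
    exact congrArg Subtype.val (Submodule.orthogonalProjection_mem_subspace_eq_self (⟨x, hx⟩ : L))
  let Φ : EuclideanSpace ℝ (Fin d) → V := fun y => e p + j y
  let Ψ : V → EuclideanSpace ℝ (Fin d) := fun x => π x - π (e p)
  have hΦc : Continuous Φ := continuous_const.add j.continuous
  have hΨΦ : ∀ y, Ψ (Φ y) = y := fun y => by simp [Ψ, Φ, hπj]
  have hΦΨ : ∀ x ∈ L, Φ (Ψ x) = x := fun x hx => by
    simp [Ψ, Φ, hjπ x hx, hjπ _ hpL]
  have hΦL : ∀ y, Φ y ∈ L := fun y => L.add_mem hpL (hjL y)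
  obtain ⟨R, hR, hball⟩ := Metric.mem_nhds_iff.1 ((e.open_target.preimage hΦc).mem_nhds
    (show (0 : EuclideanSpace ℝ (Fin d)) ∈ Φ ⁻¹' e.target by
      simpa [Φ] using e.map_source hpe))
  have hleft : ∀ y ∈ Metric.ball (0 : EuclideanSpace ℝ (Fin d)) R, Ψ (e (e.symm (Φ y))) = y :=
    fun y hy => by rw [e.right_inv (hball hy), hΨΦ]
  have hΦd : ∀ y, HasFDerivAt Φ j y := fun y => (j.hasFDerivAt).const_add _
  have hesd : ∀ y ∈ Metric.ball (0 : EuclideanSpace ℝ (Fin d)) R,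
      DifferentiableAt ℝ e.symm (Φ y) := fun y hy =>
    (hes.contDiffAt (e.open_target.mem_nhds (hball hy))).differentiableAt (by simp)
  have hgd : ∀ y ∈ Metric.ball (0 : EuclideanSpace ℝ (Fin d)) R,
      HasFDerivAt (fun y => e.symm (Φ y)) ((fderiv ℝ e.symm (Φ y)) ∘L j) y := fun y hy =>
    (hesd y hy).hasFDerivAt.comp y (hΦd y)
  have hed : ∀ y ∈ Metric.ball (0 : EuclideanSpace ℝ (Fin d)) R,
      DifferentiableAt ℝ e (e.symm (Φ y)) := fun y hy =>
    (he.contDiffAt (e.open_source.mem_nhds (e.map_target (hball hy)))).differentiableAt (by simp)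
  refine ⟨fun y => e.symm (Φ y), R, hR, by simp [Φ, e.left_inv hpe], Metric.isOpen_ball, ?_, ?_, ?_,
    ?_, ?_⟩
  · exact hes.comp ((contDiff_const.add j.contDiff).contDiffOn) hball
  · intro y hy z hz hyz
    rw [← hleft y hy, ← hleft z hz]
    exact congrArg _ (congrArg _ hyz)
  · intro y hy
    have h1 : HasFDerivAt (fun y => Ψ (e (e.symm (Φ y))))
        (π ∘L fderiv ℝ e (e.symm (Φ y)) ∘L fderiv ℝ (fun y => e.symm (Φ y)) y) y := by
      refine HasFDerivAt.comp y (g := Ψ) (f := fun y => e (e.symm (Φ y))) ?_ ?_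
      · exact π.hasFDerivAt.sub_const _
      · exact (hed y hy).hasFDerivAt.comp y (hgd y hy).differentiableAt.hasFDerivAt
    have h2 : HasFDerivAt (fun y => Ψ (e (e.symm (Φ y))))
        (ContinuousLinearMap.id ℝ (EuclideanSpace ℝ (Fin d))) y :=
      (hasFDerivAt_id y).congr_of_eventuallyEq
        (Filter.eventuallyEq_of_mem (Metric.isOpen_ball.mem_nhds hy) hleft)
    have h3 := h1.unique h2
    intro v w hvw
    have hv := congrArg (fun A => A v) h3
    have hw := congrArg (fun A => A w) h3
    simp only [ContinuousLinearMap.comp_apply, ContinuousLinearMap.id_apply] at hv hw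
    rw [← hv, ← hw, hvw]
  · intro W hW hWo
    refine ⟨e.source ∩ e ⁻¹' (Ψ ⁻¹' W), e.isOpen_inter_preimage (hWo.preimage (by fun_prop)), ?_⟩
    ext x
    constructor
    · rintro ⟨y, hy, rfl⟩
      have hs := e.map_target (hball (hW hy))
      refine ⟨(hLM _ hs).2 ?_, hs, ?_⟩
      · rw [e.right_inv (hball (hW hy))]
        exact hΦL y
      · rw [mem_preimage, mem_preimage, hleft y (hW hy)]
        exact hy
    · rintro ⟨hxM, hxs, hxW⟩
      refine ⟨Ψ (e x), hxW, ?_⟩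
      change e.symm (Φ (Ψ (e x))) = x
      rw [hΦΨ _ ((hLM x hxs).1 hxM), e.left_inv hxs]
  · intro y hy v hv
    set x := e.symm (Φ y) with hx
    have hxs : x ∈ e.source := e.map_target (hball hy)
    rw [← tangentConeAt_inter_nhds (e.open_source.mem_nhds hxs)] at hv
    have h1 := (hed y hy).hasFDerivAt.hasFDerivWithinAt (s := M ∩ e.source)
      |>.mapsTo_tangent_cone hv
    have hex : e x = Φ y := e.right_inv (hball hy)
    have h2 : fderiv ℝ e x v ∈ L := by
      refine tangentConeAt_subset_submodule L (hΦL y) ?_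
      rw [← hex]
      refine tangentConeAt_mono ?_ h1
      rintro _ ⟨z, hz, rfl⟩
      exact (hLM z hz.2).1 hz.1
    refine ⟨π (fderiv ℝ e x v), ?_⟩
    rw [(hgd y hy).fderiv, ContinuousLinearMap.comp_apply, hjπ _ h2]
    have h3 : HasFDerivAt (fun z => e.symm (e z)) (fderiv ℝ e.symm (Φ y) ∘L fderiv ℝ e x) x := by
      refine HasFDerivAt.comp x (g := e.symm) (f := e) ?_ (hed y hy).hasFDerivAt
      rw [hex]
      exact (hesd y hy).hasFDerivAt
    have h4 : HasFDerivAt (fun z => e.symm (e z)) (ContinuousLinearMap.id ℝ V) x :=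
      (hasFDerivAt_id x).congr_of_eventuallyEq
        (Filter.eventuallyEq_of_mem (e.open_source.mem_nhds hxs) fun z hz => e.left_inv hz)
    exact congrArg (fun A => A v) (h3.unique h4)

/-- Factor `D = K ∘ C` with `K` the isometry taking the standard basis to `v`; then `δ = det C`.
This compares the coordinate `d`-vector of a chart with the orienting one up to sign. -/
theorem exists_ιMulti_map_eq_smul {d : ℕ} (D : EuclideanSpace ℝ (Fin d) →ₗ[ℝ] V)
    (hD : Function.Injective D) {v : Fin d → V} (hv : Orthonormal ℝ v)
    (hvD : ∀ i, v i ∈ range D) :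
    ∃ δ : ℝ, |δ| = D.normDet ∧
      exteriorPower.ιMulti ℝ d (fun i => D (EuclideanSpace.basisFun (Fin d) ℝ i)) =
        δ • exteriorPower.ιMulti ℝ d v := by
  set e := EuclideanSpace.basisFun (Fin d) ℝ with he
  set K : EuclideanSpace ℝ (Fin d) →ₗ[ℝ] V := e.toBasis.constr ℝ v with hK
  have hKe : ∀ i, K (e i) = v i := fun i => by
    rw [hK, ← e.coe_toBasis, Basis.constr_basis]
  have hKi : ∀ x, ‖K x‖ = ‖x‖ := fun x => by
    have h1 : K x = ∑ i, (x i) • v i := by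
      rw [hK, Basis.constr_apply_fintype]
      simp [he]
    rw [EuclideanSpace.norm_eq, h1, ← sq_eq_sq₀ (norm_nonneg _) (by positivity),
      Real.sq_sqrt (by positivity), ← real_inner_self_eq_norm_sq, hv.inner_sum]
    simp [sq]
  let Ki : EuclideanSpace ℝ (Fin d) →ₗᵢ[ℝ] V := ⟨K, hKi⟩
  have hrange : K.range = D.range := by
    refine Submodule.eq_of_le_of_finrank_eq ?_ ?_
    · rw [hK, Basis.constr_range, Submodule.span_le]
      rintro _ ⟨i, rfl⟩
      exact hvD i
    · rw [LinearMap.finrank_range_of_inj Ki.injective, LinearMap.finrank_range_of_inj hD]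
  have hC : ∀ i, ∃ c, K c = D (e i) := fun i => by
    have : D (e i) ∈ K.range := hrange ▸ LinearMap.mem_range_self D _
    exact this
  choose c hc using hC
  set C : EuclideanSpace ℝ (Fin d) →ₗ[ℝ] EuclideanSpace ℝ (Fin d) := e.toBasis.constr ℝ c
  have hCe : ∀ i, C (e i) = c i := fun i => by
    rw [← e.coe_toBasis, Basis.constr_basis]
  have hDKC : D = Ki.toLinearMap ∘ₗ C := by
    refine e.toBasis.ext fun i => ?_
    rw [e.coe_toBasis, LinearMap.comp_apply, hCe]
    exact (hc i).symm
  refine ⟨C.det, ?_, ?_⟩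
  · rw [hDKC, LinearMap.normDet_comp_of_finrank_eq _ _ rfl, LinearIsometry.normDet_eq_one, one_mul,
      LinearMap.normDet_eq_abs_det]
  · have h := AlternatingMap.apply_eq_det_smul
      ((exteriorPower.ιMulti ℝ d (M := V)).compLinearMap K) e.toBasis fun i => C (e i)
    simp only [AlternatingMap.compLinearMap_apply, e.coe_toBasis, hKe] at h
    rw [hDKC]
    refine h.trans ?_
    congr 1
    have h2 := e.toBasis.det_comp C e.toBasis
    rw [Basis.det_self, mul_one, e.coe_toBasis] at h2
    exact h2

theorem IsParametrization.mono {d : ℕ} {M : Set V} {g : EuclideanSpace ℝ (Fin d) → V}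
    {B B' : Set (EuclideanSpace ℝ (Fin d))} (hg : IsParametrization M g B) (hB' : IsOpen B')
    (h : B' ⊆ B) : IsParametrization M g B' :=
  ⟨hB', hg.contDiffOn.mono h, hg.injOn.mono h, fun y hy => hg.injective_fderiv y (h hy),
    fun W hW => hg.exists_isOpen W (hW.trans h), fun y hy => hg.tangentCone_subset y (h hy)⟩

theorem IsParametrization.continuousOn_fderiv {d : ℕ} {M : Set V}
    {g : EuclideanSpace ℝ (Fin d) → V} {B : Set (EuclideanSpace ℝ (Fin d))}
    (hg : IsParametrization M g B) : ContinuousOn (fderiv ℝ g) B :=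
  hg.contDiffOn.continuousOn_fderiv_of_isOpen hg.isOpen (by simp)

/-- The Jacobian of a parametrization. -/
def jacobian {d : ℕ} (g : EuclideanSpace ℝ (Fin d) → V) (y : EuclideanSpace ℝ (Fin d)) : ℝ :=
  (fderiv ℝ g y).toLinearMap.normDet

theorem IsParametrization.continuousOn_jacobian {d : ℕ} {M : Set V}
    {g : EuclideanSpace ℝ (Fin d) → V} {B : Set (EuclideanSpace ℝ (Fin d))}
    (hg : IsParametrization M g B) : ContinuousOn (jacobian g) B := by
  have h : jacobian g = fun y => √(Matrix.gram ℝ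
      fun i => fderiv ℝ g y (EuclideanSpace.basisFun (Fin d) ℝ i)).det := by
    funext y
    have := (fderiv ℝ g y).toLinearMap.normDet_sq_eq_det_gram (EuclideanSpace.basisFun (Fin d) ℝ)
    simp only [RCLike.ofReal_real_eq_id, id] at this
    rw [jacobian, ← Real.sqrt_sq (LinearMap.normDet_nonneg _), this]
    rfl
  rw [h]
  have hc : ∀ i, ContinuousOn (fun y => fderiv ℝ g y (EuclideanSpace.basisFun (Fin d) ℝ i)) B :=
    fun i => hg.continuousOn_fderiv.clm_apply continuousOn_const
  refine ContinuousOn.sqrt ?_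
  simp only [Matrix.det_apply, Matrix.gram_apply]
  fun_prop

theorem IsParametrization.jacobian_pos {d : ℕ} {M : Set V}
    {g : EuclideanSpace ℝ (Fin d) → V} {B : Set (EuclideanSpace ℝ (Fin d))}
    (hg : IsParametrization M g B) {y : EuclideanSpace ℝ (Fin d)} (hy : y ∈ B) :
    0 < jacobian g y :=
  lt_of_le_of_ne (LinearMap.normDet_nonneg _) (Ne.symm
    (((fderiv ℝ g y).toLinearMap.normDet_ne_zero_tfae.out 4 0).mp (hg.injective_fderiv y hy)))

theorem IsParametrization.hasStrictFDerivAt {d : ℕ} {M : Set V}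
    {g : EuclideanSpace ℝ (Fin d) → V} {B : Set (EuclideanSpace ℝ (Fin d))}
    (hg : IsParametrization M g B) {y : EuclideanSpace ℝ (Fin d)} (hy : y ∈ B) :
    HasStrictFDerivAt g (fderiv ℝ g y) y :=
  (hg.contDiffOn.contDiffAt (hg.isOpen.mem_nhds hy)).hasStrictFDerivAt (by simp)

section Area

variable [MeasurableSpace V] [BorelSpace V]

open Measure

theorem IsParametrization.measurableEmbedding {d : ℕ} {M : Set V}
    {g : EuclideanSpace ℝ (Fin d) → V} {B : Set (EuclideanSpace ℝ (Fin d))}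
    (hg : IsParametrization M g B) : MeasurableEmbedding (B.restrict g) :=
  hg.contDiffOn.continuousOn.measurableEmbedding hg.isOpen.measurableSet hg.injOn

/-- Local comparison of the surface measure with the density given by the Jacobian. -/
theorem IsParametrization.exists_nhds_compare {d : ℕ} {M : Set V}
    {g : EuclideanSpace ℝ (Fin d) → V} {B : Set (EuclideanSpace ℝ (Fin d))}
    (hg : IsParametrization M g B) {ε : NNReal} (hε : 0 < ε) {y : EuclideanSpace ℝ (Fin d)}
    (hy : y ∈ B) : ∃ W ∈ 𝓝 y, W ⊆ B ∧ ∀ A ⊆ W, MeasurableSet A →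
      (μHE[d] : Measure V) (g '' A) ≤
        (1 + ε : ℝ≥0∞) ^ (d + 1) * ∫⁻ z in A, ENNReal.ofReal (jacobian g z) ∧
      ∫⁻ z in A, ENNReal.ofReal (jacobian g z) ≤
        (1 + ε : ℝ≥0∞) ^ (d + 1) * (μHE[d] : Measure V) (g '' A) := by
  obtain ⟨W₁, hW₁, hcmp⟩ := (hg.hasStrictFDerivAt hy).exists_euclideanHausdorffMeasure_image
    (finrank_euclideanSpace_fin) (hg.injective_fderiv y hy) hε
  have hpos := hg.jacobian_pos hy
  have hcont := (hg.continuousOn_jacobian).continuousAt (hg.isOpen.mem_nhds hy)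
  have hε' : (0 : ℝ) < ε := hε
  -- Freezing the Jacobian at `y` costs one factor `1 + ε`, in addition to the `d` factors from
  -- comparing distances.
  have h1 : ∀ᶠ z in 𝓝 y, jacobian g y < (1 + ε) * jacobian g z :=
    (continuousAt_const.mul hcont).eventually (lt_mem_nhds (by
      change jacobian g y < (1 + ε) * jacobian g y; nlinarith))
  have h2 : ∀ᶠ z in 𝓝 y, jacobian g z < (1 + ε) * jacobian g y :=
    hcont.eventually (gt_mem_nhds (by nlinarith))
  refine ⟨W₁ ∩ (B ∩ ({z | jacobian g y < (1 + ε) * jacobian g z} ∩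
    {z | jacobian g z < (1 + ε) * jacobian g y})), inter_mem hW₁
    (inter_mem (hg.isOpen.mem_nhds hy) (inter_mem h1 h2)), fun z hz => hz.2.1,
    fun A hA hAm => ?_⟩
  obtain ⟨hc1, hc2⟩ := hcmp A fun z hz => (hA hz).1
  have hof : ENNReal.ofReal (1 + (ε : ℝ)) = 1 + ε := by
    rw [ENNReal.ofReal_add zero_le_one hε'.le]; simp
  have hlow : ENNReal.ofReal (jacobian g y) * volume A ≤
      (1 + ε) * ∫⁻ z in A, ENNReal.ofReal (jacobian g z) := by
    rw [← setLIntegral_const, ← lintegral_const_mul' _ _ (by finiteness)]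
    refine setLIntegral_mono' hAm fun z hz => ?_
    rw [← hof, ← ENNReal.ofReal_mul (by positivity)]
    exact ENNReal.ofReal_le_ofReal (hA hz).2.2.1.le
  have hup : ∫⁻ z in A, ENNReal.ofReal (jacobian g z) ≤
      (1 + ε) * (ENNReal.ofReal (jacobian g y) * volume A) := by
    rw [← setLIntegral_const, ← lintegral_const_mul' _ _ (by finiteness)]
    refine setLIntegral_mono' hAm fun z hz => ?_
    rw [← hof, ← ENNReal.ofReal_mul (by positivity)]
    exact ENNReal.ofReal_le_ofReal (hA hz).2.2.2.le
  constructor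
  · refine hc1.trans ?_
    rw [pow_succ, mul_assoc]
    exact mul_le_mul_right hlow _
  · refine hup.trans ?_
    rw [pow_succ', mul_assoc]
    exact mul_le_mul_right hc2 _

theorem ENNReal.le_of_forall_one_add_pow_mul {a b : ℝ≥0∞} (k : ℕ)
    (h : ∀ ε : NNReal, 0 < ε → a ≤ (1 + ε : ℝ≥0∞) ^ k * b) : a ≤ b := by
  have hlim : Tendsto (fun ε : NNReal => (1 + ε : ℝ≥0∞) ^ k * b) (𝓝[>] 0)
      (𝓝 ((1 + (0 : NNReal) : ℝ≥0∞) ^ k * b)) := by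
    refine ENNReal.Tendsto.mul_const ?_ (Or.inl (by simp))
    refine ENNReal.Tendsto.pow (tendsto_const_nhds.add ?_)
    exact (ENNReal.tendsto_coe.2 tendsto_id).mono_left nhdsWithin_le_nhds
  simp only [ENNReal.coe_zero, add_zero, one_pow, one_mul] at hlim
  exact ge_of_tendsto hlim (eventually_mem_nhdsWithin.mono fun ε hε => h ε hε)

/-- **Area formula** for a parametrization. -/
theorem IsParametrization.comap_euclideanHausdorffMeasure {d : ℕ} {M : Set V}
    {g : EuclideanSpace ℝ (Fin d) → V} {B : Set (EuclideanSpace ℝ (Fin d))}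
    (hg : IsParametrization M g B) :
    (μHE[d] : Measure V).comap (B.restrict g) =
      ((volume.withDensity fun z => ENNReal.ofReal (jacobian g z)).comap (Subtype.val : B → _)) := by
  set ν := (μHE[d] : Measure V).comap (B.restrict g) with hν
  set lam : Measure B :=
    ((volume.withDensity fun z => ENNReal.ofReal (jacobian g z)).comap (Subtype.val : B → _))
  have hνE : ∀ E : Set B, ν E = (μHE[d] : Measure V) (g '' (Subtype.val '' E)) := fun E => by
    rw [hν, hg.measurableEmbedding.comap_apply, image_image]
    rfl
  have hlE : ∀ E : Set B, MeasurableSet E →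
      lam E = ∫⁻ z in Subtype.val '' E, ENNReal.ofReal (jacobian g z) := fun E hE => by
    rw [(MeasurableEmbedding.subtype_coe hg.isOpen.measurableSet).comap_apply, withDensity_apply]
    exact (MeasurableEmbedding.subtype_coe hg.isOpen.measurableSet).measurableSet_image.2 hE
  -- Transported to `B`, both sides are measures that dominate each other locally up to `(1 + ε) ^
  -- (d + 1)`; this becomes global, and then `ε → 0`.
  have key : ∀ E : Set B, MeasurableSet E → ∀ ε : NNReal, 0 < ε →
      ν E ≤ (1 + ε : ℝ≥0∞) ^ (d + 1) * lam E ∧ lam E ≤ (1 + ε : ℝ≥0∞) ^ (d + 1) * ν E := by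
    intro E hE ε hε
    have hloc : ∀ y : B, ∃ W ∈ 𝓝[univ] y, ∀ A ⊆ W, MeasurableSet A →
        ν A ≤ (1 + ε : ℝ≥0∞) ^ (d + 1) * lam A ∧ lam A ≤ (1 + ε : ℝ≥0∞) ^ (d + 1) * ν A := by
      intro y
      obtain ⟨W, hW, hWB, hc⟩ := hg.exists_nhds_compare hε y.2
      refine ⟨Subtype.val ⁻¹' W, by
        rw [nhdsWithin_univ]; exact continuous_subtype_val.continuousAt hW, fun A hA hAm => ?_⟩
      rw [hνE, hlE A hAm]
      exact hc _ (image_subset_iff.2 hA)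
        ((MeasurableEmbedding.subtype_coe hg.isOpen.measurableSet).measurableSet_image.2 hAm)
    constructor
    · refine le_measure_of_locally_le (Φ := ν) (μ := (1 + ε : ℝ≥0∞) ^ (d + 1) • lam) (K := univ)
        measure_empty (fun s => measure_iUnion_le s) (fun y _ => ?_) (subset_univ E) hE
      obtain ⟨W, hW, hc⟩ := hloc y
      exact ⟨W, hW, fun A hA hAm => (hc A hA hAm).1⟩
    · refine le_measure_of_locally_le (Φ := lam) (μ := (1 + ε : ℝ≥0∞) ^ (d + 1) • ν) (K := univ)
        measure_empty (fun s => measure_iUnion_le s) (fun y _ => ?_) (subset_univ E) hE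
      obtain ⟨W, hW, hc⟩ := hloc y
      exact ⟨W, hW, fun A hA hAm => (hc A hA hAm).2⟩
  refine Measure.ext fun E hE => le_antisymm ?_ ?_
  · exact ENNReal.le_of_forall_one_add_pow_mul (d + 1) fun ε hε => (key E hE ε hε).1
  · exact ENNReal.le_of_forall_one_add_pow_mul (d + 1) fun ε hε => (key E hE ε hε).2

theorem IsParametrization.setIntegral_image {X : Type*} [NormedAddCommGroup X] [NormedSpace ℝ X]
    {d : ℕ} {M : Set V} {g : EuclideanSpace ℝ (Fin d) → V}
    {B : Set (EuclideanSpace ℝ (Fin d))} (hg : IsParametrization M g B) (f : V → X) :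
    ∫ x in g '' B, f x ∂(μHE[d] : Measure V) = ∫ y in B, jacobian g y • f (g y) := by
  have hB := hg.isOpen.measurableSet
  have h1 : (μHE[d] : Measure V).restrict (g '' B) =
      ((μHE[d] : Measure V).comap (B.restrict g)).map (B.restrict g) := by
    rw [hg.measurableEmbedding.map_comap, image_eq_range]
    rfl
  rw [h1, hg.measurableEmbedding.integral_map, hg.comap_euclideanHausdorffMeasure]
  have h2 := integral_subtype_comap (μ := volume.withDensity fun z => ENNReal.ofReal (jacobian g z))
    hB (fun y => f (g y))
  refine h2.trans ?_
  rw [restrict_withDensity hB, integral_withDensity_eq_integral_toReal_smul₀]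
  · refine setIntegral_congr_fun hB fun y hy => ?_
    simp only [ENNReal.toReal_ofReal (hg.jacobian_pos hy).le]
  · exact (hg.continuousOn_jacobian.aemeasurable hB).ennreal_ofReal
  · exact ae_of_all _ fun _ => ENNReal.ofReal_lt_top

end Area

end Charts

end

noncomputable section

theorem ContDiffAt.alternating_apply {G : Type*} [NormedAddCommGroup G]
    [NormedSpace ℝ G] {X : Type*} [NormedAddCommGroup X] [NormedSpace ℝ X] {V : Type*} [NormedAddCommGroup V] [InnerProductSpace ℝ V]
    [FiniteDimensional ℝ V] {m : ℕ} {n : WithTop ℕ∞} {φ : G → V [⋀^Fin m]→L[ℝ] X}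
    {w : Fin m → G → V} {y : G} (hφ : ContDiffAt ℝ n φ y) (hw : ∀ i, ContDiffAt ℝ n (w i) y) :
    ContDiffAt ℝ n (fun z => φ z fun i => w i z) y := by
  let b := stdOrthonormalBasis ℝ V
  -- Expanding the arguments in a fixed basis reduces smoothness to products of coordinates and
  -- values at fixed vectors.
  have h : (fun z => φ z fun i => w i z) = fun z => ∑ σ : Fin m → Fin (finrank ℝ V),
      (∏ i, ⟪b (σ i), w i z⟫) • φ z fun i => b (σ i) := by
    funext z
    conv_lhs => rw [show (fun i => w i z) = fun i => ∑ j, ⟪b j, w i z⟫ • b j by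
      funext i; exact (b.sum_repr' (w i z)).symm]
    refine ((φ z).toMultilinearMap.map_sum fun i j => ⟪b j, w i z⟫ • b j).trans ?_
    exact Finset.sum_congr rfl fun σ _ => (φ z).toMultilinearMap.map_smul_univ _ _
  rw [h]
  refine ContDiffAt.sum fun σ _ => ContDiffAt.smul ?_ ?_
  · exact contDiffAt_prod fun i _ => contDiffAt_const.inner ℝ (hw i)
  · exact (ContinuousAlternatingMap.apply ℝ V X fun i => b (σ i)).contDiff.contDiffAt.comp y hφ

/-! ### Integrals of compactly supported exact forms -/

section IntegralDeriv

variable {G : Type*} [NormedAddCommGroup G] [NormedSpace ℝ G] [FiniteDimensional ℝ G]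
  [MeasurableSpace G] [BorelSpace G] (μ : Measure G) [μ.IsAddHaarMeasure]
  {X : Type*} [NormedAddCommGroup X] [NormedSpace ℝ X]

theorem integrable_fderiv_of_hasCompactSupport {f : G → X} (hf : ContDiff ℝ 1 f)
    (hs : HasCompactSupport f) (v : G) : Integrable (fun y => fderiv ℝ f y v) μ :=
  ((hf.continuous_fderiv one_ne_zero).clm_apply continuous_const).integrable_of_hasCompactSupport
    (hs.fderiv_apply ℝ v)

theorem integral_fderiv_eq_zero {f : G → X} (hf : ContDiff ℝ 1 f) (hs : HasCompactSupport f)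
    (v : G) : ∫ y, fderiv ℝ f y v ∂μ = 0 := by
  have h := integral_smul_fderiv_eq_neg_fderiv_smul_of_integrable (μ := μ) (𝕜 := ℝ)
    (f := fun _ : G => (1 : ℝ)) (g := f) (v := v) (by simp) (by
      simpa using integrable_fderiv_of_hasCompactSupport μ hf hs v) (by
      simpa using hf.continuous.integrable_of_hasCompactSupport hs)
    (fun x _ => differentiableAt_const _) (fun x _ => hf.differentiable one_ne_zero x)
  simpa using h

/-- Every term of `dθ` is, up to sign, a directional derivative of a compactly supported `C¹`
function, and such derivatives integrate to zero. -/
theorem integral_extDeriv_eq_zero {m : ℕ} {θ : G → G [⋀^Fin m]→L[ℝ] X} (hd : Differentiable ℝ θ)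
    (hc : ∀ w, ContDiff ℝ 1 fun y => θ y w) (hs : HasCompactSupport θ) (v : Fin (m + 1) → G) :
    ∫ y, extDeriv θ y v ∂μ = 0 := by
  have hsw : ∀ w, HasCompactSupport fun y => θ y w := fun w =>
    hs.comp_left (g := fun a : G [⋀^Fin m]→L[ℝ] X => a w) rfl
  simp_rw [extDeriv_apply (hd _)]
  rw [integral_finset_sum]
  · refine Finset.sum_eq_zero fun i _ => ?_
    have := integral_fderiv_eq_zero μ (hc (i.removeNth v)) (hsw _) (v i)
    rcases neg_one_pow_eq_or ℤ (i : ℕ) with h | h <;> simp [h, integral_neg, this]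
  · intro i _
    have := integrable_fderiv_of_hasCompactSupport μ (hc (i.removeNth v)) (hsw _) (v i)
    rcases neg_one_pow_eq_or ℤ (i : ℕ) with h | h
    · simpa [h] using this
    · simpa [h] using this.neg

end IntegralDeriv

/-! ### The sign of a chart relative to the orientation -/

section Orientation

variable {V : Type*} [NormedAddCommGroup V] [InnerProductSpace ℝ V] [FiniteDimensional ℝ V]

/-- The functional on `d`-vectors dual to `v₁ ∧ ⋯ ∧ v_d`. -/
def dualVec {d : ℕ} (v : Fin d → V) : ⋀[ℝ]^d V →ₗ[ℝ] ℝ :=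
  exteriorPower.alternatingMapLinearEquiv
    ((Matrix.detRowAlternating (n := Fin d) (R := ℝ)).compLinearMap
      (LinearMap.pi fun i => innerₛₗ ℝ (v i)))

theorem dualVec_ιMulti {d : ℕ} (v w : Fin d → V) :
    dualVec v (exteriorPower.ιMulti ℝ d w) = Matrix.det (Matrix.of fun i j => ⟪v j, w i⟫) := by
  simp only [dualVec, exteriorPower.alternatingMapLinearEquiv_apply_ιMulti,
    AlternatingMap.compLinearMap_apply]
  rfl

/-- The coordinate `d`-vector is `δ τ` with `|δ|` the Jacobian. Pairing with the functional dual to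
`τ (g y₀)` is continuous and nonzero at `y₀` for both vectors, so the sign of `δ` is constant
nearby. -/
theorem IsParametrization.exists_orientation {d : ℕ} {M : Set V} {τ : V → ⋀[ℝ]^d V}
    (hτ : IsOrientingField d M τ) {g : EuclideanSpace ℝ (Fin d) → V}
    {B : Set (EuclideanSpace ℝ (Fin d))} (hg : IsParametrization M g B)
    (hgM : MapsTo g B M) {y₀ : EuclideanSpace ℝ (Fin d)} (hy₀ : y₀ ∈ B) :
    ∃ s : ℝ, s * s = 1 ∧ ∀ᶠ y in 𝓝 y₀, y ∈ B ∧
      exteriorPower.ιMulti ℝ d (fun i => fderiv ℝ g y (EuclideanSpace.basisFun (Fin d) ℝ i)) =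
        (s * jacobian g y) • τ (g y) := by
  have hδ : ∀ y ∈ B, ∃ δ : ℝ, |δ| = jacobian g y ∧
      exteriorPower.ιMulti ℝ d (fun i => fderiv ℝ g y (EuclideanSpace.basisFun (Fin d) ℝ i)) =
        δ • τ (g y) := fun y hy => by
    obtain ⟨v, hv, hvt, hτv⟩ := hτ.1 (g y) (hgM hy)
    rw [hτv]
    exact exists_ιMulti_map_eq_smul (fderiv ℝ g y).toLinearMap (hg.injective_fderiv y hy) hv
      fun i => hg.tangentCone_subset y hy (hvt i)
  choose! δ hδJ hδτ using hδ
  obtain ⟨v, hv, -, hτv⟩ := hτ.1 (g y₀) (hgM hy₀)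
  set φ := dualVec v
  have hφ₀ : φ (τ (g y₀)) = 1 := by
    rw [hτv, dualVec_ιMulti]
    have : (Matrix.of fun i j => ⟪v j, v i⟫) = (1 : Matrix (Fin d) (Fin d) ℝ) := by
      ext i j
      rw [Matrix.of_apply, orthonormal_iff_ite.1 hv, Matrix.one_apply]
      simp [eq_comm]
    rw [this, Matrix.det_one]
  have hBn := hg.isOpen.mem_nhds hy₀
  have h1 : ContinuousAt (fun y => φ (τ (g y))) y₀ :=
    ((hτ.2 φ).comp hg.contDiffOn.continuousOn hgM).continuousAt hBn
  set c : EuclideanSpace ℝ (Fin d) → ℝ := fun y => φ (exteriorPower.ιMulti ℝ d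
    (fun i => fderiv ℝ g y (EuclideanSpace.basisFun (Fin d) ℝ i))) with hc
  have h2 : ContinuousAt c y₀ := by
    have hDg := hg.continuousOn_fderiv.continuousAt hBn
    have hD : ∀ i, ContinuousAt
        (fun y => fderiv ℝ g y (EuclideanSpace.basisFun (Fin d) ℝ i)) y₀ :=
      fun i => hDg.clm_apply continuousAt_const
    have hij : ∀ i j, ContinuousAt
        (fun y => ⟪v j, fderiv ℝ g y (EuclideanSpace.basisFun (Fin d) ℝ i)⟫) y₀ :=
      fun i j => continuousAt_const.inner (hD i)
    simp only [hc, φ, dualVec_ιMulti]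
    refine ContinuousAt.comp (g := Matrix.det) (Continuous.matrix_det continuous_id).continuousAt ?_
    exact continuousAt_pi.2 fun i => continuousAt_pi.2 fun j => hij i j
  have hcδ : ∀ y ∈ B, c y = δ y * φ (τ (g y)) := fun y hy => by
    rw [hc]; simp only; rw [hδτ y hy, map_smul, smul_eq_mul]
  have hpos : ∀ᶠ y in 𝓝 y₀, 0 < φ (τ (g y)) :=
    h1.eventually (lt_mem_nhds (by simp only [hφ₀]; exact one_pos))
  have hc₀ : c y₀ ≠ 0 := by
    rw [hcδ y₀ hy₀, hφ₀, mul_one, ← abs_ne_zero, hδJ y₀ hy₀]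
    exact (hg.jacobian_pos hy₀).ne'
  rcases lt_or_gt_of_ne hc₀ with hneg | hpos'
  · refine ⟨-1, by norm_num, ?_⟩
    filter_upwards [hBn, hpos, h2.eventually (gt_mem_nhds hneg)] with y hy hp hcy
    refine ⟨hy, ?_⟩
    rw [hcδ y hy] at hcy
    have : δ y < 0 := by
      by_contra hcon
      exact absurd hcy (not_lt.2 (mul_nonneg (not_lt.1 hcon) hp.le))
    rw [hδτ y hy, ← hδJ y hy, abs_of_neg this, neg_mul_neg, one_mul]
  · refine ⟨1, by norm_num, ?_⟩
    filter_upwards [hBn, hpos, h2.eventually (lt_mem_nhds hpos')] with y hy hp hcy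
    refine ⟨hy, ?_⟩
    rw [hcδ y hy] at hcy
    rw [hδτ y hy, ← hδJ y hy, abs_of_pos (pos_of_mul_pos_left hcy hp.le), one_mul]

end Orientation

end

noncomputable section

/-! ### Stokes' theorem on a compact submanifold and `∂M̃ = 0` -/

section Stokes

variable {V : Type*} [NormedAddCommGroup V] [InnerProductSpace ℝ V] [FiniteDimensional ℝ V]
  {X : Type*} [NormedAddCommGroup X] [NormedSpace ℝ X]

theorem extDeriv_fun_zero {G : Type*} [NormedAddCommGroup G] [NormedSpace ℝ G] {m : ℕ} (x : G) :
    extDeriv (fun _ : G => (0 : G [⋀^Fin m]→L[ℝ] X)) x = 0 := by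
  ext v
  rw [extDeriv_apply (differentiableAt_const _)]
  simp

theorem extDeriv_fun_sum {G : Type*} [NormedAddCommGroup G] [NormedSpace ℝ G] {m : ℕ} {x : G}
    {ι : Type*} (s : Finset ι) {ψ : ι → G → G [⋀^Fin m]→L[ℝ] X}
    (h : ∀ i ∈ s, DifferentiableAt ℝ (ψ i) x) :
    extDeriv (fun y => ∑ i ∈ s, ψ i y) x = ∑ i ∈ s, extDeriv (ψ i) x := by
  classical
  induction s using Finset.induction_on with
  | empty => simpa using extDeriv_fun_zero x
  | insert i s hi ih =>
    simp only [Finset.sum_insert hi]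
    rw [extDeriv_fun_add (h i (Finset.mem_insert_self _ _))
      (DifferentiableAt.fun_sum fun j hj => h j (Finset.mem_insert_of_mem hj)),
      ih fun j hj => h j (Finset.mem_insert_of_mem hj)]

/-- Evaluation of forms at a fixed `d`-vector. -/
def formEvalCLM (X : Type*) [NormedAddCommGroup X] [NormedSpace ℝ X] {d : ℕ} (α : ⋀[ℝ]^d V) :
    (V [⋀^Fin d]→L[ℝ] X) →L[ℝ] X :=
  LinearMap.mkContinuous
    { toFun := fun φ => formEval φ α
      map_add' := fun φ ψ => by rw [formEval_add]; rfl
      map_smul' := fun c φ => by rw [formEval_smul]; rfl }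
    (kvMass α) fun φ => by rw [mul_comm]; exact norm_formEval_le φ α

theorem formEvalCLM_apply {d : ℕ} (α : ⋀[ℝ]^d V) (φ : V [⋀^Fin d]→L[ℝ] X) :
    formEvalCLM X α φ = formEval φ α := rfl

theorem ContinuousOn.formEval_comp {d : ℕ} {M : Set V} {τ : V → ⋀[ℝ]^d V}
    (hτ : IsOrientingField d M τ) {Z : Type*} [TopologicalSpace Z] {K : Set Z} {π : Z → V}
    (hπ : ContinuousOn π K) (hπM : MapsTo π K M) {φ : Z → V [⋀^Fin d]→L[ℝ] X}
    (hφ : ContinuousOn φ K) : ContinuousOn (fun z => _root_.formEval (φ z) (τ (π z))) K := by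
  let b := Module.finBasis ℝ (⋀[ℝ]^d V)
  have h : (fun z => _root_.formEval (φ z) (τ (π z))) =
      fun z => ∑ i, b.coord i (τ (π z)) • _root_.formEval (φ z) (b i) := by
    funext z
    conv_lhs => rw [← b.sum_repr (τ (π z)), map_sum]
    exact Finset.sum_congr rfl fun i _ => map_smul _ _ _
  rw [h]
  exact continuousOn_finset_sum _ fun i _ => ((hτ.2 (b.coord i)).comp hπ hπM).smul
    ((formEvalCLM X (b i)).continuous.comp_continuousOn hφ)

theorem ContinuousOn.formEval {d : ℕ} {M : Set V} {τ : V → ⋀[ℝ]^d V} (hτ : IsOrientingField d M τ)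
    {φ : V → V [⋀^Fin d]→L[ℝ] X} (hφ : ContinuousOn φ M) :
    ContinuousOn (fun x => _root_.formEval (φ x) (τ x)) M :=
  ContinuousOn.formEval_comp hτ continuousOn_id (mapsTo_id M) hφ

variable [MeasurableSpace V] [BorelSpace V]

theorem IsEmbeddedSubmanifold.euclideanHausdorffMeasure_lt_top {d : ℕ} {M : Set V}
    (hM : IsEmbeddedSubmanifold d M) (hMc : IsCompact M) : (μHE[d] : Measure V) M < ⊤ := by
  refine hMc.measure_lt_top_of_nhdsWithin fun p hp => ?_
  obtain ⟨g, R, hR, hgp, hg⟩ := hM.exists_isParametrization hp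
  have h0 : (0 : EuclideanSpace ℝ (Fin d)) ∈ Metric.ball 0 R := Metric.mem_ball_self hR
  obtain ⟨W, hW, hcmp⟩ := (hg.hasStrictFDerivAt h0).exists_euclideanHausdorffMeasure_image
    finrank_euclideanSpace_fin (hg.injective_fderiv 0 h0) one_pos
  obtain ⟨r, hr, hrW⟩ := Metric.mem_nhds_iff.1 (inter_mem hW (Metric.ball_mem_nhds _ hR))
  obtain ⟨O, hO, hgO⟩ := hg.exists_isOpen (Metric.ball 0 r) (fun y hy => (hrW hy).2)
    Metric.isOpen_ball
  have hpO : p ∈ M ∩ O := by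
    rw [← hgO]
    exact ⟨0, Metric.mem_ball_self hr, hgp⟩
  refine ⟨M ∩ O, inter_mem_nhdsWithin _ (hO.mem_nhds hpO.2), ?_⟩
  rw [← hgO]
  refine (hcmp (Metric.ball 0 r) fun y hy => (hrW hy).1).1.trans_lt ?_
  have := measure_ball_lt_top (μ := (volume : Measure (EuclideanSpace ℝ (Fin d)))) (x := 0) (r := r)
  finiteness

theorem IsOrientingField.integrableOn_formEval {d : ℕ} {M : Set V} {τ : V → ⋀[ℝ]^d V}
    (hM : IsEmbeddedSubmanifold d M) (hMc : IsCompact M) (hτ : IsOrientingField d M τ)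
    {φ : V → V [⋀^Fin d]→L[ℝ] X} (hφ : ContinuousOn φ M) :
    IntegrableOn (fun x => formEval (φ x) (τ x)) M (μHE[d] : Measure V) := by
  have hc := hφ.formEval hτ
  obtain ⟨C, hC⟩ := hMc.exists_bound_of_continuousOn hc
  haveI : IsFiniteMeasure ((μHE[d] : Measure V).restrict M) :=
    ⟨by simpa using hM.euclideanHausdorffMeasure_lt_top hMc⟩
  exact Integrable.of_bound (hc.aestronglyMeasurable_of_isCompact hMc hMc.measurableSet) C
    (ae_restrict_of_forall_mem hMc.measurableSet hC)

/-- In a chart the integrand becomes `d` of the pulled-back form, extended by zero to all of `ℝᵐ⁺¹`,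
where the integral of a compactly supported exact form vanishes. -/
theorem IsOrientingField.exists_stokes_nhds {m : ℕ} {M : Set V} {τ : V → ⋀[ℝ]^(m + 1) V}
    (hM : IsEmbeddedSubmanifold (m + 1) M) (hMc : IsCompact M) (hτ : IsOrientingField (m + 1) M τ)
    {p : V} (hp : p ∈ M) :
    ∃ O : Set V, IsOpen O ∧ p ∈ O ∧ ∀ ψ : V → V [⋀^Fin m]→L[ℝ] X,
      (∀ x ∈ M, ContDiffAt ℝ 1 ψ x) → tsupport ψ ⊆ O →
        ∫ x in M, formEval (extDeriv ψ x) (τ x) ∂(μHE[m + 1] : Measure V) = 0 := by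
  obtain ⟨g, R, hR, hgp, hg⟩ := hM.exists_isParametrization hp
  have hgM : MapsTo g (Metric.ball 0 R) M := fun y hy => by
    obtain ⟨O, -, h⟩ := hg.exists_isOpen _ Subset.rfl Metric.isOpen_ball
    exact (h ▸ mem_image_of_mem g hy : g y ∈ M ∩ O).1
  obtain ⟨s, hs, hev⟩ := hg.exists_orientation hτ hgM (Metric.mem_ball_self hR)
  obtain ⟨r, hr, hrB⟩ := Metric.mem_nhds_iff.1 hev
  have hrR : Metric.ball (0 : EuclideanSpace ℝ (Fin (m + 1))) r ⊆ Metric.ball 0 R :=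
    fun y hy => (hrB hy).1
  have hgr := hg.mono Metric.isOpen_ball hrR
  have hhalf : Metric.ball (0 : EuclideanSpace ℝ (Fin (m + 1))) (r / 2) ⊆ Metric.ball 0 r :=
    Metric.ball_subset_ball (by linarith)
  -- `O` cuts out the image of the half ball only. A form supported in `O` then pulls back to zero
  -- on the outer half of `B`, and the extension by zero is smooth.
  obtain ⟨O, hO, hgO⟩ := hgr.exists_isOpen _ hhalf Metric.isOpen_ball
  have hpO : p ∈ M ∩ O := by
    rw [← hgO]
    exact ⟨0, Metric.mem_ball_self (by linarith), hgp⟩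
  refine ⟨O, hO, hpO.2, fun ψ hψ hsupp => ?_⟩
  set e := EuclideanSpace.basisFun (Fin (m + 1)) ℝ
  set B := Metric.ball (0 : EuclideanSpace ℝ (Fin (m + 1))) r
  have hzero : ∀ x ∈ M, x ∉ g '' B → extDeriv ψ x = 0 := by
    intro x hx hxg
    have hxO : x ∉ O := fun h => hxg (image_mono hhalf (hgO ▸ ⟨hx, h⟩))
    have : ψ =ᶠ[𝓝 x] fun _ => 0 := notMem_tsupport_iff_eventuallyEq.1 fun h => hxO (hsupp h)
    rw [this.extDeriv_eq, extDeriv_fun_zero]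
  have h1 : ∫ x in M, formEval (extDeriv ψ x) (τ x) ∂(μHE[m + 1] : Measure V) =
      ∫ x in g '' B, formEval (extDeriv ψ x) (τ x) ∂(μHE[m + 1] : Measure V) := by
    refine setIntegral_eq_of_subset_of_forall_diff_eq_zero hMc.measurableSet
      (image_subset_iff.2 fun y hy => hgM (hrR hy)) fun x hx => ?_
    rw [hzero x hx.1 hx.2]
    exact congrArg (fun L : ⋀[ℝ]^(m + 1) V →ₗ[ℝ] X => L (τ x)) (by
      have := formEval_smul (0 : ℝ) (extDeriv ψ x)
      simpa using this)
  rw [h1, hgr.setIntegral_image]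
  set θ₀ : EuclideanSpace ℝ (Fin (m + 1)) → EuclideanSpace ℝ (Fin (m + 1)) [⋀^Fin m]→L[ℝ] X :=
    fun y => (ψ (g y)).compContinuousLinearMap (fderiv ℝ g y) with hθ₀
  set θ := B.indicator θ₀ with hθ
  have hgy : ∀ y ∈ B, ContDiffAt ℝ ∞ g y := fun y hy =>
    hgr.contDiffOn.contDiffAt (hgr.isOpen.mem_nhds hy)
  have hψd : ∀ y ∈ B, DifferentiableAt ℝ ψ (g y) := fun y hy =>
    (hψ _ (hgM (hrR hy))).differentiableAt one_ne_zero
  have hev1 : ∀ y ∈ B, θ =ᶠ[𝓝 y] θ₀ := fun y hy =>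
    Filter.eventuallyEq_of_mem (hgr.isOpen.mem_nhds hy) fun z hz => indicator_of_mem hz _
  have hθ0 : ∀ y, y ∉ Metric.ball (0 : EuclideanSpace ℝ (Fin (m + 1))) (r / 2) → θ y = 0 := by
    intro y hy
    by_cases hyB : y ∈ B
    · have hgyO : g y ∉ O := fun h => by
        have : g y ∈ g '' Metric.ball 0 (r / 2) := hgO ▸ ⟨hgM (hrR hyB), h⟩
        obtain ⟨z, hz, hzy⟩ := this
        exact hy (hgr.injOn (hhalf hz) hyB hzy ▸ hz)
      rw [hθ, indicator_of_mem hyB, hθ₀]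
      simp only
      rw [image_eq_zero_of_notMem_tsupport fun h => hgyO (hsupp h)]
      rfl
    · exact indicator_of_notMem hyB _
  have hev2 : ∀ y ∉ B, θ =ᶠ[𝓝 y] fun _ => 0 := fun y hy => by
    refine Filter.eventuallyEq_of_mem (Metric.isClosed_closedBall.isOpen_compl.mem_nhds
      (show y ∈ (Metric.closedBall 0 (r / 2))ᶜ from ?_)) fun z hz => hθ0 z fun h =>
        hz (Metric.ball_subset_closedBall h)
    intro h
    rw [Metric.mem_closedBall] at h
    rw [Metric.mem_ball] at hy
    linarith
  have hθd : Differentiable ℝ θ := fun y => by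
    by_cases hyB : y ∈ B
    · refine DifferentiableAt.congr_of_eventuallyEq ?_ (hev1 y hyB)
      have hfd : ContDiffAt ℝ 1 (fderiv ℝ g) y := (hgy y hyB).fderiv_right (by norm_cast)
      exact (((hψd y hyB).hasFDerivAt.comp y ((hgy y hyB).differentiableAt (by simp)).hasFDerivAt)
        |>.continuousAlternatingMapCompContinuousLinearMap
        (hfd.differentiableAt one_ne_zero).hasFDerivAt).differentiableAt
    · exact (differentiableAt_const _).congr_of_eventuallyEq (hev2 y hyB)
  have hθc : ∀ w, ContDiff ℝ 1 fun y => θ y w := fun w => contDiff_iff_contDiffAt.2 fun y => by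
    by_cases hyB : y ∈ B
    · have : (fun y => θ y w) =ᶠ[𝓝 y] fun y => ψ (g y) fun i => fderiv ℝ g y (w i) :=
        (hev1 y hyB).mono fun z hz => by
          simp only [hz]
          rfl
      refine ContDiffAt.congr_of_eventuallyEq ?_ this
      have hfd : ContDiffAt ℝ 1 (fderiv ℝ g) y := (hgy y hyB).fderiv_right (by norm_cast)
      exact ((hψ _ (hgM (hrR hyB))).comp y ((hgy y hyB).of_le (by norm_cast))).alternating_apply
        fun i => hfd.clm_apply contDiffAt_const
    · have : (fun y => θ y w) =ᶠ[𝓝 y] fun y => 0 := (hev2 y hyB).mono fun z hz => by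
        simp only [hz]
        rfl
      exact contDiffAt_const.congr_of_eventuallyEq this
  have hθs : HasCompactSupport θ :=
    HasCompactSupport.intro (isCompact_closedBall 0 (r / 2)) fun y hy => hθ0 y fun h =>
      hy (Metric.ball_subset_closedBall h)
  -- The coordinate vector is `s J τ` with `s ^ 2 = 1`, so `J τ` is `s` times it.
  have h2 : ∀ y ∈ B, jacobian g y • formEval (extDeriv ψ (g y)) (τ (g y)) =
      s • extDeriv θ y fun i => e i := by
    intro y hy
    have h3 := extDeriv_pullback (r := ∞) (hψd y hy) (hgy y hy) (by simpa using two_le_infty)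
    rw [(hev1 y hy).extDeriv_eq]
    refine Eq.trans ?_ (congrArg (fun a => s • a fun i => e i) h3).symm
    have h4 := congrArg (formEval (extDeriv ψ (g y))) (hrB hy).2
    rw [formEval_ιMulti, map_smul] at h4
    change _ = s • extDeriv ψ (g y) fun i => fderiv ℝ g y (e i)
    rw [h4, smul_smul, ← mul_assoc, hs, one_mul]
  rw [setIntegral_congr_fun hgr.isOpen.measurableSet h2, integral_smul]
  have h5 : ∫ y in B, extDeriv θ y (fun i => e i) = ∫ y, extDeriv θ y fun i => e i := by
    refine setIntegral_eq_integral_of_forall_compl_eq_zero fun y hy => ?_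
    rw [(hev2 y hy).extDeriv_eq, extDeriv_fun_zero]
    rfl
  rw [h5, integral_extDeriv_eq_zero volume hθd hθc hθs, smul_zero]

theorem formEval_sum {k : ℕ} {ι : Type*} (s : Finset ι) (φ : ι → V [⋀^Fin k]→L[ℝ] X)
    (α : ⋀[ℝ]^k V) : formEval (∑ i ∈ s, φ i) α = ∑ i ∈ s, formEval (φ i) α := by
  have : formEval (∑ i ∈ s, φ i) = ∑ i ∈ s, formEval (φ i) :=
    kvector_hom_ext fun v => by simp
  rw [this, LinearMap.sum_apply]

theorem ContDiffAt.continuousAt_extDeriv {m : ℕ} {ψ : V → V [⋀^Fin m]→L[ℝ] X} {x : V}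
    (h : ContDiffAt ℝ 1 ψ x) : ContinuousAt (extDeriv ψ) x := by
  have h1 : ContinuousAt (fderiv ℝ ψ) x :=
    (h.fderiv_right (m := 0) (by norm_num)).continuousAt
  exact (ContinuousAlternatingMap.alternatizeUncurryFinCLM ℝ V X).continuous.continuousAt.comp h1

/-- **Stokes' theorem** for a compact submanifold without boundary. -/
theorem IsOrientingField.integral_extDeriv_eq_zero {m : ℕ} {M : Set V} {τ : V → ⋀[ℝ]^(m + 1) V}
    (hM : IsEmbeddedSubmanifold (m + 1) M) (hMc : IsCompact M) (hτ : IsOrientingField (m + 1) M τ)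
    {φ : V → V [⋀^Fin m]→L[ℝ] X} (hφ : ∀ x ∈ M, ContDiffAt ℝ 1 φ x) :
    ∫ x in M, formEval (extDeriv φ x) (τ x) ∂(μHE[m + 1] : Measure V) = 0 := by
  choose! O hO hpO hst using fun p (hp : p ∈ M) => hτ.exists_stokes_nhds (X := X) hM hMc hp
  obtain ⟨t, htM, hcov⟩ := hMc.elim_nhds_subcover O fun p hp => (hO p hp).mem_nhds (hpO p hp)
  have hUo : IsOpen (⋃ p ∈ t, O p) := isOpen_biUnion fun p hp => hO p (htM p hp)
  obtain ⟨δ, hδ, hthick⟩ := hMc.exists_cthickening_subset_open hUo hcov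
  -- The partition is taken over a thickening of `M`, so the sum is `1` near every point of `M` and
  -- the decomposition may be differentiated.
  obtain ⟨f, hf⟩ := SmoothPartitionOfUnity.exists_isSubordinate (modelWithCornersSelf ℝ V)
    (Metric.isClosed_cthickening (δ := δ) (E := M)) (fun p : t => O p)
    (fun p => hO p (htM p p.2)) (by
      refine hthick.trans fun x hx => ?_
      obtain ⟨p, hp, hxp⟩ := mem_iUnion₂.1 hx
      exact mem_iUnion.2 ⟨⟨p, hp⟩, hxp⟩)
  set ψ : t → V → V [⋀^Fin m]→L[ℝ] X := fun i x => f i x • φ x with hψ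
  have hψc : ∀ i, ∀ x ∈ M, ContDiffAt ℝ 1 (ψ i) x := fun i x hx =>
    ((f i).contMDiff.contDiff.contDiffAt.of_le (by norm_cast)).smul (hφ x hx)
  have hsum : ∀ x ∈ M, extDeriv φ x = ∑ i, extDeriv (ψ i) x := by
    intro x hx
    have hev : φ =ᶠ[𝓝 x] fun y => ∑ i, ψ i y := by
      have hn : Metric.thickening δ M ∈ 𝓝 x :=
        Metric.isOpen_thickening.mem_nhds (Metric.self_subset_thickening hδ M hx)
      refine Filter.eventuallyEq_of_mem hn fun y hy => ?_
      have h1 := f.sum_eq_one (Metric.thickening_subset_cthickening δ M hy)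
      rw [finsum_eq_sum_of_fintype] at h1
      simp only [hψ]
      rw [← Finset.sum_smul, h1, one_smul]
    rw [hev.extDeriv_eq, extDeriv_fun_sum _ fun i _ => (hψc i x hx).differentiableAt one_ne_zero]
  rw [setIntegral_congr_fun hMc.measurableSet (g := fun x => ∑ i, formEval (extDeriv (ψ i) x) (τ x))
    fun x hx => by simp only [hsum x hx, formEval_sum], integral_finset_sum]
  · refine Finset.sum_eq_zero fun i _ => hst i (htM i i.2) (ψ i) (hψc i) ?_
    exact (tsupport_smul_subset_left _ _).trans (hf i)
  · intro i _
    exact hτ.integrableOn_formEval hM hMc fun x hx =>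
      (hψc i x hx).continuousAt_extDeriv.continuousWithinAt

/-- The boundary of the chain of a compact submanifold without boundary vanishes. -/
theorem chainBoundary_submanifoldChain {m : ℕ} {M U : Set V} {τ : V → ⋀[ℝ]^(m + 1) V}
    (hM : IsEmbeddedSubmanifold (m + 1) M) (hMc : IsCompact M) (hτ : IsOrientingField (m + 1) M τ)
    (hUo : IsOpen U) (hUc : Convex ℝ U) (hMU : M ⊆ U) :
    chainBoundary (submanifoldChain U M τ) = (0 : DiffChain U m 2) := by
  obtain ⟨T, hT, hTv⟩ := exists_chainBoundary (V := V) (k := m) hUo hUc (le_refl 1)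
  obtain ⟨c, -, hct, hc⟩ := exists_normHausdorff_eq_smul V (m + 1)
  have h1 : ∀ p ∈ M, kElement U 1 p (τ p) = formEval (univForm U (m + 1) 1 p) (τ p) := fun p hp => by
    rw [formEval_univForm]
    rfl
  -- The boundary map turns the universal `(m+1)`-form into `d` of the universal `m`-form of class
  -- `2`, which is `C¹`; `∂M̃` is then an integral of an exact chain-valued form over `M`.
  have h2 : ∀ p ∈ M, T (formEval (univForm U (m + 1) 1 p) (τ p)) =
      formEval (extDeriv (univForm U m 2) p) (τ p) := fun p hp => by
    obtain ⟨v, -, -, hv⟩ := hτ.1 p hp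
    rw [hv, formEval_ιMulti, formEval_ιMulti]
    exact hTv p (hMU hp) v
  have hint := hτ.integrableOn_formEval hM hMc
    (((hasDiffBound_univForm hUc (m + 1) 1).continuousOn le_rfl).mono hMU)
  have hC1 := (hasDiffBound_univForm hUc m 2).isBoundedC1 hUo hUc zero_le_one
  have hC : ContDiffOn ℝ (0 + 1) (univForm U m 2) U :=
    (contDiffOn_succ_iff_fderiv_of_isOpen hUo).2
      ⟨fun x hx => (hC1.1 x hx).differentiableWithinAt, by simp, contDiffOn_zero.2 hC1.2.1⟩
  rw [hT, submanifoldChain, hc, Measure.restrict_smul, integral_smul_measure,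
    setIntegral_congr_fun hMc.measurableSet h1, map_smul, ← T.integral_comp_comm hint,
    setIntegral_congr_fun hMc.measurableSet h2,
    hτ.integral_extDeriv_eq_zero hM hMc fun x hx => ?_, smul_zero]
  simpa using hC.contDiffAt (hUo.mem_nhds (hMU hx))

end Stokes

end

noncomputable section

/-! ### Connected components as compact oriented submanifolds -/

section Components

variable {V : Type*} [NormedAddCommGroup V] [InnerProductSpace ℝ V] [FiniteDimensional ℝ V]

theorem IsEmbeddedSubmanifold.exists_isOpen_inter_connectedComponentIn {d : ℕ} {M : Set V}
    (hM : IsEmbeddedSubmanifold d M) {p : V} (hp : p ∈ M) :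
    ∃ O : Set V, IsOpen O ∧ p ∈ O ∧ ∀ y ∈ M ∩ O, M ∩ O ⊆ connectedComponentIn M y := by
  obtain ⟨g, R, hR, hgp, hg⟩ := hM.exists_isParametrization hp
  obtain ⟨O, hO, hgO⟩ := hg.exists_isOpen _ Subset.rfl Metric.isOpen_ball
  have hpO : p ∈ M ∩ O := hgO ▸ ⟨0, Metric.mem_ball_self hR, hgp⟩
  refine ⟨O, hO, hpO.2, fun y hy => IsPreconnected.subset_connectedComponentIn ?_ hy
    inter_subset_left⟩
  rw [← hgO]
  exact (convex_ball _ _).isPreconnected.image g hg.contDiffOn.continuousOn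

/-- A connected component of a submanifold is the intersection of the submanifold with an open set
and with a closed set. -/
theorem IsEmbeddedSubmanifold.exists_isOpen_connectedComponentIn {d : ℕ} {M : Set V}
    (hM : IsEmbeddedSubmanifold d M) (x : V) :
    (∃ O, IsOpen O ∧ connectedComponentIn M x = M ∩ O) ∧
      ∃ O, IsOpen O ∧ connectedComponentIn M x = M \ O := by
  choose! O hO hpO hsub using
    fun p (hp : p ∈ M) => hM.exists_isOpen_inter_connectedComponentIn hp
  have key : ∀ p ∈ M, ∀ y ∈ M ∩ O p, y ∈ connectedComponentIn M x →
      M ∩ O p ⊆ connectedComponentIn M x := fun p hp y hy hyx =>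
    connectedComponentIn_eq hyx ▸ hsub p hp y hy
  have hNM := connectedComponentIn_subset M x
  refine ⟨⟨⋃ p ∈ connectedComponentIn M x, O p, isOpen_biUnion fun p hp => hO p (hNM hp), ?_⟩,
    ⋃ p ∈ M \ connectedComponentIn M x, O p, isOpen_biUnion fun p hp => hO p hp.1, ?_⟩
  · ext y
    simp only [mem_inter_iff, mem_iUnion, exists_prop]
    refine ⟨fun hy => ⟨hNM hy, y, hy, hpO y (hNM hy)⟩, ?_⟩
    rintro ⟨hy, p, hp, hyp⟩
    exact key p (hNM hp) p ⟨hNM hp, hpO p (hNM hp)⟩ hp ⟨hy, hyp⟩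
  · ext y
    simp only [mem_diff, mem_iUnion, exists_prop, not_exists, not_and]
    refine ⟨fun hy => ⟨hNM hy, fun p hp hyp => hp.2 ?_⟩, ?_⟩
    · exact key p hp.1 y ⟨hNM hy, hyp⟩ hy ⟨hp.1, hpO p hp.1⟩
    · rintro ⟨hy, h⟩
      by_contra hyx
      exact h y ⟨hy, hyx⟩ (hpO y hy)

/-- Components are relatively open in `M`, so this and its analogue for orientations make Stokes
available on each component. -/
theorem IsEmbeddedSubmanifold.inter_isOpen {d : ℕ} {M O : Set V}
    (hM : IsEmbeddedSubmanifold d M) (hO : IsOpen O) : IsEmbeddedSubmanifold d (M ∩ O) := by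
  intro p hp
  obtain ⟨e, L, hpe, he, hes, hL, hLM⟩ := hM p hp.1
  have hsub : (e.restrOpen O hO).source ⊆ e.source := by
    rw [e.restrOpen_source]
    exact inter_subset_left
  refine ⟨e.restrOpen O hO, L, ?_, he.mono hsub, hes.mono ?_, hL, fun x hx => ?_⟩
  · rw [e.restrOpen_source]
    exact ⟨hpe, hp.2⟩
  · intro y hy
    have h1 := hsub ((e.restrOpen O hO).map_target hy)
    have h2 := (e.restrOpen O hO).right_inv hy
    exact h2 ▸ e.map_source h1
  · have hx2 := hx
    rw [e.restrOpen_source] at hx2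
    exact ⟨fun h => (hLM x hx2.1).1 h.1, fun h => ⟨(hLM x hx2.1).2 h, hx2.2⟩⟩

theorem IsOrientingField.inter_isOpen {d : ℕ} {M O : Set V} {τ : V → ⋀[ℝ]^d V}
    (hτ : IsOrientingField d M τ) (hO : IsOpen O) : IsOrientingField d (M ∩ O) τ := by
  refine ⟨fun p hp => ?_, fun φ => (hτ.2 φ).mono inter_subset_left⟩
  rw [tangentConeAt_inter_nhds (hO.mem_nhds hp.2)]
  exact hτ.1 p hp.1

end Components

/-! ### The closed solid angle form -/

section SolidAngle

/-- The determinant as a continuous alternating map. -/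
def volAlt (n : ℕ) : EucSp n [⋀^Fin n]→L[ℝ] ℝ :=
  (EuclideanSpace.basisFun (Fin n) ℝ).toBasis.det.mkContinuous 1 fun v => by
    rw [one_mul, Real.norm_eq_abs, ← volForm_ιMulti]
    exact abs_volForm_ιMulti_le v

theorem volAlt_apply {n : ℕ} (v : Fin n → EucSp n) :
    volAlt n v = (EuclideanSpace.basisFun (Fin n) ℝ).toBasis.det v := rfl

/-- Replacing the `i`-th basis vector by `y` gives determinant `y i`; moving `y` to the front gives
the sign. -/
theorem volAlt_cons_removeNth {k : ℕ} (i : Fin (k + 1)) (y : EucSp (k + 1)) :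
    volAlt (k + 1) (Fin.cons y (i.removeNth (EuclideanSpace.basisFun (Fin (k + 1)) ℝ))) =
      (-1) ^ (i : ℕ) * y i := by
  set b := EuclideanSpace.basisFun (Fin (k + 1)) ℝ with hb
  have h1 : volAlt (k + 1) (Fin.insertNth i y (i.removeNth b)) =
      (-1) ^ (i : ℕ) • volAlt (k + 1) (Fin.cons y (i.removeNth b)) :=
    (volAlt (k + 1)).toAlternatingMap.map_insertNth i y (i.removeNth b)
  have h2 : volAlt (k + 1) (Fin.insertNth i y (i.removeNth b)) = y i := by
    rw [Fin.insertNth_removeNth]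
    have h3 : (volAlt (k + 1)).toAlternatingMap.toMultilinearMap.toLinearMap b i =
        (EuclideanSpace.proj i : EucSp (k + 1) →L[ℝ] ℝ).toLinearMap := by
      refine b.toBasis.ext fun j => ?_
      rw [OrthonormalBasis.coe_toBasis]
      change volAlt (k + 1) (Function.update b i (b j)) = b j i
      rcases eq_or_ne j i with rfl | hj
      · rw [Function.update_eq_self, volAlt_apply, ← hb, ← OrthonormalBasis.coe_toBasis,
          Basis.det_self, OrthonormalBasis.coe_toBasis]
        simp [hb]
      · have : volAlt (k + 1) (Function.update b i (b j)) = 0 :=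
          (volAlt (k + 1)).map_eq_zero_of_eq _ (by simp [hj]) hj
        rw [this]
        simp [hb, hj.symm]
    exact LinearMap.congr_fun h3 y
  rw [h2] at h1
  rw [h1]
  generalize volAlt (k + 1) (Fin.cons y (i.removeNth b)) = c
  rcases Nat.even_or_odd (i : ℕ) with h | h <;> simp [h.neg_one_pow]

theorem hasFDerivAt_norm {V : Type*} [NormedAddCommGroup V] [InnerProductSpace ℝ V] {y : V}
    (hy : y ≠ 0) : HasFDerivAt (fun z : V => ‖z‖) (‖y‖⁻¹ • innerSL ℝ y) y := by
  have hn : ‖y‖ ≠ 0 := norm_ne_zero_iff.2 hy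
  have h := (hasStrictFDerivAt_norm_sq y).hasFDerivAt.sqrt (pow_ne_zero 2 hn)
  simp only [Real.sqrt_sq (norm_nonneg _)] at h
  refine h.congr_fderiv ?_
  ext u
  simp
  field_simp

/-- The form `y ↦ |y|⁻ⁿ (y ⌟ dV)` on `ℝⁿ ∖ 0`, which integrates to solid angles. -/
def solidAngleForm (k : ℕ) (y : EucSp (k + 1)) : EucSp (k + 1) [⋀^Fin k]→L[ℝ] ℝ :=
  (‖y‖ ^ (k + 1))⁻¹ • (volAlt (k + 1)).curryLeft y

theorem contDiffAt_solidAngleForm {k : ℕ} {y : EucSp (k + 1)} (hy : y ≠ 0) :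
    ContDiffAt ℝ ∞ (solidAngleForm k) y := by
  have h1 : ContDiffAt ℝ ∞ (fun y : EucSp (k + 1) => (‖y‖ ^ (k + 1))⁻¹) y :=
    ((contDiffAt_norm ℝ hy).pow _).inv (pow_ne_zero _ (norm_ne_zero_iff.2 hy))
  exact h1.smul (volAlt (k + 1)).curryLeft.contDiff.contDiffAt

/-- The field `y / |y|ⁿ` is divergence free. A top-degree form need only be tested on the standard
basis, where with `n = k + 1` the terms are `|y|⁻ⁿ - n yᵢ² |y|⁻ⁿ⁻²`, with sum zero. -/
theorem extDeriv_solidAngleForm {k : ℕ} {y : EucSp (k + 1)} (hy : y ≠ 0) :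
    extDeriv (solidAngleForm k) y = 0 := by
  set b := EuclideanSpace.basisFun (Fin (k + 1)) ℝ with hb
  ext v
  have h := AlternatingMap.apply_eq_det_smul (extDeriv (solidAngleForm k) y).toAlternatingMap
    b.toBasis v
  refine h.trans ?_
  rw [OrthonormalBasis.coe_toBasis]
  change _ • extDeriv (solidAngleForm k) y b = 0
  rw [extDeriv_apply ((contDiffAt_solidAngleForm hy).differentiableAt (by simp))]
  have hn : ‖y‖ ≠ 0 := norm_ne_zero_iff.2 hy
  have h1 : ∀ i : Fin (k + 1), ((-1 : ℤ) ^ (i : ℕ) •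
      fderiv ℝ (fun z => solidAngleForm k z (i.removeNth b)) y (b i)) =
        (‖y‖ ^ (k + 1))⁻¹ - (k + 1) * y i ^ 2 * (‖y‖ ^ (k + 3))⁻¹ := by
    intro i
    have h2 : (fun z => solidAngleForm k z (i.removeNth b)) =
        fun z => (‖z‖ ^ (k + 1))⁻¹ * ((-1) ^ (i : ℕ) * z i) := by
      funext z
      rw [← volAlt_cons_removeNth]
      rfl
    have h3 := hasFDerivAt_norm hy
    have h4 := h3.pow (k + 1)
    have h5 := (hasDerivAt_inv (pow_ne_zero (k + 1) hn)).comp_hasFDerivAt y h4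
    have h6 := h5.mul (((EuclideanSpace.proj i : EucSp (k + 1) →L[ℝ] ℝ).hasFDerivAt
      (x := y)).const_mul ((-1 : ℝ) ^ (i : ℕ)))
    rw [h2, neg_one_pow_zsmul]
    have h7 : fderiv ℝ (fun z : EucSp (k + 1) => (‖z‖ ^ (k + 1))⁻¹ * ((-1) ^ (i : ℕ) * z i)) y = _ :=
      h6.fderiv
    have hi : ⟪y, b i⟫ = y i := by simp [hb, EuclideanSpace.inner_single_right]
    have hii : (EuclideanSpace.proj i : EucSp (k + 1) →L[ℝ] ℝ) (b i) = 1 := by simp [hb]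
    have hiy : (EuclideanSpace.proj i : EucSp (k + 1) →L[ℝ] ℝ) y = y i := rfl
    rw [h7]
    simp only [ContinuousLinearMap.add_apply, ContinuousLinearMap.smul_apply, innerSL_apply_apply,
      smul_eq_mul, hi, hii, hiy, Function.comp, nsmul_eq_mul]
    have hs : ((-1 : ℝ) ^ (i : ℕ)) * (-1) ^ (i : ℕ) = 1 := by
      rw [← mul_pow]; simp
    generalize (-1 : ℝ) ^ (i : ℕ) = c at hs
    simp only [Nat.add_sub_cancel]
    push_cast
    have h8 : ∀ a d : ℝ, c * (a * (c * 1) + c * y i * d) = c * c * (a + y i * d) := fun a d => by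
      ring
    rw [h8, hs]
    field_simp
    ring
  rw [Finset.sum_congr rfl fun i _ => h1 i, Finset.sum_sub_distrib, ← Finset.sum_mul,
    ← Finset.mul_sum, ← EuclideanSpace.real_norm_sq_eq]
  simp only [Finset.sum_const, Finset.card_univ, Fintype.card_fin, nsmul_eq_mul, smul_eq_mul]
  push_cast
  rw [pow_succ _ (k+1+1), pow_succ _ (k+1)]
  field_simp
  simp

end SolidAngle

end

noncomputable section

/-! ### Closed forms on `ℝ × ℝ × E` -/

section CylinderForms

variable {E : Type*} [NormedAddCommGroup E] [NormedSpace ℝ E]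

/-- Evaluation on tuples of basis vectors embeds the forms linearly in a finite power of `ℝ`, and a
linear left inverse recovers `φ`. -/
theorem contDiffAt_of_alternating_apply {G W : Type*} [NormedAddCommGroup G] [NormedSpace ℝ G]
    [NormedAddCommGroup W] [NormedSpace ℝ W] [FiniteDimensional ℝ W] {k : ℕ} {n : WithTop ℕ∞}
    {φ : G → W [⋀^Fin k]→L[ℝ] ℝ} {y : G} (h : ∀ v, ContDiffAt ℝ n (fun z => φ z v) y) :
    ContDiffAt ℝ n φ y := by
  let b := Module.finBasis ℝ W
  let ev : (W [⋀^Fin k]→L[ℝ] ℝ) →ₗ[ℝ] (Fin k → Fin (finrank ℝ W)) → ℝ :=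
    { toFun := fun φ σ => φ fun i => b (σ i)
      map_add' := fun φ ψ => rfl
      map_smul' := fun c φ => rfl }
  have hev : LinearMap.ker ev = ⊥ := LinearMap.ker_eq_bot.2 fun φ ψ hφψ =>
    ContinuousAlternatingMap.toAlternatingMap_injective
      (b.ext_alternating fun σ _ => congrFun hφψ σ)
  obtain ⟨g, hg⟩ := ev.exists_leftInverse_of_injective hev
  have h1 : φ = fun z => g.toContinuousLinearMap fun σ => φ z fun i => b (σ i) := by
    funext z
    exact (LinearMap.congr_fun hg (φ z)).symm
  rw [h1]
  exact g.toContinuousLinearMap.contDiff.contDiffAt.comp y (contDiffAt_pi.2 fun σ => h _)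

/-- The inclusion of `E` in `ℝ × ℝ × E`. -/
def planeInr (E : Type*) [NormedAddCommGroup E] [NormedSpace ℝ E] : E →L[ℝ] ℝ × ℝ × E :=
  ContinuousLinearMap.inr ℝ ℝ (ℝ × E) ∘L ContinuousLinearMap.inr ℝ ℝ E

theorem planeInr_apply (v : E) : planeInr E v = (0, 0, v) := rfl

/-- Contraction of a form on `ℝ × ℝ × E` with `e`, restricted to `E`. -/
def planeContract (k : ℕ) (e : ℝ × ℝ × E) :
    ((ℝ × ℝ × E) [⋀^Fin (k + 1)]→L[ℝ] ℝ) →L[ℝ] (E [⋀^Fin k]→L[ℝ] ℝ) :=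
  ContinuousAlternatingMap.compContinuousLinearMapCLM (planeInr E) ∘L
    ContinuousLinearMap.apply ℝ _ e ∘L
      (ContinuousAlternatingMap.curryLeftLI (𝕜 := ℝ) (E := ℝ × ℝ × E)
        (F := ℝ) (n := k)).toContinuousLinearMap

theorem planeContract_apply {k : ℕ} (e : ℝ × ℝ × E) (φ : (ℝ × ℝ × E) [⋀^Fin (k + 1)]→L[ℝ] ℝ)
    (v : Fin k → E) :
    planeContract k e φ v = φ (Fin.cons e fun i => planeInr E (v i)) := rfl

/-- Contraction of a form on `ℝ × ℝ × E` with `e` and `e'`, restricted to `E`. -/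
def planeContract₂ (k : ℕ) (e e' : ℝ × ℝ × E) :
    ((ℝ × ℝ × E) [⋀^Fin (k + 2)]→L[ℝ] ℝ) →L[ℝ] (E [⋀^Fin k]→L[ℝ] ℝ) :=
  planeContract k e' ∘L ContinuousLinearMap.apply ℝ _ e ∘L
      (ContinuousAlternatingMap.curryLeftLI (𝕜 := ℝ) (E := ℝ × ℝ × E)
        (F := ℝ) (n := k + 1)).toContinuousLinearMap

theorem hasFDerivAt_planeInr (s t : ℝ) (x : E) :
    HasFDerivAt (fun x : E => (s, t, x)) (planeInr E) x := by
  have h : (fun x : E => (s, t, x)) = fun x => (s, t, 0) + planeInr E x := by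
    funext x
    simp [planeInr_apply]
  rw [h]
  exact (planeInr E).hasFDerivAt.const_add _

/-- Closedness evaluated on `(e, e', v)`: the mixed derivatives of the two contractions differ by an
exact form on `E`, which integrates to zero over a closed submanifold. -/
theorem planeContract_fderiv {m : ℕ} {Ψ : ℝ × ℝ × E → (ℝ × ℝ × E) [⋀^Fin (m + 2)]→L[ℝ] ℝ}
    {s t : ℝ} {x : E} (hΨ : DifferentiableAt ℝ Ψ (s, t, x)) (hcl : extDeriv Ψ (s, t, x) = 0)
    (e e' : ℝ × ℝ × E) :
    planeContract (m + 1) e' (fderiv ℝ Ψ (s, t, x) e) =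
      planeContract (m + 1) e (fderiv ℝ Ψ (s, t, x) e') -
        extDeriv (fun x => planeContract₂ m e e' (Ψ (s, t, x))) x := by
  ext v
  have h1 := congrArg (fun φ => φ (Fin.cons e (Fin.cons e' fun i => planeInr E (v i)))) hcl
  simp only [extDeriv, ContinuousAlternatingMap.alternatizeUncurryFin_apply,
    neg_one_pow_zsmul] at h1
  change _ = (0 : ℝ) at h1
  rw [Fin.sum_univ_succ, Fin.sum_univ_succ] at h1
  simp only [cons_removeNth_succ, Fin.cons_zero, Fin.cons_succ, Fin.val_zero, pow_zero, one_smul,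
    Fin.val_succ, pow_succ, mul_neg, mul_one, neg_smul, neg_neg] at h1
  have h2 : HasFDerivAt (fun x => planeContract₂ m e e' (Ψ (s, t, x)))
      (planeContract₂ m e e' ∘L fderiv ℝ Ψ (s, t, x) ∘L planeInr E) x :=
    (planeContract₂ m e e').hasFDerivAt.comp x (hΨ.hasFDerivAt.comp x (hasFDerivAt_planeInr s t x))
  have h3 : extDeriv (fun x => planeContract₂ m e e' (Ψ (s, t, x))) x v =
      ∑ i : Fin (m + 1), (-1 : ℝ) ^ (i : ℕ) • fderiv ℝ Ψ (s, t, x) (planeInr E (v i))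
        (Fin.cons e (Fin.cons e' (i.removeNth fun i => planeInr E (v i)))) := by
    rw [extDeriv, h2.fderiv, ContinuousAlternatingMap.alternatizeUncurryFin_apply]
    refine Finset.sum_congr rfl fun i _ => ?_
    rw [neg_one_pow_zsmul]
    rfl
  rw [ContinuousAlternatingMap.sub_apply, h3, planeContract_apply, planeContract_apply]
  have h4 : (Fin.removeNth 0 (Fin.cons e (Fin.cons e' fun i => planeInr E (v i)) :
      Fin (m + 3) → ℝ × ℝ × E)) = Fin.cons e' fun i => planeInr E (v i) := by
    simp
  have h5 : (Fin.removeNth 0 (Fin.cons e' fun i => planeInr E (v i) :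
      Fin (m + 2) → ℝ × ℝ × E)) = fun i => planeInr E (v i) := by
    simp
  rw [h4, h5] at h1
  linarith

end CylinderForms

/-! ### Integrability on the product of two intervals and a compact set -/

section ProductIntegral

variable {E : Type*} [NormedAddCommGroup E] [MeasurableSpace E] [BorelSpace E]
  [SecondCountableTopology E]

theorem integrable_prod_of_continuousOn {N : Set E} (hN : IsCompact N) {μ : Measure E}
    [IsFiniteMeasure μ] (hμ : μ.restrict N = μ) {T : ℝ} {f : ℝ × ℝ × E → ℝ}
    (hf : ContinuousOn f (Icc 0 1 ×ˢ Icc 0 T ×ˢ N)) :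
    Integrable f ((volume.restrict (Ioc 0 1)).prod ((volume.restrict (Ioc 0 T)).prod μ)) := by
  have hK : IsCompact (Icc (0 : ℝ) 1 ×ˢ Icc 0 T ×ˢ N) := isCompact_Icc.prod (isCompact_Icc.prod hN)
  obtain ⟨C, hC⟩ := hK.exists_bound_of_continuousOn hf
  have hS : MeasurableSet (Ioc (0 : ℝ) 1 ×ˢ Ioc 0 T ×ˢ N) :=
    measurableSet_Ioc.prod (measurableSet_Ioc.prod hN.measurableSet)
  have hsub : Ioc (0 : ℝ) 1 ×ˢ Ioc 0 T ×ˢ N ⊆ Icc (0 : ℝ) 1 ×ˢ Icc 0 T ×ˢ N :=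
    prod_mono Ioc_subset_Icc_self (prod_mono Ioc_subset_Icc_self Subset.rfl)
  have h1 : ((volume.restrict (Ioc (0 : ℝ) 1)).prod ((volume.restrict (Ioc 0 T)).prod μ)) =
      ((volume.restrict (Ioc (0 : ℝ) 1)).prod ((volume.restrict (Ioc 0 T)).prod μ)).restrict
        (Ioc (0 : ℝ) 1 ×ˢ Ioc 0 T ×ˢ N) := by
    rw [← Measure.prod_restrict, ← Measure.prod_restrict, hμ,
      Measure.restrict_restrict measurableSet_Ioc, inter_self,
      Measure.restrict_restrict measurableSet_Ioc, inter_self]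
  rw [h1]
  refine Integrable.of_bound ((hf.mono hsub).aestronglyMeasurable hS) C ?_
  exact ae_restrict_of_forall_mem hS fun z hz => hC z (hsub hz)

end ProductIntegral

/-! ### Deformation invariance of the Gauss integral -/

section GaussIntegral

variable {E : Type*} [NormedAddCommGroup E] [InnerProductSpace ℝ E] [FiniteDimensional ℝ E]
  [MeasurableSpace E] [BorelSpace E]

/-- Invariance of the integral over `N × [0, T]` of a closed form under deformations which are
closed in `t`, in the case where one end of the deformation is degenerate. -/
theorem integral_planeContract_eq_zero {m : ℕ} {N : Set E} {τ : E → ⋀[ℝ]^(m + 1) E}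
    (hN : IsEmbeddedSubmanifold (m + 1) N) (hNc : IsCompact N) (hτ : IsOrientingField (m + 1) N τ)
    {T : ℝ} (hT : 0 ≤ T) {Ψ : ℝ × ℝ × E → (ℝ × ℝ × E) [⋀^Fin (m + 2)]→L[ℝ] ℝ}
    (hΨ : ∀ s ∈ Icc (0 : ℝ) 1, ∀ t ∈ Icc 0 T, ∀ x ∈ N, ContDiffAt ℝ 1 Ψ (s, t, x))
    (hcl : ∀ s ∈ Icc (0 : ℝ) 1, ∀ t ∈ Icc 0 T, ∀ x ∈ N, extDeriv Ψ (s, t, x) = 0)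
    (h0 : ∀ t ∈ Icc 0 T, ∀ x ∈ N, planeContract (m + 1) (0, 1, 0) (Ψ (0, t, x)) = 0)
    (hper : ∀ s ∈ Icc (0 : ℝ) 1, ∀ x ∈ N, planeContract (m + 1) (1, 0, 0) (Ψ (s, T, x)) =
      planeContract (m + 1) (1, 0, 0) (Ψ (s, 0, x))) :
    ∫ t in (0 : ℝ)..T, ∫ x in N, formEval (planeContract (m + 1) (0, 1, 0) (Ψ (1, t, x))) (τ x)
      ∂(μHE[m + 1] : Measure E) = 0 := by
  set μ : Measure E := (μHE[m + 1] : Measure E).restrict N with hμ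
  haveI : IsFiniteMeasure μ := ⟨by simpa [hμ] using hN.euclideanHausdorffMeasure_lt_top hNc⟩
  have hμN : μ.restrict N = μ := by
    rw [hμ, Measure.restrict_restrict hNc.measurableSet, inter_self]
  set K : Set (ℝ × ℝ × E) := Icc (0 : ℝ) 1 ×ˢ Icc 0 T ×ˢ N with hK
  have hΨK : ∀ z ∈ K, ContDiffAt ℝ 1 Ψ z := fun z hz => hΨ _ hz.1 _ hz.2.1 _ hz.2.2
  have hΨ' : ∀ u, ContinuousOn (fun z => fderiv ℝ Ψ z u) K := fun u z hz =>
    ((((hΨK z hz).fderiv_right (m := 0) (by norm_num)).continuousAt).clm_apply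
      continuousAt_const).continuousWithinAt
  have hπ : ContinuousOn (fun z : ℝ × ℝ × E => z.2.2) K := by fun_prop
  have hπN : MapsTo (fun z : ℝ × ℝ × E => z.2.2) K N := fun z hz => hz.2.2
  set g : ℝ × ℝ × E → ℝ × ℝ × E → ℝ × ℝ × E → ℝ := fun e u z =>
    formEval (planeContract (m + 1) e (fderiv ℝ Ψ z u)) (τ z.2.2) with hg
  have hgc : ∀ e u, ContinuousOn (g e u) K := fun e u => ContinuousOn.formEval_comp hτ hπ hπN
    ((planeContract (m + 1) e).continuous.comp_continuousOn (hΨ' u))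
  have hgi : ∀ e u, Integrable (g e u)
      ((volume.restrict (Ioc 0 1)).prod ((volume.restrict (Ioc 0 T)).prod μ)) := fun e u =>
    integrable_prod_of_continuousOn hNc hμN (hgc e u)
  have hder : ∀ e u : ℝ × ℝ × E, ∀ c : ℝ → ℝ × ℝ × E, ∀ r, c r ∈ K → HasDerivAt c u r →
      ∀ x, (c r).2.2 = x →
      HasDerivAt (fun r => formEval (planeContract (m + 1) e (Ψ (c r))) (τ x)) (g e u (c r)) r := by
    intro e u c r hr hc x hx
    have h1 := ((hΨK _ hr).differentiableAt one_ne_zero).hasFDerivAt.comp_hasDerivAt r hc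
    have h2 := (formEvalCLM ℝ (τ x) ∘L planeContract (m + 1) e).hasFDerivAt.comp_hasDerivAt r h1
    rw [hg]
    simp only [hx]
    exact h2
  set eS : ℝ × ℝ × E := (1, 0, 0)
  set eT : ℝ × ℝ × E := (0, 1, 0)
  -- Integrating in `s` recovers the value at `s = 1`, because the end `s = 0` is degenerate.
  have hS : ∀ t ∈ Icc 0 T, ∀ x ∈ N, ∫ s in Ioc (0 : ℝ) 1, g eT eS (s, t, x) =
      formEval (planeContract (m + 1) eT (Ψ (1, t, x))) (τ x) := by
    intro t ht x hx
    rw [← intervalIntegral.integral_of_le zero_le_one,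
      intervalIntegral.integral_eq_sub_of_hasDerivAt
        (f := fun s => formEval (planeContract (m + 1) eT (Ψ (s, t, x))) (τ x))]
    · rw [h0 t ht x hx]
      have h : formEval (0 : E [⋀^Fin (m + 1)]→L[ℝ] ℝ) (τ x) = 0 :=
        (formEvalCLM ℝ (τ x)).map_zero
      rw [h, sub_zero]
    · intro s hs
      rw [uIcc_of_le zero_le_one] at hs
      exact hder eT eS (fun s => (s, t, x)) s ⟨hs, ht, hx⟩
        ((hasDerivAt_id s).prodMk ((hasDerivAt_const s t).prodMk (hasDerivAt_const s x))) x rfl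
    · refine ContinuousOn.intervalIntegrable ?_
      rw [uIcc_of_le zero_le_one]
      exact (hgc eT eS).comp (by fun_prop) fun s hs => ⟨hs, ht, hx⟩
  -- Integrating in `t` gives zero, because the values at `0` and `T` agree.
  have hTi : ∀ s ∈ Icc (0 : ℝ) 1, ∀ x ∈ N, ∫ t in Ioc (0 : ℝ) T, g eS eT (s, t, x) = 0 := by
    intro s hs x hx
    rw [← intervalIntegral.integral_of_le hT,
      intervalIntegral.integral_eq_sub_of_hasDerivAt
        (f := fun t => formEval (planeContract (m + 1) eS (Ψ (s, t, x))) (τ x))]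
    · rw [hper s hs x hx, sub_self]
    · intro t ht
      rw [uIcc_of_le hT] at ht
      exact hder eS eT (fun t => (s, t, x)) t ⟨hs, ht, hx⟩
        ((hasDerivAt_const t s).prodMk ((hasDerivAt_id t).prodMk (hasDerivAt_const t x))) x rfl
    · refine ContinuousOn.intervalIntegrable ?_
      rw [uIcc_of_le hT]
      exact (hgc eS eT).comp (by fun_prop) fun t ht => ⟨hs, ht, hx⟩
  -- The two mixed derivatives differ by an exact form on `N`; Stokes removes it.
  have hX : ∀ s ∈ Icc (0 : ℝ) 1, ∀ t ∈ Icc (0 : ℝ) T,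
      ∫ x, (g eT eS (s, t, x) - g eS eT (s, t, x)) ∂μ = 0 := by
    intro s hs t ht
    have h1 : ∀ x ∈ N, ContDiffAt ℝ 1 (fun x => planeContract₂ m eS eT (Ψ (s, t, x))) x :=
      fun x hx => (planeContract₂ m eS eT).contDiff.contDiffAt.comp x
        ((hΨ s hs t ht x hx).comp x (contDiffAt_const.prodMk (contDiffAt_const.prodMk contDiffAt_id)))
    have h2 := hτ.integral_extDeriv_eq_zero hN hNc h1
    rw [← neg_eq_zero, ← integral_neg] at h2
    rw [← h2]
    refine setIntegral_congr_fun hNc.measurableSet fun x hx => ?_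
    have h3 := planeContract_fderiv ((hΨ s hs t ht x hx).differentiableAt one_ne_zero)
      (hcl s hs t ht x hx) eS eT
    simp only [hg, ← formEvalCLM_apply]
    rw [h3, map_sub]
    ring
  -- Fubini in two orders: the triple integral agrees with one that vanishes in `t`; integrating in
  -- `s` first, it is the Gauss integral at `s = 1`.
  have hI : ∫ z, g eT eS z
      ∂((volume.restrict (Ioc 0 1)).prod ((volume.restrict (Ioc 0 T)).prod μ)) = 0 := by
    have h1 : ∫ z, g eS eT z
        ∂((volume.restrict (Ioc 0 1)).prod ((volume.restrict (Ioc 0 T)).prod μ)) = 0 := by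
      rw [integral_prod _ (hgi eS eT)]
      refine integral_eq_zero_of_ae ?_
      filter_upwards [(hgi eS eT).prod_right_ae, ae_restrict_mem measurableSet_Ioc] with s h hs
      rw [integral_prod_symm _ h]
      refine integral_eq_zero_of_ae (ae_restrict_of_forall_mem hNc.measurableSet fun x hx => ?_)
      exact hTi s (Ioc_subset_Icc_self hs) x hx
    have h2 : ∫ z, (g eT eS z - g eS eT z)
        ∂((volume.restrict (Ioc 0 1)).prod ((volume.restrict (Ioc 0 T)).prod μ)) = 0 := by
      have hi := (hgi eT eS).sub (hgi eS eT)
      rw [integral_prod (fun z => g eT eS z - g eS eT z) hi]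
      refine integral_eq_zero_of_ae ?_
      filter_upwards [hi.prod_right_ae, ae_restrict_mem measurableSet_Ioc] with s h hs
      rw [integral_prod (fun y => g eT eS (s, y) - g eS eT (s, y)) h]
      refine integral_eq_zero_of_ae (ae_restrict_of_forall_mem measurableSet_Ioc fun t ht => ?_)
      exact hX s (Ioc_subset_Icc_self hs) t (Ioc_subset_Icc_self ht)
    rw [integral_sub (hgi _ _) (hgi _ _), h1, sub_zero] at h2
    exact h2
  rw [integral_prod_symm _ (hgi eT eS)] at hI
  have hI2 := (hgi eT eS).integral_prod_right
  rw [integral_prod _ hI2] at hI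
  rw [intervalIntegral.integral_of_le hT]
  refine Eq.trans ?_ hI
  refine setIntegral_congr_fun measurableSet_Ioc fun t ht => ?_
  exact setIntegral_congr_fun hNc.measurableSet fun x hx =>
    (hS t (Ioc_subset_Icc_self ht) x hx).symm

end GaussIntegral

end

noncomputable section

/-! ### Curves that miss the cone over `M` are unlinked from `M` -/

section Linking

variable {m : ℕ}

/-- The pullback of the solid angle form by a map. -/
def solidAnglePullback {G : Type*} [NormedAddCommGroup G] [NormedSpace ℝ G] {k : ℕ}
    (Φ : G → EucSp (k + 1)) (z : G) : G [⋀^Fin k]→L[ℝ] ℝ :=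
  (solidAngleForm k (Φ z)).compContinuousLinearMap (fderiv ℝ Φ z)

theorem contDiffAt_solidAnglePullback {G : Type*} [NormedAddCommGroup G] [NormedSpace ℝ G]
    [FiniteDimensional ℝ G] {k : ℕ} {Φ : G → EucSp (k + 1)} {z : G} (hΦ : ContDiffAt ℝ ∞ Φ z)
    (hz : Φ z ≠ 0) : ContDiffAt ℝ 1 (solidAnglePullback Φ) z := by
  refine contDiffAt_of_alternating_apply fun v => ?_
  have h1 : ContDiffAt ℝ 1 (fderiv ℝ Φ) z := hΦ.fderiv_right (by norm_cast)
  exact (((contDiffAt_solidAngleForm hz).of_le (by norm_cast)).comp z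
    (hΦ.of_le (by norm_cast))).alternating_apply fun i => h1.clm_apply contDiffAt_const

theorem extDeriv_solidAnglePullback {G : Type*} [NormedAddCommGroup G] [NormedSpace ℝ G]
    {k : ℕ} {Φ : G → EucSp (k + 1)} {z : G} (hΦ : ContDiffAt ℝ ∞ Φ z)
    (hz : Φ z ≠ 0) : extDeriv (solidAnglePullback Φ) z = 0 := by
  refine (extDeriv_pullback ((contDiffAt_solidAngleForm hz).differentiableAt (by simp)) hΦ
    (by simpa using two_le_infty)).trans ?_
  rw [extDeriv_solidAngleForm hz]
  rfl

/-- The map `(s, t, x) ↦ q + s (x - q) - γ t`. -/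
def coneDifference (γ : ℝ → EucSp (m + 3)) (q : EucSp (m + 3)) (z : ℝ × ℝ × EucSp (m + 3)) :
    EucSp (m + 3) :=
  q + z.1 • (z.2.2 - q) - γ z.2.1

theorem contDiff_coneDifference {γ : ℝ → EucSp (m + 3)} (hγ : ContDiff ℝ ∞ γ)
    (q : EucSp (m + 3)) : ContDiff ℝ ∞ (coneDifference γ q) := by
  unfold coneDifference
  fun_prop

theorem fderiv_coneDifference {γ : ℝ → EucSp (m + 3)} (hγ : ContDiff ℝ ∞ γ)
    (q : EucSp (m + 3)) (z u : ℝ × ℝ × EucSp (m + 3)) :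
    fderiv ℝ (coneDifference γ q) z u =
      z.1 • u.2.2 + u.1 • (z.2.2 - q) - u.2.1 • deriv γ z.2.1 := by
  have h1 : HasFDerivAt (fun z : ℝ × ℝ × EucSp (m + 3) => z.1)
    (ContinuousLinearMap.fst ℝ ℝ (ℝ × EucSp (m + 3))) z := hasFDerivAt_fst
  have h2 : HasFDerivAt (fun z : ℝ × ℝ × EucSp (m + 3) => z.2.2)
    (ContinuousLinearMap.snd ℝ ℝ (EucSp (m + 3)) ∘L
      ContinuousLinearMap.snd ℝ ℝ (ℝ × EucSp (m + 3))) z := hasFDerivAt_snd.comp z hasFDerivAt_snd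
  have h3 : HasFDerivAt (fun z : ℝ × ℝ × EucSp (m + 3) => z.2.1)
    (ContinuousLinearMap.fst ℝ ℝ (EucSp (m + 3)) ∘L
      ContinuousLinearMap.snd ℝ ℝ (ℝ × EucSp (m + 3))) z := hasFDerivAt_fst.comp z hasFDerivAt_snd
  have h4 := ((hγ.differentiable (by simp)) z.2.1).hasDerivAt.hasFDerivAt.comp z h3
  have h5 := ((h1.smul (h2.sub_const q)).const_add q).sub h4
  have h6 : fderiv ℝ (coneDifference γ q) z = _ := h5.fderiv
  rw [h6]
  simp

/-- If the cone over `N` from `q` does not meet the closed curve `γ`, then the linking number of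
`γ` and `N` vanishes. -/
theorem linkingNumber_eq_zero {γ : ℝ → EucSp (m + 3)} {N : Set (EucSp (m + 3))}
    {τ : EucSp (m + 3) → ⋀[ℝ]^(m + 1) (EucSp (m + 3))} {q : EucSp (m + 3)}
    (hN : IsEmbeddedSubmanifold (m + 1) N) (hNc : IsCompact N) (hτ : IsOrientingField (m + 1) N τ)
    (hγ : ContDiff ℝ ∞ γ) (hper : Function.Periodic γ (2 * Real.pi))
    (hav : ∀ s ∈ Icc (0 : ℝ) 1, ∀ t, ∀ x ∈ N, q + s • (x - q) ≠ γ t) :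
    linkingNumber γ N τ = 0 := by
  obtain ⟨c, -, -, hc⟩ := exists_normHausdorff_eq_smul (EucSp (m + 3)) (m + 1)
  set Ψ : ℝ × ℝ × EucSp (m + 3) → (ℝ × ℝ × EucSp (m + 3)) [⋀^Fin (m + 2)]→L[ℝ] ℝ :=
    solidAnglePullback (coneDifference γ q)
  have hne : ∀ s ∈ Icc (0 : ℝ) 1, ∀ t, ∀ x ∈ N, coneDifference γ q (s, t, x) ≠ 0 :=
    fun s hs t x hx h => hav s hs t x hx (sub_eq_zero.1 h)
  have hcd := contDiff_coneDifference hγ q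
  -- Explicit value of the pullback: vectors tangent to the submanifold enter scaled by `s`, which
  -- makes the end `s = 0` degenerate.
  have happ : ∀ s t x (e : ℝ × ℝ × EucSp (m + 3)) (v : Fin (m + 1) → EucSp (m + 3)),
      planeContract (m + 1) e (Ψ (s, t, x)) v =
        (‖coneDifference γ q (s, t, x)‖ ^ (m + 3))⁻¹ * volAlt (m + 3)
          (Fin.cons (coneDifference γ q (s, t, x))
            (Fin.cons (s • e.2.2 + e.1 • (x - q) - e.2.1 • deriv γ t) fun i => s • v i)) := by
    intro s t x e v
    have h1 : (fun i => fderiv ℝ (coneDifference γ q) (s, t, x)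
        ((Fin.cons e fun i => planeInr (EucSp (m + 3)) (v i) :
          Fin (m + 2) → ℝ × ℝ × EucSp (m + 3)) i)) =
        Fin.cons (s • e.2.2 + e.1 • (x - q) - e.2.1 • deriv γ t) fun i => s • v i := by
      funext i
      refine Fin.cases ?_ (fun i => ?_) i
      · rw [Fin.cons_zero, Fin.cons_zero, fderiv_coneDifference hγ]
      · rw [Fin.cons_succ, Fin.cons_succ, fderiv_coneDifference hγ, planeInr_apply]
        simp
    rw [← h1]
    rfl
  have key := integral_planeContract_eq_zero hN hNc hτ (T := 2 * Real.pi) (by positivity) (Ψ := Ψ)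
    (fun s hs t _ x hx => contDiffAt_solidAnglePullback hcd.contDiffAt (hne s hs t x hx))
    (fun s hs t _ x hx => extDeriv_solidAnglePullback hcd.contDiffAt (hne s hs t x hx)) ?_ ?_
  · rw [linkingNumber, hc]
    -- The linking integrand is the contraction with `∂t` at `s = 1`, up to normalization and the
    -- sign from `∂t (x - γ t) = -γ'`.
    have h1 : ∀ t, ∫ x in N, volForm (m + 3) (kvWedge (x - γ t) (kvWedge (deriv γ t) (τ x))) /
        ‖x - γ t‖ ^ (m + 3) ∂(c • (μHE[m + 1] : Measure (EucSp (m + 3)))) = - c.toReal *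
        ∫ x in N, formEval (planeContract (m + 1) (0, 1, 0) (Ψ (1, t, x))) (τ x)
          ∂(μHE[m + 1] : Measure (EucSp (m + 3))) := by
      intro t
      rw [Measure.restrict_smul, integral_smul_measure, smul_eq_mul, neg_mul, ← mul_neg,
        ← integral_neg]
      congr 1
      refine setIntegral_congr_fun hNc.measurableSet fun x hx => ?_
      obtain ⟨v, -, -, hv⟩ := hτ.1 x hx
      simp only [hv, kvWedge_ιMulti, formEval_ιMulti, happ, volForm_ιMulti, ← volAlt_apply]
      have h2 : coneDifference γ q (1, t, x) = x - γ t := by simp [coneDifference]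
      have h3 : volAlt (m + 3) (Fin.cons (x - γ t) (Fin.cons (-deriv γ t) v)) =
          - volAlt (m + 3) (Fin.cons (x - γ t) (Fin.cons (deriv γ t) v)) := by
        have h := ((volAlt (m + 3)).curryLeft (x - γ t)).toAlternatingMap.map_update_neg
          (Fin.cons (deriv γ t) v) 0 (deriv γ t)
        rw [Fin.update_cons_zero, Fin.update_cons_zero] at h
        exact h
      rw [h2]
      simp only [one_smul, smul_zero, zero_smul, zero_add, zero_sub]
      rw [h3, mul_neg, neg_neg, div_eq_inv_mul]
    simp only [h1]
    rw [intervalIntegral.integral_const_mul, key, mul_zero, mul_zero]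
  · intro t _ x _
    ext v
    rw [happ]
    have h := ((volAlt (m + 3)).curryLeft (coneDifference γ q (0, t, x))).map_coord_zero
      (m := Fin.cons ((0 : ℝ) • (0 : EucSp (m + 3)) + (0 : ℝ) • (x - q) - (1 : ℝ) • deriv γ t)
        fun i => (0 : ℝ) • v i) 1 (by
          rw [show (1 : Fin (m + 2)) = Fin.succ 0 from rfl, Fin.cons_succ, zero_smul])
    refine (congrArg _ h).trans ?_
    simp
  · intro s _ x _
    ext v
    have h1 : γ (2 * Real.pi) = γ 0 := by simpa using hper 0
    have h2 : coneDifference γ q (s, 2 * Real.pi, x) = coneDifference γ q (s, 0, x) := by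
      simp [coneDifference, h1]
    rw [happ, happ, h2]
    simp

/-- The cone over `M` from `q`. -/
def coneSet (q : EucSp (m + 3)) (M : Set (EucSp (m + 3))) : Set (EucSp (m + 3)) :=
  (fun z : ℝ × EucSp (m + 3) => q + z.1 • (z.2 - q)) '' (Icc (0 : ℝ) 1 ×ˢ M)

/-- A simple link that misses the cone would have linking number zero with the component it links
once. -/
theorem spans_of_coneSet_subset {M X : Set (EucSp (m + 3))}
    {τ : EucSp (m + 3) → ⋀[ℝ]^(m + 1) (EucSp (m + 3))} {q : EucSp (m + 3)}
    (hM : IsEmbeddedSubmanifold (m + 1) M) (hMc : IsCompact M) (hτ : IsOrientingField (m + 1) M τ)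
    (hX : coneSet q M ⊆ X) : Spans M τ X := by
  rintro γ ⟨⟨hγ, hper, -, -⟩, -, x, -, hx, -⟩
  by_contra! h
  obtain ⟨⟨O, hO, hN⟩, O', hO', hN'⟩ := hM.exists_isOpen_connectedComponentIn x
  have hNc : IsCompact (connectedComponentIn M x) := hN' ▸ hMc.diff hO'
  rw [linkingNumber_eq_zero (q := q) (hN ▸ hM.inter_isOpen hO) hNc (hN ▸ hτ.inter_isOpen hO) hγ
    hper fun s hs t y hy hyt => h t (hX ⟨(s, y), ⟨hs, connectedComponentIn_subset M x hy⟩, hyt⟩)] at hx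
  simp at hx

end Linking

end

noncomputable section

/-! ### Linear algebra of the cone map -/

section ConeLinear

variable {G V : Type*} [NormedAddCommGroup G] [InnerProductSpace ℝ G] [FiniteDimensional ℝ G]
  [MeasurableSpace G] [BorelSpace G] [NormedAddCommGroup V] [InnerProductSpace ℝ V]
  [FiniteDimensional ℝ V] [MeasurableSpace V] [BorelSpace V]

/-- A linear endomorphism of `G × ℝ` which dominates the derivative of a cone map. -/
theorem exists_linearMap_cone_le (D : G →ₗ[ℝ] V) (hD : Function.Injective D) (t : ℝ) (w : V)
    {R : ℝ} (hR : ‖w‖ ≤ R) :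
    ∃ Q : WithLp 2 (G × ℝ) →ₗ[ℝ] WithLp 2 (G × ℝ),
      |Q.det| = |t| ^ finrank ℝ G * (R * D.normDet) ∧
      ∀ z : WithLp 2 (G × ℝ), ‖t • D z.fst + z.snd • w‖ ≤ ‖Q z‖ := by
  obtain ⟨C, hC, hCdet⟩ := exists_linearMap_norm_eq D hD
  have hR0 : 0 ≤ R := (norm_nonneg w).trans hR
  obtain ⟨a, ha⟩ : D.range.starProjection w ∈ D.range := Submodule.starProjection_apply_mem _ _
  -- Write `w = D a + wN` with `wN` orthogonal to the range. Then `t D v + r w = D (t v + r a) + r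
  -- wN` splits orthogonally, and `Q (v, r) = (C (t v + r a), R r)` dominates it. The shear by `a`
  -- has determinant one.
  set wN := w - D.range.starProjection w with hwN
  have horth : ∀ v, ⟪D v, wN⟫ = 0 := fun v =>
    D.range.inner_right_of_mem_orthogonal ⟨v, rfl⟩
      (Submodule.sub_starProjection_mem_orthogonal w)
  have hw : w = D a + wN := by rw [ha, hwN]; abel
  have hwNR : ‖wN‖ ≤ R := by
    refine le_trans ?_ hR
    refine le_of_sq_le_sq ?_ (norm_nonneg w)
    have := norm_add_sq_eq_norm_sq_add_norm_sq_of_inner_eq_zero (D a) wN (horth a)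
    rw [← hw] at this
    nlinarith [norm_nonneg (D a)]
  let e := WithLp.linearEquiv 2 ℝ (G × ℝ)
  let T : G × ℝ →ₗ[ℝ] G × ℝ := LinearMap.transvection (LinearMap.snd ℝ G ℝ) (a, 0)
  let Q₀ : G × ℝ →ₗ[ℝ] G × ℝ :=
    LinearMap.prodMap C (R • LinearMap.id) ∘ₗ T ∘ₗ LinearMap.prodMap (t • LinearMap.id) LinearMap.id
  refine ⟨e.symm.toLinearMap ∘ₗ Q₀ ∘ₗ e.toLinearMap, ?_, fun z => ?_⟩
  · have h1 : (e.symm.toLinearMap ∘ₗ Q₀ ∘ₗ e.toLinearMap).det = Q₀.det :=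
      LinearMap.det_conj Q₀ e.symm
    have hT : T.det = 1 := by
      rw [LinearMap.transvection.det]
      simp
    rw [h1, LinearMap.det_comp, LinearMap.det_comp, hT, LinearMap.det_prodMap,
      LinearMap.det_prodMap, LinearMap.det_smul, LinearMap.det_smul]
    simp only [LinearMap.det_id, finrank_self, pow_one, mul_one, one_mul, abs_mul, abs_pow, hCdet,
      abs_of_nonneg hR0]
    ring
  · have h1 : t • D z.fst + z.snd • w = D (t • z.fst + z.snd • a) + z.snd • wN := by
      rw [map_add, map_smul, map_smul]
      nth_rw 1 [hw]
      rw [smul_add, add_assoc]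
    have h2 : (e.symm.toLinearMap ∘ₗ Q₀ ∘ₗ e.toLinearMap) z =
        WithLp.toLp 2 (C (t • z.fst + z.snd • a), R * z.snd) := by
      simp [e, Q₀, T, LinearMap.transvection.apply]
    refine le_of_sq_le_sq ?_ (norm_nonneg _)
    rw [h1, h2, WithLp.prod_norm_sq_eq_of_L2]
    have h3 := norm_add_sq_eq_norm_sq_add_norm_sq_of_inner_eq_zero (D (t • z.fst + z.snd • a))
      (z.snd • wN) (by rw [inner_smul_right, horth, mul_zero])
    simp only [← sq] at h3
    rw [h3]
    change _ ≤ ‖C (t • z.fst + z.snd • a)‖ ^ 2 + ‖R * z.snd‖ ^ 2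
    rw [hC, norm_smul, norm_mul, Real.norm_of_nonneg hR0, mul_comm R]
    gcongr

end ConeLinear

/-! ### The area of a cone -/

section ConeMeasure

variable {V : Type*} [NormedAddCommGroup V] [InnerProductSpace ℝ V] [FiniteDimensional ℝ V]
  [MeasurableSpace V] [BorelSpace V]

theorem volume_fst_snd_mem {G : Type*} [NormedAddCommGroup G] [InnerProductSpace ℝ G]
    [FiniteDimensional ℝ G] [MeasurableSpace G] [BorelSpace G] {E : Set G} (hE : MeasurableSet E) :
    volume {z : WithLp 2 (G × ℝ) | z.fst ∈ E ∧ z.snd ∈ Ioc (0 : ℝ) 1} = volume E := by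
  have h := (WithLp.volume_preserving_symm_measurableEquiv_toLp_prod G ℝ).measure_preimage
    (hE.prod (measurableSet_Ioc (a := (0 : ℝ)) (b := 1))).nullMeasurableSet
  rw [Measure.volume_eq_prod, Measure.prod_prod, Real.volume_Ioc] at h
  simp only [sub_zero, ENNReal.ofReal_one, mul_one] at h
  exact h

/-- The part of the cone over `E` from `q` away from the vertex. -/
def openCone (q : V) (E : Set V) : Set V :=
  (fun z : ℝ × V => q + z.1 • (z.2 - q)) '' (Ioc (0 : ℝ) 1 ×ˢ E)

/-- The cone map in the coordinates given by `g`. -/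
def coneMap {d : ℕ} (g : EuclideanSpace ℝ (Fin d) → V) (q : V)
    (z : WithLp 2 (EuclideanSpace ℝ (Fin d) × ℝ)) : V :=
  q + z.snd • (g z.fst - q)

theorem hasStrictFDerivAt_coneMap {d : ℕ} {g : EuclideanSpace ℝ (Fin d) → V} (q : V)
    {D : EuclideanSpace ℝ (Fin d) →L[ℝ] V} {z : WithLp 2 (EuclideanSpace ℝ (Fin d) × ℝ)}
    (hg : HasStrictFDerivAt g D z.fst) :
    ∃ D' : WithLp 2 (EuclideanSpace ℝ (Fin d) × ℝ) →L[ℝ] V, HasStrictFDerivAt (coneMap g q) D' z ∧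
      ∀ u, D' u = z.snd • D u.fst + u.snd • (g z.fst - q) := by
  have h1 := (WithLp.fstL 2 ℝ (EuclideanSpace ℝ (Fin d)) ℝ).hasStrictFDerivAt (x := z)
  have h2 := (WithLp.sndL 2 ℝ (EuclideanSpace ℝ (Fin d)) ℝ).hasStrictFDerivAt (x := z)
  exact ⟨_, (h2.smul ((hg.comp z h1).sub_const q)).const_add q, fun u => rfl⟩

theorem openCone_iUnion {ι : Type*} (q : V) (s : ι → Set V) :
    openCone q (⋃ i, s i) = ⋃ i, openCone q (s i) := by
  simp only [openCone, prod_iUnion, image_iUnion]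

/-- The derivative of the cone map is dominated by a linear map of determinant `tᵈ R J ≤ R c` for `0
< t ≤ 1`, and the parameter domain `A × (0, 1]` has the volume of `A`. -/
theorem IsParametrization.sphericalHausdorff_coneMap_le {d : ℕ} {M : Set V}
    {g : EuclideanSpace ℝ (Fin d) → V} {B : Set (EuclideanSpace ℝ (Fin d))}
    (hg : IsParametrization M g B) {q : V} {R c : ℝ} (hR : 0 < R)
    (hgR : ∀ y ∈ B, ‖g y - q‖ ≤ R) (hc : ∀ y ∈ B, jacobian g y ≤ c) {ε : NNReal} (hε : 0 < ε)
    {A : Set (EuclideanSpace ℝ (Fin d))} (hA : A ⊆ B) (hAm : MeasurableSet A) :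
    sphericalHausdorff (d + 1) (coneMap g q '' {z | z.fst ∈ A ∧ z.snd ∈ Ioc (0 : ℝ) 1}) ≤
      (1 + ε : ℝ≥0∞) ^ (d + 1) * ENNReal.ofReal (R * c) * volume A := by
  rw [← volume_fst_snd_mem hAm, ← smul_eq_mul, ← Measure.smul_apply]
  refine le_measure_of_locally_le (K := {z | z.fst ∈ B ∧ z.snd ∈ Ioc (0 : ℝ) 1})
    (Φ := fun E => sphericalHausdorff (d + 1) (coneMap g q '' E)) (by simp)
    (fun s => by rw [image_iUnion]; exact measure_iUnion_le _) ?_ (fun z hz => ⟨hA hz.1, hz.2⟩) ?_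
  · rintro z ⟨hz, ht⟩
    obtain ⟨D', hD', hDu⟩ := hasStrictFDerivAt_coneMap q (hg.hasStrictFDerivAt hz)
    obtain ⟨Q, hQ, hQD⟩ := exists_linearMap_cone_le (fderiv ℝ g z.fst).toLinearMap
      (hg.injective_fderiv _ hz) z.snd (g z.fst - q) (hgR _ hz)
    have hj : 0 < jacobian g z.fst := hg.jacobian_pos hz
    change |Q.det| = |z.snd| ^ _ * (R * jacobian g z.fst) at hQ
    rw [abs_of_pos ht.1] at hQ
    have hQ0 : 0 < |Q.det| := by
      rw [hQ]
      exact mul_pos (pow_pos ht.1 _) (mul_pos hR hj)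
    have hQ1 : |Q.det| ≤ R * c := by
      rw [hQ]
      calc z.snd ^ finrank ℝ (EuclideanSpace ℝ (Fin d)) * (R * jacobian g z.fst)
          ≤ 1 * (R * jacobian g z.fst) :=
            mul_le_mul_of_nonneg_right (pow_le_one₀ ht.1.le ht.2) (mul_pos hR hj).le
        _ ≤ R * c := by
            rw [one_mul]
            exact mul_le_mul_of_nonneg_left (hc _ hz) hR.le
    have hrank : finrank ℝ (WithLp 2 (EuclideanSpace ℝ (Fin d) × ℝ)) = d + 1 := by
      rw [(WithLp.linearEquiv 2 ℝ (EuclideanSpace ℝ (Fin d) × ℝ)).finrank_eq, finrank_prod,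
        finrank_euclideanSpace_fin, finrank_self]
    obtain ⟨W, hW, h⟩ := hD'.exists_sphericalHausdorff_image_le hrank Q (abs_pos.1 hQ0)
      (fun u => by rw [hDu]; exact hQD u) hε
    refine ⟨W, mem_nhdsWithin_of_mem_nhds hW, fun E hE _ => (h E hE).trans ?_⟩
    rw [Measure.smul_apply, smul_eq_mul, mul_assoc]
    gcongr
  · have h1 : Measurable fun z : WithLp 2 (EuclideanSpace ℝ (Fin d) × ℝ) => z.fst :=
      (WithLp.fstL 2 ℝ (EuclideanSpace ℝ (Fin d)) ℝ).continuous.measurable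
    have h2 : Measurable fun z : WithLp 2 (EuclideanSpace ℝ (Fin d) × ℝ) => z.snd :=
      (WithLp.sndL 2 ℝ (EuclideanSpace ℝ (Fin d)) ℝ).continuous.measurable
    exact (h1 hAm).inter (h2 measurableSet_Ioc)

/-- The area of a cone over a submanifold is at most the area of the submanifold times the length
of the longest generator. -/
theorem sphericalHausdorff_openCone_le {d : ℕ} {M : Set V} (hM : IsEmbeddedSubmanifold d M)
    (hMm : MeasurableSet M) {q : V} {R : ℝ} (hR : 0 < R) (hMR : ∀ x ∈ M, ‖x - q‖ ≤ R) :
    sphericalHausdorff (d + 1) (openCone q M) ≤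
      ENNReal.ofReal R * (μHE[d] : Measure V) M := by
  -- The factors `1 + ε` are `d + 1` from the cone map, one from freezing the Jacobian, and `d` from
  -- returning to the measure on `M`.
  refine ENNReal.le_of_forall_one_add_pow_mul (2 * d + 2) fun ε hε => ?_
  rw [← mul_assoc, ← smul_eq_mul, ← Measure.smul_apply]
  refine le_measure_of_locally_le (K := M)
    (Φ := fun E => sphericalHausdorff (d + 1) (openCone q E)) (by simp [openCone])
    (fun s => by rw [openCone_iUnion]; exact measure_iUnion_le _) ?_ Subset.rfl hMm
  intro p hp
  obtain ⟨g, r₀, hr₀, hgp, hg⟩ := hM.exists_isParametrization hp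
  have h0 : (0 : EuclideanSpace ℝ (Fin d)) ∈ Metric.ball 0 r₀ := Metric.mem_ball_self hr₀
  have hj : 0 < jacobian g 0 := hg.jacobian_pos h0
  have hε' : (0 : ℝ) < ε := hε
  obtain ⟨W, hW, hcmp⟩ := (hg.hasStrictFDerivAt h0).exists_euclideanHausdorffMeasure_image
    finrank_euclideanSpace_fin (hg.injective_fderiv 0 h0) hε
  have hjn : ∀ᶠ y in 𝓝 0, jacobian g y < (1 + ε) * jacobian g 0 :=
    (hg.continuousOn_jacobian.continuousAt (Metric.ball_mem_nhds _ hr₀)).eventually_lt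
      continuousAt_const (by nlinarith)
  obtain ⟨r, hr, hrW⟩ := Metric.mem_nhds_iff.1
    (inter_mem (inter_mem hW hjn) (Metric.ball_mem_nhds _ hr₀))
  have hgr := hg.mono Metric.isOpen_ball fun y hy => (hrW hy).2
  obtain ⟨O, hO, hgO⟩ := hgr.exists_isOpen _ Subset.rfl Metric.isOpen_ball
  have hgM : ∀ y ∈ Metric.ball 0 r, g y ∈ M := fun y hy =>
    (hgO ▸ mem_image_of_mem g hy : g y ∈ M ∩ O).1
  have hpO : p ∈ M ∩ O := hgO ▸ ⟨0, Metric.mem_ball_self hr, hgp⟩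
  refine ⟨M ∩ O, inter_mem_nhdsWithin _ (hO.mem_nhds hpO.2), fun E hE hEm => ?_⟩
  set A : Set (EuclideanSpace ℝ (Fin d)) :=
    Subtype.val '' ((Metric.ball 0 r).restrict g ⁻¹' E) with hA
  have hAm : MeasurableSet A :=
    measurableSet_ball.subtype_image (hgr.measurableEmbedding.measurable hEm)
  have hAB : A ⊆ Metric.ball 0 r := by
    rintro _ ⟨y, -, rfl⟩
    exact y.2
  have hgA : g '' A = E := by
    refine Subset.antisymm ?_ fun x hx => ?_
    · rintro _ ⟨_, ⟨y, hy, rfl⟩, rfl⟩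
      exact hy
    · obtain ⟨y, hy, rfl⟩ : x ∈ g '' Metric.ball 0 r := hgO ▸ hE hx
      exact ⟨y, ⟨⟨y, hy⟩, hx, rfl⟩, rfl⟩
  have hcone : openCone q E = coneMap g q '' {z | z.fst ∈ A ∧ z.snd ∈ Ioc (0 : ℝ) 1} := by
    rw [← hgA]
    ext x
    constructor
    · rintro ⟨⟨t, _⟩, ⟨ht, y, hy, rfl⟩, rfl⟩
      exact ⟨WithLp.toLp 2 (y, t), ⟨hy, ht⟩, rfl⟩
    · rintro ⟨z, ⟨hz, ht⟩, rfl⟩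
      exact ⟨(z.snd, g z.fst), ⟨ht, mem_image_of_mem g hz⟩, rfl⟩
  have h1 := hgr.sphericalHausdorff_coneMap_le (q := q) (c := (1 + ε) * jacobian g 0) hR
    (fun y hy => hMR _ (hgM y hy)) (fun y hy => (hrW hy).1.2.le) hε hAB hAm
  have h2 := (hcmp A fun y hy => (hrW (hAB hy)).1.1).2
  rw [hgA] at h2
  change ENNReal.ofReal (jacobian g 0) * _ ≤ _ at h2
  rw [hcone]
  refine h1.trans ?_
  have h3 : ENNReal.ofReal (R * ((1 + ε) * jacobian g 0)) =
      ENNReal.ofReal R * ((1 + ε) * ENNReal.ofReal (jacobian g 0)) := by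
    rw [ENNReal.ofReal_mul hR.le, ENNReal.ofReal_mul (by positivity),
      ENNReal.ofReal_add zero_le_one hε'.le, ENNReal.ofReal_one, ENNReal.ofReal_coe_nnreal]
  rw [h3, Measure.smul_apply, smul_eq_mul]
  calc (1 + ε : ℝ≥0∞) ^ (d + 1) * (ENNReal.ofReal R * ((1 + ε) * ENNReal.ofReal (jacobian g 0))) *
        volume A
      = (1 + ε : ℝ≥0∞) ^ (d + 2) * ENNReal.ofReal R *
          (ENNReal.ofReal (jacobian g 0) * volume A) := by ring
    _ ≤ (1 + ε : ℝ≥0∞) ^ (d + 2) * ENNReal.ofReal R *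
          ((1 + ε : ℝ≥0∞) ^ d * (μHE[d] : Measure V) E) := by gcongr
    _ = (1 + ε : ℝ≥0∞) ^ (2 * d + 2) * ENNReal.ofReal R * (μHE[d] : Measure V) E := by ring

end ConeMeasure

end

noncomputable section

/-! ### Making a compact set reduced by adding small disks -/

section Disks

variable {V : Type*} [NormedAddCommGroup V] [InnerProductSpace ℝ V] [FiniteDimensional ℝ V]
  [MeasurableSpace V] [BorelSpace V]

theorem sphericalHausdorff_singleton {k : ℕ} (hk : k ≠ 0) (q : V) :
    sphericalHausdorff k ({q} : Set V) = 0 := by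
  have h := sphericalHausdorff_image_le (H := EuclideanSpace ℝ (Fin k)) (k := k)
    finrank_euclideanSpace_fin (f := fun _ => q) (A := {0}) (L := 0)
    (LipschitzWith.const q).lipschitzOnWith
  rw [image_singleton] at h
  simpa [hk] using h

/-- The flat disk of radius `r` about `x` in the direction of the range of `L`. -/
def flatDisk {k : ℕ} (L : EuclideanSpace ℝ (Fin k) →ₗᵢ[ℝ] V) (x : V) (r : ℝ) : Set V :=
  (fun y => x + L y) '' Metric.closedBall 0 r

theorem isometry_flatDisk {k : ℕ} (L : EuclideanSpace ℝ (Fin k) →ₗᵢ[ℝ] V) (x : V) :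
    Isometry fun y => x + L y :=
  (isometry_add_left x).comp L.isometry

theorem isCompact_flatDisk {k : ℕ} (L : EuclideanSpace ℝ (Fin k) →ₗᵢ[ℝ] V) (x : V) (r : ℝ) :
    IsCompact (flatDisk L x r) :=
  (isCompact_closedBall 0 r).image (isometry_flatDisk L x).continuous

theorem mem_flatDisk {k : ℕ} (L : EuclideanSpace ℝ (Fin k) →ₗᵢ[ℝ] V) (x : V) {r : ℝ} (hr : 0 ≤ r) :
    x ∈ flatDisk L x r :=
  ⟨0, Metric.mem_closedBall_self hr, by simp⟩

theorem flatDisk_subset_closedBall {k : ℕ} (L : EuclideanSpace ℝ (Fin k) →ₗᵢ[ℝ] V) (x : V)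
    (r : ℝ) : flatDisk L x r ⊆ Metric.closedBall x r := by
  rintro _ ⟨y, hy, rfl⟩
  simpa using hy

theorem sphericalHausdorff_flatDisk_le {k : ℕ} (L : EuclideanSpace ℝ (Fin k) →ₗᵢ[ℝ] V) (x : V)
    {r : ℝ} (hr : 0 ≤ r) :
    sphericalHausdorff k (flatDisk L x r) ≤ unitBallVolume k * ENNReal.ofReal r ^ k := by
  have h := sphericalHausdorff_image_le finrank_euclideanSpace_fin
    ((isometry_flatDisk L x).lipschitz.lipschitzOnWith (s := Metric.closedBall 0 r))
  rw [volume_closedBall_eq finrank_euclideanSpace_fin _ hr] at h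
  simpa [flatDisk] using h

/-- Even at the rim a ball meets the disk in the isometric image of a nonempty open subset of `ℝᵏ`.
-/
theorem normHausdorff_flatDisk_inter_ball_pos {k : ℕ} (L : EuclideanSpace ℝ (Fin k) →ₗᵢ[ℝ] V)
    (x : V) {r : ℝ} (hr : 0 < r) {p : V} (hp : p ∈ flatDisk L x r) {ρ : ℝ} (hρ : 0 < ρ) :
    0 < (normHausdorff k : Measure V) (flatDisk L x r ∩ Metric.ball p ρ) := by
  obtain ⟨y, hy, rfl⟩ := hp
  have hne : (Metric.ball (0 : EuclideanSpace ℝ (Fin k)) r ∩ Metric.ball y ρ).Nonempty := by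
    rw [← closure_ball _ hr.ne'] at hy
    rw [inter_comm]
    exact mem_closure_iff.1 hy _ Metric.isOpen_ball (Metric.mem_ball_self hρ)
  have hpos : 0 < volume (Metric.ball (0 : EuclideanSpace ℝ (Fin k)) r ∩ Metric.ball y ρ) :=
    (Metric.isOpen_ball.inter Metric.isOpen_ball).measure_pos volume hne
  have hsub : (fun y => x + L y) '' (Metric.ball 0 r ∩ Metric.ball y ρ) ⊆
      flatDisk L x r ∩ Metric.ball (x + L y) ρ := by
    rintro _ ⟨z, ⟨hz, hzy⟩, rfl⟩
    refine ⟨⟨z, Metric.ball_subset_closedBall hz, rfl⟩, ?_⟩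
    rw [Metric.mem_ball, (isometry_flatDisk L x).dist_eq]
    exact hzy
  refine lt_of_lt_of_le ?_ ((euclideanHausdorffMeasure_le_normHausdorff k _).trans
    (measure_mono hsub))
  have h := euclideanHausdorffMeasure_image_le_of_dist_le (L := 1) (f := id)
    (g := fun y => x + L y) (A := Metric.ball (0 : EuclideanSpace ℝ (Fin k)) r ∩ Metric.ball y ρ)
    (fun a _ b _ => by rw [(isometry_flatDisk L x).dist_eq]; simp) k
  rw [image_id, EuclideanSpace.euclideanHausdorffMeasure_eq_volume] at h
  simp only [ENNReal.coe_one, one_pow, one_mul] at h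
  exact hpos.trans_le h

theorem IsEmbeddedSubmanifold.euclideanHausdorffMeasure_pos {d : ℕ} {M : Set V}
    (hM : IsEmbeddedSubmanifold d M) (hne : M.Nonempty) : 0 < (μHE[d] : Measure V) M := by
  obtain ⟨p, hp⟩ := hne
  obtain ⟨g, R, hR, hgp, hg⟩ := hM.exists_isParametrization hp
  have h0 : (0 : EuclideanSpace ℝ (Fin d)) ∈ Metric.ball 0 R := Metric.mem_ball_self hR
  obtain ⟨W, hW, hcmp⟩ := (hg.hasStrictFDerivAt h0).exists_euclideanHausdorffMeasure_image
    finrank_euclideanSpace_fin (hg.injective_fderiv 0 h0) one_pos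
  obtain ⟨r, hr, hrW⟩ := Metric.mem_nhds_iff.1 (inter_mem hW (Metric.ball_mem_nhds _ hR))
  obtain ⟨O, hO, hgO⟩ := hg.exists_isOpen (Metric.ball 0 r) (fun y hy => (hrW hy).2)
    Metric.isOpen_ball
  have h1 := (hcmp (Metric.ball 0 r) fun y hy => (hrW hy).1).2
  have h2 : 0 < ENNReal.ofReal (jacobian g 0) * volume (Metric.ball (0 : EuclideanSpace ℝ (Fin d)) r) :=
    ENNReal.mul_pos (ENNReal.ofReal_pos.2 (hg.jacobian_pos h0)).ne'
      (Metric.measure_ball_pos volume 0 hr).ne'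
  have h3 := h2.trans_le h1
  have h4 : g '' Metric.ball 0 r ⊆ M := hgO ▸ inter_subset_left
  exact (pos_iff_ne_zero.2 (right_ne_zero_of_mul h3.ne')).trans_le (measure_mono h4)

/-- A nonempty compact subset of an open set becomes reduced, and remains compact, after adding
disks of arbitrarily small total area. -/
theorem exists_reduced_superset {k : ℕ} (L : EuclideanSpace ℝ (Fin k) →ₗᵢ[ℝ] V) (hk : k ≠ 0)
    {C U : Set V} (hC : IsCompact C) (hne : C.Nonempty) (hU : IsOpen U) (hCU : C ⊆ U)
    {η : ℝ≥0∞} (hη : η ≠ 0) :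
    ∃ X : Set V, IsCompact X ∧ C ⊆ X ∧ X ⊆ U ∧ core k X = X ∧
      sphericalHausdorff k X ≤ sphericalHausdorff k C + η := by
  haveI : Nonempty C := hne.to_subtype
  -- Centres dense in `C` put a disk of positive measure near each of its points.
  obtain ⟨x, hx⟩ := TopologicalSpace.exists_dense_seq C
  obtain ⟨θ, hθ, hθs⟩ := ENNReal.exists_pos_sum_of_countable' hη ℕ
  have hr : ∀ i : ℕ, ∃ r : ℝ, 0 < r ∧ r ≤ ((i : ℝ) + 1)⁻¹ ∧
      Metric.closedBall (x i : V) r ⊆ U ∧ unitBallVolume k * ENNReal.ofReal r ^ k ≤ θ i := by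
    intro i
    have h1 : Tendsto (fun r : ℝ => unitBallVolume k * ENNReal.ofReal r ^ k) (𝓝 0) (𝓝 0) := by
      have h : Tendsto (fun r : ℝ => unitBallVolume k * ENNReal.ofReal r ^ k) (𝓝 0)
          (𝓝 (unitBallVolume k * ENNReal.ofReal 0 ^ k)) :=
        ENNReal.Tendsto.const_mul (ENNReal.Tendsto.pow (ENNReal.continuous_ofReal.tendsto 0))
          (Or.inr (unitBallVolume_ne_top k))
      simpa [hk] using h
    have h2 : ∀ᶠ r : ℝ in 𝓝[>] 0, unitBallVolume k * ENNReal.ofReal r ^ k < θ i :=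
      (h1.mono_left nhdsWithin_le_nhds).eventually_lt_const (hθ i)
    have h3 : ∀ᶠ r : ℝ in 𝓝[>] 0, r ≤ ((i : ℝ) + 1)⁻¹ :=
      (eventually_le_nhds (by positivity)).filter_mono nhdsWithin_le_nhds
    obtain ⟨δ, hδ, hδU⟩ := Metric.nhds_basis_closedBall.mem_iff.1 (hU.mem_nhds (hCU (x i).2))
    have h4 : ∀ᶠ r : ℝ in 𝓝[>] 0, r ≤ δ :=
      (eventually_le_nhds hδ).filter_mono nhdsWithin_le_nhds
    obtain ⟨r, ⟨⟨h2, h3⟩, h4⟩, h5⟩ :=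
      (((h2.and h3).and h4).and self_mem_nhdsWithin).exists
    exact ⟨r, h5, h3, (Metric.closedBall_subset_closedBall h4).trans hδU, h2.le⟩
  choose r hr0 hri hrU hrθ using hr
  set X : Set V := C ∪ ⋃ i, flatDisk L (x i) (r i) with hX
  have hXU : X ⊆ U := union_subset hCU
    (iUnion_subset fun i => (flatDisk_subset_closedBall _ _ _).trans (hrU i))
  -- Closedness: since the radii are at most `1 / (i + 1)`, all disks with index at least `n` lie in
  -- the `1 / (n + 1)`-thickening of `C`, so `X` is an intersection of finite unions of disks with
  -- thickenings.
  have hXZ : X = ⋂ n : ℕ, ((⋃ i ∈ Finset.range n, flatDisk L (x i : V) (r i)) ∪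
      Metric.cthickening ((n : ℝ) + 1)⁻¹ C) := by
    refine Subset.antisymm (subset_iInter fun n => union_subset ?_ (iUnion_subset fun i => ?_))
      fun y hy => ?_
    · exact (Metric.self_subset_cthickening C).trans subset_union_right
    · rcases lt_or_ge i n with hi | hi
      · exact (subset_biUnion_of_mem (u := fun i => flatDisk L (x i : V) (r i))
          (Finset.mem_coe.2 (Finset.mem_range.2 hi))).trans subset_union_left
      · refine fun y hy => Or.inr (Metric.mem_cthickening_of_dist_le y (x i) _ _ (x i).2 ?_)
        refine (flatDisk_subset_closedBall _ _ _ hy : dist y (x i) ≤ r i).trans ((hri i).trans ?_)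
        gcongr
    · by_cases h : ∃ i, y ∈ flatDisk L (x i : V) (r i)
      · exact Or.inr (mem_iUnion.2 h)
      · push Not at h
        refine Or.inl (hC.isClosed.closure_eq ▸ ?_)
        rw [Metric.closure_eq_iInter_cthickening' C (range fun n : ℕ => ((n : ℝ) + 1)⁻¹)]
        · refine mem_iInter₂.2 ?_
          rintro _ ⟨n, rfl⟩
          rcases mem_iInter.1 hy n with h' | h'
          · obtain ⟨i, -, hi⟩ := mem_iUnion₂.1 h'
            exact absurd hi (h i)
          · exact h'
        · rintro ε hε
          obtain ⟨n, hn⟩ := exists_nat_one_div_lt hε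
          exact ⟨_, ⟨n, rfl⟩, by positivity, by simpa using hn.le⟩
  have hXclosed : IsClosed X := by
    rw [hXZ]
    refine isClosed_iInter fun n => IsClosed.union ?_ Metric.isClosed_cthickening
    exact (Finset.range n).isCompact_biUnion (fun i _ => isCompact_flatDisk L _ _) |>.isClosed
  have hXb : X ⊆ Metric.cthickening 1 C := by
    rw [hXZ]
    refine (iInter_subset _ 0).trans ?_
    simp
  refine ⟨X, hC.cthickening.of_isClosed_subset hXclosed hXb, subset_union_left, hXU, ?_, ?_⟩
  · refine Subset.antisymm (sep_subset _ _) fun p hp => ⟨hp, fun ρ hρ => ?_⟩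
    rcases hp with hp | hp
    · obtain ⟨i, hi⟩ := hx.exists_dist_lt (⟨p, hp⟩ : C) (half_pos hρ)
      refine (normHausdorff_flatDisk_inter_ball_pos L _ (hr0 i) (mem_flatDisk L (x i : V) (hr0 i).le)
        (half_pos hρ)).trans_le (measure_mono (inter_subset_inter ?_ ?_))
      · exact (subset_iUnion (fun i => flatDisk L (x i : V) (r i)) i).trans subset_union_right
      · refine Metric.ball_subset_ball' ?_
        have : dist (x i : V) p < ρ / 2 := by rw [dist_comm]; exact hi
        linarith
    · obtain ⟨i, hi⟩ := mem_iUnion.1 hp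
      exact (normHausdorff_flatDisk_inter_ball_pos L _ (hr0 i) hi hρ).trans_le
        (measure_mono (inter_subset_inter_left _ ((subset_iUnion (fun i =>
          flatDisk L (x i : V) (r i)) i).trans subset_union_right)))
  · refine (measure_union_le _ _).trans (add_le_add_right ?_ _)
    refine (measure_iUnion_le _).trans ((ENNReal.tsum_le_tsum fun i => ?_).trans hθs.le)
    exact (sphericalHausdorff_flatDisk_le L _ (hr0 i).le).trans (hrθ i)

end Disks

/-! ### A spanning set of size at most `c₀` -/

section SpanningSet

/-- The isometric inclusion of `ℝ^k` in `ℝ^(k+1)`. -/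
def euclideanCastSucc (k : ℕ) : EucSp k →ₗᵢ[ℝ] EucSp (k + 1) :=
  ((EuclideanSpace.basisFun (Fin k) ℝ).toBasis.constr ℝ fun i =>
    EuclideanSpace.basisFun (Fin (k + 1)) ℝ i.castSucc).isometryOfOrthonormal
    (v := (EuclideanSpace.basisFun (Fin k) ℝ).toBasis)
    (by simp) (by
      have h : (((EuclideanSpace.basisFun (Fin k) ℝ).toBasis.constr ℝ fun i =>
          EuclideanSpace.basisFun (Fin (k + 1)) ℝ i.castSucc) ∘
          (EuclideanSpace.basisFun (Fin k) ℝ).toBasis) =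
          (EuclideanSpace.basisFun (Fin (k + 1)) ℝ) ∘ Fin.castSucc := by
        funext i
        exact Basis.constr_basis _ _ _ _
      rw [h]
      exact (EuclideanSpace.basisFun (Fin (k + 1)) ℝ).orthonormal.comp _
        (Fin.castSucc_injective k))

/-- In an open set `p` can be pushed further away from `q`. The strictness is what leaves room for
the added disks. -/
theorem norm_sub_lt_diam {V : Type*} [NormedAddCommGroup V] [NormedSpace ℝ V] [Nontrivial V]
    {U : Set V} (hU : IsOpen U) (hUb : Bornology.IsBounded U) {p q : V} (hp : p ∈ U) (hq : q ∈ U) :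
    ‖p - q‖ < Metric.diam U := by
  obtain ⟨δ, hδ, hδU⟩ := Metric.nhds_basis_closedBall.mem_iff.1 (hU.mem_nhds hp)
  obtain ⟨e, he, hpe⟩ : ∃ e : V, ‖e‖ = 1 ∧ p - q = ‖p - q‖ • e := by
    rcases eq_or_ne (p - q) 0 with h | h
    · obtain ⟨e, he⟩ := exists_norm_eq V zero_le_one
      exact ⟨e, he, by simp [h]⟩
    · exact ⟨‖p - q‖⁻¹ • (p - q), by rw [norm_smul, norm_inv, norm_norm,
        inv_mul_cancel₀ (norm_ne_zero_iff.2 h)], by rw [smul_smul,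
        mul_inv_cancel₀ (norm_ne_zero_iff.2 h), one_smul]⟩
  have h1 : p + δ • e ∈ U := hδU (by simp [norm_smul, he, abs_of_pos hδ])
  have h2 := Metric.dist_le_diam_of_mem hUb h1 hq
  rw [dist_eq_norm, show p + δ • e - q = (‖p - q‖ + δ) • e by rw [add_smul, ← hpe]; abel, norm_smul,
    he, mul_one, Real.norm_of_nonneg (by positivity)] at h2
  linarith

variable {m : ℕ}

theorem isCompact_coneSet {M : Set (EucSp (m + 3))} (hM : IsCompact M) (q : EucSp (m + 3)) :
    IsCompact (coneSet q M) :=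
  (isCompact_Icc.prod hM).image (by fun_prop)

theorem coneSet_subset {M U : Set (EucSp (m + 3))} (hU : Convex ℝ U) (hMU : M ⊆ U)
    {q : EucSp (m + 3)} (hq : q ∈ U) : coneSet q M ⊆ U := by
  rintro _ ⟨⟨t, x⟩, ⟨ht, hx⟩, rfl⟩
  exact hU.add_smul_sub_mem hq (hMU hx) ht

theorem coneSet_subset_insert (q : EucSp (m + 3)) (M : Set (EucSp (m + 3))) :
    coneSet q M ⊆ {q} ∪ openCone q M := by
  rintro _ ⟨⟨t, x⟩, ⟨ht, hx⟩, rfl⟩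
  rcases ht.1.eq_or_lt with h | h
  · exact Or.inl (by simp [show t = 0 from h.symm])
  · exact Or.inr ⟨(t, x), ⟨⟨h, ht.2⟩, hx⟩, rfl⟩

/-- There is a spanning set of area at most `diam U · vol M`: a slight enlargement of the cone
over `M`. -/
theorem exists_mem_spanningSets_le_areaBound {M U : Set (EucSp (m + 3))}
    {τ : EucSp (m + 3) → ⋀[ℝ]^(m + 1) (EucSp (m + 3))} {q : EucSp (m + 3)}
    (hMc : IsCompact M) (hM : IsEmbeddedSubmanifold (m + 1) M) (hτ : IsOrientingField (m + 1) M τ)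
    (hUo : IsOpen U) (hUc : Convex ℝ U) (hUb : Bornology.IsBounded U) (hMU : M ⊆ U) (hq : q ∈ U) :
    ∃ X ∈ spanningSets M τ U, (sphericalHausdorff (m + 2) : Measure (EucSp (m + 3))) X ≤
      ENNReal.ofReal (areaBound M U) := by
  -- For empty `M` the bound is zero and leaves no slack, but there are no simple links and the
  -- empty set spans.
  rcases M.eq_empty_or_nonempty with rfl | hne
  · refine ⟨∅, ⟨isCompact_empty, empty_subset _, by simp [core], by simp, ?_⟩, by simp⟩
    rintro γ ⟨-, -, x, hx, -⟩
    exact absurd hx (notMem_empty x)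
  obtain ⟨c, hc0, hct, hc⟩ := exists_normHausdorff_eq_smul (EucSp (m + 3)) (m + 1)
  set v := (normHausdorff (m + 1) : Measure (EucSp (m + 3))) M with hv
  have hv0 : v ≠ 0 := by
    rw [hv, hc, Measure.smul_apply, smul_eq_mul]
    exact mul_ne_zero hc0 (hM.euclideanHausdorffMeasure_pos hne).ne'
  have hvt : v ≠ ⊤ := by
    rw [hv, hc, Measure.smul_apply, smul_eq_mul]
    exact ENNReal.mul_ne_top hct (hM.euclideanHausdorffMeasure_lt_top hMc).ne
  obtain ⟨p, hp, hmax⟩ := hMc.exists_isMaxOn hne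
    (f := fun x => ‖x - q‖) (by fun_prop)
  have hpd := norm_sub_lt_diam hUo hUb (hMU hp) hq
  -- `R` exceeds the longest generator of the cone and stays below the diameter.
  obtain ⟨R, hpR, hRd⟩ := exists_between hpd
  have hR0 : 0 < R := (norm_nonneg _).trans_lt hpR
  have hcone : sphericalHausdorff (m + 2) (coneSet q M) ≤ ENNReal.ofReal R * v := by
    refine (measure_mono (coneSet_subset_insert q M)).trans ((measure_union_le _ _).trans ?_)
    rw [sphericalHausdorff_singleton (by simp), zero_add]
    refine (sphericalHausdorff_openCone_le hM hMc.measurableSet hR0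
      fun x hx => (hmax hx).trans hpR.le).trans ?_
    gcongr
    exact euclideanHausdorffMeasure_le_normHausdorff _ _
  let L : EuclideanSpace ℝ (Fin (m + 2)) →ₗᵢ[ℝ] EucSp (m + 3) :=
    euclideanCastSucc (m + 2)
  -- The disks may use exactly the remaining area `(diam U - R) vol M`, which is positive.
  obtain ⟨X, hXc, hCX, hXU, hcore, hXle⟩ := exists_reduced_superset L (by simp)
    (isCompact_coneSet hMc q) ⟨_, mem_image_of_mem _ (mk_mem_prod ⟨le_rfl, zero_le_one⟩ hp)⟩ hUo
    (coneSet_subset hUc hMU hq) (η := ENNReal.ofReal (Metric.diam U - R) * v)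
    (mul_ne_zero (ENNReal.ofReal_pos.2 (sub_pos.2 hRd)).ne' hv0)
  have hle : sphericalHausdorff (m + 2) X ≤ ENNReal.ofReal (areaBound M U) := by
    refine hXle.trans ((add_le_add_left hcone _).trans ?_)
    rw [← add_mul, ← ENNReal.ofReal_add hR0.le (sub_pos.2 hRd).le, add_sub_cancel, areaBound,
      ENNReal.ofReal_mul Metric.diam_nonneg, ENNReal.ofReal_toReal hvt]
  exact ⟨X, ⟨hXc, hXU, hcore, hle.trans_lt ENNReal.ofReal_lt_top,
    spans_of_coneSet_subset hM hMc hτ hCX⟩, hle⟩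

end SpanningSet

end

theorem mainTheorem8 (m : ℕ)
    (M U : Set (EucSp (m + 3))) (τ : EucSp (m + 3) → ⋀[ℝ]^(m + 1) (EucSp (m + 3)))
    (Y : EucSp (m + 3) → EucSp (m + 3)) (F : ℝ → EucSp (m + 3) → EucSp (m + 3))
    (q : EucSp (m + 3))
    (hMc : IsCompact M) (hM : IsEmbeddedSubmanifold (m + 1) M) (hτ : IsOrientingField (m + 1) M τ)
    (hUo : IsOpen U) (hUc : Convex ℝ U) (hUb : Bornology.IsBounded U) (hMU : M ⊆ U)
    (hY : SmoothBoundedOn Y U)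
    (hYM : ∀ p ∈ M, ‖Y p‖ = 1 ∧ ∀ v ∈ tangentConeAt ℝ M p, inner ℝ (Y p) v = 0)
    (hq : q ∈ U) (hFU : ∀ t ∈ Set.Icc (0 : ℝ) 1, ∀ p ∈ U, F t p ∈ U)
    (hF0 : ∀ p ∈ U, F 0 p = p) (hF1 : ∀ p ∈ U, F 1 p = q)
    (hFs : ContDiffOn ℝ ∞ (Function.uncurry F) (Set.Icc (0 : ℝ) 1 ×ˢ U))
    (hFb : SmoothBoundedOn (fun x : WithLp 2 (ℝ × EucSp (m + 3)) => F x.fst x.snd)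
      (openCylinder U))
    (hFY : ∀ p ∈ M, HasDerivWithinAt (fun t => F t p) (Y p) (Set.Icc 0 1) 0) :
    ∃ S₀ ∈ filmClosure M τ U Y F,
      ((chainArea F S₀ : ℝ) : EReal) = ((minimalSize M τ U : ℝ≥0∞) : EReal) :=
  exists_minimizer_of_boundary_eq_zero M U τ Y F q hUo hUc hUb hY hFU hF0 hF1 hFs hFb
    (chainBoundary_submanifoldChain hM hMc hτ hUo hUc hMU)
    (exists_mem_spanningSets_le_areaBound hMc hM hτ hUo hUc hUb hMU hq)
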